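/- **Setting.** Let $A\in\{0,1\}$ be a treatment, $Y$ a real outcome, $M$ a mediator, $D$ a treatment-induced confounder, $X$ covariates, $Z,W$ proxies and $U$ a latent confounder, with values in standard Borel spaces, and let $D(a),M(a,d),Y(a,d,m)$ be potential outcomes, jointly measurable in their arguments; $Y(a,m)=Y(a,D(a),m)$, $Y(m)=Y(A,m)$. The estimand is $\psi=E[Y(1,D(1),M(0,D(1)))]$, assumed to exist. Assume consistency ($D(A)=D$, $M(A,D)=M$, $Y(A,D,M)=Y$ a.s.); positivity (conditional densities $P(A=a\mid U,X)$, $f(d\mid a,U,X)$, $f(m\mid d,a,U,X)$ with respect to $\sigma$-finite dominating measures exist and are a.e. positive); latent exchangeability $\{Y(a,\cdot),D(a)\}\perp A\mid U,X$, $Y(\cdot)\perp M\mid D,A,U,X$, $M(a,\cdot)\perp(D,A)\mid U,X$; latent cross-world independence $\{Y(a,\cdot),D(a)\}\perp M(a^*,\cdot)\mid U,X$ (independence of the potential-outcome families as random functions, for all $a,a^*$); and the proxy conditions $W\perp(A,D,M)\mid U,X$, $Z\perp(W,D,M,Y)\mid A,U,X$. Let $Q$ be the law of $\mathcal O=(A,Y,M,D,W,Z,X)$.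 Square-integrable $h_2(W,M,D,X),h_1(W,D,X),h_0(W,X)$ are outcome bridge functions if $E(Y\mid A=1,M,D,Z,X)=E(h_2\mid A=1,M,D,Z,X)$, $E(h_2\mid A=0,D,Z,X)=E(h_1\mid A=0,D,Z,X)$, $E(h_1\mid A=1,Z,X)=E(h_0\mid A=1,Z,X)$. Functions $q_0(Z,X),q_1(Z,D,X),q_2(Z,M,D,X)$, square-integrable given $A=1$, $A=0$, $A=1$ respectively, are treatment bridge functions if $1/f(A=1\mid W,X)=E(q_0\mid A=1,W,X)$, $E(q_0\mid A=1,D,W,X)\frac{f(A=1\mid D,W,X)}{f(A=0\mid D,W,X)}=E(q_1\mid A=0,D,W,X)$, $E(q_1\mid A=0,M,D,W,X)\frac{f(A=0\mid M,D,W,X)}{f(A=1\mid M,D,W,X)}=E(q_2\mid A=1,M,D,W,X)$. Let $h_j(\cdot;\beta_j)$, $q_j(\cdot;\gamma_j)$, $j=0,1,2$, be parametric models with finite-dimensional parameters in given parameter sets, and let $c_2(Z,M,D,X)$, $c_1(Z,D,X)$, $c_0(Z,X)$, $b_0(W,X)$, $b_1(W,D,X)$, $b_2(W,M,D,X)$ be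 vector functions of the dimensions of $\beta_2,\beta_1,\beta_0,\gamma_0,\gamma_1,\gamma_2$. From an i.i.d. sample of $\mathcal O$, let $\hat\theta=(\hat\beta_2,\hat\beta_1,\hat\beta_0,\hat\gamma_0,\hat\gamma_1,\hat\gamma_2)$ be measurable and, with probability tending to one, lie in the parameter space and solve $$\sum_i A_i[Y_i-h_2(\beta_2)]c_2=0,\quad \sum_i(1-A_i)[h_2(\beta_2)-h_1(\beta_1)]c_1=0,\quad \sum_i A_i[h_1(\beta_1)-h_0(\beta_0)]c_0=0,$$ $$\sum_i[A_iq_0(\gamma_0)-1]b_0=0,\quad \sum_i[(1-A_i)q_1(\gamma_1)-A_iq_0(\gamma_0)]b_1=0,\quad \sum_i[A_iq_2(\gamma_2)-(1-A_i)q_1(\gamma_1)]b_2=0,$$ and let $$\hat\psi_{P\text{-}quadR}=\frac1n\sum_{i=1}^n\big\{A_i\hat q_0[\hat h_1-\hat h_0]+(1-A_i)\hat q_1[\hat h_2-\hat h_1]+A_i\hat q_2[Y_i-\hat h_2]+\hat h_0\big\},$$ where hats denote the fitted models evaluated at observation $i$. **Regularity conditions.** The parameter sets are compact; the population versions of the six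 estimating equations, taken sequentially, have a unique root $\theta^*$, which is interior (no model need be correct for this); the stacked estimating function and the summand of $\hat\psi_{P\text{-}quadR}$ are continuous in $\theta$, continuously differentiable near $\theta^*$, they and (near $\theta^*$) their derivatives are dominated by integrable functions, and they are square-integrable at $\theta^*$; the expected derivative of the stacked estimating function at $\theta^*$ is nonsingular; $Y$ and the $h_j$ at $\theta^*$ are square-integrable, and so are $q_0,q_1,q_2$ at $\theta^*$ given $A=1$, $A=0$, $A=1$. **Submodels.** Write Z(i), Z(ii), Z(iii) for $L^2$-completeness of $Z$ for $U$ given $(A=1,M,D,X)$, given $(A=0,D,X)$, given $(A=1,X)$, and W(i), W(ii) for that of $W$ for $U$ given $(A=1,X)$, given $(A=0,D,X)$. Let $w_0=1/P(A=1\mid U,X)$, $w_1=\frac{f(D\mid A=1,U,X)}{f(D\mid A=0,U,X)P(A=0\mid U,X)}$, $w_2=\frac{f(M\mid D,A=0,U,X)}{f(M\mid D,A=1,U,X)P(A=1\mid U,X)}$. "Correctly specified" means that the parametric models contain bridge functions solving the corresponding equations. * $\mathcal M_1$: $h_2,h_1,h_0$ are correctly specified, and Z(i)–(iii) hold. * $\mathcal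 M_2$: $q_0,q_1,q_2$ are correctly specified, W(i)–(ii) hold, $w_0,w_1,w_2$ are square-integrable given $A=1$, $A=0$, $A=1$, and the density of $(D,M)$ given $A=1,U=u,X=x$ is bounded in $u$ at each $(d,m,x)$. * $\mathcal M_3$: $h_2,h_1,q_0$ are correctly specified, Z(i), Z(ii), W(i) hold, and $w_0$ is square-integrable given $A=1$. * $\mathcal M_4$: $h_2,q_0,q_1$ are correctly specified, Z(i), W(i), W(ii) hold, and $w_0,w_1$ are square-integrable given $A=1$, $A=0$. **Theorem 6.** (a) Under $\mathcal M_1\cup\mathcal M_2\cup\mathcal M_3\cup\mathcal M_4$, $\hat\psi_{P\text{-}quadR}\to\psi$ in probability, and there is a mean-zero square-integrable $\varphi(\mathcal O)$ with $\sqrt n(\hat\psi_{P\text{-}quadR}-\psi)=n^{-1/2}\sum_i\varphi(\mathcal O_i)+o_p(1)$, so that $\sqrt n(\hat\psi_{P\text{-}quadR}-\psi)$ converges in distribution to $N(0,E\varphi^2)$. (b) Let $\mathcal M_{sp}$ be the model of all laws of $\mathcal O$ with $E Y^2<\infty$ for which outcome bridge functions exist, with target $E[h_0(W,X)]$. Suppose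 that $\mathcal M_1\cap\mathcal M_2\cap\mathcal M_3\cap\mathcal M_4$ holds, that the operators $T_2:L_2(W,M,D,X)\to L_2(Z,A=1,M,D,X)$, $T_1:L_2(W,M,D,X)\to L_2(Z,A=0,D,X)$, $T_0:L_2(W,D,X)\to L_2(Z,A=1,X)$ of conditional expectation given the variables on the right are surjective at $Q$, that the outcome bridge functions are unique, and that positivity holds uniformly ($P(A=a\mid U,X)$ is bounded away from $0$, and $f(d\mid a,U,X)$, $f(m\mid d,a,U,X)$ are bounded away from $0$ and $\infty$). Then $\hat\psi_{P\text{-}quadR}$ is locally efficient at $Q$ in $\mathcal M_{sp}$: with bridge functions $h_2,h_1,h_0,q_0,q_1,q_2$ at $Q$, the function $$EIF_\psi=Aq_0[h_1-h_0]+(1-A)q_1[h_2-h_1]+Aq_2[Y-h_2]+h_0-\psi$$ is the efficient influence function at $Q$: it has mean zero and finite variance, it represents the derivative of the target along every one-dimensional submodel of $\mathcal M_{sp}$ through $Q$ that is differentiable in quadratic mean and whose likelihood ratio $p_t=dQ_t/dQ$ satisfies $|p_t-1|\le C|t|$ for $t$ near $0$, and it belongs to the closed linear span in $L^2(Q)$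 of the scores of these submodels. Moreover $\sqrt n(\hat\psi_{P\text{-}quadR}-\psi)=n^{-1/2}\sum_iEIF_\psi(\mathcal O_i)+o_p(1)$, which converges in distribution to $N(0,E[EIF_\psi^2])$. -/

import Mathlib

open MeasureTheory ProbabilityTheory Filter Topology

namespace PathSpecific

noncomputable section

/-- The σ-algebra generated by a random element. -/
abbrev sigmaOf {Ω β : Type*} [MeasurableSpace β] (f : Ω → β) : MeasurableSpace Ω :=
  MeasurableSpace.comap f inferInstance

/-! ### Observed data and laws of observed data -/

/-- One observation, in the order `(A, Y, M, D, W, Z, X)`; `A = true` stands for `A = 1`. -/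
abbrev Obs (𝒟 ℳ 𝒲 𝒵 𝒳 : Type*) : Type _ := Bool × ℝ × ℳ × 𝒟 × 𝒲 × 𝒵 × 𝒳

section Observed

variable {𝒟 ℳ 𝒲 𝒵 𝒳 : Type*}

namespace Obs

abbrev A (o : Obs 𝒟 ℳ 𝒲 𝒵 𝒳) : Bool := o.1
abbrev Y (o : Obs 𝒟 ℳ 𝒲 𝒵 𝒳) : ℝ := o.2.1
abbrev M (o : Obs 𝒟 ℳ 𝒲 𝒵 𝒳) : ℳ := o.2.2.1
abbrev D (o : Obs 𝒟 ℳ 𝒲 𝒵 𝒳) : 𝒟 := o.2.2.2.1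
abbrev W (o : Obs 𝒟 ℳ 𝒲 𝒵 𝒳) : 𝒲 := o.2.2.2.2.1
abbrev Z (o : Obs 𝒟 ℳ 𝒲 𝒵 𝒳) : 𝒵 := o.2.2.2.2.2.1
abbrev X (o : Obs 𝒟 ℳ 𝒲 𝒵 𝒳) : 𝒳 := o.2.2.2.2.2.2

/-- The treatment as a real number in `{0, 1}`. -/
def trt (o : Obs 𝒟 ℳ 𝒲 𝒵 𝒳) : ℝ := if A o then 1 else 0

abbrev WMDX (o : Obs 𝒟 ℳ 𝒲 𝒵 𝒳) : 𝒲 × ℳ × 𝒟 × 𝒳 := (W o, M o, D o, X o)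
abbrev WDX (o : Obs 𝒟 ℳ 𝒲 𝒵 𝒳) : 𝒲 × 𝒟 × 𝒳 := (W o, D o, X o)
abbrev WX (o : Obs 𝒟 ℳ 𝒲 𝒵 𝒳) : 𝒲 × 𝒳 := (W o, X o)
abbrev ZMDX (o : Obs 𝒟 ℳ 𝒲 𝒵 𝒳) : 𝒵 × ℳ × 𝒟 × 𝒳 := (Z o, M o, D o, X o)
abbrev ZDX (o : Obs 𝒟 ℳ 𝒲 𝒵 𝒳) : 𝒵 × 𝒟 × 𝒳 := (Z o, D o, X o)
abbrev ZX (o : Obs 𝒟 ℳ 𝒲 𝒵 𝒳) : 𝒵 × 𝒳 := (Z o, X o)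

/-- The event `A = a`. -/
def arm (a : Bool) : Set (Obs 𝒟 ℳ 𝒲 𝒵 𝒳) := {o | A o = a}

end Obs

open Obs

variable [MeasurableSpace 𝒟] [MeasurableSpace ℳ] [MeasurableSpace 𝒲] [MeasurableSpace 𝒵]
  [MeasurableSpace 𝒳]

/-- The law `Q` given `A = a`. -/
abbrev given (Q : Measure (Obs 𝒟 ℳ 𝒲 𝒵 𝒳)) (a : Bool) : Measure (Obs 𝒟 ℳ 𝒲 𝒵 𝒳) :=
  ProbabilityTheory.cond Q (arm a)

/-- The conditional probability `f(A = a | V)` under `Q`. -/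
abbrev prop (Q : Measure (Obs 𝒟 ℳ 𝒲 𝒵 𝒳)) (a : Bool) {β : Type*} [MeasurableSpace β]
    (V : Obs 𝒟 ℳ 𝒲 𝒵 𝒳 → β) : Obs 𝒟 ℳ 𝒲 𝒵 𝒳 → ℝ :=
  Q[(arm a).indicator (fun _ => (1 : ℝ)) | sigmaOf V]

/-! ### Confounding bridge functions of an observed-data law -/

/-- `E(Y | A=1, M, D, Z, X) = E[h₂(W,M,D,X) | A=1, M, D, Z, X]`. -/
structure IsH2 (Q : Measure (Obs 𝒟 ℳ 𝒲 𝒵 𝒳)) (h2 : 𝒲 × ℳ × 𝒟 × 𝒳 → ℝ) : Prop where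
  meas : Measurable h2
  sq : MemLp (fun o => h2 (WMDX o)) 2 Q
  eqn : (given Q true)[fun o => Y o | sigmaOf ZMDX] =ᵐ[given Q true]
    (given Q true)[fun o => h2 (WMDX o) | sigmaOf ZMDX]

/-- `E[h₂(W,M,D,X) | A=0, D, Z, X] = E[h₁(W,D,X) | A=0, D, Z, X]`. -/
structure IsH1 (Q : Measure (Obs 𝒟 ℳ 𝒲 𝒵 𝒳)) (h2 : 𝒲 × ℳ × 𝒟 × 𝒳 → ℝ)
    (h1 : 𝒲 × 𝒟 × 𝒳 → ℝ) : Prop where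
  meas : Measurable h1
  sq : MemLp (fun o => h1 (WDX o)) 2 Q
  eqn : (given Q false)[fun o => h2 (WMDX o) | sigmaOf ZDX] =ᵐ[given Q false]
    (given Q false)[fun o => h1 (WDX o) | sigmaOf ZDX]

/-- `E[h₁(W,D,X) | A=1, Z, X] = E[h₀(W,X) | A=1, Z, X]`. -/
structure IsH0 (Q : Measure (Obs 𝒟 ℳ 𝒲 𝒵 𝒳)) (h1 : 𝒲 × 𝒟 × 𝒳 → ℝ)
    (h0 : 𝒲 × 𝒳 → ℝ) : Prop where
  meas : Measurable h0
  sq : MemLp (fun o => h0 (WX o)) 2 Q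
  eqn : (given Q true)[fun o => h1 (WDX o) | sigmaOf ZX] =ᵐ[given Q true]
    (given Q true)[fun o => h0 (WX o) | sigmaOf ZX]

/-- `1 / f(A=1 | W, X) = E[q₀(Z,X) | A=1, W, X]`. -/
structure IsQ0 (Q : Measure (Obs 𝒟 ℳ 𝒲 𝒵 𝒳)) (q0 : 𝒵 × 𝒳 → ℝ) : Prop where
  meas : Measurable q0
  sq : MemLp (fun o => q0 (ZX o)) 2 (given Q true)
  eqn : (fun o => 1 / prop Q true WX o) =ᵐ[given Q true]
    (given Q true)[fun o => q0 (ZX o) | sigmaOf WX]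

/-- `E[q₀(Z,X) | A=1, D, W, X] f(A=1|D,W,X) / f(A=0|D,W,X) = E[q₁(Z,D,X) | A=0, D, W, X]`. -/
structure IsQ1 (Q : Measure (Obs 𝒟 ℳ 𝒲 𝒵 𝒳)) (q0 : 𝒵 × 𝒳 → ℝ)
    (q1 : 𝒵 × 𝒟 × 𝒳 → ℝ) : Prop where
  meas : Measurable q1
  sq : MemLp (fun o => q1 (ZDX o)) 2 (given Q false)
  eqn : (fun o => ((given Q true)[fun o' => q0 (ZX o') | sigmaOf WDX]) o
      * (prop Q true WDX o / prop Q false WDX o)) =ᵐ[given Q false]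
    (given Q false)[fun o => q1 (ZDX o) | sigmaOf WDX]

/-- `E[q₁(Z,D,X) | A=0, M, D, W, X] f(A=0|M,D,W,X) / f(A=1|M,D,W,X)
= E[q₂(Z,M,D,X) | A=1, M, D, W, X]`. -/
structure IsQ2 (Q : Measure (Obs 𝒟 ℳ 𝒲 𝒵 𝒳)) (q1 : 𝒵 × 𝒟 × 𝒳 → ℝ)
    (q2 : 𝒵 × ℳ × 𝒟 × 𝒳 → ℝ) : Prop where
  meas : Measurable q2
  sq : MemLp (fun o => q2 (ZMDX o)) 2 (given Q true)
  eqn : (fun o => ((given Q false)[fun o' => q1 (ZDX o') | sigmaOf WMDX]) o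
      * (prop Q false WMDX o / prop Q true WMDX o)) =ᵐ[given Q true]
    (given Q true)[fun o => q2 (ZMDX o) | sigmaOf WMDX]

/-- The uncentred influence function
`A q₀ (h₁ - h₀) + (1 - A) q₁ (h₂ - h₁) + A q₂ (Y - h₂) + h₀`. -/
def moment (h2 : 𝒲 × ℳ × 𝒟 × 𝒳 → ℝ) (h1 : 𝒲 × 𝒟 × 𝒳 → ℝ) (h0 : 𝒲 × 𝒳 → ℝ)
    (q0 : 𝒵 × 𝒳 → ℝ) (q1 : 𝒵 × 𝒟 × 𝒳 → ℝ) (q2 : 𝒵 × ℳ × 𝒟 × 𝒳 → ℝ)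
    (o : Obs 𝒟 ℳ 𝒲 𝒵 𝒳) : ℝ :=
  trt o * q0 (ZX o) * (h1 (WDX o) - h0 (WX o))
    + (1 - trt o) * q1 (ZDX o) * (h2 (WMDX o) - h1 (WDX o))
    + trt o * q2 (ZMDX o) * (Y o - h2 (WMDX o))
    + h0 (WX o)

/-! ### The semiparametric model, its smooth submodels and efficiency -/

/-- `Q` belongs to the model of all observed-data laws for which outcome confounding bridge
functions `h₂, h₁, h₀` exist, and `v` is the value `E[h₀(W,X)]` of the target at `Q`. -/
def IsTarget (Q : Measure (Obs 𝒟 ℳ 𝒲 𝒵 𝒳)) (v : ℝ) : Prop :=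
  MemLp (fun o => Y o) 2 Q ∧ ∃ h2 h1 h0, IsH2 Q h2 ∧ IsH1 Q h2 h1 ∧ IsH0 Q h1 h0 ∧
    v = ∫ o, h0 (WX o) ∂Q

/-- A regular one-dimensional parametric submodel `t ↦ p t • Q` of the semiparametric model,
passing through `Q` at `t = 0`, with score `s` at `t = 0` (differentiability in quadratic mean)
and with value `v t` of the target at `t`. -/
structure IsSubmodel (Q : Measure (Obs 𝒟 ℳ 𝒲 𝒵 𝒳)) (p : ℝ → Obs 𝒟 ℳ 𝒲 𝒵 𝒳 → ℝ)
    (s : Obs 𝒟 ℳ 𝒲 𝒵 𝒳 → ℝ) (v : ℝ → ℝ) : Prop where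
  meas : ∀ t, Measurable (p t)
  lip : ∃ C : ℝ, ∀ᶠ t in 𝓝 (0 : ℝ), ∀ᵐ o ∂Q, |p t o - 1| ≤ C * |t|
  prob : ∀ᶠ t in 𝓝 (0 : ℝ),
    IsProbabilityMeasure (Q.withDensity fun o => ENNReal.ofReal (p t o))
  mem : ∀ᶠ t in 𝓝 (0 : ℝ), IsTarget (Q.withDensity fun o => ENNReal.ofReal (p t o)) (v t)
  score_sq : MemLp s 2 Q
  dqm : Tendsto (fun t : ℝ => ∫ o, ((Real.sqrt (p t o) - 1) / t - s o / 2) ^ 2 ∂Q)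
    (𝓝[≠] 0) (𝓝 0)

/-- The scores at `Q` of regular one-dimensional submodels. -/
def scores (Q : Measure (Obs 𝒟 ℳ 𝒲 𝒵 𝒳)) : Set (Obs 𝒟 ℳ 𝒲 𝒵 𝒳 → ℝ) :=
  {s | ∃ p v, IsSubmodel Q p s v}

/-- `φ` is the efficient influence function of the target at `Q` in the semiparametric model:
it represents the derivative of the target along every regular submodel, and it lies in the
tangent space, the `L²(Q)`-closure of the linear span of the scores. -/
structure IsEIF (Q : Measure (Obs 𝒟 ℳ 𝒲 𝒵 𝒳)) (φ : Obs 𝒟 ℳ 𝒲 𝒵 𝒳 → ℝ) : Prop where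
  sq : MemLp φ 2 Q
  mean : ∫ o, φ o ∂Q = 0
  gradient : ∀ p s v, IsSubmodel Q p s v → HasDerivAt v (∫ o, φ o * s o ∂Q) 0
  tangent : ∀ ε : ℝ, 0 < ε → ∃ s ∈ Submodule.span ℝ (scores Q),
    eLpNorm (fun o => φ o - s o) 2 Q < ENNReal.ofReal ε

/-- Surjectivity of the conditional expectation operators
`T₂ : L₂(W,M,D,X) → L₂(Z,A=1,M,D,X)`, `T₁ : L₂(W,M,D,X) → L₂(Z,A=0,D,X)` and
`T₀ : L₂(W,D,X) → L₂(Z,A=1,X)` at `Q`. -/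
structure Surjectivity (Q : Measure (Obs 𝒟 ℳ 𝒲 𝒵 𝒳)) : Prop where
  T2 : ∀ k : 𝒵 × ℳ × 𝒟 × 𝒳 → ℝ, Measurable k →
    MemLp (fun o => k (ZMDX o)) 2 (given Q true) →
    ∃ g : 𝒲 × ℳ × 𝒟 × 𝒳 → ℝ, Measurable g ∧ MemLp (fun o => g (WMDX o)) 2 Q ∧
      (given Q true)[fun o => g (WMDX o) | sigmaOf ZMDX] =ᵐ[given Q true] fun o => k (ZMDX o)
  T1 : ∀ k : 𝒵 × 𝒟 × 𝒳 → ℝ, Measurable k →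
    MemLp (fun o => k (ZDX o)) 2 (given Q false) →
    ∃ g : 𝒲 × ℳ × 𝒟 × 𝒳 → ℝ, Measurable g ∧ MemLp (fun o => g (WMDX o)) 2 Q ∧
      (given Q false)[fun o => g (WMDX o) | sigmaOf ZDX] =ᵐ[given Q false] fun o => k (ZDX o)
  T0 : ∀ k : 𝒵 × 𝒳 → ℝ, Measurable k →
    MemLp (fun o => k (ZX o)) 2 (given Q true) →
    ∃ g : 𝒲 × 𝒟 × 𝒳 → ℝ, Measurable g ∧ MemLp (fun o => g (WDX o)) 2 Q ∧
      (given Q true)[fun o => g (WDX o) | sigmaOf ZX] =ᵐ[given Q true] fun o => k (ZX o)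

/-- The outcome confounding bridge functions are unique, in the order `h₂, h₁, h₀` in which they
are obtained. -/
structure UniqueBridges (Q : Measure (Obs 𝒟 ℳ 𝒲 𝒵 𝒳)) : Prop where
  h2 : ∀ f g, IsH2 Q f → IsH2 Q g → (fun o => f (WMDX o)) =ᵐ[Q] fun o => g (WMDX o)
  h1 : ∀ h2 f g, IsH2 Q h2 → IsH1 Q h2 f → IsH1 Q h2 g →
    (fun o => f (WDX o)) =ᵐ[Q] fun o => g (WDX o)
  h0 : ∀ h2 h1 f g, IsH2 Q h2 → IsH1 Q h2 h1 → IsH0 Q h1 f → IsH0 Q h1 g →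
    (fun o => f (WX o)) =ᵐ[Q] fun o => g (WX o)

end Observed

/-! ### Parametric bridge models, estimating equations and the estimator -/

/-- Dimensions of `β₂, β₁, β₀, γ₀, γ₁, γ₂`. -/
structure Dims where
  (b2 b1 b0 g0 g1 g2 : ℕ)

/-- The parameter `θ = (β₂, β₁, β₀, γ₀, γ₁, γ₂)`. -/
abbrev Param (k : Dims) : Type :=
  EuclideanSpace ℝ (Fin k.b2) × EuclideanSpace ℝ (Fin k.b1) × EuclideanSpace ℝ (Fin k.b0) ×
    EuclideanSpace ℝ (Fin k.g0) × EuclideanSpace ℝ (Fin k.g1) × EuclideanSpace ℝ (Fin k.g2)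

namespace Param

variable {k : Dims}

abbrev b2 (θ : Param k) : EuclideanSpace ℝ (Fin k.b2) := θ.1
abbrev b1 (θ : Param k) : EuclideanSpace ℝ (Fin k.b1) := θ.2.1
abbrev b0 (θ : Param k) : EuclideanSpace ℝ (Fin k.b0) := θ.2.2.1
abbrev g0 (θ : Param k) : EuclideanSpace ℝ (Fin k.g0) := θ.2.2.2.1
abbrev g1 (θ : Param k) : EuclideanSpace ℝ (Fin k.g1) := θ.2.2.2.2.1
abbrev g2 (θ : Param k) : EuclideanSpace ℝ (Fin k.g2) := θ.2.2.2.2.2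

end Param

/-- Parametric models for the six bridge functions, their parameter sets, and the user-chosen
vector functions in the estimating equations. -/
structure BridgeModels (k : Dims) (𝒟 ℳ 𝒲 𝒵 𝒳 : Type*) [MeasurableSpace 𝒟] [MeasurableSpace ℳ]
    [MeasurableSpace 𝒲] [MeasurableSpace 𝒵] [MeasurableSpace 𝒳] where
  h2 : EuclideanSpace ℝ (Fin k.b2) → 𝒲 × ℳ × 𝒟 × 𝒳 → ℝ
  h1 : EuclideanSpace ℝ (Fin k.b1) → 𝒲 × 𝒟 × 𝒳 → ℝ
  h0 : EuclideanSpace ℝ (Fin k.b0) → 𝒲 × 𝒳 → ℝ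
  q0 : EuclideanSpace ℝ (Fin k.g0) → 𝒵 × 𝒳 → ℝ
  q1 : EuclideanSpace ℝ (Fin k.g1) → 𝒵 × 𝒟 × 𝒳 → ℝ
  q2 : EuclideanSpace ℝ (Fin k.g2) → 𝒵 × ℳ × 𝒟 × 𝒳 → ℝ
  B2 : Set (EuclideanSpace ℝ (Fin k.b2))
  B1 : Set (EuclideanSpace ℝ (Fin k.b1))
  B0 : Set (EuclideanSpace ℝ (Fin k.b0))
  G0 : Set (EuclideanSpace ℝ (Fin k.g0))
  G1 : Set (EuclideanSpace ℝ (Fin k.g1))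
  G2 : Set (EuclideanSpace ℝ (Fin k.g2))
  c2 : 𝒵 × ℳ × 𝒟 × 𝒳 → EuclideanSpace ℝ (Fin k.b2)
  c1 : 𝒵 × 𝒟 × 𝒳 → EuclideanSpace ℝ (Fin k.b1)
  c0 : 𝒵 × 𝒳 → EuclideanSpace ℝ (Fin k.b0)
  d0 : 𝒲 × 𝒳 → EuclideanSpace ℝ (Fin k.g0)
  d1 : 𝒲 × 𝒟 × 𝒳 → EuclideanSpace ℝ (Fin k.g1)
  d2 : 𝒲 × ℳ × 𝒟 × 𝒳 → EuclideanSpace ℝ (Fin k.g2)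
  h2_meas : Measurable fun p : EuclideanSpace ℝ (Fin k.b2) × (𝒲 × ℳ × 𝒟 × 𝒳) => h2 p.1 p.2
  h1_meas : Measurable fun p : EuclideanSpace ℝ (Fin k.b1) × (𝒲 × 𝒟 × 𝒳) => h1 p.1 p.2
  h0_meas : Measurable fun p : EuclideanSpace ℝ (Fin k.b0) × (𝒲 × 𝒳) => h0 p.1 p.2
  q0_meas : Measurable fun p : EuclideanSpace ℝ (Fin k.g0) × (𝒵 × 𝒳) => q0 p.1 p.2
  q1_meas : Measurable fun p : EuclideanSpace ℝ (Fin k.g1) × (𝒵 × 𝒟 × 𝒳) => q1 p.1 p.2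
  q2_meas : Measurable fun p : EuclideanSpace ℝ (Fin k.g2) × (𝒵 × ℳ × 𝒟 × 𝒳) => q2 p.1 p.2
  c2_meas : Measurable c2
  c1_meas : Measurable c1
  c0_meas : Measurable c0
  d0_meas : Measurable d0
  d1_meas : Measurable d1
  d2_meas : Measurable d2

section Models

open Obs

variable {𝒟 ℳ 𝒲 𝒵 𝒳 : Type*} [MeasurableSpace 𝒟] [MeasurableSpace ℳ] [MeasurableSpace 𝒲]
  [MeasurableSpace 𝒵] [MeasurableSpace 𝒳] {k : Dims}

namespace BridgeModels

/-- The parameter space. -/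
def space (B : BridgeModels k 𝒟 ℳ 𝒲 𝒵 𝒳) : Set (Param k) :=
  B.B2 ×ˢ B.B1 ×ˢ B.B0 ×ˢ B.G0 ×ˢ B.G1 ×ˢ B.G2

/-! The summands of the six estimating equations. -/

def estH2 (B : BridgeModels k 𝒟 ℳ 𝒲 𝒵 𝒳) (β2 : EuclideanSpace ℝ (Fin k.b2))
    (o : Obs 𝒟 ℳ 𝒲 𝒵 𝒳) : EuclideanSpace ℝ (Fin k.b2) :=
  (trt o * (Y o - B.h2 β2 (WMDX o))) • B.c2 (ZMDX o)

def estH1 (B : BridgeModels k 𝒟 ℳ 𝒲 𝒵 𝒳) (β2 : EuclideanSpace ℝ (Fin k.b2))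
    (β1 : EuclideanSpace ℝ (Fin k.b1)) (o : Obs 𝒟 ℳ 𝒲 𝒵 𝒳) : EuclideanSpace ℝ (Fin k.b1) :=
  ((1 - trt o) * (B.h2 β2 (WMDX o) - B.h1 β1 (WDX o))) • B.c1 (ZDX o)

def estH0 (B : BridgeModels k 𝒟 ℳ 𝒲 𝒵 𝒳) (β1 : EuclideanSpace ℝ (Fin k.b1))
    (β0 : EuclideanSpace ℝ (Fin k.b0)) (o : Obs 𝒟 ℳ 𝒲 𝒵 𝒳) : EuclideanSpace ℝ (Fin k.b0) :=
  (trt o * (B.h1 β1 (WDX o) - B.h0 β0 (WX o))) • B.c0 (ZX o)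

def estQ0 (B : BridgeModels k 𝒟 ℳ 𝒲 𝒵 𝒳) (γ0 : EuclideanSpace ℝ (Fin k.g0))
    (o : Obs 𝒟 ℳ 𝒲 𝒵 𝒳) : EuclideanSpace ℝ (Fin k.g0) :=
  (trt o * B.q0 γ0 (ZX o) - 1) • B.d0 (WX o)

def estQ1 (B : BridgeModels k 𝒟 ℳ 𝒲 𝒵 𝒳) (γ0 : EuclideanSpace ℝ (Fin k.g0))
    (γ1 : EuclideanSpace ℝ (Fin k.g1)) (o : Obs 𝒟 ℳ 𝒲 𝒵 𝒳) : EuclideanSpace ℝ (Fin k.g1) :=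
  ((1 - trt o) * B.q1 γ1 (ZDX o) - trt o * B.q0 γ0 (ZX o)) • B.d1 (WDX o)

def estQ2 (B : BridgeModels k 𝒟 ℳ 𝒲 𝒵 𝒳) (γ1 : EuclideanSpace ℝ (Fin k.g1))
    (γ2 : EuclideanSpace ℝ (Fin k.g2)) (o : Obs 𝒟 ℳ 𝒲 𝒵 𝒳) : EuclideanSpace ℝ (Fin k.g2) :=
  (trt o * B.q2 γ2 (ZMDX o) - (1 - trt o) * B.q1 γ1 (ZDX o)) • B.d2 (WMDX o)

/-- The stacked estimating function. -/
def est (B : BridgeModels k 𝒟 ℳ 𝒲 𝒵 𝒳) (o : Obs 𝒟 ℳ 𝒲 𝒵 𝒳) (θ : Param k) : Param k :=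
  (B.estH2 θ.b2 o, B.estH1 θ.b2 θ.b1 o, B.estH0 θ.b1 θ.b0 o,
    B.estQ0 θ.g0 o, B.estQ1 θ.g0 θ.g1 o, B.estQ2 θ.g1 θ.g2 o)

/-- The summand of the quadruply robust estimator at the parameter `θ`. -/
def quad (B : BridgeModels k 𝒟 ℳ 𝒲 𝒵 𝒳) (o : Obs 𝒟 ℳ 𝒲 𝒵 𝒳) (θ : Param k) : ℝ :=
  moment (B.h2 θ.b2) (B.h1 θ.b1) (B.h0 θ.b0) (B.q0 θ.g0) (B.q1 θ.g1) (B.q2 θ.g2) o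

/-- The quadruply robust estimator from the observations `O 0, …, O (n-1)` and the nuisance
estimate `θ`. -/
def psiHat (B : BridgeModels k 𝒟 ℳ 𝒲 𝒵 𝒳) (n : ℕ) (O : ℕ → Obs 𝒟 ℳ 𝒲 𝒵 𝒳) (θ : Param k) : ℝ :=
  (∑ i ∈ Finset.range n, B.quad (O i) θ) / n

/-! Correct specification: the parametric model contains a bridge function. -/

def Spec1 (B : BridgeModels k 𝒟 ℳ 𝒲 𝒵 𝒳) (Q : Measure (Obs 𝒟 ℳ 𝒲 𝒵 𝒳)) : Prop :=
  ∃ β2 ∈ B.B2, ∃ β1 ∈ B.B1, ∃ β0 ∈ B.B0,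
    IsH2 Q (B.h2 β2) ∧ IsH1 Q (B.h2 β2) (B.h1 β1) ∧ IsH0 Q (B.h1 β1) (B.h0 β0)

def Spec2 (B : BridgeModels k 𝒟 ℳ 𝒲 𝒵 𝒳) (Q : Measure (Obs 𝒟 ℳ 𝒲 𝒵 𝒳)) : Prop :=
  ∃ γ0 ∈ B.G0, ∃ γ1 ∈ B.G1, ∃ γ2 ∈ B.G2,
    IsQ0 Q (B.q0 γ0) ∧ IsQ1 Q (B.q0 γ0) (B.q1 γ1) ∧ IsQ2 Q (B.q1 γ1) (B.q2 γ2)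

def Spec3 (B : BridgeModels k 𝒟 ℳ 𝒲 𝒵 𝒳) (Q : Measure (Obs 𝒟 ℳ 𝒲 𝒵 𝒳)) : Prop :=
  ∃ β2 ∈ B.B2, ∃ β1 ∈ B.B1, ∃ γ0 ∈ B.G0,
    IsH2 Q (B.h2 β2) ∧ IsH1 Q (B.h2 β2) (B.h1 β1) ∧ IsQ0 Q (B.q0 γ0)

def Spec4 (B : BridgeModels k 𝒟 ℳ 𝒲 𝒵 𝒳) (Q : Measure (Obs 𝒟 ℳ 𝒲 𝒵 𝒳)) : Prop :=
  ∃ β2 ∈ B.B2, ∃ γ0 ∈ B.G0, ∃ γ1 ∈ B.G1,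
    IsH2 Q (B.h2 β2) ∧ IsQ0 Q (B.q0 γ0) ∧ IsQ1 Q (B.q0 γ0) (B.q1 γ1)

end BridgeModels

/-- Smoothness and domination of a family `F o θ` on a parameter space `Θ` around `θs`. -/
structure SmoothFamily {V : Type*} [NormedAddCommGroup V] [NormedSpace ℝ V]
    (Q : Measure (Obs 𝒟 ℳ 𝒲 𝒵 𝒳)) (Θ : Set (Param k)) (θs : Param k)
    (F : Obs 𝒟 ℳ 𝒲 𝒵 𝒳 → Param k → V) : Prop where
  cont : ∀ᵐ o ∂Q, ContinuousOn (F o) Θ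
  dom : ∃ K : Obs 𝒟 ℳ 𝒲 𝒵 𝒳 → ℝ, Integrable K Q ∧ ∀ᵐ o ∂Q, ∀ θ ∈ Θ, ‖F o θ‖ ≤ K o
  deriv : ∃ N : Set (Param k), IsOpen N ∧ θs ∈ N ∧ N ⊆ Θ ∧
    (∀ᵐ o ∂Q, ContDiffOn ℝ 1 (F o) N) ∧
    ∃ K : Obs 𝒟 ℳ 𝒲 𝒵 𝒳 → ℝ, Integrable K Q ∧
      ∀ᵐ o ∂Q, ∀ θ ∈ N, ‖fderiv ℝ (F o) θ‖ ≤ K o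
  sq : MemLp (fun o => F o θs) 2 Q

/-- The usual regularity conditions for the estimating equations: compact parameter sets, an
interior point `θs` which is the unique sequential root of the population equations, smooth and
dominated estimating functions, nonsingular derivative, square-integrability. No bridge model is
required to be correct. -/
structure Regularity (Q : Measure (Obs 𝒟 ℳ 𝒲 𝒵 𝒳)) (B : BridgeModels k 𝒟 ℳ 𝒲 𝒵 𝒳)
    (θs : Param k) : Prop where
  compact : IsCompact B.space
  root : ∫ o, B.est o θs ∂Q = 0
  uniq_b2 : ∀ β ∈ B.B2, ∫ o, B.estH2 β o ∂Q = 0 → β = θs.b2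
  uniq_b1 : ∀ β ∈ B.B1, ∫ o, B.estH1 θs.b2 β o ∂Q = 0 → β = θs.b1
  uniq_b0 : ∀ β ∈ B.B0, ∫ o, B.estH0 θs.b1 β o ∂Q = 0 → β = θs.b0
  uniq_g0 : ∀ γ ∈ B.G0, ∫ o, B.estQ0 γ o ∂Q = 0 → γ = θs.g0
  uniq_g1 : ∀ γ ∈ B.G1, ∫ o, B.estQ1 θs.g0 γ o ∂Q = 0 → γ = θs.g1
  uniq_g2 : ∀ γ ∈ B.G2, ∫ o, B.estQ2 θs.g1 γ o ∂Q = 0 → γ = θs.g2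
  est_smooth : SmoothFamily Q B.space θs B.est
  quad_smooth : SmoothFamily Q B.space θs B.quad
  nonsingular : Function.Bijective (∫ o, fderiv ℝ (B.est o) θs ∂Q : Param k →L[ℝ] Param k)
  Y_sq : MemLp (fun o => Y o) 2 Q
  h2_sq : MemLp (fun o => B.h2 θs.b2 (WMDX o)) 2 Q
  h1_sq : MemLp (fun o => B.h1 θs.b1 (WDX o)) 2 Q
  h0_sq : MemLp (fun o => B.h0 θs.b0 (WX o)) 2 Q
  q0_sq : MemLp (fun o => B.q0 θs.g0 (ZX o)) 2 (given Q true)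
  q1_sq : MemLp (fun o => B.q1 θs.g1 (ZDX o)) 2 (given Q false)
  q2_sq : MemLp (fun o => B.q2 θs.g2 (ZMDX o)) 2 (given Q true)

end Models

/-! ### Asymptotic properties of an estimator -/

section Asymptotics

variable {S : Type*} [MeasurableSpace S]

/-- `est n` is asymptotically linear for `ψ`, with influence function `φ` at the law `Q`, on the
sample `O`. -/
structure AsympLinear {𝒪 : Type*} [MeasurableSpace 𝒪] (Pr : Measure S) (Q : Measure 𝒪)
    (O : ℕ → S → 𝒪) (est : ℕ → S → ℝ) (ψ : ℝ) (φ : 𝒪 → ℝ) : Prop where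
  meas : Measurable φ
  sq : MemLp φ 2 Q
  mean : ∫ o, φ o ∂Q = 0
  expansion : TendstoInMeasure Pr
    (fun (n : ℕ) ω => Real.sqrt n * (est n ω - ψ)
      - (Real.sqrt n)⁻¹ * ∑ i ∈ Finset.range n, φ (O i ω)) atTop (fun _ => 0)

/-- `√n (est n - ψ)` converges in distribution to the centred normal law with variance `v`. -/
def AsympNormal (Pr : Measure S) [IsProbabilityMeasure Pr] (est : ℕ → S → ℝ) (ψ v : ℝ) : Prop :=
  TendstoInDistribution (fun (n : ℕ) ω => Real.sqrt n * (est n ω - ψ)) atTop (id : ℝ → ℝ)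
    (fun _ => Pr) (gaussianReal 0 v.toNNReal)

end Asymptotics

/-! ### Counterfactual model -/

/-- All variables of the causal model on a common space: the latent confounder `U`, the observed
variables, and the potential outcomes `D(a)`, `M(a,d)`, `Y(a,d,m)`. -/
structure CausalModel (Ω 𝒰 𝒟 ℳ 𝒲 𝒵 𝒳 : Type*) [MeasurableSpace Ω] [MeasurableSpace 𝒰]
    [MeasurableSpace 𝒟] [MeasurableSpace ℳ] [MeasurableSpace 𝒲] [MeasurableSpace 𝒵]
    [MeasurableSpace 𝒳] where
  U : Ω → 𝒰
  X : Ω → 𝒳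
  W : Ω → 𝒲
  Z : Ω → 𝒵
  A : Ω → Bool
  D : Ω → 𝒟
  M : Ω → ℳ
  Y : Ω → ℝ
  Dpot : Bool → Ω → 𝒟
  Mpot : Bool → 𝒟 → Ω → ℳ
  Ypot : Bool → 𝒟 → ℳ → Ω → ℝ
  U_meas : Measurable U
  X_meas : Measurable X
  W_meas : Measurable W
  Z_meas : Measurable Z
  A_meas : Measurable A
  D_meas : Measurable D
  M_meas : Measurable M
  Y_meas : Measurable Y
  Dpot_meas : ∀ a, Measurable (Dpot a)
  Mpot_meas : ∀ a, Measurable fun p : 𝒟 × Ω => Mpot a p.1 p.2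
  Ypot_meas : ∀ a, Measurable fun p : (𝒟 × ℳ) × Ω => Ypot a p.1.1 p.1.2 p.2

/-- Dominating measures for `D` and `M`, and conditional densities: `e a (u,x) = P(A=a | u,x)`,
`fD a ((u,x),d) = f(d | A=a, u, x)` and `fM a (((u,x),d),m) = f(m | d, A=a, u, x)`. -/
structure Densities (𝒰 𝒟 ℳ 𝒳 : Type*) [MeasurableSpace 𝒰] [MeasurableSpace 𝒟] [MeasurableSpace ℳ]
    [MeasurableSpace 𝒳] where
  muD : Measure 𝒟
  muM : Measure ℳ
  sigD : SigmaFinite muD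
  sigM : SigmaFinite muM
  e : Bool → 𝒰 × 𝒳 → ℝ
  fD : Bool → (𝒰 × 𝒳) × 𝒟 → ℝ
  fM : Bool → ((𝒰 × 𝒳) × 𝒟) × ℳ → ℝ
  e_meas : ∀ a, Measurable (e a)
  fD_meas : ∀ a, Measurable (fD a)
  fM_meas : ∀ a, Measurable (fM a)

attribute [instance] Densities.sigD Densities.sigM

/-- The family `F i`, as one random function of the index, is measurable with respect to the
σ-algebra `𝓖`. For a countable index set with its discrete σ-algebra this says that `𝓖` contains
the σ-algebra generated by all `F i`. -/
def Carries {Ω ι β : Type*} [MeasurableSpace ι] [MeasurableSpace β] (𝓖 : MeasurableSpace Ω)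
    (F : ι → Ω → β) : Prop :=
  @Measurable (ι × Ω) β (@Prod.instMeasurableSpace ι Ω inferInstance 𝓖) inferInstance
    (fun p => F p.1 p.2)

namespace CausalModel

variable {Ω 𝒰 𝒟 ℳ 𝒲 𝒵 𝒳 : Type*} [mΩ : MeasurableSpace Ω] [MeasurableSpace 𝒰]
  [MeasurableSpace 𝒟] [MeasurableSpace ℳ] [MeasurableSpace 𝒲] [MeasurableSpace 𝒵]
  [MeasurableSpace 𝒳]

/-- The observed data. -/
def obs (C : CausalModel Ω 𝒰 𝒟 ℳ 𝒲 𝒵 𝒳) (ω : Ω) : Obs 𝒟 ℳ 𝒲 𝒵 𝒳 :=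
  (C.A ω, C.Y ω, C.M ω, C.D ω, C.W ω, C.Z ω, C.X ω)

abbrev UX (C : CausalModel Ω 𝒰 𝒟 ℳ 𝒲 𝒵 𝒳) (ω : Ω) : 𝒰 × 𝒳 := (C.U ω, C.X ω)

/-- `Y(a,m) = Y(a, D(a), m)`. -/
def Yam (C : CausalModel Ω 𝒰 𝒟 ℳ 𝒲 𝒵 𝒳) (a : Bool) (m : ℳ) (ω : Ω) : ℝ :=
  C.Ypot a (C.Dpot a ω) m ω

/-- `Y(m) = Y(A, D(A), m)`. -/
def Ym (C : CausalModel Ω 𝒰 𝒟 ℳ 𝒲 𝒵 𝒳) (m : ℳ) (ω : Ω) : ℝ := C.Yam (C.A ω) m ω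

/-- The nested counterfactual `Y(1, D(1), M(0, D(1)))`. -/
def nested (C : CausalModel Ω 𝒰 𝒟 ℳ 𝒲 𝒵 𝒳) (ω : Ω) : ℝ :=
  C.Ypot true (C.Dpot true ω) (C.Mpot false (C.Dpot true ω) ω) ω

/-- The estimand `ψ = E[Y(1, D(1), M(0, D(1)))]`. -/
def psi (C : CausalModel Ω 𝒰 𝒟 ℳ 𝒲 𝒵 𝒳) (P : Measure Ω) : ℝ := ∫ ω, C.nested ω ∂P

/-- Consistency. -/
structure Consistency (C : CausalModel Ω 𝒰 𝒟 ℳ 𝒲 𝒵 𝒳) (P : Measure Ω) : Prop where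
  D : ∀ᵐ ω ∂P, ∀ a, C.A ω = a → C.Dpot a ω = C.D ω
  M : ∀ᵐ ω ∂P, ∀ a d, C.A ω = a → C.D ω = d → C.Mpot a d ω = C.M ω
  Y : ∀ᵐ ω ∂P, ∀ a d m, C.A ω = a → C.D ω = d → C.M ω = m → C.Ypot a d m ω = C.Y ω

/-- The law `P` on the event `A = a` (not normalised). -/
abbrev on (C : CausalModel Ω 𝒰 𝒟 ℳ 𝒲 𝒵 𝒳) (P : Measure Ω) (a : Bool) : Measure Ω :=
  P.restrict {ω | C.A ω = a}

/-- The law `P` given `A = a`. -/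
abbrev given (C : CausalModel Ω 𝒰 𝒟 ℳ 𝒲 𝒵 𝒳) (P : Measure Ω) (a : Bool) : Measure Ω :=
  ProbabilityTheory.cond P {ω | C.A ω = a}

/-- Positivity: the conditional densities of `A` given `(U,X)`, of `D` given `(A,U,X)` and of `M`
given `(D,A,U,X)` exist and are positive. -/
structure Positivity (C : CausalModel Ω 𝒰 𝒟 ℳ 𝒲 𝒵 𝒳) (P : Measure Ω) [IsProbabilityMeasure P]
    (f : Densities 𝒰 𝒟 ℳ 𝒳) : Prop where
  dens_A : ∀ a, (C.on P a).map C.UX =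
    (P.map C.UX).withDensity fun p => ENNReal.ofReal (f.e a p)
  dens_D : ∀ a, (C.on P a).map (fun ω => (C.UX ω, C.D ω)) =
    (((C.on P a).map C.UX).prod f.muD).withDensity fun p => ENNReal.ofReal (f.fD a p)
  dens_M : ∀ a, (C.on P a).map (fun ω => ((C.UX ω, C.D ω), C.M ω)) =
    (((C.on P a).map fun ω => (C.UX ω, C.D ω)).prod f.muM).withDensity
      fun p => ENNReal.ofReal (f.fM a p)
  pos_A : ∀ a, ∀ᵐ p ∂(P.map C.UX), 0 < f.e a p
  pos_D : ∀ a, ∀ᵐ p ∂((P.map C.UX).prod f.muD), 0 < f.fD a p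
  pos_M : ∀ a, ∀ᵐ p ∂(((P.map C.UX).prod f.muD).prod f.muM), 0 < f.fM a p

/-- Uniform version of positivity: the treatment probabilities are bounded away from zero and the
densities of `D` and `M` are bounded away from zero and infinity. -/
def StrictPositivity (C : CausalModel Ω 𝒰 𝒟 ℳ 𝒲 𝒵 𝒳) (P : Measure Ω)
    (f : Densities 𝒰 𝒟 ℳ 𝒳) : Prop :=
  ∃ c : ℝ, 0 < c ∧ ∀ a,
    (∀ᵐ p ∂(P.map C.UX), c ≤ f.e a p) ∧
    (∀ᵐ p ∂((P.map C.UX).prod f.muD), c ≤ f.fD a p ∧ f.fD a p ≤ c⁻¹) ∧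
    (∀ᵐ p ∂(((P.map C.UX).prod f.muD).prod f.muM), c ≤ f.fM a p ∧ f.fM a p ≤ c⁻¹)

section Independence

variable [StandardBorelSpace Ω]

/-- Latent conditional exchangeability, for the counterfactual families as random functions:
`{Y(a,·), D(a)} ⊥ A | U, X`; `Y(·) ⊥ M | D, A, U, X`; `M(a,·) ⊥ {D, A} | U, X`. -/
structure Exchangeability (C : CausalModel Ω 𝒰 𝒟 ℳ 𝒲 𝒵 𝒳) (P : Measure Ω)
    [IsProbabilityMeasure P] : Prop where
  YD : ∀ a, ∃ 𝓖 ≤ mΩ, Carries 𝓖 (C.Yam a) ∧ Measurable[𝓖] (C.Dpot a) ∧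
    CondIndep (sigmaOf C.UX) 𝓖 (sigmaOf C.A) (C.U_meas.prodMk C.X_meas).comap_le P
  Y : ∃ 𝓖 ≤ mΩ, Carries 𝓖 C.Ym ∧
    CondIndep (sigmaOf fun ω => (C.D ω, C.A ω, C.UX ω)) 𝓖 (sigmaOf C.M)
      (C.D_meas.prodMk (C.A_meas.prodMk (C.U_meas.prodMk C.X_meas))).comap_le P
  M : ∀ a, ∃ 𝓖 ≤ mΩ, Carries 𝓖 (C.Mpot a) ∧
    CondIndep (sigmaOf C.UX) 𝓖 (sigmaOf fun ω => (C.D ω, C.A ω))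
      (C.U_meas.prodMk C.X_meas).comap_le P

/-- Latent cross-world independence: `{Y(a,·), D(a)} ⊥ M(a',·) | U, X`. -/
def CrossWorld (C : CausalModel Ω 𝒰 𝒟 ℳ 𝒲 𝒵 𝒳) (P : Measure Ω)
    [IsProbabilityMeasure P] : Prop :=
  ∀ a a', ∃ 𝓖 ≤ mΩ, ∃ 𝓗 ≤ mΩ, Carries 𝓖 (C.Yam a) ∧ Measurable[𝓖] (C.Dpot a) ∧
    Carries 𝓗 (C.Mpot a') ∧
    CondIndep (sigmaOf C.UX) 𝓖 𝓗 (C.U_meas.prodMk C.X_meas).comap_le P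

/-- Proxy variables: `W ⊥ {A, D, M} | U, X` and `Z ⊥ {W, D, M, Y} | A, U, X`. -/
structure Proxies (C : CausalModel Ω 𝒰 𝒟 ℳ 𝒲 𝒵 𝒳) (P : Measure Ω)
    [IsProbabilityMeasure P] : Prop where
  W : CondIndepFun (sigmaOf C.UX) (C.U_meas.prodMk C.X_meas).comap_le
    C.W (fun ω => (C.A ω, C.D ω, C.M ω)) P
  Z : CondIndepFun (sigmaOf fun ω => (C.A ω, C.UX ω))
    (C.A_meas.prodMk (C.U_meas.prodMk C.X_meas)).comap_le
    C.Z (fun ω => (C.W ω, C.D ω, C.M ω, C.Y ω)) P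

end Independence

/-! Completeness. In each case the conditioning variables other than the proxy are carried along
as arguments of `g`. -/

/-- Completeness of `Z` for `U` given `A = 1, M, D, X`. -/
def CompleteZ1 (C : CausalModel Ω 𝒰 𝒟 ℳ 𝒲 𝒵 𝒳) (P : Measure Ω) : Prop :=
  ∀ g : 𝒰 × ℳ × 𝒟 × 𝒳 → ℝ, Measurable g →
    MemLp (fun ω => g (C.U ω, C.M ω, C.D ω, C.X ω)) 2 (C.given P true) →
    (C.given P true)[fun ω => g (C.U ω, C.M ω, C.D ω, C.X ω) |
      sigmaOf fun ω => (C.Z ω, C.M ω, C.D ω, C.X ω)] =ᵐ[C.given P true] 0 →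
    (fun ω => g (C.U ω, C.M ω, C.D ω, C.X ω)) =ᵐ[C.given P true] 0

/-- Completeness of `Z` for `U` given `A = 0, D, X`. -/
def CompleteZ2 (C : CausalModel Ω 𝒰 𝒟 ℳ 𝒲 𝒵 𝒳) (P : Measure Ω) : Prop :=
  ∀ g : 𝒰 × 𝒟 × 𝒳 → ℝ, Measurable g →
    MemLp (fun ω => g (C.U ω, C.D ω, C.X ω)) 2 (C.given P false) →
    (C.given P false)[fun ω => g (C.U ω, C.D ω, C.X ω) |
      sigmaOf fun ω => (C.Z ω, C.D ω, C.X ω)] =ᵐ[C.given P false] 0 →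
    (fun ω => g (C.U ω, C.D ω, C.X ω)) =ᵐ[C.given P false] 0

/-- Completeness of `Z` for `U` given `A = 1, X`. -/
def CompleteZ3 (C : CausalModel Ω 𝒰 𝒟 ℳ 𝒲 𝒵 𝒳) (P : Measure Ω) : Prop :=
  ∀ g : 𝒰 × 𝒳 → ℝ, Measurable g →
    MemLp (fun ω => g (C.U ω, C.X ω)) 2 (C.given P true) →
    (C.given P true)[fun ω => g (C.U ω, C.X ω) |
      sigmaOf fun ω => (C.Z ω, C.X ω)] =ᵐ[C.given P true] 0 →
    (fun ω => g (C.U ω, C.X ω)) =ᵐ[C.given P true] 0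

/-- Completeness of `W` for `U` given `A = 1, X`. -/
def CompleteW1 (C : CausalModel Ω 𝒰 𝒟 ℳ 𝒲 𝒵 𝒳) (P : Measure Ω) : Prop :=
  ∀ g : 𝒰 × 𝒳 → ℝ, Measurable g →
    MemLp (fun ω => g (C.U ω, C.X ω)) 2 (C.given P true) →
    (C.given P true)[fun ω => g (C.U ω, C.X ω) |
      sigmaOf fun ω => (C.W ω, C.X ω)] =ᵐ[C.given P true] 0 →
    (fun ω => g (C.U ω, C.X ω)) =ᵐ[C.given P true] 0

/-- Completeness of `W` for `U` given `A = 0, D, X`. -/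
def CompleteW2 (C : CausalModel Ω 𝒰 𝒟 ℳ 𝒲 𝒵 𝒳) (P : Measure Ω) : Prop :=
  ∀ g : 𝒰 × 𝒟 × 𝒳 → ℝ, Measurable g →
    MemLp (fun ω => g (C.U ω, C.D ω, C.X ω)) 2 (C.given P false) →
    (C.given P false)[fun ω => g (C.U ω, C.D ω, C.X ω) |
      sigmaOf fun ω => (C.W ω, C.D ω, C.X ω)] =ᵐ[C.given P false] 0 →
    (fun ω => g (C.U ω, C.D ω, C.X ω)) =ᵐ[C.given P false] 0

/-! Square-integrability of the latent inverse probability weights, so that completeness, which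
concerns square-integrable functions, can be used. -/

/-- `1 / P(A=1|U,X)` is square-integrable given `A = 1`. -/
def Weight0 (C : CausalModel Ω 𝒰 𝒟 ℳ 𝒲 𝒵 𝒳) (P : Measure Ω) (f : Densities 𝒰 𝒟 ℳ 𝒳) : Prop :=
  MemLp (fun ω => 1 / f.e true (C.UX ω)) 2 (C.given P true)

/-- `f(D|A=1,U,X) / (f(D|A=0,U,X) P(A=0|U,X))` is square-integrable given `A = 0`. -/
def Weight1 (C : CausalModel Ω 𝒰 𝒟 ℳ 𝒲 𝒵 𝒳) (P : Measure Ω) (f : Densities 𝒰 𝒟 ℳ 𝒳) : Prop :=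
  MemLp (fun ω => f.fD true (C.UX ω, C.D ω) /
    (f.fD false (C.UX ω, C.D ω) * f.e false (C.UX ω))) 2 (C.given P false)

/-- `f(M|D,A=0,U,X) / (f(M|D,A=1,U,X) P(A=1|U,X))` is square-integrable given `A = 1`, and the
density of `(D, M)` given `A = 1, U = u, X = x` is, at each `(d,m,x)`, bounded in `u`. -/
def Weight2 (C : CausalModel Ω 𝒰 𝒟 ℳ 𝒲 𝒵 𝒳) (P : Measure Ω) (f : Densities 𝒰 𝒟 ℳ 𝒳) : Prop :=
  MemLp (fun ω => f.fM false ((C.UX ω, C.D ω), C.M ω) /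
    (f.fM true ((C.UX ω, C.D ω), C.M ω) * f.e true (C.UX ω))) 2 (C.given P true) ∧
  ∃ K : 𝒟 × ℳ × 𝒳 → ℝ, Measurable K ∧
    ∀ᵐ p ∂(((P.map C.UX).prod f.muD).prod f.muM),
      f.fD true p.1 * f.fM true p ≤ K (p.1.2, p.2, p.1.1.2)

/-! The four submodels: three bridge functions are correctly specified, and the completeness
conditions hold under which these three identify the estimand. -/

variable {k : Dims}

/-- `h₂, h₁, h₀` are correctly specified. -/
structure InM1 (C : CausalModel Ω 𝒰 𝒟 ℳ 𝒲 𝒵 𝒳) (P : Measure Ω)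
    (B : BridgeModels k 𝒟 ℳ 𝒲 𝒵 𝒳) : Prop where
  spec : B.Spec1 (P.map C.obs)
  z1 : C.CompleteZ1 P
  z2 : C.CompleteZ2 P
  z3 : C.CompleteZ3 P

/-- `q₀, q₁, q₂` are correctly specified. -/
structure InM2 (C : CausalModel Ω 𝒰 𝒟 ℳ 𝒲 𝒵 𝒳) (P : Measure Ω) (f : Densities 𝒰 𝒟 ℳ 𝒳)
    (B : BridgeModels k 𝒟 ℳ 𝒲 𝒵 𝒳) : Prop where
  spec : B.Spec2 (P.map C.obs)
  w1 : C.CompleteW1 P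
  w2 : C.CompleteW2 P
  weight0 : C.Weight0 P f
  weight1 : C.Weight1 P f
  weight2 : C.Weight2 P f

/-- `h₂, h₁, q₀` are correctly specified. -/
structure InM3 (C : CausalModel Ω 𝒰 𝒟 ℳ 𝒲 𝒵 𝒳) (P : Measure Ω) (f : Densities 𝒰 𝒟 ℳ 𝒳)
    (B : BridgeModels k 𝒟 ℳ 𝒲 𝒵 𝒳) : Prop where
  spec : B.Spec3 (P.map C.obs)
  z1 : C.CompleteZ1 P
  z2 : C.CompleteZ2 P
  w1 : C.CompleteW1 P
  weight0 : C.Weight0 P f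

/-- `h₂, q₀, q₁` are correctly specified. -/
structure InM4 (C : CausalModel Ω 𝒰 𝒟 ℳ 𝒲 𝒵 𝒳) (P : Measure Ω) (f : Densities 𝒰 𝒟 ℳ 𝒳)
    (B : BridgeModels k 𝒟 ℳ 𝒲 𝒵 𝒳) : Prop where
  spec : B.Spec4 (P.map C.obs)
  z1 : C.CompleteZ1 P
  w1 : C.CompleteW1 P
  w2 : C.CompleteW2 P
  weight0 : C.Weight0 P f
  weight1 : C.Weight1 P f

end CausalModel

end

end PathSpecific

open PathSpecific

/-! The argument joins three facts: a smooth plug-in average of estimating-equation solutions is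
asymptotically linear; its limit is $\psi$ as soon as one of four triples of bridge functions is
correct; and at the intersection its influence function is an unconstrained gradient.

Asymptotics. Dominated continuity on a compact set and uniqueness of the population root make
$\hat\theta$ consistent (`IsSample.whp_dist_root_lt`). Dominated differentiability linearizes both
the estimating equations and the plug-in average near $\theta^*$ (`IsSample.whp_linearization`).
With $J$ and $L$ the expected derivatives of the estimating function $F$ and of the summand $G$,
solving the first linearization and inserting the result in the second gives the influence function
$G(\theta^*)-c-LJ^{-1}F(\theta^*)$ (`IsSample.plugin_expansion`). The limit law then comes from the
central limit theorem.

Identification. Let $\eta_j$ be the mean of $h_j$ over the conditional law of $W$ given $(U,X)$. The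
causal assumptions show that the nested counterfactual has the law of $Y$ on arm 1 reweighted by
$w_2$ (`lintegral_nested_aux`), hence $\psi=E[Aw_2Y]$. Completeness of $Z$ lifts each outcome bridge
equation from the proxy to $U$, which gives the chain
$E[Aw_2Y]=E[(1-A)w_1\eta_2]=E[Aw_0\eta_1]=E[h_0]$. Dually, completeness of $W$ lifts the treatment
bridge equations: the latent means of $q_0,q_1,q_2$ on their arms are $w_0,w_1,w_2$. The $q_2$
equation has only completeness given $(A=1,X)$ at its disposal; boundedness of the density of
$(D,M)$ in $u$ lets it be applied section by section in $(d,m)$ (`CompleteW1.ae_eq_zero_UXDM`). A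
correct $h_j$ annihilates one increment of the moment function and a correct $q_j$ makes
neighbouring terms telescope, so each triple leaves exactly one expression of the chain
(`integral_quad_eq_psi`). Uniqueness of the sequential root ensures that the limits of the correctly
specified parameters are bridge functions.

Efficiency. When all six functions are correct, a change of any one of them leaves the mean of the
moment function unchanged; hence $L=0$ and nuisance estimation has no first-order effect. For the
tangent space, the operators $h_2\mapsto E(h_2\mid A=1,Z,M,D,X)$, $h_1\mapsto E(h_1\mid A=0,Z,D,X)$
and $h_0\mapsto E(h_0\mid A=1,Z,X)$ are boundedly invertible (`ProxyKernels.invertibleBridges`). For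
$h_2$ this is surjectivity with uniqueness. For the two smaller function spaces the lower bound is
inherited from $T_2$ through the latent variables, and density of the range comes from completeness
of $W$. Invertibility survives small bounded perturbations of the law, so every bounded mean-zero
function is a score (`mem_scores`) and the tangent space is all of mean-zero $L^2$.

For the derivative, write $m_t$ for the moment function with the outcome bridges of $Q_t$ and the
treatment bridges of $Q$. The target at $Q_t$ is $\int p_t m_t\,dQ$, while $\int m_t\,dQ$ does not
depend on $t$. The increment is therefore $\int(p_t-1)m_t\,dQ$, and replacing $m_t$ by $m_0$ costs
$O(t^2)$ because the bridges are Lipschitz in the law (`WeightedBridges.exists_bound`). -/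

open scoped ENNReal
set_option linter.unusedSectionVars false

/-! ### Events whose probability tends to one, and averages over an i.i.d. sample -/

section Whp

variable {S : Type*} [MeasurableSpace S] {Pr : Measure S}

/-- The events `E n` have probability tending to one. -/
def Whp (Pr : Measure S) (E : ℕ → Set S) : Prop :=
  Tendsto (fun n => Pr (E n)ᶜ) atTop (𝓝 0)

lemma Whp.mono {E F : ℕ → Set S} (h : Whp Pr E) (hEF : ∀ᶠ n in atTop, E n ⊆ F n) : Whp Pr F := by
  refine tendsto_of_tendsto_of_tendsto_of_le_of_le' tendsto_const_nhds h
    (Eventually.of_forall fun _ => zero_le) ?_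
  filter_upwards [hEF] with n hn
  exact measure_mono (Set.compl_subset_compl.2 hn)

lemma Whp.mono_ae {E F : ℕ → Set S} {p : S → Prop} (h : Whp Pr E) (hp : ∀ᵐ ω ∂Pr, p ω)
    (hEF : ∀ᶠ n in atTop, ∀ ω, p ω → ω ∈ E n → ω ∈ F n) : Whp Pr F := by
  refine tendsto_of_tendsto_of_tendsto_of_le_of_le' tendsto_const_nhds h
    (Eventually.of_forall fun _ => zero_le) ?_
  filter_upwards [hEF] with n hn
  refine measure_mono_ae ?_
  filter_upwards [hp] with ω hω h1 h2
  exact h1 (hn ω hω h2)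

lemma Whp.inter {E F : ℕ → Set S} (hE : Whp Pr E) (hF : Whp Pr F) :
    Whp Pr (fun n => E n ∩ F n) := by
  have := hE.add hF
  rw [add_zero] at this
  refine tendsto_of_tendsto_of_tendsto_of_le_of_le tendsto_const_nhds this
    (fun _ => zero_le) (fun n => ?_)
  simp only [Set.compl_inter]
  exact measure_union_le _ _

lemma whp_univ : Whp Pr (fun _ => Set.univ) := by simp [Whp]

lemma Whp.biInter {ι : Type*} {s : Set ι} (hs : s.Finite) {E : ι → ℕ → Set S}
    (h : ∀ i ∈ s, Whp Pr (E i)) : Whp Pr (fun n => ⋂ i ∈ s, E i n) := by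
  induction s, hs using Set.Finite.induction_on with
  | empty => simpa using whp_univ
  | insert _ _ ih =>
    simp only [Set.biInter_insert]
    exact (h _ (Set.mem_insert _ _)).inter (ih fun i hi => h i (Set.mem_insert_of_mem _ hi))

lemma whp_of_tendsto_one [IsProbabilityMeasure Pr] {E : ℕ → Set S}
    (hE : ∀ n, MeasurableSet (E n)) (h : Tendsto (fun n => Pr (E n)) atTop (𝓝 1)) :
    Whp Pr E := by
  have : (fun n => Pr (E n)ᶜ) = fun n => 1 - Pr (E n) := by
    funext n; exact prob_compl_eq_one_sub (hE n)
  rw [Whp, this]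
  simpa using ENNReal.Tendsto.sub (tendsto_const_nhds (x := (1 : ℝ≥0∞))) h (by simp)

lemma tendstoInMeasure_iff_whp {V : Type*} [SeminormedAddCommGroup V] {X : ℕ → S → V} {Y : S → V} :
    TendstoInMeasure Pr X atTop Y ↔ ∀ ε : ℝ, 0 < ε → Whp Pr fun n => {ω | ‖X n ω - Y ω‖ < ε} := by
  rw [tendstoInMeasure_iff_norm]
  refine forall₂_congr fun ε _ => ?_
  simp only [Whp, Set.compl_ofPred, not_lt]

/-- A real sequence that is bounded in probability. -/
def BddInProb (Pr : Measure S) (X : ℕ → S → ℝ) : Prop :=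
  ∀ ε : ℝ≥0∞, 0 < ε → ∃ C : ℝ, 0 < C ∧ ∀ᶠ n in atTop, Pr {ω | C < X n ω} ≤ ε

/-- If `X n ≤ c (ε) * B n` with probability tending to one for arbitrarily small `c`, with `B`
bounded in probability, then `X n → 0` in probability. -/
lemma tendstoInMeasure_zero_of_le_mul {V : Type*} [SeminormedAddCommGroup V] {X : ℕ → S → V}
    {B : ℕ → S → ℝ} (hB : BddInProb Pr B)
    (h : ∀ c : ℝ, 0 < c → Whp Pr fun n => {ω | ‖X n ω‖ ≤ c * B n ω}) :
    TendstoInMeasure Pr X atTop (fun _ => 0) := by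
  rw [tendstoInMeasure_iff_norm]
  intro η hη
  rw [ENNReal.tendsto_nhds_zero]
  intro ε hε
  obtain ⟨C, hC, hBC⟩ := hB (ε / 2) (ENNReal.half_pos hε.ne')
  -- With factor $\eta/(2C)$ the bound is at most $\eta/2$ where $B_n\le C$, which contradicts
  -- $\eta\le\|X_n\|$.
  have h1 := ENNReal.tendsto_nhds_zero.1 (h (η / (2 * C)) (by positivity)) (ε / 2)
    (ENNReal.half_pos hε.ne')
  filter_upwards [hBC, h1] with n h2 h3
  calc Pr {ω | η ≤ ‖X n ω - 0‖}
      ≤ Pr ({ω | C < B n ω} ∪ {ω | ‖X n ω‖ ≤ η / (2 * C) * B n ω}ᶜ) := by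
        refine measure_mono fun ω hω => ?_
        by_contra hcon
        simp only [Set.mem_union, Set.mem_ofPred_eq, Set.mem_compl_iff, not_or, not_lt,
          not_not, sub_zero] at hcon hω
        have : η / (2 * C) * B n ω ≤ η / (2 * C) * C :=
          mul_le_mul_of_nonneg_left hcon.1 (by positivity)
        have h4 : η / (2 * C) * C = η / 2 := by field_simp
        linarith [hcon.2]
    _ ≤ ε / 2 + ε / 2 := (measure_union_le _ _).trans (add_le_add h2 h3)
    _ = ε := ENNReal.add_halves ε

end Whp

section Sample

variable {S 𝒪 : Type*} [MeasurableSpace S] [MeasurableSpace 𝒪]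

/-- The average of `f` over the first `n` observations. -/
noncomputable def avg {V : Type*} [AddCommGroup V] [Module ℝ V] (O : ℕ → S → 𝒪) (n : ℕ)
    (f : 𝒪 → V) (ω : S) : V :=
  (n : ℝ)⁻¹ • ∑ i ∈ Finset.range n, f (O i ω)

/-- `O` is an i.i.d. sample from `Q`. -/
structure IsSample (Pr : Measure S) (Q : Measure 𝒪) (O : ℕ → S → 𝒪) : Prop where
  meas : ∀ i, Measurable (O i)
  law : ∀ i, Pr.map (O i) = Q
  indep : iIndepFun O Pr

variable {Pr : Measure S} [IsProbabilityMeasure Pr] {Q : Measure 𝒪} {O : ℕ → S → 𝒪}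

lemma avg_sub {V : Type*} [AddCommGroup V] [Module ℝ V] (n : ℕ) (f g : 𝒪 → V) (ω : S) :
    avg O n (fun o => f o - g o) ω = avg O n f ω - avg O n g ω := by
  simp [avg, smul_sub]

lemma norm_avg_le {V : Type*} [NormedAddCommGroup V] [NormedSpace ℝ V] {n : ℕ} {f : 𝒪 → V}
    {g : 𝒪 → ℝ} {ω : S} (h : ∀ i, ‖f (O i ω)‖ ≤ g (O i ω)) : ‖avg O n f ω‖ ≤ avg O n g ω := by
  rw [avg, avg, norm_smul, smul_eq_mul, norm_inv, Real.norm_natCast]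
  exact mul_le_mul_of_nonneg_left (norm_sum_le_of_le _ fun i _ => h i) (by positivity)

lemma IsSample.ae (hO : IsSample Pr Q O) {p : 𝒪 → Prop} (hp : ∀ᵐ o ∂Q, p o) :
    ∀ᵐ ω ∂Pr, ∀ i, p (O i ω) := by
  rw [ae_all_iff]
  intro i
  rw [← hO.law i] at hp
  exact ae_of_ae_map (hO.meas i).aemeasurable hp

lemma IsSample.isProbabilityMeasure (hO : IsSample Pr Q O) : IsProbabilityMeasure Q := by
  rw [← hO.law 0]
  exact Measure.isProbabilityMeasure_map (hO.meas 0).aemeasurable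

lemma IsSample.identDistrib (hO : IsSample Pr Q O) {V : Type*} [MeasurableSpace V] {f : 𝒪 → V}
    (hf : Measurable f) (i : ℕ) : IdentDistrib (fun ω => f (O i ω)) (fun ω => f (O 0 ω)) Pr Pr := by
  refine ⟨(hf.comp (hO.meas i)).aemeasurable, (hf.comp (hO.meas 0)).aemeasurable, ?_⟩
  have h := fun i => Measure.map_map (μ := Pr) hf (hO.meas i)
  simp only [hO.law] at h
  exact (h i).symm.trans (h 0)

lemma IsSample.integral_comp (hO : IsSample Pr Q O) {V : Type*} [NormedAddCommGroup V]
    [NormedSpace ℝ V] {f : 𝒪 → V} (hf : AEStronglyMeasurable f Q) (i : ℕ) :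
    ∫ ω, f (O i ω) ∂Pr = ∫ o, f o ∂Q := by
  rw [← hO.law i, integral_map (hO.meas i).aemeasurable (by rwa [hO.law i])]

/-- Weak law of large numbers. -/
lemma IsSample.whp_avg (hO : IsSample Pr Q O) {V : Type*} [NormedAddCommGroup V]
    [NormedSpace ℝ V] [CompleteSpace V] {f : 𝒪 → V} (hf : Integrable f Q) {ε : ℝ} (hε : 0 < ε) :
    Whp Pr fun n => {ω | ‖avg O n f ω - ∫ o, f o ∂Q‖ < ε} := by
  borelize V
  -- The law of large numbers is applied to a strongly measurable version; almost surely no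
  -- observation falls in the exceptional null set.
  obtain ⟨g, hg, hfg⟩ := hf.aestronglyMeasurable
  have hgi : Integrable g Q := hf.congr hfg
  have hfg' := hO.ae hfg
  have hint : ∫ o, f o ∂Q = ∫ o, g o ∂Q := integral_congr_ae hfg
  have key : ∀ᵐ ω ∂Pr, Tendsto (fun n : ℕ => avg O n g ω) atTop (𝓝 (∫ o, g o ∂Q)) := by
    have := strong_law_ae (μ := Pr) (fun i ω => g (O i ω))
      (by rw [← hO.law 0] at hgi; exact hgi.comp_measurable (hO.meas 0))
      (fun i j hij => (hO.indep.indepFun hij).comp hg.measurable hg.measurable)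
      (fun i => hO.identDistrib hg.measurable i)
    rw [hO.integral_comp hg.aestronglyMeasurable 0] at this
    exact this
  have hm : TendstoInMeasure Pr (fun n => avg O n g) atTop (fun _ => ∫ o, g o ∂Q) := by
    refine tendstoInMeasure_of_tendsto_ae (fun n => ?_) key
    have : StronglyMeasurable (fun ω => ∑ i ∈ Finset.range n, g (O i ω)) :=
      Finset.stronglyMeasurable_fun_sum _ fun i _ => hg.comp_measurable (hO.meas i)
    exact (this.const_smul _).aestronglyMeasurable
  refine (tendstoInMeasure_iff_whp.1 hm ε hε).mono_ae hfg' (Eventually.of_forall fun n ω h1 h2 => ?_)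
  have : avg O n f ω = avg O n g ω := by simp [avg, h1]
  simpa [this, hint] using h2

/-- Averages of integrable functions with small integral are small with probability tending to
one. -/
lemma IsSample.whp_avg_lt (hO : IsSample Pr Q O) {f : 𝒪 → ℝ} (hf : Integrable f Q) {ε : ℝ}
    (hε : ∫ o, f o ∂Q < ε) : Whp Pr fun n => {ω | avg O n f ω < ε} := by
  refine (hO.whp_avg hf (sub_pos.2 hε)).mono (Eventually.of_forall fun n ω hω => ?_)
  have := (abs_lt.1 (Set.mem_ofPred_eq ▸ hω : |_| < _)).2
  simp only [Set.mem_ofPred_eq]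
  linarith

/-- Centred normalized sums of square-integrable real functions are bounded in probability. -/
lemma IsSample.bddInProb_real (hO : IsSample Pr Q O) {f : 𝒪 → ℝ} (hfm : Measurable f)
    (hf : MemLp f 2 Q) (h0 : ∫ o, f o ∂Q = 0) :
    BddInProb Pr fun n ω => |(Real.sqrt n)⁻¹ * ∑ i ∈ Finset.range n, f (O i ω)| := by
  have hL : ∀ i, MemLp (fun ω => f (O i ω)) 2 Pr := fun i => by
    rw [← hO.law i] at hf; exact hf.comp_measurePreserving ⟨hO.meas i, rfl⟩
  set v := Var[fun ω => f (O 0 ω); Pr] with hv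
  have hvi : ∀ i, Var[fun ω => f (O i ω); Pr] = v := fun i => (hO.identDistrib hfm i).variance_eq
  have hmean : ∀ n, ∫ ω, ∑ i ∈ Finset.range n, f (O i ω) ∂Pr = 0 := fun n => by
    rw [integral_finsetSum _ fun i _ => (hL i).integrable (by norm_num)]
    exact Finset.sum_eq_zero fun i _ => by rw [hO.integral_comp hfm.aestronglyMeasurable i, h0]
  have hvar : ∀ n : ℕ, Var[fun ω => ∑ i ∈ Finset.range n, f (O i ω); Pr] = n * v := fun n => by
    have := IndepFun.variance_sum (μ := Pr) (X := fun i ω => f (O i ω)) (s := Finset.range n)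
      (fun i _ => hL i) (fun i _ j _ hij => (hO.indep.indepFun hij).comp hfm hfm)
    simp only [hvi, Finset.sum_const, Finset.card_range, nsmul_eq_mul] at this
    rw [← this]; congr 1; ext ω; simp
  have hv0 : 0 ≤ v := variance_nonneg _ _
  intro ε hε
  obtain ⟨δ, hδ, hδε⟩ : ∃ δ : ℝ, 0 < δ ∧ ENNReal.ofReal δ ≤ ε := by
    rcases eq_or_ne ε ⊤ with rfl | h
    · exact ⟨1, one_pos, le_top⟩
    · exact ⟨ε.toReal, ENNReal.toReal_pos hε.ne' h, by rw [ENNReal.ofReal_toReal h]⟩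
  -- Chebyshev bounds the probability by $nv/(n(v+1)/\delta)\le\delta$. The added 1 keeps the
  -- threshold positive when the variance is zero.
  refine ⟨Real.sqrt ((v + 1) / δ), by positivity, ?_⟩
  filter_upwards [eventually_ge_atTop 1] with n hn
  have hn0 : (0 : ℝ) < n := by exact_mod_cast hn
  have hLs : MemLp (fun ω => ∑ i ∈ Finset.range n, f (O i ω)) 2 Pr :=
    memLp_finsetSum _ fun i _ => hL i
  have hc : 0 < Real.sqrt n * Real.sqrt ((v + 1) / δ) := by positivity
  have := meas_ge_le_variance_div_sq hLs hc
  rw [hmean, hvar] at this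
  refine (measure_mono fun ω hω => ?_).trans (this.trans ((ENNReal.ofReal_le_ofReal ?_).trans hδε))
  · simp only [Set.mem_ofPred_eq, sub_zero, abs_mul, abs_inv, abs_of_nonneg (Real.sqrt_nonneg _)] at hω ⊢
    rw [inv_mul_eq_div, lt_div_iff₀ (by positivity)] at hω
    rw [mul_comm]; exact hω.le
  · rw [mul_pow, Real.sq_sqrt hn0.le, Real.sq_sqrt (by positivity), div_le_iff₀ (by positivity)]
    have : δ * (n * ((v + 1) / δ)) = n * (v + 1) := by field_simp
    rw [this]; nlinarith

lemma BddInProb.add {X Y : ℕ → S → ℝ} (hX : BddInProb Pr X) (hY : BddInProb Pr Y) :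
    BddInProb Pr fun n ω => X n ω + Y n ω := by
  intro ε hε
  obtain ⟨C, hC, h1⟩ := hX (ε / 2) (ENNReal.half_pos hε.ne')
  obtain ⟨D, hD, h2⟩ := hY (ε / 2) (ENNReal.half_pos hε.ne')
  refine ⟨C + D, by positivity, ?_⟩
  filter_upwards [h1, h2] with n h3 h4
  calc Pr {ω | C + D < X n ω + Y n ω} ≤ Pr ({ω | C < X n ω} ∪ {ω | D < Y n ω}) := by
        refine measure_mono fun ω hω => ?_
        by_contra hcon
        simp only [Set.mem_union, Set.mem_ofPred_eq, not_or, not_lt] at hcon hω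
        linarith [hcon.1, hcon.2]
    _ ≤ ε / 2 + ε / 2 := (measure_union_le _ _).trans (add_le_add h3 h4)
    _ = ε := ENNReal.add_halves ε

lemma BddInProb.sum {ι : Type*} (s : Finset ι) {X : ι → ℕ → S → ℝ}
    (h : ∀ i ∈ s, BddInProb Pr (X i)) : BddInProb Pr fun n ω => ∑ i ∈ s, X i n ω := by
  classical
  induction s using Finset.induction_on with
  | empty =>
    intro ε hε
    exact ⟨1, one_pos, Eventually.of_forall fun n => by simp [not_lt.2 zero_le_one]⟩
  | insert i s hi ih =>
    simp only [Finset.sum_insert hi]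
    exact (h i (Finset.mem_insert_self _ _)).add
      (ih fun j hj => h j (Finset.mem_insert_of_mem hj))

lemma BddInProb.of_le_mul {X Y : ℕ → S → ℝ} {c : ℝ} (hc : 0 < c) (hY : BddInProb Pr Y)
    (h : ∀ n ω, X n ω ≤ c * Y n ω) : BddInProb Pr X := by
  intro ε hε
  obtain ⟨C, hC, h1⟩ := hY ε hε
  refine ⟨c * C, by positivity, ?_⟩
  filter_upwards [h1] with n h2
  refine (measure_mono fun ω hω => ?_).trans h2
  exact lt_of_mul_lt_mul_left (lt_of_lt_of_le hω (h n ω)) hc.le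

/-- Centred normalized sums of square-integrable functions with values in a finite-dimensional
space are bounded in probability. -/
lemma IsSample.bddInProb (hO : IsSample Pr Q O) {V : Type*} [NormedAddCommGroup V]
    [NormedSpace ℝ V] [FiniteDimensional ℝ V] [MeasurableSpace V] [BorelSpace V] {f : 𝒪 → V}
    (hfm : Measurable f) (hf : MemLp f 2 Q) (h0 : ∫ o, f o ∂Q = 0) :
    BddInProb Pr fun n ω => ‖(Real.sqrt n)⁻¹ • ∑ i ∈ Finset.range n, f (O i ω)‖ := by
  have := hO.isProbabilityMeasure
  let b := Module.finBasis ℝ V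
  let ℓ : Fin (Module.finrank ℝ V) → V →L[ℝ] ℝ := fun i => LinearMap.toContinuousLinearMap (b.coord i)
  have hℓ : ∀ v, v = ∑ i, ℓ i v • b i := fun v => (b.sum_repr v).symm
  have hi : ∀ i, BddInProb Pr fun n ω =>
      |(Real.sqrt n)⁻¹ * ∑ j ∈ Finset.range n, ℓ i (f (O j ω))| := fun i => by
    refine hO.bddInProb_real (f := fun o => ℓ i (f o)) ((ℓ i).continuous.measurable.comp hfm)
      ((ℓ i).comp_memLp' hf) ?_
    rw [ContinuousLinearMap.integral_comp_comm _ (hf.integrable (by norm_num)), h0, map_zero]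
  have hs := BddInProb.sum Finset.univ fun i _ => hi i
  refine BddInProb.of_le_mul (c := ∑ i, ‖b i‖ + 1) (by positivity) hs fun n ω => ?_
  set v := (Real.sqrt n)⁻¹ • ∑ i ∈ Finset.range n, f (O i ω) with hv
  have hvi : ∀ i, ℓ i v = (Real.sqrt n)⁻¹ * ∑ j ∈ Finset.range n, ℓ i (f (O j ω)) := fun i => by
    rw [hv, map_smul, map_sum, smul_eq_mul]
  have hnn : 0 ≤ ∑ i, |ℓ i v| := Finset.sum_nonneg fun _ _ => abs_nonneg _
  calc ‖v‖ = ‖∑ i, ℓ i v • b i‖ := by rw [← hℓ v]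
    _ ≤ ∑ i, |ℓ i v| * ‖b i‖ := norm_sum_le_of_le _ fun i _ => by rw [norm_smul, Real.norm_eq_abs]
    _ ≤ ∑ i, |ℓ i v| * (∑ j, ‖b j‖) := Finset.sum_le_sum fun i _ =>
        mul_le_mul_of_nonneg_left
          (Finset.single_le_sum (f := fun j => ‖b j‖) (fun _ _ => norm_nonneg _) (Finset.mem_univ i))
          (abs_nonneg _)
    _ = (∑ i, |ℓ i v|) * ∑ j, ‖b j‖ := by rw [Finset.sum_mul]
    _ ≤ (∑ i, ‖b i‖ + 1) * ∑ i, |ℓ i v| := by nlinarith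
    _ = _ := by simp only [hvi]

/-- Central limit theorem for a centred square-integrable function. -/
lemma IsSample.clt (hO : IsSample Pr Q O) {f : 𝒪 → ℝ} (hfm : Measurable f)
    (hf : MemLp f 2 Q) (h0 : ∫ o, f o ∂Q = 0) :
    TendstoInDistribution (fun (n : ℕ) ω => (Real.sqrt n)⁻¹ * ∑ i ∈ Finset.range n, f (O i ω))
      atTop (id : ℝ → ℝ) (fun _ => Pr) (gaussianReal 0 (∫ o, f o ^ 2 ∂Q).toNNReal) := by
  have hL : MemLp (fun ω => f (O 0 ω)) 2 Pr := by
    rw [← hO.law 0] at hf; exact hf.comp_measurePreserving ⟨hO.meas 0, rfl⟩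
  have hmean : ∫ ω, f (O 0 ω) ∂Pr = 0 := by
    rw [hO.integral_comp hfm.aestronglyMeasurable 0, h0]
  have hvar : Var[fun ω => f (O 0 ω); Pr] = ∫ o, f o ^ 2 ∂Q := by
    rw [variance_of_integral_eq_zero hL.aestronglyMeasurable.aemeasurable hmean,
      ← hO.integral_comp (hfm.pow_const 2).aestronglyMeasurable 0]
  have := tendstoInDistribution_inv_sqrt_mul_sum_sub (P := Pr) (X := fun i ω => f (O i ω))
    (Y := (id : ℝ → ℝ)) (P' := gaussianReal 0 (∫ o, f o ^ 2 ∂Q).toNNReal)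
    (by rw [hvar]; exact HasLaw.id) hL
    (hO.indep.comp (fun _ => f) fun _ => hfm) (fun i => hO.identDistrib hfm i)
  simpa [hmean] using this

end Sample

/-! ### Uniform control of averages of parametric families -/

section Families

variable {S 𝒪 : Type*} [MeasurableSpace S] [MeasurableSpace 𝒪]
  {Pr : Measure S} [IsProbabilityMeasure Pr] {Q : Measure 𝒪} {O : ℕ → S → 𝒪}

/-- A family of functions, continuous and dominated on `T` and tending to zero at `θ₀`, has near
`θ₀` an integrable envelope with arbitrarily small integral. -/
lemma exists_small_envelope {E : Type*} [PseudoMetricSpace E] [SecondCountableTopology E]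
    {T : Set E} {θ₀ : E} {G : 𝒪 → E → ℝ}
    (hmeas : ∀ θ ∈ T, AEMeasurable (fun o => G o θ) Q)
    (hcont : ∀ᵐ o ∂Q, ContinuousOn (G o) T)
    (hdom : ∃ K : 𝒪 → ℝ, Integrable K Q ∧ ∀ᵐ o ∂Q, ∀ θ ∈ T, G o θ ≤ K o)
    (hlim : ∀ᵐ o ∂Q, Tendsto (G o) (𝓝[T] θ₀) (𝓝 0)) {ε : ℝ} (hε : 0 < ε) :
    ∃ δ > 0, ∃ Δ : 𝒪 → ℝ, Integrable Δ Q ∧ ∫ o, Δ o ∂Q < ε ∧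
      ∀ᵐ o ∂Q, ∀ θ ∈ T, dist θ θ₀ < δ → G o θ ≤ Δ o := by
  -- The envelope is a supremum over shrinking balls. Taking it over a countable dense subset keeps
  -- it measurable, dominated convergence sends its integral to zero, and continuity restores the
  -- missing points.
  have hD : ∀ m : ℕ, ∃ t, t ⊆ T ∩ Metric.ball θ₀ (1 / (m + 1)) ∧ t.Countable ∧
      T ∩ Metric.ball θ₀ (1 / (m + 1)) ⊆ closure t := fun m =>
    (TopologicalSpace.IsSeparable.of_separableSpace _).exists_countable_dense_subset
  choose D hDs hDc hDd using hD
  obtain ⟨K, hK, hGK⟩ := hdom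
  set M : ℕ → 𝒪 → ℝ≥0∞ := fun m o => ⨆ θ ∈ D m, ENNReal.ofReal (G o θ) with hM
  have hMm : ∀ m, AEMeasurable (M m) Q := fun m =>
    AEMeasurable.biSup _ (hDc m) fun θ hθ => (hmeas θ (hDs m hθ).1).ennreal_ofReal
  have hMK : ∀ m, ∀ᵐ o ∂Q, M m o ≤ ENNReal.ofReal (K o) := fun m => by
    filter_upwards [hGK] with o ho
    exact iSup₂_le fun θ hθ => ENNReal.ofReal_le_ofReal (ho θ (hDs m hθ).1)
  have hKfin : ∫⁻ o, ENNReal.ofReal (K o) ∂Q ≠ ∞ :=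
    (lt_of_le_of_lt (lintegral_mono fun o => Real.ofReal_le_enorm (K o)) hK.2).ne
  have hM0 : ∀ᵐ o ∂Q, Tendsto (fun m => M m o) atTop (𝓝 0) := by
    filter_upwards [hlim] with o ho
    rw [ENNReal.tendsto_nhds_zero]
    intro η hη
    obtain ⟨r, hr, hrη⟩ : ∃ r : ℝ, 0 < r ∧ ENNReal.ofReal r ≤ η := by
      rcases eq_or_ne η ⊤ with rfl | h
      · exact ⟨1, one_pos, le_top⟩
      · exact ⟨η.toReal, ENNReal.toReal_pos hη.ne' h, by rw [ENNReal.ofReal_toReal h]⟩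
    have h1 := ho (Iio_mem_nhds hr)
    rw [mem_map, mem_nhdsWithin_iff_exists_mem_nhds_inter] at h1
    obtain ⟨u, hu, huT⟩ := h1
    obtain ⟨s, hs, hsu⟩ := Metric.mem_nhds_iff.1 hu
    obtain ⟨m₀, hm₀⟩ := exists_nat_one_div_lt hs
    filter_upwards [eventually_ge_atTop m₀] with m hm
    refine iSup₂_le fun θ hθ => (ENNReal.ofReal_le_ofReal ?_).trans hrη
    have h2 := hDs m hθ
    refine (huT ⟨hsu ?_, h2.1⟩ : G o θ ∈ Set.Iio r).le
    refine Metric.ball_subset_ball ?_ h2.2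
    exact (one_div_le_one_div_of_le (by positivity) (by gcongr)).trans hm₀.le
  have hlimM : Tendsto (fun m => ∫⁻ o, M m o ∂Q) atTop (𝓝 0) := by
    have := tendsto_lintegral_of_dominated_convergence' (μ := Q) (F := M) (f := fun _ => 0)
      (fun o => ENNReal.ofReal (K o)) hMm hMK hKfin hM0
    simpa using this
  obtain ⟨m, hm⟩ := ((tendsto_order.1 hlimM).2 (ENNReal.ofReal ε) (ENNReal.ofReal_pos.2 hε)).exists
  have hmfin : ∫⁻ o, M m o ∂Q ≠ ∞ := (hm.trans ENNReal.ofReal_lt_top).ne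
  refine ⟨1 / (m + 1), by positivity, fun o => (M m o).toReal,
    integrable_toReal_of_lintegral_ne_top (hMm m) hmfin, ?_, ?_⟩
  · rw [integral_toReal (hMm m) (ae_lt_top' (hMm m) hmfin)]
    exact (ENNReal.lt_ofReal_iff_toReal_lt hmfin).1 hm
  · filter_upwards [ae_lt_top' (hMm m) hmfin, hcont] with o ho hc θ hθ hd
    -- The bound on the dense set passes to the limit along $\theta'\to\theta$ within that set.
    have hcl : θ ∈ closure (D m) := hDd m ⟨hθ, hd⟩
    have hle : ∀ θ' ∈ D m, G o θ' ≤ (M m o).toReal := fun θ' hθ' => by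
      rw [← ENNReal.ofReal_le_iff_le_toReal ho.ne]
      exact le_iSup₂ (f := fun θ (_ : θ ∈ D m) => ENNReal.ofReal (G o θ)) θ' hθ'
    have hne : (𝓝[D m] θ).NeBot := mem_closure_iff_nhdsWithin_neBot.1 hcl
    have ht : Tendsto (G o) (𝓝[D m] θ) (𝓝 (G o θ)) :=
      (hc θ hθ).mono_left (nhdsWithin_mono _ fun x hx => (hDs m hx).1)
    exact le_of_tendsto ht (eventually_mem_nhdsWithin.mono hle)

variable {E V : Type*} [NormedAddCommGroup V] [NormedSpace ℝ V] [CompleteSpace V]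

/-- Near $\theta_0$ the oscillation of $F$ has an envelope with mean below half of $\|E
F(\theta_0)\|$. A zero average at a nearby $\theta$ would make the average at $\theta_0$ smaller
than that half, while the law of large numbers keeps it within the other half of its limit. -/
lemma IsSample.whp_avg_ne_zero (hO : IsSample Pr Q O) [PseudoMetricSpace E]
    [SecondCountableTopology E] {Θ : Set E} {F : 𝒪 → E → V}
    (hmeas : ∀ θ ∈ Θ, AEStronglyMeasurable (fun o => F o θ) Q)
    (hcont : ∀ᵐ o ∂Q, ContinuousOn (F o) Θ)
    (hdom : ∃ K : 𝒪 → ℝ, Integrable K Q ∧ ∀ᵐ o ∂Q, ∀ θ ∈ Θ, ‖F o θ‖ ≤ K o)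
    {θ₀ : E} (hθ₀ : θ₀ ∈ Θ) (hne : ∫ o, F o θ₀ ∂Q ≠ 0) :
    ∃ δ > 0, Whp Pr fun n => {ω | ∀ θ ∈ Θ, dist θ θ₀ < δ → avg O n (fun o => F o θ) ω ≠ 0} := by
  obtain ⟨K, hK, hFK⟩ := hdom
  have hm : 0 < ‖∫ o, F o θ₀ ∂Q‖ := norm_pos_iff.2 hne
  obtain ⟨δ, hδ, Δ, hΔ, hΔε, hFΔ⟩ := exists_small_envelope (Q := Q) (T := Θ) (θ₀ := θ₀)
    (G := fun o θ => ‖F o θ - F o θ₀‖)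
    (fun θ hθ => ((hmeas θ hθ).sub (hmeas θ₀ hθ₀)).norm.aemeasurable)
    (by filter_upwards [hcont] with o ho using (ho.sub continuousOn_const).norm)
    ⟨fun o => K o + K o, hK.add hK, by
      filter_upwards [hFK] with o ho θ hθ
      exact (norm_sub_le _ _).trans (add_le_add (ho θ hθ) (ho θ₀ hθ₀))⟩
    (by
      filter_upwards [hcont] with o ho
      have := ((ho θ₀ hθ₀).sub (continuousWithinAt_const (b := F o θ₀))).norm
      simpa [ContinuousWithinAt] using this)
    (half_pos hm)
  refine ⟨δ, hδ, ?_⟩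
  have hint : Integrable (fun o => F o θ₀) Q :=
    hK.mono' (hmeas θ₀ hθ₀) (by filter_upwards [hFK] with o ho using ho θ₀ hθ₀)
  refine (((hO.whp_avg hint (half_pos hm))).inter (hO.whp_avg_lt hΔ hΔε)).mono_ae
    (hO.ae hFΔ) (Eventually.of_forall fun n ω h1 h2 θ hθ hd h0 => ?_)
  obtain ⟨h3, h4⟩ := h2
  have h5 : ‖avg O n (fun o => F o θ - F o θ₀) ω‖ ≤ avg O n Δ ω :=
    norm_avg_le fun i => h1 i θ hθ hd
  rw [avg_sub, h0, zero_sub, norm_neg] at h5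
  have h6 := norm_le_norm_add_norm_sub (avg O n (fun o => F o θ₀) ω) (∫ o, F o θ₀ ∂Q)
  simp only [Set.mem_ofPred_eq] at h3 h4
  linarith

/-- Consistency of approximate roots of estimating equations over a compact parameter set. -/
lemma IsSample.whp_dist_root_lt (hO : IsSample Pr Q O) [PseudoMetricSpace E]
    [SecondCountableTopology E] {Θ : Set E} (hΘ : IsCompact Θ) {F : 𝒪 → E → V}
    (hmeas : ∀ θ ∈ Θ, AEStronglyMeasurable (fun o => F o θ) Q)
    (hcont : ∀ᵐ o ∂Q, ContinuousOn (F o) Θ)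
    (hdom : ∃ K : 𝒪 → ℝ, Integrable K Q ∧ ∀ᵐ o ∂Q, ∀ θ ∈ Θ, ‖F o θ‖ ≤ K o)
    {θs : E} (huniq : ∀ θ ∈ Θ, ∫ o, F o θ ∂Q = 0 → θ = θs) {θhat : ℕ → S → E}
    (hsol : Whp Pr fun n => {ω | θhat n ω ∈ Θ ∧ avg O n (fun o => F o (θhat n ω)) ω = 0})
    {ε : ℝ} (hε : 0 < ε) : Whp Pr fun n => {ω | dist (θhat n ω) θs < ε} := by
  -- Away from $\theta^*$ the parameter set is compact, so finitely many neighbourhoods without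
  -- empirical roots cover it. The events are intersected over this finite cover.
  have hK : IsCompact (Θ \ Metric.ball θs ε) := hΘ.diff Metric.isOpen_ball
  have hloc : ∀ θ ∈ Θ \ Metric.ball θs ε, ∃ δ > 0, Whp Pr fun n =>
      {ω | ∀ θ' ∈ Θ, dist θ' θ < δ → avg O n (fun o => F o θ') ω ≠ 0} := fun θ hθ => by
    refine hO.whp_avg_ne_zero hmeas hcont hdom hθ.1 fun h0 => hθ.2 ?_
    rw [huniq θ hθ.1 h0]
    exact Metric.mem_ball_self hε
  choose! δ hδ hW using hloc
  obtain ⟨t, ht, htc⟩ := hK.elim_nhds_subcover (fun θ => Metric.ball θ (δ θ))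
    fun θ hθ => Metric.ball_mem_nhds θ (hδ θ hθ)
  refine (hsol.inter (Whp.biInter t.finite_toSet fun θ hθ => hW θ (ht θ hθ))).mono
    (Eventually.of_forall fun n ω hω => ?_)
  obtain ⟨⟨h1, h2⟩, h3⟩ := hω
  by_contra hcon
  obtain ⟨θ, hθt, hθ⟩ := Set.mem_iUnion₂.1 (htc ⟨h1, hcon⟩)
  exact Set.mem_iInter₂.1 h3 θ hθt _ h1 hθ h2

/-- Each directional derivative is an almost sure limit of difference quotients, which are
measurable. In finite dimension the derivative is a finite combination of its values on a basis. -/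
lemma aestronglyMeasurable_fderiv [NormedAddCommGroup E] [NormedSpace ℝ E]
    [FiniteDimensional ℝ E] {F : 𝒪 → E → V} (hmeas : ∀ θ, AEStronglyMeasurable (fun o => F o θ) Q)
    {θ : E} (hd : ∀ᵐ o ∂Q, DifferentiableAt ℝ (F o) θ) :
    AEStronglyMeasurable (fun o => fderiv ℝ (F o) θ) Q := by
  have happ : ∀ v, AEStronglyMeasurable (fun o => fderiv ℝ (F o) θ v) Q := fun v => by
    refine aestronglyMeasurable_of_tendsto_ae atTop
      (f := fun (n : ℕ) o => ((n : ℝ) + 1) • (F o (θ + ((n : ℝ) + 1)⁻¹ • v) - F o θ))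
      (fun n => ((hmeas _).sub (hmeas _)).const_smul _) ?_
    filter_upwards [hd] with o ho
    have h1 : Tendsto (fun n : ℕ => ((n : ℝ) + 1)) atTop atTop :=
      tendsto_atTop_add_const_right _ _ tendsto_natCast_atTop_atTop
    exact ho.hasFDerivAt.lim_real v |>.comp h1
  let b := Module.finBasis ℝ E
  have hrep : (fun o => fderiv ℝ (F o) θ) = fun o => ∑ i,
      ((ContinuousLinearMap.smulRightL ℝ E V) (LinearMap.toContinuousLinearMap (b.coord i)))
        (fderiv ℝ (F o) θ (b i)) := by
    funext o
    ext v
    conv_lhs => rw [← b.sum_repr v, map_sum]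
    simp
  rw [hrep]
  exact Finset.aestronglyMeasurable_fun_sum _ fun i _ =>
    (ContinuousLinearMap.continuous _).comp_aestronglyMeasurable (happ (b i))

/-- Uniform linearization of averages of a family of functions which is differentiable near `θs`
with dominated derivative. -/
lemma IsSample.whp_linearization (hO : IsSample Pr Q O) [NormedAddCommGroup E] [NormedSpace ℝ E]
    [FiniteDimensional ℝ E] {F : 𝒪 → E → V}
    (hmeas : ∀ θ, AEStronglyMeasurable (fun o => F o θ) Q) {N : Set E} (hN : IsOpen N) {θs : E}
    (hθs : θs ∈ N) (hd : ∀ᵐ o ∂Q, ContDiffOn ℝ 1 (F o) N)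
    (hdom : ∃ K : 𝒪 → ℝ, Integrable K Q ∧ ∀ᵐ o ∂Q, ∀ θ ∈ N, ‖fderiv ℝ (F o) θ‖ ≤ K o)
    {ε : ℝ} (hε : 0 < ε) :
    ∃ δ > 0, Whp Pr fun n => {ω | ∀ θ, dist θ θs < δ →
      ‖avg O n (fun o => F o θ) ω - avg O n (fun o => F o θs) ω
        - (∫ o, fderiv ℝ (F o) θs ∂Q) (θ - θs)‖ ≤ ε * ‖θ - θs‖} := by
  obtain ⟨K, hK, hFK⟩ := hdom
  obtain ⟨r, hr, hrN⟩ := Metric.isOpen_iff.1 hN θs hθs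
  have hdiff : ∀ᵐ o ∂Q, ∀ θ ∈ N, DifferentiableAt ℝ (F o) θ := by
    filter_upwards [hd] with o ho θ hθ
    exact (ho.differentiableOn one_ne_zero).differentiableAt (hN.mem_nhds hθ)
  have hFm : AEStronglyMeasurable (fun o => fderiv ℝ (F o) θs) Q :=
    aestronglyMeasurable_fderiv hmeas (by filter_upwards [hdiff] with o ho using ho θs hθs)
  have hFi : Integrable (fun o => fderiv ℝ (F o) θs) Q :=
    hK.mono' hFm (by filter_upwards [hFK] with o ho using ho θs hθs)
  have : ProperSpace E := FiniteDimensional.proper_real E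
  have : SecondCountableTopology E := inferInstance
  -- The centre is removed because the family to be controlled is the quotient of the Taylor
  -- remainder by $\|\theta-\theta^*\|$. It tends to zero at $\theta^*$ by differentiability alone
  -- and is continuous elsewhere in the ball.
  let T : Set E := Metric.ball θs r \ {θs}
  let R : 𝒪 → E → V := fun o θ => F o θ - F o θs - fderiv ℝ (F o) θs (θ - θs)
  obtain ⟨δ, hδ, Δ, hΔ, hΔε, hRΔ⟩ := exists_small_envelope (Q := Q) (T := T) (θ₀ := θs)
    (G := fun o θ => ‖R o θ‖ / ‖θ - θs‖)
    (fun θ _ => ((((hmeas θ).sub (hmeas θs)).sub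
      ((ContinuousLinearMap.apply ℝ V (θ - θs)).continuous.comp_aestronglyMeasurable
        hFm)).norm.aemeasurable.div_const _))
    (by
      filter_upwards [hdiff] with o ho θ hθ
      have h1 : ContinuousAt (F o) θ := (ho θ (hrN hθ.1)).continuousAt
      have h2 : ContinuousAt (R o) θ := (h1.sub continuousAt_const).sub (by fun_prop)
      refine (h2.norm.div (by fun_prop) ?_).continuousWithinAt
      exact norm_ne_zero_iff.2 (sub_ne_zero.2 hθ.2))
    ⟨fun o => K o + K o, hK.add hK, by
      filter_upwards [hFK, hdiff] with o ho ho2 θ hθ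
      have hne : 0 < ‖θ - θs‖ := norm_pos_iff.2 (sub_ne_zero.2 hθ.2)
      rw [div_le_iff₀ hne]
      -- The mean value inequality on the convex ball bounds the increment by $K$, and the linear
      -- term contributes a second $K$; hence the dominating function $K+K$.
      have h1 : ‖F o θ - F o θs‖ ≤ K o * ‖θ - θs‖ :=
        (convex_ball θs r).norm_image_sub_le_of_norm_fderiv_le
          (fun x hx => ho2 x (hrN hx)) (fun x hx => ho x (hrN hx))
          (Metric.mem_ball_self hr) hθ.1
      have h2 : ‖fderiv ℝ (F o) θs (θ - θs)‖ ≤ K o * ‖θ - θs‖ :=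
        (ContinuousLinearMap.le_opNorm _ _).trans
          (mul_le_mul_of_nonneg_right (ho θs hθs) hne.le)
      rw [add_mul]
      exact (norm_sub_le _ _).trans (add_le_add h1 h2)⟩
    (by
      filter_upwards [hdiff] with o ho
      have h1 := (ho θs hθs).hasFDerivAt.isLittleO
      have h2 := h1.norm_norm.tendsto_div_nhds_zero
      exact h2.mono_left nhdsWithin_le_nhds)
    (half_pos hε)
  refine ⟨min δ r, lt_min hδ hr, ?_⟩
  refine ((hO.whp_avg hFi (half_pos hε)).inter (hO.whp_avg_lt hΔ hΔε)).mono_ae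
    (hO.ae hRΔ) (Eventually.of_forall fun n ω h1 h2 θ hd => ?_)
  obtain ⟨h3, h4⟩ := h2
  simp only [Set.mem_ofPred_eq] at h3 h4
  rcases eq_or_ne θ θs with rfl | hne
  · simp
  have hpos : 0 < ‖θ - θs‖ := norm_pos_iff.2 (sub_ne_zero.2 hne)
  have h5 : ‖avg O n (fun o => R o θ) ω‖ ≤ avg O n (fun o => Δ o * ‖θ - θs‖) ω :=
    norm_avg_le fun i => by
      have := h1 i θ ⟨hd.trans_le (min_le_right _ _), hne⟩ (hd.trans_le (min_le_left _ _))
      rwa [div_le_iff₀ hpos] at this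
  have h6 : avg O n (fun o => Δ o * ‖θ - θs‖) ω = avg O n Δ ω * ‖θ - θs‖ := by
    simp [avg, Finset.sum_mul, mul_assoc]
  have h7 : avg O n (fun o => R o θ) ω = avg O n (fun o => F o θ) ω - avg O n (fun o => F o θs) ω
      - (avg O n (fun o => fderiv ℝ (F o) θs) ω) (θ - θs) := by
    simp only [R]
    rw [avg_sub, avg_sub]
    congr 1
    simp [avg]
  have h8 : avg O n (fun o => F o θ) ω - avg O n (fun o => F o θs) ω
        - (∫ o, fderiv ℝ (F o) θs ∂Q) (θ - θs) = avg O n (fun o => R o θ) ω +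
      (avg O n (fun o => fderiv ℝ (F o) θs) ω - ∫ o, fderiv ℝ (F o) θs ∂Q) (θ - θs) := by
    rw [h7, sub_apply]; abel
  rw [h8]
  calc _ ≤ ‖avg O n (fun o => R o θ) ω‖ + ‖(avg O n (fun o => fderiv ℝ (F o) θs) ω
        - ∫ o, fderiv ℝ (F o) θs ∂Q) (θ - θs)‖ := norm_add_le _ _
    _ ≤ avg O n Δ ω * ‖θ - θs‖ + ε / 2 * ‖θ - θs‖ := by
        refine add_le_add (h5.trans h6.le) ((ContinuousLinearMap.le_opNorm _ _).trans ?_)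
        exact mul_le_mul_of_nonneg_right h3.le hpos.le
    _ ≤ ε * ‖θ - θs‖ := by
        rw [← add_mul]
        exact mul_le_mul_of_nonneg_right (by linarith) hpos.le

end Families

/-! ### Asymptotic linearity of plug-in averages -/

section Plugin

variable {S 𝒪 : Type*} [MeasurableSpace S] [MeasurableSpace 𝒪]
  {Pr : Measure S} [IsProbabilityMeasure Pr] {Q : Measure 𝒪} {O : ℕ → S → 𝒪}

lemma sqrt_mul_avg {V : Type*} [AddCommGroup V] [Module ℝ V] (n : ℕ) (f : 𝒪 → V) (ω : S) :
    Real.sqrt n • avg O n f ω = (Real.sqrt n)⁻¹ • ∑ i ∈ Finset.range n, f (O i ω) := by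
  rw [avg, smul_smul]
  congr 1
  rcases Nat.eq_zero_or_pos n with rfl | hn
  · simp
  have : (0 : ℝ) < n := by exact_mod_cast hn
  rw [← Real.sqrt_div_self, div_eq_mul_inv]

variable {E : Type*} [NormedAddCommGroup E] [NormedSpace ℝ E] [FiniteDimensional ℝ E]

/-- The plug-in average of `G` at a consistent root of the estimating equations of `F` is
asymptotically linear. -/
lemma IsSample.plugin_expansion [MeasurableSpace E] [BorelSpace E] (hO : IsSample Pr Q O)
    {F : 𝒪 → E → E} {G : 𝒪 → E → ℝ} {θs : E} {θhat : ℕ → S → E}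
    {J : E →L[ℝ] E} {L : E →L[ℝ] ℝ} (e : E ≃L[ℝ] E) (he : (e : E →L[ℝ] E) = J)
    (hFm : Measurable fun o => F o θs) (hF2 : MemLp (fun o => F o θs) 2 Q)
    (hF0 : ∫ o, F o θs ∂Q = 0)
    (hlinF : ∀ ε > 0, ∃ δ > 0, Whp Pr fun n => {ω | ∀ θ, dist θ θs < δ →
      ‖avg O n (fun o => F o θ) ω - avg O n (fun o => F o θs) ω - J (θ - θs)‖ ≤ ε * ‖θ - θs‖})
    (hlinG : ∀ ε > 0, ∃ δ > 0, Whp Pr fun n => {ω | ∀ θ, dist θ θs < δ →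
      ‖avg O n (fun o => G o θ) ω - avg O n (fun o => G o θs) ω - L (θ - θs)‖ ≤ ε * ‖θ - θs‖})
    (hcons : ∀ ε > 0, Whp Pr fun n => {ω | dist (θhat n ω) θs < ε})
    (hsol : Whp Pr fun n => {ω | avg O n (fun o => F o (θhat n ω)) ω = 0}) (c : ℝ) :
    TendstoInMeasure Pr (fun (n : ℕ) ω => Real.sqrt n * (avg O n (fun o => G o (θhat n ω)) ω - c)
      - (Real.sqrt n)⁻¹ * ∑ i ∈ Finset.range n,
        (G (O i ω) θs - c - L (e.symm (F (O i ω) θs)))) atTop (fun _ => 0) := by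
  have : CompleteSpace E := FiniteDimensional.complete ℝ E
  set A : E →L[ℝ] E := (e.symm : E →L[ℝ] E) with hA
  have hAJ : ∀ v, A (J v) = v := fun v => by rw [← he, hA]; simp
  refine tendstoInMeasure_zero_of_le_mul (hO.bddInProb hFm hF2 hF0) fun c' hc' => ?_
  set κ := ‖L.comp A‖ + 1 with hκ
  have hκ0 : 0 < κ := by positivity
  set a := ‖A‖ + 1 with ha
  have ha0 : 0 < a := by positivity
  -- The first bound gives $\varepsilon a\le 1/2$, so that $\|D\|$ can be absorbed on the left; the
  -- second makes the final coefficient at most $c'$.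
  set ε := min (1 / (2 * a)) (c' / (κ * (2 * a))) with hε
  have hε0 : 0 < ε := lt_min (by positivity) (by positivity)
  have hεa : ε * a ≤ 1 / 2 := by
    calc ε * a ≤ 1 / (2 * a) * a := mul_le_mul_of_nonneg_right (min_le_left _ _) ha0.le
      _ = 1 / 2 := by field_simp
  have hεκ : κ * ε * (2 * a) ≤ c' := by
    calc κ * ε * (2 * a) ≤ κ * (c' / (κ * (2 * a))) * (2 * a) := by
          gcongr; exact min_le_right _ _
      _ = c' := by field_simp
  obtain ⟨δ, hδ, h1⟩ := hlinF ε hε0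
  obtain ⟨δ', hδ', h2⟩ := hlinG ε hε0
  refine (((h1.inter h2).inter (hcons _ (lt_min hδ hδ'))).inter hsol).mono ?_
  filter_upwards [eventually_ge_atTop 1] with n hn ω hω
  obtain ⟨⟨⟨h3, h4⟩, h5⟩, h6⟩ := hω
  simp only [Set.mem_ofPred_eq] at h3 h4 h5 h6 ⊢
  set D := θhat n ω - θs with hD
  set f := avg O n (fun o => F o θs) ω with hf
  set g := avg O n (fun o => G o θs) ω with hg
  have h7 := h3 _ (h5.trans_le (min_le_left _ _))
  have h8 := h4 _ (h5.trans_le (min_le_right _ _))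
  rw [h6, zero_sub] at h7
  have h7' : ‖J D + f‖ ≤ ε * ‖D‖ := by
    have : J D + f = -(-f - J D) := by abel
    rw [this, norm_neg]; exact h7
  -- At a root the linearization reads $JD+f\approx0$. Applying $J^{-1}$ gives $\|D\|\le
  -- a(\varepsilon\|D\|+\|f\|)$, and half of $\|D\|$ is absorbed.
  have hDf : ‖D‖ ≤ 2 * a * ‖f‖ := by
    have h9 : ‖D‖ ≤ a * (ε * ‖D‖ + ‖f‖) := by
      calc ‖D‖ = ‖A (J D)‖ := by rw [hAJ]
        _ ≤ ‖A‖ * ‖J D‖ := A.le_opNorm _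
        _ ≤ a * ‖J D‖ := mul_le_mul_of_nonneg_right (by linarith) (norm_nonneg _)
        _ ≤ a * (ε * ‖D‖ + ‖f‖) := by
            refine mul_le_mul_of_nonneg_left ?_ ha0.le
            calc ‖J D‖ = ‖(J D + f) - f‖ := by rw [add_sub_cancel_right]
              _ ≤ ‖J D + f‖ + ‖f‖ := norm_sub_le _ _
              _ ≤ _ := by linarith
    have h10 : ε * a * ‖D‖ ≤ 1 / 2 * ‖D‖ := mul_le_mul_of_nonneg_right hεa (norm_nonneg _)
    nlinarith
  -- The correction $L J^{-1}f$ is combined with $LD=LJ^{-1}JD$, so that the whole error consists of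
  -- the remainder of $G$ and $LJ^{-1}$ applied to the remainder of $F$.
  have hexp : Real.sqrt n * (avg O n (fun o => G o (θhat n ω)) ω - c)
      - (Real.sqrt n)⁻¹ * ∑ i ∈ Finset.range n, (G (O i ω) θs - c - L (e.symm (F (O i ω) θs))) =
      Real.sqrt n * ((avg O n (fun o => G o (θhat n ω)) ω - g - L D) + L (A (J D + f))) := by
    have h11 := sqrt_mul_avg (O := O) n (fun o => G o θs - c - L (e.symm (F o θs))) ω
    simp only [smul_eq_mul] at h11
    rw [← h11, ← mul_sub, avg_sub, avg_sub]
    have h12 : avg O n (fun _ => c) ω = c := by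
      have : (n : ℝ) ≠ 0 := by positivity
      simp [avg, this]
    have h13 : avg O n (fun o => L (e.symm (F o θs))) ω = L (A f) := by
      simp [avg, hf, hA]
    rw [h12, h13, map_add, map_add, hAJ]
    ring
  rw [hexp, norm_mul, Real.norm_of_nonneg (Real.sqrt_nonneg _)]
  have hfs : ‖(Real.sqrt n)⁻¹ • ∑ i ∈ Finset.range n, F (O i ω) θs‖ = Real.sqrt n * ‖f‖ := by
    rw [← sqrt_mul_avg (O := O) n (fun o => F o θs) ω, norm_smul,
      Real.norm_of_nonneg (Real.sqrt_nonneg _)]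
  rw [hfs]
  have h14 : ‖L (A (J D + f))‖ ≤ ‖L.comp A‖ * (ε * ‖D‖) :=
    ((L.comp A).le_opNorm _).trans (mul_le_mul_of_nonneg_left h7' (norm_nonneg _))
  calc Real.sqrt n * ‖(avg O n (fun o => G o (θhat n ω)) ω - g - L D) + L (A (J D + f))‖
      ≤ Real.sqrt n * (κ * ε * ‖D‖) := by
        refine mul_le_mul_of_nonneg_left ((norm_add_le _ _).trans ?_) (Real.sqrt_nonneg _)
        rw [hκ]; linarith
    _ ≤ Real.sqrt n * (κ * ε * (2 * a * ‖f‖)) := by gcongr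
    _ = (κ * ε * (2 * a)) * (Real.sqrt n * ‖f‖) := by ring
    _ ≤ c' * (Real.sqrt n * ‖f‖) := by gcongr

/-- Asymptotic linearity of the plug-in average of `G` at measurable solutions of the estimating
equations of `F` over a compact parameter set. -/
lemma IsSample.exists_plugin_expansion [MeasurableSpace E] [BorelSpace E] (hO : IsSample Pr Q O)
    {F : 𝒪 → E → E} {G : 𝒪 → E → ℝ} {θs : E} {θhat : ℕ → S → E} {Θ N N' : Set E}
    (hΘ : IsCompact Θ) (hF : Measurable fun p : 𝒪 × E => F p.1 p.2)
    (hG : Measurable fun p : 𝒪 × E => G p.1 p.2)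
    (hF2 : MemLp (fun o => F o θs) 2 Q) (hG2 : MemLp (fun o => G o θs) 2 Q)
    (hF0 : ∫ o, F o θs ∂Q = 0) (hcont : ∀ᵐ o ∂Q, ContinuousOn (F o) Θ)
    (hdom : ∃ K : 𝒪 → ℝ, Integrable K Q ∧ ∀ᵐ o ∂Q, ∀ θ ∈ Θ, ‖F o θ‖ ≤ K o)
    (huniq : ∀ θ ∈ Θ, ∫ o, F o θ ∂Q = 0 → θ = θs)
    (hN : IsOpen N) (hθN : θs ∈ N) (hd : ∀ᵐ o ∂Q, ContDiffOn ℝ 1 (F o) N)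
    (hdN : ∃ K : 𝒪 → ℝ, Integrable K Q ∧ ∀ᵐ o ∂Q, ∀ θ ∈ N, ‖fderiv ℝ (F o) θ‖ ≤ K o)
    (hN' : IsOpen N') (hθN' : θs ∈ N') (hd' : ∀ᵐ o ∂Q, ContDiffOn ℝ 1 (G o) N')
    (hdN' : ∃ K : 𝒪 → ℝ, Integrable K Q ∧ ∀ᵐ o ∂Q, ∀ θ ∈ N', ‖fderiv ℝ (G o) θ‖ ≤ K o)
    (hbij : Function.Bijective (∫ o, fderiv ℝ (F o) θs ∂Q : E →L[ℝ] E))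
    (hθ : ∀ n, Measurable (θhat n))
    (hsol : Tendsto (fun n => Pr {ω | θhat n ω ∈ Θ ∧
      ∑ i ∈ Finset.range n, F (O i ω) (θhat n ω) = 0}) atTop (𝓝 1)) {c : ℝ}
    (hc : ∫ o, G o θs ∂Q = c) :
    ∃ ℓ : E →L[ℝ] ℝ, (∫ o, fderiv ℝ (G o) θs ∂Q = 0 → ℓ = 0) ∧ AsympLinear Pr Q O
      (fun n ω => avg O n (fun o => G o (θhat n ω)) ω) c
      (fun o => G o θs - c - ℓ (F o θs)) := by
  have := hO.isProbabilityMeasure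
  have : CompleteSpace E := FiniteDimensional.complete ℝ E
  have : ProperSpace E := FiniteDimensional.proper_real E
  have hme : ∀ θ, Measurable fun o => F o θ := fun θ => hF.comp measurable_prodMk_right
  have hmq : ∀ θ, Measurable fun o => G o θ := fun θ => hG.comp measurable_prodMk_right
  have hW : Whp Pr fun n => {ω | θhat n ω ∈ Θ ∧
      ∑ i ∈ Finset.range n, F (O i ω) (θhat n ω) = 0} := by
    refine whp_of_tendsto_one (fun n => ?_) hsol
    refine ((hθ n) hΘ.isClosed.measurableSet).inter ?_
    refine (?_ : Measurable fun ω => ∑ i ∈ Finset.range n, F (O i ω) (θhat n ω))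
      (measurableSet_singleton 0)
    exact Finset.measurable_fun_sum _ fun i _ => hF.comp ((hO.meas i).prodMk (hθ n))
  have hsol' : Whp Pr fun n => {ω | θhat n ω ∈ Θ ∧
      avg O n (fun o => F o (θhat n ω)) ω = 0} :=
    hW.mono (Eventually.of_forall fun n ω hω => ⟨hω.1, by rw [avg, hω.2, smul_zero]⟩)
  have hcons : ∀ ε > 0, Whp Pr fun n => {ω | dist (θhat n ω) θs < ε} := fun ε hε =>
    hO.whp_dist_root_lt hΘ (fun θ _ => (hme θ).aestronglyMeasurable) hcont
      hdom (fun θ hθ h0 => huniq θ hθ h0) hsol' hε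
  let e : E ≃L[ℝ] E :=
    (LinearEquiv.ofBijective (∫ o, fderiv ℝ (F o) θs ∂Q : E →L[ℝ] E).toLinearMap
      hbij).toContinuousLinearEquiv
  have he : (e : E →L[ℝ] E) = ∫ o, fderiv ℝ (F o) θs ∂Q := by
    ext1 v; rfl
  have hexp := hO.plugin_expansion (F := F) (G := G)
    (L := ∫ o, fderiv ℝ (G o) θs ∂Q) e he (hme θs) hF2 hF0
    (fun ε hε => hO.whp_linearization (fun θ => (hme θ).aestronglyMeasurable) hN hθN hd hdN hε)
    (fun ε hε => hO.whp_linearization (fun θ => (hmq θ).aestronglyMeasurable) hN' hθN' hd' hdN' hε)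
    hcons (hsol'.mono (Eventually.of_forall fun n ω hω => hω.2)) c
  -- $\ell=LJ^{-1}$ is the effect of estimating the nuisance parameter; it disappears when the
  -- expected derivative of $G$ is zero.
  let ℓ : E →L[ℝ] ℝ := (∫ o, fderiv ℝ (G o) θs ∂Q).comp (e.symm : E →L[ℝ] E)
  refine ⟨ℓ, fun h0 => by simp [ℓ, h0], ?_, ?_, ?_, hexp⟩
  · exact ((hmq θs).sub_const c).sub (ℓ.continuous.measurable.comp (hme θs))
  · exact (hG2.sub (memLp_const c)).sub (ℓ.comp_memLp' hF2)
  · have i1 := hG2.integrable (by norm_num)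
    have i2 := hF2.integrable (by norm_num)
    have : ∫ o, ℓ (F o θs) ∂Q = 0 := by
      rw [ℓ.integral_comp_comm i2, hF0, map_zero]
    have i3 : Integrable (fun o => G o θs - c) Q := i1.sub (integrable_const c)
    rw [integral_sub i3 (ℓ.integrable_comp i2),
      integral_sub i1 (integrable_const c), this, hc]
    simp

/-- An asymptotically linear estimator is consistent and asymptotically normal. -/
lemma IsSample.asympNormal (hO : IsSample Pr Q O) {est : ℕ → S → ℝ} {ψ : ℝ} {φ : 𝒪 → ℝ}
    (hest : ∀ n, Measurable (est n)) (h : AsympLinear Pr Q O est ψ φ) :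
    AsympNormal Pr est ψ (∫ o, φ o ^ 2 ∂Q) := by
  refine tendstoInDistribution_of_tendstoInMeasure_sub _ _ (hO.clt h.meas h.sq h.mean)
    h.expansion fun n => (((hest n).sub_const ψ).const_mul _).aemeasurable

/-- Since $\sqrt n\ge1$, dropping this factor only decreases the remainder of the expansion, and the
average of the centred influence function tends to zero by the law of large numbers. -/
lemma IsSample.tendstoInMeasure_of_asympLinear (hO : IsSample Pr Q O) {est : ℕ → S → ℝ} {ψ : ℝ}
    {φ : 𝒪 → ℝ} (h : AsympLinear Pr Q O est ψ φ) :
    TendstoInMeasure Pr est atTop (fun _ => ψ) := by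
  rw [tendstoInMeasure_iff_whp]
  intro ε hε
  have := hO.isProbabilityMeasure
  have h1 := tendstoInMeasure_iff_whp.1 h.expansion (ε / 2) (half_pos hε)
  have h2 := hO.whp_avg (h.sq.integrable (by norm_num)) (half_pos hε)
  refine (h1.inter h2).mono ?_
  filter_upwards [eventually_ge_atTop 1] with n hn ω hω
  obtain ⟨h3, h4⟩ := hω
  have hn1 : (1 : ℝ) ≤ Real.sqrt n := Real.one_le_sqrt.2 (by exact_mod_cast hn)
  have h5 := sqrt_mul_avg (O := O) n φ ω
  simp only [smul_eq_mul] at h5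
  simp only [Set.mem_ofPred_eq, h.mean, sub_zero] at h3 h4 ⊢
  rw [← h5, ← mul_sub, norm_mul, Real.norm_of_nonneg (Real.sqrt_nonneg _)] at h3
  have h6 : ‖est n ω - ψ - avg O n φ ω‖ < ε / 2 :=
    lt_of_le_of_lt (le_mul_of_one_le_left (norm_nonneg _) hn1) h3
  calc ‖est n ω - ψ‖ = ‖(est n ω - ψ - avg O n φ ω) + avg O n φ ω‖ := by rw [sub_add_cancel]
    _ ≤ _ := norm_add_le _ _
    _ < ε := by linarith

end Plugin

/-! ### The estimating equations and the quadruply robust estimator as a plug-in problem -/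

namespace PathSpecific

section Regular

open Obs

variable {𝒟 ℳ 𝒲 𝒵 𝒳 S : Type*} [MeasurableSpace 𝒟] [MeasurableSpace ℳ] [MeasurableSpace 𝒲]
  [MeasurableSpace 𝒵] [MeasurableSpace 𝒳] [MeasurableSpace S] {k : Dims}

@[fun_prop]
lemma measurable_trt : Measurable (trt : Obs 𝒟 ℳ 𝒲 𝒵 𝒳 → ℝ) := by
  have : (trt : Obs 𝒟 ℳ 𝒲 𝒵 𝒳 → ℝ) = (fun b : Bool => if b then (1 : ℝ) else 0) ∘ Prod.fst := by
    funext o; simp [trt]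
  rw [this]
  exact (measurable_of_countable _).comp measurable_fst

lemma BridgeModels.measurable_est (B : BridgeModels k 𝒟 ℳ 𝒲 𝒵 𝒳) :
    Measurable fun p : Obs 𝒟 ℳ 𝒲 𝒵 𝒳 × Param k => B.est p.1 p.2 := by
  have t : Measurable fun p : Obs 𝒟 ℳ 𝒲 𝒵 𝒳 × Param k => trt p.1 := measurable_trt.comp measurable_fst
  have h2 : Measurable fun p : Obs 𝒟 ℳ 𝒲 𝒵 𝒳 × Param k => B.h2 p.2.b2 (WMDX p.1) :=
    B.h2_meas.comp (f := fun p : Obs 𝒟 ℳ 𝒲 𝒵 𝒳 × Param k => (p.2.b2, WMDX p.1)) (by fun_prop)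
  have h1 : Measurable fun p : Obs 𝒟 ℳ 𝒲 𝒵 𝒳 × Param k => B.h1 p.2.b1 (WDX p.1) :=
    B.h1_meas.comp (f := fun p : Obs 𝒟 ℳ 𝒲 𝒵 𝒳 × Param k => (p.2.b1, WDX p.1)) (by fun_prop)
  have h0 : Measurable fun p : Obs 𝒟 ℳ 𝒲 𝒵 𝒳 × Param k => B.h0 p.2.b0 (WX p.1) :=
    B.h0_meas.comp (f := fun p : Obs 𝒟 ℳ 𝒲 𝒵 𝒳 × Param k => (p.2.b0, WX p.1)) (by fun_prop)
  have q0 : Measurable fun p : Obs 𝒟 ℳ 𝒲 𝒵 𝒳 × Param k => B.q0 p.2.g0 (ZX p.1) :=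
    B.q0_meas.comp (f := fun p : Obs 𝒟 ℳ 𝒲 𝒵 𝒳 × Param k => (p.2.g0, ZX p.1)) (by fun_prop)
  have q1 : Measurable fun p : Obs 𝒟 ℳ 𝒲 𝒵 𝒳 × Param k => B.q1 p.2.g1 (ZDX p.1) :=
    B.q1_meas.comp (f := fun p : Obs 𝒟 ℳ 𝒲 𝒵 𝒳 × Param k => (p.2.g1, ZDX p.1)) (by fun_prop)
  have q2 : Measurable fun p : Obs 𝒟 ℳ 𝒲 𝒵 𝒳 × Param k => B.q2 p.2.g2 (ZMDX p.1) :=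
    B.q2_meas.comp (f := fun p : Obs 𝒟 ℳ 𝒲 𝒵 𝒳 × Param k => (p.2.g2, ZMDX p.1)) (by fun_prop)
  have c2 : Measurable fun p : Obs 𝒟 ℳ 𝒲 𝒵 𝒳 × Param k => B.c2 (ZMDX p.1) := B.c2_meas.comp (by fun_prop)
  have c1 : Measurable fun p : Obs 𝒟 ℳ 𝒲 𝒵 𝒳 × Param k => B.c1 (ZDX p.1) := B.c1_meas.comp (by fun_prop)
  have c0 : Measurable fun p : Obs 𝒟 ℳ 𝒲 𝒵 𝒳 × Param k => B.c0 (ZX p.1) := B.c0_meas.comp (by fun_prop)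
  have d2 : Measurable fun p : Obs 𝒟 ℳ 𝒲 𝒵 𝒳 × Param k => B.d2 (WMDX p.1) := B.d2_meas.comp (by fun_prop)
  have d1 : Measurable fun p : Obs 𝒟 ℳ 𝒲 𝒵 𝒳 × Param k => B.d1 (WDX p.1) := B.d1_meas.comp (by fun_prop)
  have d0 : Measurable fun p : Obs 𝒟 ℳ 𝒲 𝒵 𝒳 × Param k => B.d0 (WX p.1) := B.d0_meas.comp (by fun_prop)
  have y : Measurable fun p : Obs 𝒟 ℳ 𝒲 𝒵 𝒳 × Param k => Y p.1 := by fun_prop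
  exact ((t.mul (y.sub h2)).smul c2).prodMk <|
    (((measurable_const.sub t).mul (h2.sub h1)).smul c1).prodMk <|
    ((t.mul (h1.sub h0)).smul c0).prodMk <|
    (((t.mul q0).sub measurable_const).smul d0).prodMk <|
    ((((measurable_const.sub t).mul q1).sub (t.mul q0)).smul d1).prodMk <|
    (((t.mul q2).sub ((measurable_const.sub t).mul q1)).smul d2)

lemma BridgeModels.measurable_quad (B : BridgeModels k 𝒟 ℳ 𝒲 𝒵 𝒳) :
    Measurable fun p : Obs 𝒟 ℳ 𝒲 𝒵 𝒳 × Param k => B.quad p.1 p.2 := by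
  have t : Measurable fun p : Obs 𝒟 ℳ 𝒲 𝒵 𝒳 × Param k => trt p.1 := measurable_trt.comp measurable_fst
  have h2 : Measurable fun p : Obs 𝒟 ℳ 𝒲 𝒵 𝒳 × Param k => B.h2 p.2.b2 (WMDX p.1) :=
    B.h2_meas.comp (f := fun p : Obs 𝒟 ℳ 𝒲 𝒵 𝒳 × Param k => (p.2.b2, WMDX p.1)) (by fun_prop)
  have h1 : Measurable fun p : Obs 𝒟 ℳ 𝒲 𝒵 𝒳 × Param k => B.h1 p.2.b1 (WDX p.1) :=
    B.h1_meas.comp (f := fun p : Obs 𝒟 ℳ 𝒲 𝒵 𝒳 × Param k => (p.2.b1, WDX p.1)) (by fun_prop)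
  have h0 : Measurable fun p : Obs 𝒟 ℳ 𝒲 𝒵 𝒳 × Param k => B.h0 p.2.b0 (WX p.1) :=
    B.h0_meas.comp (f := fun p : Obs 𝒟 ℳ 𝒲 𝒵 𝒳 × Param k => (p.2.b0, WX p.1)) (by fun_prop)
  have q0 : Measurable fun p : Obs 𝒟 ℳ 𝒲 𝒵 𝒳 × Param k => B.q0 p.2.g0 (ZX p.1) :=
    B.q0_meas.comp (f := fun p : Obs 𝒟 ℳ 𝒲 𝒵 𝒳 × Param k => (p.2.g0, ZX p.1)) (by fun_prop)
  have q1 : Measurable fun p : Obs 𝒟 ℳ 𝒲 𝒵 𝒳 × Param k => B.q1 p.2.g1 (ZDX p.1) :=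
    B.q1_meas.comp (f := fun p : Obs 𝒟 ℳ 𝒲 𝒵 𝒳 × Param k => (p.2.g1, ZDX p.1)) (by fun_prop)
  have q2 : Measurable fun p : Obs 𝒟 ℳ 𝒲 𝒵 𝒳 × Param k => B.q2 p.2.g2 (ZMDX p.1) :=
    B.q2_meas.comp (f := fun p : Obs 𝒟 ℳ 𝒲 𝒵 𝒳 × Param k => (p.2.g2, ZMDX p.1)) (by fun_prop)
  have y : Measurable fun p : Obs 𝒟 ℳ 𝒲 𝒵 𝒳 × Param k => Y p.1 := by fun_prop
  exact ((((t.mul q0).mul (h1.sub h0)).add (((measurable_const.sub t).mul q1).mul (h2.sub h1))).add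
    ((t.mul q2).mul (y.sub h2))).add h0

variable {Pr : Measure S} [IsProbabilityMeasure Pr] {Q : Measure (Obs 𝒟 ℳ 𝒲 𝒵 𝒳)}
  {O : ℕ → S → Obs 𝒟 ℳ 𝒲 𝒵 𝒳} {B : BridgeModels k 𝒟 ℳ 𝒲 𝒵 𝒳} {θs : Param k}

lemma SmoothFamily.integrable {V : Type*} [NormedAddCommGroup V] [NormedSpace ℝ V] {Θ : Set (Param k)}
    {F : Obs 𝒟 ℳ 𝒲 𝒵 𝒳 → Param k → V} (hF : SmoothFamily Q Θ θs F) {θ : Param k} (hθ : θ ∈ Θ)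
    (hm : AEStronglyMeasurable (fun o => F o θ) Q) : Integrable (fun o => F o θ) Q := by
  obtain ⟨K, hK, h⟩ := hF.dom
  exact hK.mono' hm (by filter_upwards [h] with o ho using ho θ hθ)

lemma SmoothFamily.mem {V : Type*} [NormedAddCommGroup V] [NormedSpace ℝ V] {Θ : Set (Param k)}
    {F : Obs 𝒟 ℳ 𝒲 𝒵 𝒳 → Param k → V} (hF : SmoothFamily Q Θ θs F) : θs ∈ Θ := by
  obtain ⟨N, _, h, hN, _⟩ := hF.deriv
  exact hN h

lemma Regularity.integrable_est (h : Regularity Q B θs) {θ : Param k} (hθ : θ ∈ B.space) :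
    Integrable (fun o => B.est o θ) Q :=
  h.est_smooth.integrable hθ (B.measurable_est.comp measurable_prodMk_right).aestronglyMeasurable

lemma Regularity.integrable_quad (h : Regularity Q B θs) {θ : Param k} (hθ : θ ∈ B.space) :
    Integrable (fun o => B.quad o θ) Q :=
  h.quad_smooth.integrable hθ (B.measurable_quad.comp measurable_prodMk_right).aestronglyMeasurable

/-- The integral of the stacked estimating function, block by block. -/
lemma Regularity.integral_est (h : Regularity Q B θs) {θ : Param k} (hθ : θ ∈ B.space) :
    ∫ o, B.est o θ ∂Q = (∫ o, B.estH2 θ.b2 o ∂Q, ∫ o, B.estH1 θ.b2 θ.b1 o ∂Q,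
      ∫ o, B.estH0 θ.b1 θ.b0 o ∂Q, ∫ o, B.estQ0 θ.g0 o ∂Q, ∫ o, B.estQ1 θ.g0 θ.g1 o ∂Q,
      ∫ o, B.estQ2 θ.g1 θ.g2 o ∂Q) := by
  have h0 := h.integrable_est hθ
  simp only [BridgeModels.est] at h0 ⊢
  rw [integral_pair h0.fst h0.snd, integral_pair h0.snd.fst h0.snd.snd,
    integral_pair h0.snd.snd.fst h0.snd.snd.snd,
    integral_pair h0.snd.snd.snd.fst h0.snd.snd.snd.snd,
    integral_pair h0.snd.snd.snd.snd.fst h0.snd.snd.snd.snd.snd]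

/-- The system is triangular: each equation contains one new parameter besides those already
determined. The outcome and treatment blocks are solved separately, in the order of the sequential
uniqueness assumptions. -/
lemma Regularity.unique_root (h : Regularity Q B θs) {θ : Param k} (hθ : θ ∈ B.space)
    (h0 : ∫ o, B.est o θ ∂Q = 0) : θ = θs := by
  rw [h.integral_est hθ] at h0
  obtain ⟨m2, m1, m0, n0, n1, n2⟩ := hθ
  simp only [Prod.mk_eq_zero] at h0
  obtain ⟨e2, e1, e0, f0, f1, f2⟩ := h0
  have i2 : θ.b2 = θs.b2 := h.uniq_b2 _ m2 e2
  rw [i2] at e1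
  have i1 : θ.b1 = θs.b1 := h.uniq_b1 _ m1 e1
  rw [i1] at e0
  have i0 : θ.b0 = θs.b0 := h.uniq_b0 _ m0 e0
  have j0 : θ.g0 = θs.g0 := h.uniq_g0 _ n0 f0
  rw [j0] at f1
  have j1 : θ.g1 = θs.g1 := h.uniq_g1 _ n1 f1
  rw [j1] at f2
  have j2 : θ.g2 = θs.g2 := h.uniq_g2 _ n2 f2
  exact Prod.ext i2 (Prod.ext i1 (Prod.ext i0 (Prod.ext j0 (Prod.ext j1 j2))))

instance : BorelSpace (Param k) := by
  have h1 : BorelSpace (EuclideanSpace ℝ (Fin k.g1) × EuclideanSpace ℝ (Fin k.g2)) := inferInstance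
  have h2 : BorelSpace (EuclideanSpace ℝ (Fin k.g0) × EuclideanSpace ℝ (Fin k.g1) ×
    EuclideanSpace ℝ (Fin k.g2)) := inferInstance
  have h3 : BorelSpace (EuclideanSpace ℝ (Fin k.b0) × EuclideanSpace ℝ (Fin k.g0) ×
    EuclideanSpace ℝ (Fin k.g1) × EuclideanSpace ℝ (Fin k.g2)) := inferInstance
  have h4 : BorelSpace (EuclideanSpace ℝ (Fin k.b1) × EuclideanSpace ℝ (Fin k.b0) ×
    EuclideanSpace ℝ (Fin k.g0) × EuclideanSpace ℝ (Fin k.g1) × EuclideanSpace ℝ (Fin k.g2)) :=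
    inferInstance
  exact Prod.borelSpace

/-- Asymptotic linearity of the quadruply robust estimator around its probability limit. -/
lemma Regularity.exists_asympLinear (h : Regularity Q B θs) (hO : IsSample Pr Q O)
    {θhat : ℕ → S → Param k} (hθ : ∀ n, Measurable (θhat n))
    (hsol : Tendsto (fun n => Pr {ω | θhat n ω ∈ B.space ∧
      ∑ i ∈ Finset.range n, B.est (O i ω) (θhat n ω) = 0}) atTop (𝓝 1)) {c : ℝ}
    (hc : ∫ o, B.quad o θs ∂Q = c) :
    ∃ ℓ : Param k →L[ℝ] ℝ, (∫ o, fderiv ℝ (B.quad o) θs ∂Q = 0 → ℓ = 0) ∧ AsympLinear Pr Q O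
      (fun n ω => B.psiHat n (fun i => O i ω) (θhat n ω)) c
      (fun o => B.quad o θs - c - ℓ (B.est o θs)) := by
  obtain ⟨N, hN, hθN, -, hd, hdom⟩ := h.est_smooth.deriv
  obtain ⟨N', hN', hθN', -, hd', hdom'⟩ := h.quad_smooth.deriv
  have hpsi : ∀ n ω, B.psiHat n (fun i => O i ω) (θhat n ω)
      = avg O n (fun o => B.quad o (θhat n ω)) ω := fun n ω => by
    rw [BridgeModels.psiHat, avg, smul_eq_mul, div_eq_inv_mul]
  simp only [hpsi]
  exact hO.exists_plugin_expansion h.compact B.measurable_est B.measurable_quad h.est_smooth.sq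
    h.quad_smooth.sq h.root h.est_smooth.cont h.est_smooth.dom (fun θ => h.unique_root) hN hθN hd
    hdom hN' hθN' hd' hdom' h.nonsingular hθ hsol hc

lemma BridgeModels.measurable_psiHat (B : BridgeModels k 𝒟 ℳ 𝒲 𝒵 𝒳) (hO : IsSample Pr Q O)
    {θhat : ℕ → S → Param k} (hθ : ∀ n, Measurable (θhat n)) (n : ℕ) :
    Measurable fun ω => B.psiHat n (fun i => O i ω) (θhat n ω) :=
  (Finset.measurable_fun_sum _ fun i _ =>
      B.measurable_quad.comp ((hO.meas i).prodMk (hθ n))).div_const _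

end Regular

end PathSpecific

/-! ### Conditional means in weak form -/

section CondMean

variable {Ω τ β γ α : Type*} [mΩ : MeasurableSpace Ω] [MeasurableSpace τ] [mβ : MeasurableSpace β]
  [MeasurableSpace γ] [MeasurableSpace α] {μ : Measure Ω} [IsFiniteMeasure μ]

/-- The conditional mean of `R` given `T` vanishes, in weak form. -/
def CondMeanZero (μ : Measure Ω) (R : Ω → ℝ) (T : Ω → τ) : Prop :=
  ∀ s, MeasurableSet s → ∫ ω in T ⁻¹' s, R ω ∂μ = 0

lemma CondMeanZero.condExp_eq_zero {R : Ω → ℝ} {T : Ω → τ} (h : CondMeanZero μ R T)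
    (hT : Measurable T) (hR : Integrable R μ) : μ[R | sigmaOf T] =ᵐ[μ] 0 := by
  symm
  refine ae_eq_condExp_of_forall_setIntegral_eq hT.comap_le hR
    (fun _ _ _ => integrableOn_zero) ?_ (stronglyMeasurable_zero.aestronglyMeasurable)
  rintro s ⟨s', hs', rfl⟩ -
  simp [h s' hs']

/-- This is the pull-out property of conditional expectation. The factor $g$ may be unbounded as
long as the product is integrable, which is needed for the weights and the bridge functions. -/
lemma CondMeanZero.integral_mul {R : Ω → ℝ} {T : Ω → τ} (h : CondMeanZero μ R T)
    (hT : Measurable T) (hR : Integrable R μ) {g : τ → ℝ} (hg : Measurable g)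
    (hgR : Integrable (fun ω => g (T ω) * R ω) μ) : ∫ ω, g (T ω) * R ω ∂μ = 0 := by
  have hm : StronglyMeasurable[sigmaOf T] fun ω => g (T ω) :=
    (hg.comp (comap_measurable T)).stronglyMeasurable
  have h1 : μ[(fun ω => g (T ω)) * R | sigmaOf T] =ᵐ[μ] (fun ω => g (T ω)) * μ[R | sigmaOf T] :=
    condExp_mul_of_stronglyMeasurable_left hm hgR hR
  have h2 : μ[(fun ω => g (T ω)) * R | sigmaOf T] =ᵐ[μ] 0 := by
    filter_upwards [h1, h.condExp_eq_zero hT hR] with ω h3 h4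
    simp [h3, h4]
  rw [show (fun ω => g (T ω) * R ω) = (fun ω => g (T ω)) * R from rfl,
    ← integral_condExp hT.comap_le, integral_congr_ae h2]
  simp

/-- Indicators are bounded test functions. Bounded tests have the advantage that all products in
later chains of integrals are integrable. -/
lemma condMeanZero_of_integral_mul {R : Ω → ℝ} {T : Ω → τ} (hT : Measurable T)
    (h : ∀ g : τ → ℝ, Measurable g → (∀ t, |g t| ≤ 1) → ∫ ω, g (T ω) * R ω ∂μ = 0) :
    CondMeanZero μ R T := by
  intro s hs
  rw [← h (s.indicator 1) (measurable_one.indicator hs) fun t => by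
    by_cases ht : t ∈ s <;> simp [ht], ← integral_indicator (hT hs)]
  refine integral_congr_ae (Eventually.of_forall fun ω => ?_)
  by_cases hω : T ω ∈ s
  · simp [hω]
  · simp [hω]

lemma CondMeanZero.comp {R : Ω → ℝ} {T : Ω → τ} (h : CondMeanZero μ R T) {f : τ → β}
    (hf : Measurable f) : CondMeanZero μ R (fun ω => f (T ω)) :=
  fun _ hs => h _ (hf hs)

lemma CondMeanZero.congr {R R' : Ω → ℝ} {T : Ω → τ} (h : CondMeanZero μ R T) (hR : R =ᵐ[μ] R') :
    CondMeanZero μ R' T := fun s hs => by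
  rw [← h s hs]
  exact integral_congr_ae (ae_restrict_of_ae hR.symm)

/-- If `R'` is a function of `T` and `R - R'` has conditional mean zero given `T`, then integrating
`R` or `R'` against functions of `T` is the same. -/
lemma CondMeanZero.integral_mul_eq {R : Ω → ℝ} {T : Ω → τ} {r : τ → ℝ} (hr : Measurable r)
    (h : CondMeanZero μ (fun ω => R ω - r (T ω)) T) (hT : Measurable T) (hR : Integrable R μ)
    (hr' : Integrable (fun ω => r (T ω)) μ) {g : τ → ℝ} (hg : Measurable g)
    (hgR : Integrable (fun ω => g (T ω) * R ω) μ) :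
    Integrable (fun ω => g (T ω) * r (T ω)) μ ∧
      ∫ ω, g (T ω) * r (T ω) ∂μ = ∫ ω, g (T ω) * R ω ∂μ := by
  have hm : StronglyMeasurable[sigmaOf T] fun ω => g (T ω) :=
    (hg.comp (comap_measurable T)).stronglyMeasurable
  have hm' : StronglyMeasurable[sigmaOf T] fun ω => r (T ω) :=
    (hr.comp (comap_measurable T)).stronglyMeasurable
  -- $r(T)$ is a version of $E(R\mid T)$, hence $g(T)r(T)$ is one of $E(g(T)R\mid T)$. In this way
  -- the integrability of $g(T)r(T)$ is obtained rather than assumed.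
  have h0 : (fun ω => r (T ω)) =ᵐ[μ] μ[R | sigmaOf T] := by
    refine ae_eq_condExp_of_forall_setIntegral_eq hT.comap_le hR
      (fun _ _ _ => hr'.integrableOn) ?_ hm'.aestronglyMeasurable
    rintro s ⟨s', hs', rfl⟩ -
    have := h s' hs'
    rw [integral_sub hR.integrableOn hr'.integrableOn, sub_eq_zero] at this
    exact this.symm
  have h1 : μ[(fun ω => g (T ω)) * R | sigmaOf T] =ᵐ[μ] (fun ω => g (T ω)) * μ[R | sigmaOf T] :=
    condExp_mul_of_stronglyMeasurable_left hm hgR hR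
  have h2 : (fun ω => g (T ω) * r (T ω)) =ᵐ[μ] μ[(fun ω => g (T ω)) * R | sigmaOf T] := by
    filter_upwards [h1, h0] with ω h3 h4
    simp only [h3, Pi.mul_apply, ← h4]
  refine ⟨integrable_condExp.congr h2.symm, ?_⟩
  rw [integral_congr_ae h2, integral_condExp hT.comap_le]
  rfl

/-- Conditional expectations under a conditional probability agree iff the difference has
conditional mean zero on the conditioning event. -/
lemma cond_condExp_ae_eq_iff {E : Set Ω} {f g : Ω → ℝ} {T : Ω → τ} (hT : Measurable T)
    (hf : Integrable f (μ.restrict E)) (hg : Integrable g (μ.restrict E)) :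
    (ProbabilityTheory.cond μ E)[f | sigmaOf T] =ᵐ[ProbabilityTheory.cond μ E]
      (ProbabilityTheory.cond μ E)[g | sigmaOf T] ↔
    CondMeanZero (μ.restrict E) (fun ω => f ω - g ω) T := by
  rw [ProbabilityTheory.cond]
  -- On a null event the conditional measure is the zero measure, and both sides hold trivially.
  by_cases hE : μ E = 0
  · have h0 : μ.restrict E = 0 := Measure.restrict_eq_zero.2 hE
    simp only [h0, smul_zero, ae_zero, CondMeanZero, Measure.restrict_zero, integral_zero_measure,
      implies_true, iff_true]
    exact Filter.eventually_bot
  set c := (μ E)⁻¹ with hc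
  have hc0 : c ≠ 0 := by simp [hc]
  have hct : c ≠ ∞ := by simp [hc, hE]
  have hcr : c.toReal ≠ 0 := (ENNReal.toReal_pos hc0 hct).ne'
  set ν := c • μ.restrict E with hν
  have : IsFiniteMeasure ν := Measure.smul_finite _ hct
  have hfν : Integrable f ν := hf.smul_measure hct
  have hgν : Integrable g ν := hg.smul_measure hct
  have hset : ∀ s, MeasurableSet s → (∫ ω in T ⁻¹' s, f ω ∂ν = ∫ ω in T ⁻¹' s, g ω ∂ν ↔
      ∫ ω in T ⁻¹' s, (f ω - g ω) ∂(μ.restrict E) = 0) := fun s hs => by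
    rw [hν, Measure.restrict_smul, integral_smul_measure, integral_smul_measure,
      integral_sub hf.integrableOn hg.integrableOn, sub_eq_zero]
    simp [hcr]
  constructor
  · intro h s hs
    rw [← hset s hs, ← setIntegral_condExp hT.comap_le hfν ⟨s, hs, rfl⟩,
      ← setIntegral_condExp hT.comap_le hgν ⟨s, hs, rfl⟩]
    exact integral_congr_ae (ae_restrict_of_ae h)
  · intro h
    refine ae_eq_condExp_of_forall_setIntegral_eq hT.comap_le hgν
      (fun _ _ _ => integrable_condExp.integrableOn) ?_ stronglyMeasurable_condExp.aestronglyMeasurable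
    rintro s ⟨s', hs', rfl⟩ -
    rw [setIntegral_condExp hT.comap_le hfν ⟨s', hs', rfl⟩]
    exact (hset s' hs').2 (h s' hs')

lemma memLp_cond_iff {E : Set Ω} {f : Ω → ℝ} {p : ℝ≥0∞} (hE : μ E ≠ 0) :
    MemLp f p (ProbabilityTheory.cond μ E) ↔ MemLp f p (μ.restrict E) := by
  rw [ProbabilityTheory.cond]
  have hc0 : (μ E)⁻¹ ≠ 0 := by simp
  have hct : (μ E)⁻¹ ≠ ∞ := by simp [hE]
  refine ⟨fun h => ?_, fun h => h.smul_measure hct⟩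
  have := h.smul_measure (c := μ E) (measure_ne_top _ _)
  rwa [smul_smul, ENNReal.mul_inv_cancel hE (measure_ne_top _ _), one_smul] at this

lemma ae_cond_iff {E : Set Ω} {p : Ω → Prop} :
    (∀ᵐ ω ∂(ProbabilityTheory.cond μ E), p ω) ↔ ∀ᵐ ω ∂(μ.restrict E), p ω := by
  rw [ProbabilityTheory.cond, Measure.ae_ennreal_smul_measure_iff (by simp)]

/-! ### Conditional laws -/

/-- On rectangles, conditional independence factors the conditional probability given $V$; the
factor for $h$ is the kernel, and the pull-out property turns the product into an integral of the
kernel over the event for $(V,g)$. Rectangles determine the joint law. -/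
lemma hasCondDistrib_of_condIndep [StandardBorelSpace Ω] {P : Measure Ω} [IsProbabilityMeasure P]
    {V : Ω → β} {g : Ω → α}
    {h : Ω → γ} (hV : Measurable V) (hg : Measurable g) (hh : Measurable h)
    (hci : CondIndep (sigmaOf V) (sigmaOf g) (sigmaOf h) hV.comap_le P)
    {κ : Kernel β γ} [IsMarkovKernel κ] (hκ : HasCondDistrib h V κ P) :
    HasCondDistrib h (fun ω => (V ω, g ω)) (κ.prodMkRight α) P := by
  refine ⟨by fun_prop, ?_⟩
  have : IsProbabilityMeasure (P.map fun ω => (V ω, g ω)) :=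
    Measure.isProbabilityMeasure_map (by fun_prop)
  refine Measure.ext_prod₃' fun {s t u} hs ht hu => ?_
  set k : Ω → ℝ := fun ω => (κ (V ω) u).toReal with hk
  have hκm : Measurable fun b => κ b u := κ.measurable_coe hu
  have hkm : StronglyMeasurable[sigmaOf V] k :=
    (hκm.ennreal_toReal.comp (comap_measurable V)).stronglyMeasurable
  have hk1 : ∀ ω, ‖k ω‖ ≤ 1 := fun ω => by
    rw [Real.norm_of_nonneg ENNReal.toReal_nonneg]
    exact measureReal_le_one
  have hkint : Integrable k P := .of_bound (hkm.mono hV.comap_le).aestronglyMeasurable 1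
    (Eventually.of_forall hk1)
  have hlin : ∀ s, MeasurableSet s → ∀ t, MeasurableSet t →
      ∫⁻ ω in V ⁻¹' s ∩ g ⁻¹' t, κ (V ω) u ∂P = ENNReal.ofReal (∫ ω in V ⁻¹' s ∩ g ⁻¹' t, k ω ∂P) :=
    fun s hs t ht => by
      rw [ofReal_integral_eq_lintegral_ofReal hkint.integrableOn
        (Eventually.of_forall fun _ => ENNReal.toReal_nonneg)]
      simp [hk]
  have hset : ∀ s, MeasurableSet s → P (V ⁻¹' s ∩ h ⁻¹' u) = ∫⁻ ω in V ⁻¹' s, κ (V ω) u ∂P :=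
    fun s hs => by
    have h1 := congrArg (fun m => m (s ×ˢ u)) hκ.map_eq
    rw [Measure.map_apply (by fun_prop) (hs.prod hu), Measure.compProd_apply_prod hs hu,
      setLIntegral_map hs hκm hV, Set.mk_preimage_prod] at h1
    exact h1
  have hE : k =ᵐ[P] P⟦h ⁻¹' u | sigmaOf V⟧ := by
    refine ae_eq_condExp_of_forall_setIntegral_eq hV.comap_le
      ((integrable_const 1).indicator (hh hu)) (fun _ _ _ => hkint.integrableOn) ?_
      hkm.aestronglyMeasurable
    rintro s ⟨s', hs', rfl⟩ -
    rw [integral_indicator (hh hu), Measure.restrict_restrict (hh hu), setIntegral_const, smul_eq_mul,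
      mul_one, measureReal_def, Set.inter_comm, hset s' hs',
      integral_toReal (f := fun ω => κ (V ω) u) (hκm.comp hV).aemeasurable]
    exact Eventually.of_forall fun ω => measure_lt_top _ _
  have hind := (condIndep_iff _ _ _ hV.comap_le hg.comap_le hh.comap_le P).1 hci
    (g ⁻¹' t) (h ⁻¹' u) ⟨t, ht, rfl⟩ ⟨u, hu, rfl⟩
  have hti : Integrable ((g ⁻¹' t).indicator fun _ => (1 : ℝ)) P :=
    (integrable_const 1).indicator (hg ht)
  have hpull : P[k * (g ⁻¹' t).indicator (fun _ => (1 : ℝ)) | sigmaOf V] =ᵐ[P]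
      k * P⟦g ⁻¹' t | sigmaOf V⟧ :=
    condExp_stronglyMeasurable_mul_of_bound hV.comap_le hkm hti 1 (Eventually.of_forall hk1)
  have hki : Integrable (k * (g ⁻¹' t).indicator fun _ => (1 : ℝ)) P := by
    refine hti.bdd_mul (c := 1) (hkm.mono hV.comap_le).aestronglyMeasurable (Eventually.of_forall hk1)
  have key : ∫ ω in V ⁻¹' s, ((g ⁻¹' t ∩ h ⁻¹' u).indicator (fun _ => (1 : ℝ))) ω ∂P =
      ∫ ω in V ⁻¹' s, (k * (g ⁻¹' t).indicator fun _ => (1 : ℝ)) ω ∂P := by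
    rw [← setIntegral_condExp hV.comap_le ((integrable_const 1).indicator ((hg ht).inter (hh hu)))
      ⟨s, hs, rfl⟩, ← setIntegral_condExp hV.comap_le hki ⟨s, hs, rfl⟩]
    refine integral_congr_ae (ae_restrict_of_ae ?_)
    filter_upwards [hind, hpull, hE] with ω h1 h2 h3
    rw [h1, h2, Pi.mul_apply, Pi.mul_apply, ← h3, mul_comm]
  rw [Measure.map_apply (by fun_prop) ((hs.prod ht).prod hu), Measure.compProd_apply_prod (hs.prod ht) hu,
    setLIntegral_map (hs.prod ht) (by exact hκm.comp measurable_fst) (by fun_prop)]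
  simp only [Kernel.prodMkRight_apply, Set.mk_preimage_prod]
  rw [hlin s hs t ht]
  rw [integral_indicator ((hg ht).inter (hh hu)), Measure.restrict_restrict ((hg ht).inter (hh hu)),
    setIntegral_const, smul_eq_mul, mul_one] at key
  have hr : ∫ ω in V ⁻¹' s, (k * (g ⁻¹' t).indicator fun _ => (1 : ℝ)) ω ∂P =
      ∫ ω in V ⁻¹' s ∩ g ⁻¹' t, k ω ∂P := by
    have : (k * (g ⁻¹' t).indicator fun _ => (1 : ℝ)) = (g ⁻¹' t).indicator k := by
      funext ω; by_cases hω : ω ∈ g ⁻¹' t <;> simp [hω]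
    rw [this, integral_indicator (hg ht), Measure.restrict_restrict (hg ht), Set.inter_comm]
  rw [← hr, ← key, measureReal_def, ENNReal.ofReal_toReal (measure_ne_top _ _)]
  congr 1
  ext ω; simp [and_comm, and_left_comm]

variable {X : Ω → τ} {Y : Ω → γ} {κ : Kernel τ γ} [IsMarkovKernel κ]

lemma ProbabilityTheory.HasCondDistrib.lintegral_eq (h : HasCondDistrib Y X κ μ) (hX : Measurable X)
    (hY : Measurable Y) {F : τ × γ → ℝ≥0∞} (hF : Measurable F) :
    ∫⁻ ω, F (X ω, Y ω) ∂μ = ∫⁻ ω, ∫⁻ c, F (X ω, c) ∂(κ (X ω)) ∂μ := by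
  rw [← lintegral_map (μ := μ) (g := fun ω => (X ω, Y ω)) hF (by fun_prop), h.map_eq,
    Measure.lintegral_compProd hF, lintegral_map hF.lintegral_kernel_prod_right' hX]

lemma hasCondDistrib_of_lintegral_eq (hX : Measurable X) (hY : Measurable Y)
    (h : ∀ F : τ × γ → ℝ≥0∞, Measurable F →
      ∫⁻ ω, F (X ω, Y ω) ∂μ = ∫⁻ ω, ∫⁻ c, F (X ω, c) ∂(κ (X ω)) ∂μ) :
    HasCondDistrib Y X κ μ := by
  refine ⟨by fun_prop, Measure.ext_of_lintegral _ fun F hF => ?_⟩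
  rw [lintegral_map hF (by fun_prop), h F hF, Measure.lintegral_compProd hF,
    lintegral_map hF.lintegral_kernel_prod_right' hX]

lemma ProbabilityTheory.HasCondDistrib.integrable_kernel (h : HasCondDistrib Y X κ μ) (hX : Measurable X)
    (hY : Measurable Y) {F : τ × γ → ℝ} (hF : Measurable F)
    (hi : Integrable (fun ω => F (X ω, Y ω)) μ) :
    Integrable (fun ω => ∫ c, F (X ω, c) ∂(κ (X ω))) μ ∧
      ∫ ω, F (X ω, Y ω) ∂μ = ∫ ω, ∫ c, F (X ω, c) ∂(κ (X ω)) ∂μ := by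
  have hi' : Integrable F (μ.map X ⊗ₘ κ) := by
    rw [← h.map_eq]
    exact (integrable_map_measure hF.aestronglyMeasurable (by fun_prop)).2 hi
  have hm : AEStronglyMeasurable (fun x => ∫ c, F (x, c) ∂(κ x)) (μ.map X) :=
    (hF.stronglyMeasurable.integral_kernel_prod_right').aestronglyMeasurable
  constructor
  · rw [Measure.compProd] at hi'
    exact (integrable_map_measure hm hX.aemeasurable).1
      (by simpa using MeasureTheory.Integrable.integral_compProd hi')
  · rw [← integral_map (φ := X) hX.aemeasurable hm, ← Measure.integral_compProd hi', ← h.map_eq,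
      integral_map (by fun_prop) hF.aestronglyMeasurable]

/-- Jensen: averaging over the conditional law does not increase the second moment. -/
lemma ProbabilityTheory.HasCondDistrib.memLp_two_kernel (h : HasCondDistrib Y X κ μ) (hX : Measurable X)
    (hY : Measurable Y) {F : τ × γ → ℝ} (hF : Measurable F)
    (hi : MemLp (fun ω => F (X ω, Y ω)) 2 μ) :
    MemLp (fun ω => ∫ c, F (X ω, c) ∂(κ (X ω))) 2 μ := by
  have hm : Measurable (fun x => ∫ c, F (x, c) ∂(κ x)) :=
    (hF.stronglyMeasurable.integral_kernel_prod_right').measurable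
  refine ⟨(hm.comp hX).aestronglyMeasurable, ?_⟩
  have h1 := hi.2
  rw [eLpNorm_lt_top_iff_lintegral_rpow_enorm_lt_top (by norm_num) (by norm_num)] at h1 ⊢
  simp only [ENNReal.toReal_ofNat, ENNReal.rpow_ofNat] at h1 ⊢
  have h2 := h.lintegral_eq hX hY (F := fun p => ‖F p‖ₑ ^ 2) (by fun_prop)
  rw [h2] at h1
  refine lt_of_le_of_lt (lintegral_mono fun ω => ?_) h1
  calc ‖∫ c, F (X ω, c) ∂(κ (X ω))‖ₑ ^ 2 ≤ (∫⁻ c, ‖F (X ω, c)‖ₑ ∂(κ (X ω))) ^ 2 := by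
        gcongr; exact enorm_integral_le_lintegral_enorm _
    _ ≤ ∫⁻ c, ‖F (X ω, c)‖ₑ ^ 2 ∂(κ (X ω)) := by
        have hmc : Measurable fun c => F (X ω, c) := hF.comp measurable_prodMk_left
        have := ENNReal.lintegral_mul_le_Lp_mul_Lq (κ (X ω)) Real.HolderConjugate.two_two
          (f := fun c => ‖F (X ω, c)‖ₑ) (g := fun _ => 1) hmc.enorm.aemeasurable aemeasurable_const
        simp only [Pi.mul_apply, mul_one, ENNReal.rpow_ofNat, one_pow, lintegral_one, measure_univ,
          ENNReal.one_rpow] at this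
        calc _ ≤ ((∫⁻ c, ‖F (X ω, c)‖ₑ ^ 2 ∂(κ (X ω))) ^ (1 / 2 : ℝ)) ^ 2 := by gcongr
          _ = _ := by rw [← ENNReal.rpow_natCast, ← ENNReal.rpow_mul]; norm_num

lemma ProbabilityTheory.HasCondDistrib.restrict (h : HasCondDistrib Y X κ μ) (hX : Measurable X) (hY : Measurable Y)
    {s : Set τ} (hs : MeasurableSet s) : HasCondDistrib Y X κ (μ.restrict (X ⁻¹' s)) := by
  refine hasCondDistrib_of_lintegral_eq hX hY fun F hF => ?_
  have h1 := h.lintegral_eq hX hY (F := fun p => s.indicator 1 p.1 * F p)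
    (((measurable_one.indicator hs).comp measurable_fst).mul hF)
  have e : ∀ G : Ω → ℝ≥0∞, ∫⁻ ω in X ⁻¹' s, G ω ∂μ = ∫⁻ ω, s.indicator 1 (X ω) * G ω ∂μ :=
    fun G => by
    rw [← lintegral_indicator (hX hs)]
    refine lintegral_congr fun ω => ?_
    by_cases hω : X ω ∈ s
    · simp [hω]
    · simp [hω]
  rw [e, e, h1]
  refine lintegral_congr fun ω => ?_
  simp only
  rw [lintegral_const_mul]
  exact hF.comp measurable_prodMk_left

end CondMean

/-! ### Conditional residuals, lifting by completeness, and densities -/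

section General

variable {Ω τ β γ α : Type*} [mΩ : MeasurableSpace Ω] [MeasurableSpace τ] [mβ : MeasurableSpace β]
  [MeasurableSpace γ] [MeasurableSpace α] {μ : Measure Ω} [IsFiniteMeasure μ]

lemma CondMeanZero.add {R R' : Ω → ℝ} {T : Ω → τ} (h : CondMeanZero μ R T)
    (h' : CondMeanZero μ R' T) (hR : Integrable R μ) (hR' : Integrable R' μ) :
    CondMeanZero μ (fun ω => R ω + R' ω) T := fun s hs => by
  rw [integral_add hR.integrableOn hR'.integrableOn, h s hs, h' s hs, add_zero]

lemma CondMeanZero.sub {R R' : Ω → ℝ} {T : Ω → τ} (h : CondMeanZero μ R T)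
    (h' : CondMeanZero μ R' T) (hR : Integrable R μ) (hR' : Integrable R' μ) :
    CondMeanZero μ (fun ω => R ω - R' ω) T := fun s hs => by
  rw [integral_sub hR.integrableOn hR'.integrableOn, h s hs, h' s hs, sub_zero]

lemma ProbabilityTheory.HasCondDistrib.condMeanZero {X : Ω → τ} {Y : Ω → γ} {κ : Kernel τ γ}
    [IsMarkovKernel κ] (h : HasCondDistrib Y X κ μ) (hX : Measurable X)
    (hY : Measurable Y) {F : τ × γ → ℝ} (hF : Measurable F)
    (hi : Integrable (fun ω => F (X ω, Y ω)) μ) :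
    CondMeanZero μ (fun ω => F (X ω, Y ω) - ∫ c, F (X ω, c) ∂(κ (X ω))) X := fun s hs => by
  have h1 := (h.restrict hX hY hs).integrable_kernel hX hY hF hi.integrableOn
  rw [integral_sub hi.integrableOn h1.1, h1.2, sub_self]

/-- Completeness turns a residual with conditional mean zero given the proxy `Z` and `b L` into one
with conditional mean zero given the latent variable `L`. -/
lemma condMeanZero_of_complete {ζ ℓ : Type*} [MeasurableSpace ζ] [MeasurableSpace ℓ] {Z : Ω → ζ}
    {R₀ : Ω → τ} {l : τ → ℓ} {b : ℓ → β} (hZ : Measurable Z) (hR₀ : Measurable R₀)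
    (hl : Measurable l) (hb : Measurable b) {κ : Kernel ℓ ζ} [IsMarkovKernel κ]
    (hκ : HasCondDistrib Z R₀ (κ.comap l hl) μ)
    (hcomp : ∀ g : ℓ → ℝ, Measurable g → MemLp (fun ω => g (l (R₀ ω))) 2 μ →
      CondMeanZero μ (fun ω => g (l (R₀ ω))) (fun ω => (Z ω, b (l (R₀ ω)))) →
      (fun ω => g (l (R₀ ω))) =ᵐ[μ] 0)
    {r : τ → ℝ} (hr : Measurable r) (hr2 : MemLp (fun ω => r (R₀ ω)) 2 μ)
    (hr0 : CondMeanZero μ (fun ω => r (R₀ ω)) (fun ω => (Z ω, b (l (R₀ ω))))) :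
    CondMeanZero μ (fun ω => r (R₀ ω)) (fun ω => l (R₀ ω)) := by
  have hL : Measurable fun ω => l (R₀ ω) := hl.comp hR₀
  have hB : Measurable fun ω => (Z ω, b (l (R₀ ω))) := hZ.prodMk (hb.comp hL)
  have hri := hr2.integrable one_le_two
  -- $g(L)$ is the conditional mean of the residual given the latent $L=l(R_0)$, and is the function
  -- to which completeness is applied.
  obtain ⟨g, hg, hgL⟩ := (stronglyMeasurable_condExp (μ := μ) (f := fun ω => r (R₀ ω))
    (m := sigmaOf fun ω => l (R₀ ω))).measurable.exists_eq_measurable_comp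
  have hgL' : (fun ω => g (l (R₀ ω))) = μ[fun ω => r (R₀ ω) | sigmaOf fun ω => l (R₀ ω)] := hgL.symm
  have hg2 : MemLp (fun ω => g (l (R₀ ω))) 2 μ := hgL' ▸ hr2.condExp one_le_two
  have hgi := hg2.integrable one_le_two
  have hrg : CondMeanZero μ (fun ω => r (R₀ ω) - g (l (R₀ ω))) (fun ω => l (R₀ ω)) := fun s hs => by
    rw [integral_sub hri.integrableOn hgi.integrableOn, hgL', setIntegral_condExp hL.comap_le hri
      ⟨s, hs, rfl⟩, sub_self]
  suffices h0 : (fun ω => g (l (R₀ ω))) =ᵐ[μ] 0 by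
    refine hrg.congr ?_
    filter_upwards [h0] with ω hω
    simp only [Pi.zero_apply] at hω
    rw [hω, sub_zero]
  refine hcomp g hg hg2 (condMeanZero_of_integral_mul hB fun k hk hk1 => ?_)
  -- A test function of $(Z,b(L))$ is averaged over the law of $Z$, which depends on $R_0$ through
  -- $L$ only. The result is a function of $L$, and against such functions $r(R_0)$ and $g(L)$
  -- cannot be distinguished.
  set kb : ℓ → ℝ := fun t => ∫ z, k (z, b t) ∂(κ t) with hkb
  have hkbm : Measurable kb := by
    have : Measurable fun p : ℓ × ζ => k (p.2, b p.1) := hk.comp (by fun_prop)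
    exact this.stronglyMeasurable.integral_kernel_prod_right'.measurable
  have hkb1 : ∀ t, ‖kb t‖ ≤ 1 := fun t => by
    refine (norm_integral_le_of_norm_le_const (C := 1) (Eventually.of_forall fun z => hk1 _)).trans ?_
    simp
  have hav : ∀ s : τ → ℝ, Measurable s → Integrable (fun ω => s (R₀ ω)) μ →
      ∫ ω, k (Z ω, b (l (R₀ ω))) * s (R₀ ω) ∂μ = ∫ ω, kb (l (R₀ ω)) * s (R₀ ω) ∂μ := fun s hs hsi => by
    have hm : Measurable fun p : τ × ζ => k (p.2, b (l p.1)) * s p.1 := by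
      have h1 : Measurable fun p : τ × ζ => (p.2, b (l p.1)) := by fun_prop
      exact (hk.comp h1).mul (by fun_prop)
    have hi : Integrable (fun ω => k (Z ω, b (l (R₀ ω))) * s (R₀ ω)) μ :=
      hsi.bdd_mul (c := 1) (hk.comp hB).aestronglyMeasurable (Eventually.of_forall fun ω => hk1 _)
    have h2 := (hκ.integrable_kernel hR₀ hZ hm hi).2
    rw [h2]
    refine integral_congr_ae (Eventually.of_forall fun ω => ?_)
    simp only [Kernel.comap_apply, hkb, integral_mul_const]
  rw [hav (fun t => g (l t)) (hg.comp hl) hgi]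
  have hki : ∀ s : Ω → ℝ, Integrable s μ → Integrable (fun ω => kb (l (R₀ ω)) * s ω) μ := fun s hs =>
    hs.bdd_mul (c := 1) (hkbm.comp hL).aestronglyMeasurable (Eventually.of_forall fun ω => hkb1 _)
  have h3 := hrg.integral_mul hL (hri.sub hgi) hkbm (hki _ (hri.sub hgi))
  simp only [mul_sub] at h3
  rw [integral_sub (hki _ hri) (hki _ hgi), sub_eq_zero] at h3
  rw [← h3, ← hav r hr hri]
  exact hr0.integral_mul hB hri hk (hri.bdd_mul (c := 1) (hk.comp hB).aestronglyMeasurable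
    (Eventually.of_forall fun ω => hk1 _))

/-- Integrals of functions of a random element with a density. -/
lemma integrable_comp_iff_of_map_eq_withDensity {T : Ω → τ} (hT : Measurable T) {ν : Measure τ}
    {g : τ → ℝ} (hg : Measurable g) (hg0 : ∀ᵐ t ∂ν, 0 ≤ g t)
    (h : μ.map T = ν.withDensity fun t => ENNReal.ofReal (g t)) {F : τ → ℝ} (hF : Measurable F) :
    (Integrable (fun ω => F (T ω)) μ ↔ Integrable (fun t => g t * F t) ν) ∧
      ∫ ω, F (T ω) ∂μ = ∫ t, g t * F t ∂ν := by
  have hgm : Measurable fun t => ENNReal.ofReal (g t) := hg.ennreal_ofReal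
  have hlt : ∀ᵐ t ∂ν, ENNReal.ofReal (g t) < ∞ := Eventually.of_forall fun _ => ENNReal.ofReal_lt_top
  have hae : ∀ᵐ t ∂ν, (ENNReal.ofReal (g t)).toReal • F t = g t * F t := by
    filter_upwards [hg0] with t ht
    rw [ENNReal.toReal_ofReal ht, smul_eq_mul]
  constructor
  · have h1 : Integrable (fun ω => F (T ω)) μ ↔ Integrable F (μ.map T) :=
      (integrable_map_measure hF.aestronglyMeasurable hT.aemeasurable).symm
    rw [h1, h, integrable_withDensity_iff_integrable_smul' hgm hlt]
    exact integrable_congr hae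
  · rw [← integral_map hT.aemeasurable hF.aestronglyMeasurable, h,
      integral_withDensity_eq_integral_toReal_smul hgm hlt]
    exact integral_congr_ae hae

end General

/-! ### Conditional laws of the proxies -/

namespace PathSpecific.CausalModel

variable {Ω 𝒰 𝒟 ℳ 𝒲 𝒵 𝒳 : Type*} [mΩ : MeasurableSpace Ω] [MeasurableSpace 𝒰]
  [MeasurableSpace 𝒟] [MeasurableSpace ℳ] [MeasurableSpace 𝒲] [MeasurableSpace 𝒵]
  [MeasurableSpace 𝒳]

attribute [fun_prop] U_meas X_meas W_meas Z_meas A_meas D_meas M_meas Y_meas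

/-- The variables `((U, X), (W, D, M, Y))`. -/
abbrev core (C : CausalModel Ω 𝒰 𝒟 ℳ 𝒲 𝒵 𝒳) (ω : Ω) : (𝒰 × 𝒳) × (𝒲 × 𝒟 × ℳ × ℝ) :=
  (C.UX ω, (C.W ω, C.D ω, C.M ω, C.Y ω))

/-- The variables `((U, X), D)`. -/
abbrev UXD (C : CausalModel Ω 𝒰 𝒟 ℳ 𝒲 𝒵 𝒳) (ω : Ω) : (𝒰 × 𝒳) × 𝒟 := (C.UX ω, C.D ω)

/-- The variables `(((U, X), D), M)`. -/
abbrev UXDM (C : CausalModel Ω 𝒰 𝒟 ℳ 𝒲 𝒵 𝒳) (ω : Ω) : ((𝒰 × 𝒳) × 𝒟) × ℳ :=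
  ((C.UX ω, C.D ω), C.M ω)

variable {C : CausalModel Ω 𝒰 𝒟 ℳ 𝒲 𝒵 𝒳} {P : Measure Ω}

lemma measurable_obs : Measurable C.obs := by
  unfold obs; fun_prop

lemma measurableSet_arm (a : Bool) : MeasurableSet {ω | C.A ω = a} :=
  C.A_meas (measurableSet_singleton a)

/-- Conditional laws of the proxies `W` and `Z`. -/
structure ProxyKernels (C : CausalModel Ω 𝒰 𝒟 ℳ 𝒲 𝒵 𝒳) (P : Measure Ω)
    (κW : Kernel (𝒰 × 𝒳) 𝒲) (κZ : Bool → Kernel (𝒰 × 𝒳) 𝒵) : Prop where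
  markovW : IsMarkovKernel κW
  markovZ : ∀ a, IsMarkovKernel (κZ a)
  W₀ : HasCondDistrib C.W C.UX κW P
  W : ∀ a, HasCondDistrib C.W (fun ω => (C.UX ω, (C.D ω, C.M ω, C.Z ω)))
    (κW.prodMkRight _) (C.on P a)
  Z : ∀ a, HasCondDistrib C.Z C.core ((κZ a).prodMkRight _) (C.on P a)

/-- The laws exist because the spaces are standard Borel, and the proxy conditions enlarge their
conditioning sets. The law of $W$ is common to both arms, whereas that of $Z$ may depend on the arm.
Together the two conditions also make $W$ independent of $Z$ given the latent variables. -/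
lemma exists_proxyKernels [StandardBorelSpace Ω] [StandardBorelSpace 𝒲] [StandardBorelSpace 𝒵]
    [IsProbabilityMeasure P] (h : C.Proxies P) : ∃ κW κZ, C.ProxyKernels P κW κZ := by
  have : Nonempty Ω := nonempty_of_isProbabilityMeasure P
  have : Nonempty 𝒲 := ⟨C.W (Classical.arbitrary Ω)⟩
  have : Nonempty 𝒵 := ⟨C.Z (Classical.arbitrary Ω)⟩
  let κW := condDistrib C.W C.UX P
  let κ := condDistrib C.Z (fun ω => (C.A ω, C.UX ω)) P
  let κZ : Bool → Kernel (𝒰 × 𝒳) 𝒵 := fun a => κ.comap (fun v => (a, v)) measurable_prodMk_left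
  have hW₀ : HasCondDistrib C.W C.UX κW P :=
    ⟨by fun_prop, (compProd_map_condDistrib C.W_meas.aemeasurable).symm⟩
  have hZ₀ : HasCondDistrib C.Z (fun ω => (C.A ω, C.UX ω)) κ P :=
    ⟨by fun_prop, (compProd_map_condDistrib C.Z_meas.aemeasurable).symm⟩
  have hW₁ : HasCondDistrib C.W (fun ω => (C.UX ω, (C.A ω, C.D ω, C.M ω)))
      (κW.prodMkRight _) P :=
    hasCondDistrib_of_condIndep (by fun_prop) (by fun_prop) (by fun_prop) h.W.symm hW₀
  have hZ₁ : HasCondDistrib C.Z (fun ω => ((C.A ω, C.UX ω), (C.W ω, C.D ω, C.M ω, C.Y ω)))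
      (κ.prodMkRight _) P :=
    hasCondDistrib_of_condIndep (by fun_prop) (by fun_prop) (by fun_prop) h.Z.symm hZ₀
  have hZ : ∀ a, HasCondDistrib C.Z C.core ((κZ a).prodMkRight _) (C.on P a) := fun a => by
    refine hasCondDistrib_of_lintegral_eq (by fun_prop) (by fun_prop) fun F hF => ?_
    have hs : MeasurableSet {p : (Bool × (𝒰 × 𝒳)) × (𝒲 × 𝒟 × ℳ × ℝ) | p.1.1 = a} :=
      (measurable_fst.fst) (measurableSet_singleton a)
    have h1 := (hZ₁.restrict (by fun_prop) (by fun_prop) hs).lintegral_eq (by fun_prop) (by fun_prop)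
      (F := fun p => F ((p.1.1.2, p.1.2), p.2)) (hF.comp (by fun_prop))
    refine h1.trans (setLIntegral_congr_fun (measurableSet_arm a) fun ω hω => ?_)
    have hω' : C.A ω = a := hω
    simp [κZ, Kernel.prodMkRight_apply, Kernel.comap_apply, hω']
  refine ⟨κW, κZ, inferInstance, fun a => inferInstance, hW₀, fun a => ?_, hZ⟩
  -- To add $Z$ to the conditioning variables of $W$, first $Z$ and then $W$ is integrated out; the
  -- two kernels depend on $(U,X)$ only, so Tonelli exchanges them, and the integration over $Z$ is
  -- then undone.
  refine hasCondDistrib_of_lintegral_eq (by fun_prop) (by fun_prop) fun F hF => ?_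
  have hs : MeasurableSet {p : (𝒰 × 𝒳) × (Bool × 𝒟 × ℳ) | p.2.1 = a} :=
    (measurable_snd.fst) (measurableSet_singleton a)
  have hW₂ := hW₁.restrict (by fun_prop) (by fun_prop) hs
  have h1 := (hZ a).lintegral_eq (by fun_prop) (by fun_prop)
    (F := fun p => F ((p.1.1, (p.1.2.2.1, p.1.2.2.2.1, p.2)), p.1.2.1)) (hF.comp (by fun_prop))
  have hG : Measurable fun p : ((𝒰 × 𝒳) × 𝒟 × ℳ × 𝒲) × 𝒵 =>
      F ((p.1.1, (p.1.2.1, p.1.2.2.1, p.2)), p.1.2.2.2) := hF.comp (by fun_prop)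
  have hGl : Measurable fun q : (𝒰 × 𝒳) × 𝒟 × ℳ × 𝒲 =>
      ∫⁻ z, F ((q.1, (q.2.1, q.2.2.1, z)), q.2.2.2) ∂(κZ a q.1) := by
    have := Measurable.lintegral_kernel_prod_right' (κ := (κZ a).comap
      (fun q : (𝒰 × 𝒳) × 𝒟 × ℳ × 𝒲 => q.1) measurable_fst) hG
    exact this
  have h2 := hW₂.lintegral_eq (by fun_prop) (by fun_prop)
    (F := fun p => ∫⁻ z, F ((p.1.1, (p.1.2.2.1, p.1.2.2.2, z)), p.2) ∂(κZ a p.1.1))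
    (hGl.comp (g := fun q : (𝒰 × 𝒳) × 𝒟 × ℳ × 𝒲 =>
      ∫⁻ z, F ((q.1, (q.2.1, q.2.2.1, z)), q.2.2.2) ∂(κZ a q.1))
      (f := fun p : ((𝒰 × 𝒳) × (Bool × 𝒟 × ℳ)) × 𝒲 => (p.1.1, p.1.2.2.1, p.1.2.2.2, p.2))
      (by fun_prop))
  have hH : Measurable fun p : ((𝒰 × 𝒳) × 𝒟 × ℳ × 𝒵) × 𝒲 => F (p.1, p.2) := hF
  have hHl : Measurable fun q : (𝒰 × 𝒳) × 𝒟 × ℳ × 𝒵 => ∫⁻ w, F (q, w) ∂(κW q.1) := by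
    have := Measurable.lintegral_kernel_prod_right' (κ := κW.comap
      (fun q : (𝒰 × 𝒳) × 𝒟 × ℳ × 𝒵 => q.1) measurable_fst) hH
    exact this
  have h3 := (hZ a).lintegral_eq (by fun_prop) (by fun_prop)
    (F := fun p => ∫⁻ w, F ((p.1.1, (p.1.2.2.1, p.1.2.2.2.1, p.2)), w) ∂(κW p.1.1))
    (hHl.comp (f := fun p : ((𝒰 × 𝒳) × (𝒲 × 𝒟 × ℳ × ℝ)) × 𝒵 =>
      (p.1.1, p.1.2.2.1, p.1.2.2.2.1, p.2)) (by fun_prop))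
  simp only [Kernel.prodMkRight_apply] at h1 h2 h3 ⊢
  refine (h1.trans h2).trans (Eq.trans ?_ h3.symm)
  refine lintegral_congr fun ω => ?_
  exact lintegral_lintegral_swap (f := fun w z => F ((C.UX ω, (C.D ω, C.M ω, z)), w))
    (hF.comp (by fun_prop : Measurable fun p : 𝒲 × 𝒵 =>
      ((C.UX ω, (C.D ω, C.M ω, p.2)), p.1))).aemeasurable

end PathSpecific.CausalModel

/-! ### Latent weights and changes of arm -/

section General

variable {Ω τ β γ α : Type*} [mΩ : MeasurableSpace Ω] [MeasurableSpace τ] [mβ : MeasurableSpace β]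
  [MeasurableSpace γ] [MeasurableSpace α]

lemma prod_withDensity_withDensity_ofReal {μ : Measure α} {ν : Measure β} [SFinite μ] [SFinite ν]
    {f : α → ℝ} {g : α × β → ℝ} (hf : Measurable f) (hg : Measurable g)
    (hf0 : ∀ᵐ a ∂μ, 0 ≤ f a) :
    ((μ.withDensity fun a => ENNReal.ofReal (f a)).prod ν).withDensity
      (fun p => ENNReal.ofReal (g p)) =
    (μ.prod ν).withDensity fun p => ENNReal.ofReal (f p.1 * g p) := by
  have h1 : (μ.withDensity fun a => ENNReal.ofReal (f a)).prod ν =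
      (μ.prod ν).withDensity fun p => ENNReal.ofReal (f p.1) :=
    prod_withDensity_left₀ hf.ennreal_ofReal.aemeasurable
  rw [h1, ← withDensity_mul _ (by fun_prop) (by fun_prop)]
  refine withDensity_congr_ae ?_
  have : ∀ᵐ p ∂(μ.prod ν), 0 ≤ f p.1 := Measure.quasiMeasurePreserving_fst.ae hf0
  filter_upwards [this] with p hp
  simp [ENNReal.ofReal_mul hp]

lemma CondMeanZero.sub_trans {μ : Measure Ω} [IsFiniteMeasure μ] {R R' R'' : Ω → ℝ} {T : Ω → τ}
    (h : CondMeanZero μ (fun ω => R ω - R' ω) T)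
    (h' : CondMeanZero μ (fun ω => R' ω - R'' ω) T) (hR : Integrable R μ) (hR' : Integrable R' μ)
    (hR'' : Integrable R'' μ) :
    CondMeanZero μ (fun ω => R ω - R'' ω) T := by
  have := h.add h' (hR.sub hR') (hR'.sub hR'')
  simpa using this

/-- Integrating `R` against functions of `T` when `R - R'` has conditional mean zero given `T`. -/
lemma CondMeanZero.integral_mul_congr {μ : Measure Ω} [IsFiniteMeasure μ] {R R' : Ω → ℝ} {T : Ω → τ}
    (h : CondMeanZero μ (fun ω => R ω - R' ω) T) (hT : Measurable T) (hR : Integrable R μ)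
    (hR' : Integrable R' μ) {g : τ → ℝ} (hg : Measurable g)
    (hgR : Integrable (fun ω => g (T ω) * R ω) μ) (hgR' : Integrable (fun ω => g (T ω) * R' ω) μ) :
    ∫ ω, g (T ω) * R ω ∂μ = ∫ ω, g (T ω) * R' ω ∂μ := by
  have h1 := h.integral_mul hT (hR.sub hR') hg
    ((hgR.sub hgR').congr (Eventually.of_forall fun ω => by simp [mul_sub]))
  simp only [mul_sub] at h1
  rwa [integral_sub hgR hgR', sub_eq_zero] at h1

lemma Integrable.bdd_left_mul {μ : Measure Ω} {R : Ω → ℝ} {T : Ω → τ} (hR : Integrable R μ)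
    (hT : Measurable T) {g : τ → ℝ} (hg : Measurable g) (hg1 : ∀ t, |g t| ≤ 1) :
    Integrable (fun ω => g (T ω) * R ω) μ :=
  hR.bdd_mul (c := 1) (hg.comp hT).aestronglyMeasurable (Eventually.of_forall fun _ => hg1 _)

end General

namespace PathSpecific

variable {Ω 𝒰 𝒟 ℳ 𝒲 𝒵 𝒳 : Type*} [mΩ : MeasurableSpace Ω] [MeasurableSpace 𝒰]
  [MeasurableSpace 𝒟] [MeasurableSpace ℳ] [MeasurableSpace 𝒲] [MeasurableSpace 𝒵]
  [MeasurableSpace 𝒳]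

namespace Densities

attribute [fun_prop] e_meas fD_meas fM_meas

variable (f : Densities 𝒰 𝒟 ℳ 𝒳)

/-- The density of `((U,X),D)` on `A = a`. -/
def den1 (a : Bool) (p : (𝒰 × 𝒳) × 𝒟) : ℝ := f.e a p.1 * f.fD a p

/-- The density of `(((U,X),D),M)` on `A = a`. -/
def den2 (a : Bool) (p : ((𝒰 × 𝒳) × 𝒟) × ℳ) : ℝ := f.den1 a p.1 * f.fM a p

/-- The weight `1 / P(A=1|U,X)`. -/
noncomputable def w0 (v : 𝒰 × 𝒳) : ℝ := 1 / f.e true v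

/-- The weight `f(D|A=1,U,X) / (f(D|A=0,U,X) P(A=0|U,X))`. -/
noncomputable def w1 (p : (𝒰 × 𝒳) × 𝒟) : ℝ := f.fD true p / (f.fD false p * f.e false p.1)

/-- The weight `f(M|D,A=0,U,X) / (f(M|D,A=1,U,X) P(A=1|U,X))`. -/
noncomputable def w2 (p : ((𝒰 × 𝒳) × 𝒟) × ℳ) : ℝ := f.fM false p / (f.fM true p * f.e true p.1.1)

@[fun_prop] lemma measurable_den1 (a : Bool) : Measurable (f.den1 a) := by
  unfold den1
  exact ((f.e_meas a).comp measurable_fst).mul (f.fD_meas a)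

@[fun_prop] lemma measurable_den2 (a : Bool) : Measurable (f.den2 a) := by
  unfold den2
  exact ((f.measurable_den1 a).comp measurable_fst).mul (f.fM_meas a)

@[fun_prop] lemma measurable_w0 : Measurable f.w0 := by
  unfold w0
  exact measurable_const.div (f.e_meas true)

@[fun_prop] lemma measurable_w1 : Measurable f.w1 := by
  unfold w1
  exact (f.fD_meas _).div ((f.fD_meas _).mul ((f.e_meas _).comp measurable_fst))

@[fun_prop] lemma measurable_w2 : Measurable f.w2 := by
  unfold w2
  exact (f.fM_meas _).div ((f.fM_meas _).mul ((f.e_meas _).comp measurable_fst.fst))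

end Densities

namespace CausalModel

variable {C : CausalModel Ω 𝒰 𝒟 ℳ 𝒲 𝒵 𝒳} {P : Measure Ω} [IsProbabilityMeasure P]
  {f : Densities 𝒰 𝒟 ℳ 𝒳}

namespace Positivity

lemma pos1 (h : C.Positivity P f) (a : Bool) :
    ∀ᵐ p ∂((P.map C.UX).prod f.muD), 0 < f.e a p.1 ∧ 0 < f.fD a p :=
  (Measure.quasiMeasurePreserving_fst.ae (h.pos_A a)).and (h.pos_D a)

lemma pos2 (h : C.Positivity P f) (a : Bool) :
    ∀ᵐ p ∂(((P.map C.UX).prod f.muD).prod f.muM),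
      0 < f.e a p.1.1 ∧ 0 < f.fD a p.1 ∧ 0 < f.fM a p := by
  filter_upwards [Measure.quasiMeasurePreserving_fst.ae (h.pos1 a), h.pos_M a] with p h1 h2
  exact ⟨h1.1, h1.2, h2⟩

lemma map_UXD (h : C.Positivity P f) (a : Bool) : (C.on P a).map C.UXD =
    ((P.map C.UX).prod f.muD).withDensity fun p => ENNReal.ofReal (f.den1 a p) := by
  rw [show C.UXD = fun ω => (C.UX ω, C.D ω) from rfl, h.dens_D a, h.dens_A a,
    prod_withDensity_withDensity_ofReal (f.e_meas a) (f.fD_meas a)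
      ((h.pos_A a).mono fun _ h => h.le)]
  rfl

lemma map_UXDM (h : C.Positivity P f) (a : Bool) : (C.on P a).map C.UXDM =
    (((P.map C.UX).prod f.muD).prod f.muM).withDensity fun p => ENNReal.ofReal (f.den2 a p) := by
  have h1 := h.dens_M a
  have h2 := h.map_UXD a
  rw [show C.UXD = fun ω => (C.UX ω, C.D ω) from rfl] at h2
  rw [h2, prod_withDensity_withDensity_ofReal (f.measurable_den1 a) (f.fM_meas a)
      ((h.pos1 a).mono fun _ h => (mul_pos h.1 h.2).le)] at h1
  exact h1

lemma den0_nonneg (h : C.Positivity P f) (a : Bool) :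
    ∀ᵐ p ∂(P.map C.UX), 0 ≤ f.e a p := (h.pos_A a).mono fun _ h => h.le

lemma den1_nonneg (h : C.Positivity P f) (a : Bool) :
    ∀ᵐ p ∂((P.map C.UX).prod f.muD), 0 ≤ f.den1 a p :=
  (h.pos1 a).mono fun _ h => (mul_pos h.1 h.2).le

lemma den2_nonneg (h : C.Positivity P f) (a : Bool) :
    ∀ᵐ p ∂(((P.map C.UX).prod f.muD).prod f.muM), 0 ≤ f.den2 a p :=
  (h.pos2 a).mono fun _ h => (mul_pos (mul_pos h.1 h.2.1) h.2.2).le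

/-- From arm `1` to the whole population. -/
lemma integral_w0 (h : C.Positivity P f) {F : 𝒰 × 𝒳 → ℝ} (hF : Measurable F) :
    (Integrable (fun ω => f.w0 (C.UX ω) * F (C.UX ω)) (C.on P true) ↔
      Integrable (fun ω => F (C.UX ω)) P) ∧
    ∫ ω, f.w0 (C.UX ω) * F (C.UX ω) ∂(C.on P true) = ∫ ω, F (C.UX ω) ∂P := by
  have hm : Measurable fun v => f.w0 v * F v := by fun_prop
  have h1 := integrable_comp_iff_of_map_eq_withDensity (μ := C.on P true) (T := C.UX)
    (by fun_prop) (f.e_meas true) (h.den0_nonneg true) (h.dens_A true) (F := fun v => f.w0 v * F v) hm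
  have h2 : (fun v => f.e true v * (f.w0 v * F v)) =ᵐ[P.map C.UX] F := by
    filter_upwards [h.pos_A true] with v hv
    simp only [Densities.w0]
    field_simp
  rw [h1.1, h1.2, integrable_congr h2, integral_congr_ae h2,
    integrable_map_measure hF.aestronglyMeasurable (by fun_prop),
    integral_map (by fun_prop) hF.aestronglyMeasurable]
  exact ⟨Iff.rfl, rfl⟩

/-- From arm `0` to arm `1`, given `D, U, X`. -/
lemma integral_w1 (h : C.Positivity P f) {F : (𝒰 × 𝒳) × 𝒟 → ℝ} (hF : Measurable F) :
    (Integrable (fun ω => f.w1 (C.UXD ω) * F (C.UXD ω)) (C.on P false) ↔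
      Integrable (fun ω => f.w0 (C.UX ω) * F (C.UXD ω)) (C.on P true)) ∧
    ∫ ω, f.w1 (C.UXD ω) * F (C.UXD ω) ∂(C.on P false) =
      ∫ ω, f.w0 (C.UX ω) * F (C.UXD ω) ∂(C.on P true) := by
  have hm : Measurable fun v => f.w1 v * F v := by fun_prop
  have hm' : Measurable fun v : (𝒰 × 𝒳) × 𝒟 => f.w0 v.1 * F v := by fun_prop
  have h1 := integrable_comp_iff_of_map_eq_withDensity (T := C.UXD) (by fun_prop)
    (f.measurable_den1 false) (h.den1_nonneg false) (h.map_UXD false) hm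
  have h2 := integrable_comp_iff_of_map_eq_withDensity (T := C.UXD) (by fun_prop)
    (f.measurable_den1 true) (h.den1_nonneg true) (h.map_UXD true) hm'
  have h3 : (fun v => f.den1 false v * (f.w1 v * F v)) =ᵐ[(P.map C.UX).prod f.muD]
      fun v => f.den1 true v * (f.w0 v.1 * F v) := by
    filter_upwards [h.pos1 true, h.pos1 false] with v hv hv'
    obtain ⟨_, _⟩ := hv
    obtain ⟨_, _⟩ := hv'
    simp only [Densities.w0, Densities.w1, Densities.den1]
    field_simp
  rw [h1.1, h1.2, integrable_congr h3, integral_congr_ae h3, h2.1, h2.2]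
  exact ⟨Iff.rfl, rfl⟩

/-- From arm `1` to arm `0`, given `M, D, U, X`. -/
lemma integral_w2 (h : C.Positivity P f) {F : ((𝒰 × 𝒳) × 𝒟) × ℳ → ℝ} (hF : Measurable F) :
    (Integrable (fun ω => f.w2 (C.UXDM ω) * F (C.UXDM ω)) (C.on P true) ↔
      Integrable (fun ω => f.w1 (C.UXD ω) * F (C.UXDM ω)) (C.on P false)) ∧
    ∫ ω, f.w2 (C.UXDM ω) * F (C.UXDM ω) ∂(C.on P true) =
      ∫ ω, f.w1 (C.UXD ω) * F (C.UXDM ω) ∂(C.on P false) := by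
  have hm : Measurable fun v => f.w2 v * F v := by fun_prop
  have hm' : Measurable fun v : ((𝒰 × 𝒳) × 𝒟) × ℳ => f.w1 v.1 * F v := by fun_prop
  have h1 := integrable_comp_iff_of_map_eq_withDensity (T := C.UXDM) (by fun_prop)
    (f.measurable_den2 true) (h.den2_nonneg true) (h.map_UXDM true) hm
  have h2 := integrable_comp_iff_of_map_eq_withDensity (T := C.UXDM) (by fun_prop)
    (f.measurable_den2 false) (h.den2_nonneg false) (h.map_UXDM false) hm'
  have h3 : (fun v => f.den2 true v * (f.w2 v * F v)) =ᵐ[((P.map C.UX).prod f.muD).prod f.muM]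
      fun v => f.den2 false v * (f.w1 v.1 * F v) := by
    filter_upwards [h.pos2 true, h.pos2 false] with v hv hv'
    obtain ⟨_, _, _⟩ := hv
    obtain ⟨_, _, _⟩ := hv'
    simp only [Densities.w2, Densities.w1, Densities.den1, Densities.den2]
    field_simp
  rw [h1.1, h1.2, integrable_congr h3, integral_congr_ae h3, h2.1, h2.2]
  exact ⟨Iff.rfl, rfl⟩

lemma ne_zero (h : C.Positivity P f) (a : Bool) : P {ω | C.A ω = a} ≠ 0 := fun h0 => by
  have h1 : C.on P a = 0 := Measure.restrict_eq_zero.2 h0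
  have h2 := h.dens_A a
  rw [h1, Measure.map_zero] at h2
  have h3 := (withDensity_eq_zero_iff (by fun_prop)).1 h2.symm
  have : IsProbabilityMeasure (P.map C.UX) := Measure.isProbabilityMeasure_map (by fun_prop)
  have h4 : ∀ᵐ p ∂(P.map C.UX), False := by
    filter_upwards [h3, h.pos_A a] with p h5 h6
    simp at h5
    linarith
  simp at h4
  exact IsProbabilityMeasure.ne_zero _ h4

end Positivity

end CausalModel

end PathSpecific

/-! ### Latent means of the outcome bridges and completeness in weak form -/

section General

variable {Ω τ β γ α : Type*} [mΩ : MeasurableSpace Ω] [MeasurableSpace τ] [mβ : MeasurableSpace β]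
  [MeasurableSpace γ] [MeasurableSpace α] {μ : Measure Ω}

lemma CondMeanZero.symm {R R' : Ω → ℝ} {T : Ω → τ} (h : CondMeanZero μ (fun ω => R ω - R' ω) T) :
    CondMeanZero μ (fun ω => R' ω - R ω) T := fun s hs => by
  have := h s hs
  rw [← neg_eq_zero, ← integral_neg] at this
  simpa using this

/-- A positive density makes a law and its dominating measure have the same null sets. -/
lemma ae_comp_iff_of_map_eq_withDensity {T : Ω → τ} (hT : Measurable T) {ν : Measure τ}
    {g : τ → ℝ} (hg : Measurable g) (hg0 : ∀ᵐ t ∂ν, 0 < g t)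
    (h : μ.map T = ν.withDensity fun t => ENNReal.ofReal (g t)) {p : τ → Prop}
    (hp : MeasurableSet {t | p t}) : (∀ᵐ ω ∂μ, p (T ω)) ↔ ∀ᵐ t ∂ν, p t := by
  rw [← ae_map_iff hT.aemeasurable hp, h, ae_withDensity_iff hg.ennreal_ofReal]
  refine ⟨fun h1 => ?_, fun h1 => h1.mono fun t ht _ => ht⟩
  filter_upwards [h1, hg0] with t h2 h3
  exact h2 (by simpa using h3)

/-- If the conditional law depends on the conditioning element through `p` only, then it is also
the conditional law given `p`. -/
lemma ProbabilityTheory.HasCondDistrib.of_comap [IsFiniteMeasure μ] {X : Ω → τ} {Y : Ω → γ}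
    {κ : Kernel α γ} [IsMarkovKernel κ] {p : τ → β} {l : β → α} (hp : Measurable p) (hl : Measurable l)
    (hX : Measurable X) (hY : Measurable Y)
    (h : HasCondDistrib Y X (κ.comap (fun t => l (p t)) (hl.comp hp)) μ) :
    HasCondDistrib Y (fun ω => p (X ω)) (κ.comap l hl) μ :=
  hasCondDistrib_of_lintegral_eq (hp.comp hX) hY fun F hF =>
    h.lintegral_eq hX hY (F := fun q => F (p q.1, q.2)) (by fun_prop)

end General

namespace PathSpecific.CausalModel

variable {Ω 𝒰 𝒟 ℳ 𝒲 𝒵 𝒳 : Type*} [mΩ : MeasurableSpace Ω] [MeasurableSpace 𝒰]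
  [MeasurableSpace 𝒟] [MeasurableSpace ℳ] [MeasurableSpace 𝒲] [MeasurableSpace 𝒵]
  [MeasurableSpace 𝒳]

variable {C : CausalModel Ω 𝒰 𝒟 ℳ 𝒲 𝒵 𝒳} {P : Measure Ω} [IsProbabilityMeasure P]
  {f : Densities 𝒰 𝒟 ℳ 𝒳}

/-! The observed arguments of the bridge functions, as functions on the causal model. -/

abbrev WMDX (C : CausalModel Ω 𝒰 𝒟 ℳ 𝒲 𝒵 𝒳) (ω : Ω) : 𝒲 × ℳ × 𝒟 × 𝒳 :=
  (C.W ω, C.M ω, C.D ω, C.X ω)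
abbrev WDX (C : CausalModel Ω 𝒰 𝒟 ℳ 𝒲 𝒵 𝒳) (ω : Ω) : 𝒲 × 𝒟 × 𝒳 := (C.W ω, C.D ω, C.X ω)
abbrev WX (C : CausalModel Ω 𝒰 𝒟 ℳ 𝒲 𝒵 𝒳) (ω : Ω) : 𝒲 × 𝒳 := (C.W ω, C.X ω)
abbrev ZMDX (C : CausalModel Ω 𝒰 𝒟 ℳ 𝒲 𝒵 𝒳) (ω : Ω) : 𝒵 × ℳ × 𝒟 × 𝒳 :=
  (C.Z ω, C.M ω, C.D ω, C.X ω)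
abbrev ZDX (C : CausalModel Ω 𝒰 𝒟 ℳ 𝒲 𝒵 𝒳) (ω : Ω) : 𝒵 × 𝒟 × 𝒳 := (C.Z ω, C.D ω, C.X ω)
abbrev ZX (C : CausalModel Ω 𝒰 𝒟 ℳ 𝒲 𝒵 𝒳) (ω : Ω) : 𝒵 × 𝒳 := (C.Z ω, C.X ω)

/-- The condition on the right does not involve the arm, so almost sure statements about $(U,X,D,M)$
can be carried from one arm to the other. -/
lemma Positivity.ae_UXDM (h : C.Positivity P f) (a : Bool) {p : ((𝒰 × 𝒳) × 𝒟) × ℳ → Prop}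
    (hp : MeasurableSet {t | p t}) : (∀ᵐ ω ∂(C.on P a), p (C.UXDM ω)) ↔
      ∀ᵐ t ∂(((P.map C.UX).prod f.muD).prod f.muM), p t :=
  ae_comp_iff_of_map_eq_withDensity (by fun_prop) (f.measurable_den2 a)
    ((h.pos2 a).mono fun _ h => mul_pos (mul_pos h.1 h.2.1) h.2.2) (h.map_UXDM a) hp

lemma Positivity.ae_UX (h : C.Positivity P f) (a : Bool) {p : 𝒰 × 𝒳 → Prop}
    (hp : MeasurableSet {t | p t}) : (∀ᵐ ω ∂(C.on P a), p (C.UX ω)) ↔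
      ∀ᵐ t ∂(P.map C.UX), p t :=
  ae_comp_iff_of_map_eq_withDensity (by fun_prop) (f.e_meas a) (h.pos_A a) (h.dens_A a) hp

namespace ProxyKernels

variable {κW : Kernel (𝒰 × 𝒳) 𝒲} {κZ : Bool → Kernel (𝒰 × 𝒳) 𝒵}

lemma W_UXDM (h : C.ProxyKernels P κW κZ) (a : Bool) :
    HasCondDistrib C.W C.UXDM (κW.comap (fun t => t.1.1) (by fun_prop)) (C.on P a) := by
  have := h.markovW
  exact ProbabilityTheory.HasCondDistrib.of_comap (κ := κW)
    (p := fun t : (𝒰 × 𝒳) × (𝒟 × ℳ × 𝒵) => ((t.1, t.2.1), t.2.2.1))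
    (l := fun t => t.1.1) (by fun_prop) (by fun_prop) (by fun_prop) (by fun_prop) (h.W a)

lemma W_UXD (h : C.ProxyKernels P κW κZ) (a : Bool) :
    HasCondDistrib C.W C.UXD (κW.comap (fun t => t.1) (by fun_prop)) (C.on P a) := by
  have := h.markovW
  exact ProbabilityTheory.HasCondDistrib.of_comap (κ := κW)
    (p := fun t : ((𝒰 × 𝒳) × 𝒟) × ℳ => t.1)
    (l := fun t => t.1) (by fun_prop) (by fun_prop) (by fun_prop) (by fun_prop) (h.W_UXDM a)

lemma W_UX (h : C.ProxyKernels P κW κZ) (a : Bool) :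
    HasCondDistrib C.W C.UX κW (C.on P a) := by
  have := h.markovW
  exact ProbabilityTheory.HasCondDistrib.of_comap (κ := κW)
    (p := fun t : (𝒰 × 𝒳) × 𝒟 => t.1)
    (l := fun t => t) (by fun_prop) (by fun_prop) (by fun_prop) (by fun_prop) (h.W_UXD a)

variable (κW)

/-- The conditional mean of `h₂(W,M,D,X)` given the latent variables. -/
noncomputable def _root_.PathSpecific.eta2 (h2 : 𝒲 × ℳ × 𝒟 × 𝒳 → ℝ) (p : ((𝒰 × 𝒳) × 𝒟) × ℳ) : ℝ :=
  ∫ w, h2 (w, p.2, p.1.2, p.1.1.2) ∂(κW p.1.1)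

/-- The conditional mean of `h₁(W,D,X)` given the latent variables. -/
noncomputable def _root_.PathSpecific.eta1 (h1 : 𝒲 × 𝒟 × 𝒳 → ℝ) (p : (𝒰 × 𝒳) × 𝒟) : ℝ :=
  ∫ w, h1 (w, p.2, p.1.2) ∂(κW p.1)

/-- The conditional mean of `h₀(W,X)` given the latent variables. -/
noncomputable def _root_.PathSpecific.eta0 (h0 : 𝒲 × 𝒳 → ℝ) (p : 𝒰 × 𝒳) : ℝ :=
  ∫ w, h0 (w, p.2) ∂(κW p)

variable {κW} {h2 : 𝒲 × ℳ × 𝒟 × 𝒳 → ℝ} {h1 : 𝒲 × 𝒟 × 𝒳 → ℝ} {h0 : 𝒲 × 𝒳 → ℝ}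

lemma _root_.PathSpecific.measurable_eta2 [IsMarkovKernel κW] (hh : Measurable h2) :
    Measurable (eta2 κW h2) := by
  have : Measurable fun p : (((𝒰 × 𝒳) × 𝒟) × ℳ) × 𝒲 => h2 (p.2, p.1.2, p.1.1.2, p.1.1.1.2) :=
    hh.comp (by fun_prop)
  exact (StronglyMeasurable.integral_kernel_prod_right' (κ := κW.comap
    (fun t : ((𝒰 × 𝒳) × 𝒟) × ℳ => t.1.1) (by fun_prop)) this.stronglyMeasurable).measurable

lemma _root_.PathSpecific.measurable_eta1 [IsMarkovKernel κW] (hh : Measurable h1) :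
    Measurable (eta1 κW h1) := by
  have : Measurable fun p : ((𝒰 × 𝒳) × 𝒟) × 𝒲 => h1 (p.2, p.1.2, p.1.1.2) :=
    hh.comp (by fun_prop)
  exact (StronglyMeasurable.integral_kernel_prod_right' (κ := κW.comap
    (fun t : (𝒰 × 𝒳) × 𝒟 => t.1) (by fun_prop)) this.stronglyMeasurable).measurable

lemma _root_.PathSpecific.measurable_eta0 [IsMarkovKernel κW] (hh : Measurable h0) :
    Measurable (eta0 κW h0) := by
  have : Measurable fun p : (𝒰 × 𝒳) × 𝒲 => h0 (p.2, p.1.2) := hh.comp (by fun_prop)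
  exact (StronglyMeasurable.integral_kernel_prod_right' (κ := κW) this.stronglyMeasurable).measurable

/-- Given $(U,X,D,M)$ and the arm, $W$ follows the kernel $\kappa_W(U,X)$; Jensen's inequality gives
square-integrability. The residual has mean zero given all of $(U,X,D,M)$, a statement that can be
coarsened later; the same holds for `eta1_spec` and `eta0_spec`. -/
lemma eta2_spec (h : C.ProxyKernels P κW κZ) (a : Bool) (hh : Measurable h2)
    (h2i : MemLp (fun ω => h2 (C.WMDX ω)) 2 (C.on P a)) :
    MemLp (fun ω => eta2 κW h2 (C.UXDM ω)) 2 (C.on P a) ∧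
      CondMeanZero (C.on P a) (fun ω => h2 (C.WMDX ω) - eta2 κW h2 (C.UXDM ω)) C.UXDM := by
  have := h.markovW
  have hm : Measurable fun p : (((𝒰 × 𝒳) × 𝒟) × ℳ) × 𝒲 => h2 (p.2, p.1.2, p.1.1.2, p.1.1.1.2) :=
    hh.comp (by fun_prop)
  exact ⟨(h.W_UXDM a).memLp_two_kernel (by fun_prop) (by fun_prop) hm h2i,
    (h.W_UXDM a).condMeanZero (by fun_prop) (by fun_prop) hm (h2i.integrable one_le_two)⟩

lemma eta1_spec (h : C.ProxyKernels P κW κZ) (a : Bool) (hh : Measurable h1)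
    (h1i : MemLp (fun ω => h1 (C.WDX ω)) 2 (C.on P a)) :
    MemLp (fun ω => eta1 κW h1 (C.UXD ω)) 2 (C.on P a) ∧
      CondMeanZero (C.on P a) (fun ω => h1 (C.WDX ω) - eta1 κW h1 (C.UXD ω)) C.UXDM := by
  have := h.markovW
  have hm : Measurable fun p : (((𝒰 × 𝒳) × 𝒟) × ℳ) × 𝒲 => h1 (p.2, p.1.1.2, p.1.1.1.2) :=
    hh.comp (by fun_prop)
  exact ⟨(h.W_UXDM a).memLp_two_kernel (by fun_prop) (by fun_prop) hm h1i,
    (h.W_UXDM a).condMeanZero (by fun_prop) (by fun_prop) hm (h1i.integrable one_le_two)⟩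

lemma eta0_spec (h : C.ProxyKernels P κW κZ) (a : Bool) (hh : Measurable h0)
    (h0i : MemLp (fun ω => h0 (C.WX ω)) 2 (C.on P a)) :
    MemLp (fun ω => eta0 κW h0 (C.UX ω)) 2 (C.on P a) ∧
      CondMeanZero (C.on P a) (fun ω => h0 (C.WX ω) - eta0 κW h0 (C.UX ω)) C.UXDM := by
  have := h.markovW
  have hm : Measurable fun p : (((𝒰 × 𝒳) × 𝒟) × ℳ) × 𝒲 => h0 (p.2, p.1.1.1.2) :=
    hh.comp (by fun_prop)
  exact ⟨(h.W_UXDM a).memLp_two_kernel (by fun_prop) (by fun_prop) hm h0i,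
    (h.W_UXDM a).condMeanZero (by fun_prop) (by fun_prop) hm (h0i.integrable one_le_two)⟩

/-- The mean of `h₀(W,X)` in the whole population. -/
lemma integral_eta0 (h : C.ProxyKernels P κW κZ) (hh : Measurable h0)
    (h0i : Integrable (fun ω => h0 (C.WX ω)) P) :
    ∫ ω, h0 (C.WX ω) ∂P = ∫ ω, eta0 κW h0 (C.UX ω) ∂P := by
  have := h.markovW
  have hm : Measurable fun p : (𝒰 × 𝒳) × 𝒲 => h0 (p.2, p.1.2) := hh.comp (by fun_prop)
  exact (h.W₀.integrable_kernel (by fun_prop) (by fun_prop) hm h0i).2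

/-! Completeness in weak form. -/

lemma completeZ1 (h : C.ProxyKernels P κW κZ) (hpos : C.Positivity P f) (hc : C.CompleteZ1 P)
    {r : (𝒰 × 𝒳) × (𝒲 × 𝒟 × ℳ × ℝ) → ℝ} (hr : Measurable r)
    (hr2 : MemLp (fun ω => r (C.core ω)) 2 (C.on P true))
    (hr0 : CondMeanZero (C.on P true) (fun ω => r (C.core ω)) C.ZMDX) :
    CondMeanZero (C.on P true) (fun ω => r (C.core ω)) C.UXDM := by
  have := h.markovZ
  -- The map $b$ keeps the observed part $(M,D,X)$ of the latent vector, so $(Z,b(L))$ is exactly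
  -- the conditioning set of the bridge equation. The residual itself may involve $W$ and $Y$, since
  -- $Z$ is independent of the whole core given $A,U,X$.
  refine condMeanZero_of_complete (κ := (κZ true).comap (fun t => t.1.1) (by fun_prop))
    (Z := C.Z) (R₀ := C.core) (l := fun t => ((t.1, t.2.2.1), t.2.2.2.1))
    (b := fun t : ((𝒰 × 𝒳) × 𝒟) × ℳ => (t.2, t.1.2, t.1.1.2))
    (by fun_prop) (by fun_prop) (by fun_prop) (by fun_prop) (h.Z true) ?_ hr hr2 hr0
  intro g hg hg2 hg0
  have hi := hg2.integrable one_le_two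
  have h1 := hc (fun t => g (((t.1, t.2.2.2), t.2.2.1), t.2.1)) (by fun_prop)
    ((memLp_cond_iff (hpos.ne_zero true)).2 hg2) (by
      have := (cond_condExp_ae_eq_iff (μ := P) (E := {ω | C.A ω = true}) (T := C.ZMDX) (by fun_prop) hi
        (integrable_zero Ω ℝ _)).2 (by simpa using hg0)
      rw [condExp_zero] at this
      exact this)
  exact ae_cond_iff.1 h1

lemma completeZ2 (h : C.ProxyKernels P κW κZ) (hpos : C.Positivity P f) (hc : C.CompleteZ2 P)
    {r : (𝒰 × 𝒳) × (𝒲 × 𝒟 × ℳ × ℝ) → ℝ} (hr : Measurable r)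
    (hr2 : MemLp (fun ω => r (C.core ω)) 2 (C.on P false))
    (hr0 : CondMeanZero (C.on P false) (fun ω => r (C.core ω)) C.ZDX) :
    CondMeanZero (C.on P false) (fun ω => r (C.core ω)) C.UXD := by
  have := h.markovZ
  refine condMeanZero_of_complete (κ := (κZ false).comap (fun t => t.1) (by fun_prop))
    (Z := C.Z) (R₀ := C.core) (l := fun t => (t.1, t.2.2.1))
    (b := fun t : (𝒰 × 𝒳) × 𝒟 => (t.2, t.1.2))
    (by fun_prop) (by fun_prop) (by fun_prop) (by fun_prop) (h.Z false) ?_ hr hr2 hr0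
  intro g hg hg2 hg0
  have hi := hg2.integrable one_le_two
  have h1 := hc (fun t => g ((t.1, t.2.2), t.2.1)) (by fun_prop)
    ((memLp_cond_iff (hpos.ne_zero false)).2 hg2) (by
      have := (cond_condExp_ae_eq_iff (μ := P) (E := {ω | C.A ω = false}) (T := C.ZDX) (by fun_prop) hi
        (integrable_zero Ω ℝ _)).2 (by simpa using hg0)
      rw [condExp_zero] at this
      exact this)
  exact ae_cond_iff.1 h1

lemma completeZ3 (h : C.ProxyKernels P κW κZ) (hpos : C.Positivity P f) (hc : C.CompleteZ3 P)
    {r : (𝒰 × 𝒳) × (𝒲 × 𝒟 × ℳ × ℝ) → ℝ} (hr : Measurable r)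
    (hr2 : MemLp (fun ω => r (C.core ω)) 2 (C.on P true))
    (hr0 : CondMeanZero (C.on P true) (fun ω => r (C.core ω)) C.ZX) :
    CondMeanZero (C.on P true) (fun ω => r (C.core ω)) C.UX := by
  have := h.markovZ
  refine condMeanZero_of_complete (κ := κZ true)
    (Z := C.Z) (R₀ := C.core) (l := fun t => t.1) (b := fun t : 𝒰 × 𝒳 => t.2)
    (by fun_prop) (by fun_prop) (by fun_prop) (by fun_prop) (h.Z true) ?_ hr hr2 hr0
  intro g hg hg2 hg0
  have hi := hg2.integrable one_le_two
  have h1 := hc g hg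
    ((memLp_cond_iff (hpos.ne_zero true)).2 hg2) (by
      have := (cond_condExp_ae_eq_iff (μ := P) (E := {ω | C.A ω = true}) (T := C.ZX) (by fun_prop) hi
        (integrable_zero Ω ℝ _)).2 (by simpa using hg0)
      rw [condExp_zero] at this
      exact this)
  exact ae_cond_iff.1 h1

end ProxyKernels

lemma CompleteW1.ae_eq_zero (hc : C.CompleteW1 P) (hpos : C.Positivity P f) {g : 𝒰 × 𝒳 → ℝ}
    (hg : Measurable g) (hg2 : MemLp (fun ω => g (C.UX ω)) 2 (C.on P true))
    (hg0 : CondMeanZero (C.on P true) (fun ω => g (C.UX ω)) C.WX) :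
    (fun ω => g (C.UX ω)) =ᵐ[C.on P true] 0 := by
  have hi := hg2.integrable one_le_two
  have h1 := hc g hg ((memLp_cond_iff (hpos.ne_zero true)).2 hg2) (by
      have := (cond_condExp_ae_eq_iff (μ := P) (E := {ω | C.A ω = true}) (T := C.WX) (by fun_prop) hi
        (integrable_zero Ω ℝ _)).2 (by simpa using hg0)
      rw [condExp_zero] at this
      exact this)
  exact ae_cond_iff.1 h1

lemma CompleteW2.ae_eq_zero (hc : C.CompleteW2 P) (hpos : C.Positivity P f) {g : (𝒰 × 𝒳) × 𝒟 → ℝ}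
    (hg : Measurable g) (hg2 : MemLp (fun ω => g (C.UXD ω)) 2 (C.on P false))
    (hg0 : CondMeanZero (C.on P false) (fun ω => g (C.UXD ω)) C.WDX) :
    (fun ω => g (C.UXD ω)) =ᵐ[C.on P false] 0 := by
  have hi := hg2.integrable one_le_two
  have h1 := hc (fun t => g ((t.1, t.2.2), t.2.1)) (by fun_prop)
    ((memLp_cond_iff (hpos.ne_zero false)).2 hg2) (by
      have := (cond_condExp_ae_eq_iff (μ := P) (E := {ω | C.A ω = false}) (T := C.WDX) (by fun_prop) hi
        (integrable_zero Ω ℝ _)).2 (by simpa using hg0)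
      rw [condExp_zero] at this
      exact this)
  exact ae_cond_iff.1 h1

/-- A function of `(W,M,D,X)` vanishing on one arm vanishes. -/
lemma ProxyKernels.ae_of_ae_arm {κW : Kernel (𝒰 × 𝒳) 𝒲} {κZ : Bool → Kernel (𝒰 × 𝒳) 𝒵}
    (h : C.ProxyKernels P κW κZ) (hpos : C.Positivity P f) (a : Bool)
    {p : 𝒲 × ℳ × 𝒟 × 𝒳 → Prop} (hp : MeasurableSet {t | p t})
    (h0 : ∀ᵐ ω ∂(C.on P a), p (C.WMDX ω)) : ∀ᵐ ω ∂P, p (C.WMDX ω) := by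
  have := h.markovW
  let F : (((𝒰 × 𝒳) × 𝒟) × ℳ) × 𝒲 → ℝ≥0∞ := fun q =>
    {t | p t}ᶜ.indicator 1 (q.2, q.1.2, q.1.1.2, q.1.1.1.2)
  have hF : Measurable F := (measurable_one.indicator hp.compl).comp (by fun_prop)
  -- The law of $W$ given the latent variables is the same in both arms and their laws are
  -- equivalent. The criterion on the right is therefore free of $b$.
  have hint : ∀ b, (∀ᵐ ω ∂(C.on P b), p (C.WMDX ω)) ↔
      ∀ᵐ t ∂(((P.map C.UX).prod f.muD).prod f.muM), ∫⁻ w, F (t, w) ∂(κW t.1.1) = 0 := fun b => by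
    have hm : Measurable fun t => ∫⁻ w, F (t, w) ∂(κW t.1.1) := by
      have := Measurable.lintegral_kernel_prod_right' (κ := κW.comap
        (fun t : ((𝒰 × 𝒳) × 𝒟) × ℳ => t.1.1) (by fun_prop)) hF
      exact this
    rw [← hpos.ae_UXDM b (measurableSet_eq_fun hm measurable_const)]
    have h1 := (h.W_UXDM b).lintegral_eq (by fun_prop) (by fun_prop) hF
    have h2 : (∀ᵐ ω ∂(C.on P b), p (C.WMDX ω)) ↔ ∫⁻ ω, F (C.UXDM ω, C.W ω) ∂(C.on P b) = 0 := by
      have hFm : Measurable fun ω => F (C.UXDM ω, C.W ω) := hF.comp (by fun_prop)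
      rw [lintegral_eq_zero_iff hFm]
      refine ⟨fun h => h.mono fun ω hω => ?_, fun h => h.mono fun ω hω => ?_⟩
      · simp [F, hω]
      · by_contra h3
        simp [F, h3] at hω
    have hm' : Measurable fun ω => ∫⁻ w, F (C.UXDM ω, w) ∂(κW (C.UX ω)) :=
      hm.comp (f := C.UXDM) (by fun_prop)
    rw [h2, h1]
    simp only [Kernel.comap_apply]
    rw [lintegral_eq_zero_iff hm']
    rfl
  have hall : ∀ b, ∀ᵐ ω ∂(C.on P b), p (C.WMDX ω) := fun b => (hint b).2 ((hint a).1 h0)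
  have h3 : ∀ᵐ ω ∂P.restrict ({ω | C.A ω = true} ∪ {ω | C.A ω = false}), p (C.WMDX ω) := by
    rw [ae_restrict_union_iff]
    exact ⟨hall true, hall false⟩
  have h4 : {ω | C.A ω = true} ∪ {ω | C.A ω = false} = Set.univ := by
    ext ω; simp
  rwa [h4, Measure.restrict_univ] at h3

end PathSpecific.CausalModel

/-! ### Completeness of $W$ for functions that also involve $(D,M)$ -/

section General

variable {Ω τ β γ α : Type*} [mΩ : MeasurableSpace Ω] [MeasurableSpace τ] [mβ : MeasurableSpace β]
  [MeasurableSpace γ] [MeasurableSpace α] {μ : Measure Ω} [IsFiniteMeasure μ]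

/-- If `G` has conditional mean zero given the parameter and `T`, then almost all of its sections
have conditional mean zero given `T`. -/
lemma ae_condMeanZero_of_prod [StandardBorelSpace τ] {ν : Measure α} [SigmaFinite ν] {G : α × Ω → ℝ}
    (hG : Integrable G (ν.prod μ)) {T : Ω → τ} (hT : Measurable T)
    (h : ∀ t, MeasurableSet t → ∀ s, MeasurableSet s →
      ∫ p in t ×ˢ (T ⁻¹' s), G p ∂(ν.prod μ) = 0) :
    ∀ᵐ p ∂ν, CondMeanZero μ (fun ω => G (p, ω)) T := by
  have hsec : ∀ s, MeasurableSet s → ∀ᵐ p ∂ν, ∫ ω in T ⁻¹' s, G (p, ω) ∂μ = 0 := fun s hs => by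
    have hGs : Integrable G (ν.prod (μ.restrict (T ⁻¹' s))) := by
      have := hG.restrict (s := Set.univ ×ˢ (T ⁻¹' s))
      rwa [← Measure.prod_restrict, Measure.restrict_univ] at this
    refine hGs.integral_prod_left.ae_eq_zero_of_forall_setIntegral_eq_zero fun t ht _ => ?_
    have h1 := h t ht s hs
    rw [← Measure.prod_restrict, integral_prod] at h1
    · exact h1
    · have := hG.restrict (s := t ×ˢ (T ⁻¹' s))
      rwa [← Measure.prod_restrict] at this
  -- A standard Borel space embeds in the line, where the rational half-lines form a countable
  -- generating $\pi$-system. One null set of sections then serves for all measurable sets.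
  let e := embeddingReal τ
  have he : MeasurableEmbedding e := measurableEmbedding_embeddingReal τ
  have hq : ∀ᵐ p ∂ν, ∀ q : ℚ, ∫ ω in T ⁻¹' (e ⁻¹' Set.Iic (q : ℝ)), G (p, ω) ∂μ = 0 :=
    ae_all_iff.2 fun q => hsec _ (he.measurable measurableSet_Iic)
  filter_upwards [hq, hsec Set.univ MeasurableSet.univ, hG.prod_right_ae] with p h1 h2 h3
  simp only [Set.preimage_univ, Measure.restrict_univ] at h2
  have hm : ∀ s : Set ℝ, MeasurableSet s → MeasurableSet (T ⁻¹' (e ⁻¹' s)) := fun s hs =>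
    hT (he.measurable hs)
  have key : ∀ s : Set ℝ, MeasurableSet s → ∫ ω in T ⁻¹' (e ⁻¹' s), G (p, ω) ∂μ = 0 := by
    intro s hs
    induction s, hs using MeasurableSpace.induction_on_inter Real.borel_eq_generateFrom_Iic_rat
      Real.isPiSystem_Iic_rat with
    | empty => simp
    | basic s hs =>
      simp only [Set.iUnion_singleton_eq_range, Set.mem_range] at hs
      obtain ⟨q, rfl⟩ := hs
      exact h1 q
    | compl s hs ih =>
      have := integral_add_compl (hm s hs) h3
      rw [ih, h2, zero_add] at this
      exact this
    | iUnion f hd hf ih =>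
      simp only [Set.preimage_iUnion]
      rw [integral_iUnion (fun i => hm _ (hf i)) (fun i j hij => ((hd hij).preimage _).preimage _)
        h3.integrableOn]
      simp [ih]
  intro s hs
  have := key _ (he.measurableSet_image' hs)
  rwa [he.injective.preimage_image] at this

end General

namespace PathSpecific.CausalModel

variable {Ω 𝒰 𝒟 ℳ 𝒲 𝒵 𝒳 : Type*} [mΩ : MeasurableSpace Ω] [MeasurableSpace 𝒰]
  [MeasurableSpace 𝒟] [MeasurableSpace ℳ] [MeasurableSpace 𝒲] [MeasurableSpace 𝒵]
  [MeasurableSpace 𝒳]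

variable {C : CausalModel Ω 𝒰 𝒟 ℳ 𝒲 𝒵 𝒳} {P : Measure Ω} [IsProbabilityMeasure P]
  {f : Densities 𝒰 𝒟 ℳ 𝒳} {κW : Kernel (𝒰 × 𝒳) 𝒲} {κZ : Bool → Kernel (𝒰 × 𝒳) 𝒵}

lemma measurePreserving_swapDM (ρ : Measure (𝒰 × 𝒳)) [SFinite ρ] (μD : Measure 𝒟) [SFinite μD]
    (μM : Measure ℳ) [SFinite μM] :
    MeasurePreserving (MeasurableEquiv.prodAssoc.trans MeasurableEquiv.prodComm)
      ((ρ.prod μD).prod μM) ((μD.prod μM).prod ρ) := by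
  refine MeasurePreserving.trans (μb := ρ.prod (μD.prod μM)) ?_ ?_
  · exact ⟨by fun_prop, Measure.prodAssoc_prod⟩
  · exact Measure.measurePreserving_swap

/-- Completeness of `W` given `A = 1, X` extends to functions that also depend on `(D, M)`, under
the boundedness of the density of `(D, M)`. -/
lemma CompleteW1.ae_eq_zero_UXDM [StandardBorelSpace 𝒲] [StandardBorelSpace 𝒳]
    (hc : C.CompleteW1 P) (hpos : C.Positivity P f) (hκ : C.ProxyKernels P κW κZ)
    {K : 𝒟 × ℳ × 𝒳 → ℝ} (hK : Measurable K)
    (hKb : ∀ᵐ p ∂(((P.map C.UX).prod f.muD).prod f.muM),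
      f.fD true p.1 * f.fM true p ≤ K (p.1.2, p.2, p.1.1.2))
    {r : ((𝒰 × 𝒳) × 𝒟) × ℳ → ℝ} (hr : Measurable r)
    (hr2 : MemLp (fun ω => r (C.UXDM ω)) 2 (C.on P true))
    (hr0 : CondMeanZero (C.on P true) (fun ω => r (C.UXDM ω)) C.WMDX) :
    (fun ω => r (C.UXDM ω)) =ᵐ[C.on P true] 0 := by
  have := hκ.markovW
  set ρ := P.map C.UX with hρ
  have : IsProbabilityMeasure ρ := Measure.isProbabilityMeasure_map (by fun_prop)
  set ν := f.muD.prod f.muM with hν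
  set μ := C.on P true with hμ
  have hsw := measurePreserving_swapDM ρ f.muD f.muM
  let J : (𝒟 × ℳ) × (𝒰 × 𝒳) → ((𝒰 × 𝒳) × 𝒟) × ℳ := fun q => ((q.2, q.1.1), q.1.2)
  have hJ : Measurable J := by fun_prop
  have hsw' : ∀ F : ((𝒰 × 𝒳) × 𝒟) × ℳ → ℝ,
      (Integrable F ((ρ.prod f.muD).prod f.muM) ↔ Integrable (fun q => F (J q)) (ν.prod ρ)) ∧
      ∫ t, F t ∂((ρ.prod f.muD).prod f.muM) = ∫ q, F (J q) ∂(ν.prod ρ) := fun F =>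
    ⟨(hsw.integrable_comp_emb (g := fun q => F (J q)) (MeasurableEquiv.measurableEmbedding _)),
      hsw.integral_comp (MeasurableEquiv.measurableEmbedding _) (fun q => F (J q))⟩
  have hae' : ∀ {p : ((𝒰 × 𝒳) × 𝒟) × ℳ → Prop}, (∀ᵐ t ∂((ρ.prod f.muD).prod f.muM), p t) →
      ∀ᵐ q ∂(ν.prod ρ), p (J q) := fun {p} h => by
    have := hsw.symm.quasiMeasurePreserving.ae h
    exact this
  have hden : ∀ F : ((𝒰 × 𝒳) × 𝒟) × ℳ → ℝ, Measurable F →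
      (Integrable (fun ω => F (C.UXDM ω)) μ ↔
        Integrable (fun q => f.den2 true (J q) * F (J q)) (ν.prod ρ)) ∧
      ∫ ω, F (C.UXDM ω) ∂μ = ∫ q, f.den2 true (J q) * F (J q) ∂(ν.prod ρ) := fun F hF => by
    have h1 := integrable_comp_iff_of_map_eq_withDensity (μ := μ) (T := C.UXDM) (by fun_prop)
      (f.measurable_den2 true) (hpos.den2_nonneg true) (hpos.map_UXDM true) hF
    have h2 := hsw' fun t => f.den2 true t * F t
    exact ⟨h1.1.trans h2.1, h1.2.trans h2.2⟩
  have hUX : ∀ F : 𝒰 × 𝒳 → ℝ, Measurable F →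
      (Integrable (fun ω => F (C.UX ω)) μ ↔ Integrable (fun v => f.e true v * F v) ρ) ∧
      ∫ ω, F (C.UX ω) ∂μ = ∫ v, f.e true v * F v ∂ρ := fun F hF =>
    integrable_comp_iff_of_map_eq_withDensity (μ := μ) (T := C.UX) (by fun_prop)
      (f.e_meas true) (hpos.den0_nonneg true) (hpos.dens_A true) hF
  -- The truncation keeps points where the bound on the density is at most $n$. It depends on
  -- $(d,m,x)$ and not on $u$, so it can be moved into an observed test function.
  let I : ℕ → 𝒟 × ℳ × 𝒳 → ℝ := fun n => {y | K y ≤ n}.indicator 1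
  have hI : ∀ n, Measurable (I n) := fun n =>
    measurable_one.indicator (measurableSet_le hK measurable_const)
  have hI1 : ∀ n y, |I n y| ≤ 1 := fun n y => by
    by_cases hy : K y ≤ n <;> simp [I, hy]
  -- For fixed $(d,m)$ the section is $r$ times the conditional density of $(D,M)$. The factor
  -- $P(A=1\mid U,X)$ is left out because the arm-1 law of $(U,X)$ supplies it.
  let G : ℕ → (𝒟 × ℳ) × (𝒰 × 𝒳) → ℝ := fun n q =>
    f.fD true (J q).1 * f.fM true (J q) * r (J q) * I n (q.1.1, q.1.2, q.2.2)
  have hG : ∀ n, Measurable (G n) := fun n => by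
    have h1 : Measurable fun q => f.fD true (J q).1 := (f.fD_meas _).comp (by fun_prop)
    have h2 : Measurable fun q => f.fM true (J q) := (f.fM_meas _).comp (by fun_prop)
    have h3 : Measurable fun q : (𝒟 × ℳ) × (𝒰 × 𝒳) => I n (q.1.1, q.1.2, q.2.2) :=
      (hI n).comp (by fun_prop)
    exact ((h1.mul h2).mul (hr.comp hJ)).mul h3
  have hGe : ∀ n q, f.e true q.2 * G n q = f.den2 true (J q) *
      (I n (q.1.1, q.1.2, q.2.2) * r (J q)) := fun n q => by
    simp only [G, Densities.den2, Densities.den1]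
    ring
  have hri := hr2.integrable one_le_two
  -- integrability of the truncated sections
  have hGi : ∀ n, Integrable (fun q => f.e true q.2 * G n q) (ν.prod ρ) := fun n => by
    have h1 := ((hden r hr).1.1 hri)
    have h2 := h1.bdd_mul (c := 1) (f := fun q : (𝒟 × ℳ) × (𝒰 × 𝒳) => I n (q.1.1, q.1.2, q.2.2))
      ((hI n).comp (by fun_prop)).aestronglyMeasurable (Eventually.of_forall fun q => hI1 n _)
    refine h2.congr (Eventually.of_forall fun q => ?_)
    simp only [hGe]
    ring
  have hGμ : ∀ n, Integrable (fun q : (𝒟 × ℳ) × Ω => G n (q.1, C.UX q.2)) (ν.prod μ) := fun n => by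
    have hm : Measurable fun q : (𝒟 × ℳ) × Ω => G n (q.1, C.UX q.2) := (hG n).comp (by fun_prop)
    rw [integrable_prod_iff hm.aestronglyMeasurable]
    have h1 := (integrable_prod_iff (hGi n).1).1 (hGi n)
    constructor
    · filter_upwards [h1.1] with p hp
      exact (hUX (fun v => G n (p, v)) ((hG n).comp measurable_prodMk_left)).1.2 hp
    · refine h1.2.congr (Eventually.of_forall fun p => ?_)
      have h2 := (hUX (fun v => ‖G n (p, v)‖) ((hG n).comp measurable_prodMk_left).norm).2
      simp only
      rw [h2]
      refine integral_congr_ae ?_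
      filter_upwards [hpos.den0_nonneg true] with v hv
      rw [norm_mul, Real.norm_of_nonneg hv]
  have hcm : ∀ n, ∀ᵐ p ∂ν, CondMeanZero μ (fun ω => G n (p, C.UX ω)) C.WX := fun n => by
    refine ae_condMeanZero_of_prod (hGμ n) (by fun_prop) fun t ht s hs => ?_
    let k1 : 𝒲 × 𝒳 → ℝ := s.indicator 1
    have hk1 : Measurable k1 := measurable_one.indicator hs
    have hk1b : ∀ y, |k1 y| ≤ 1 := fun y => by by_cases hy : y ∈ s <;> simp [k1, hy]
    let k2 : 𝒟 × ℳ → ℝ := t.indicator 1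
    have hk2 : Measurable k2 := measurable_one.indicator ht
    have hk2b : ∀ y, |k2 y| ≤ 1 := fun y => by by_cases hy : y ∈ t <;> simp [k2, hy]
    -- A rectangle in $(d,m)$ and $(w,x)$, together with the truncation, is one bounded function of
    -- $(W,M,D,X)$, so the hypothesis on $r$ can be tested against it.
    let k : 𝒲 × ℳ × 𝒟 × 𝒳 → ℝ := fun y =>
      k2 (y.2.2.1, y.2.1) * I n (y.2.2.1, y.2.1, y.2.2.2) * k1 (y.1, y.2.2.2)
    have hk : Measurable k :=
      ((hk2.comp (by fun_prop)).mul ((hI n).comp (by fun_prop))).mul (hk1.comp (by fun_prop))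
    have hkb : ∀ y, |k y| ≤ 1 := fun y => by
      simp only [k, abs_mul]
      exact mul_le_one₀ (mul_le_one₀ (hk2b _) (abs_nonneg _) (hI1 _ _)) (abs_nonneg _) (hk1b _)
    have hkbar : ∀ q : (𝒟 × ℳ) × (𝒰 × 𝒳), eta2 κW k (J q) =
        k2 q.1 * I n (q.1.1, q.1.2, q.2.2) * eta0 κW k1 q.2 := fun q => by
      simp only [eta2, eta0, k, J, integral_const_mul]
    have hm1 : Measurable (eta0 κW k1) := measurable_eta0 hk1
    have hm2 : Measurable (eta2 κW k) := measurable_eta2 hk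
    have hb1 : ∀ v, ‖eta0 κW k1 v‖ ≤ 1 := fun v => by
      refine (norm_integral_le_of_norm_le_const (C := 1)
        (Eventually.of_forall fun z => hk1b _)).trans ?_
      simp
    have hb2 : ∀ v, ‖eta2 κW k v‖ ≤ 1 := fun v => by
      refine (norm_integral_le_of_norm_le_const (C := 1)
        (Eventually.of_forall fun z => hkb _)).trans ?_
      simp
    have hkL : MemLp (fun ω => k (C.WMDX ω)) 2 μ :=
      MemLp.of_bound (hk.comp (by fun_prop)).aestronglyMeasurable 1 (Eventually.of_forall fun _ => hkb _)
    have h1 : ∫ ω, k (C.WMDX ω) * r (C.UXDM ω) ∂μ = 0 :=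
      hr0.integral_mul (by fun_prop) hri hk (Integrable.bdd_left_mul hri (by fun_prop) hk hkb)
    have h2 : ∫ ω, r (C.UXDM ω) * k (C.WMDX ω) ∂μ = ∫ ω, r (C.UXDM ω) * eta2 κW k (C.UXDM ω) ∂μ := by
      have hs2 := hκ.eta2_spec true hk hkL
      refine hs2.2.integral_mul_congr (by fun_prop) (hkL.integrable one_le_two)
        (hs2.1.integrable one_le_two) hr ?_ ?_
      · exact (Integrable.bdd_left_mul hri (T := C.WMDX) (by fun_prop) hk hkb).congr
          (Eventually.of_forall fun ω => by simp [mul_comm])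
      · refine (hri.bdd_mul (c := 1) (f := fun ω => eta2 κW k (C.UXDM ω))
          (hm2.comp (by fun_prop)).aestronglyMeasurable (Eventually.of_forall fun ω => hb2 _)).congr
          (Eventually.of_forall fun ω => by simp [mul_comm])
    have h3 := (hden (fun t => r t * eta2 κW k t) (hr.mul hm2)).2
    have h4 : ∫ q, k2 q.1 * (f.e true q.2 * (eta0 κW k1 q.2 * G n q)) ∂(ν.prod ρ) = 0 := by
      rw [← h1]
      simp only [mul_comm (k _)]
      rw [h2, h3]
      refine integral_congr_ae (Eventually.of_forall fun q => ?_)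
      simp only [hkbar]
      have := hGe n q
      linear_combination (k2 q.1 * eta0 κW k1 q.2) * this
    have hi4 : Integrable (fun q => k2 q.1 * (f.e true q.2 * (eta0 κW k1 q.2 * G n q))) (ν.prod ρ) := by
      have h5 : Measurable fun q : (𝒟 × ℳ) × (𝒰 × 𝒳) => k2 q.1 * eta0 κW k1 q.2 :=
        (hk2.comp measurable_fst).mul (hm1.comp measurable_snd)
      refine ((hGi n).bdd_mul (c := 1) h5.aestronglyMeasurable
        (Eventually.of_forall fun q => ?_)).congr (Eventually.of_forall fun q => ?_)
      · rw [norm_mul]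
        exact mul_le_one₀ (hk2b _) (norm_nonneg _) (hb1 _)
      · simp only
        ring
    rw [integral_prod _ hi4] at h4
    have h6 : ∫ p in t ×ˢ (C.WX ⁻¹' s), G n (p.1, C.UX p.2) ∂(ν.prod μ) =
        ∫ p, k2 p.1 * (k1 (C.WX p.2) * G n (p.1, C.UX p.2)) ∂(ν.prod μ) := by
      rw [← integral_indicator (ht.prod ((show Measurable C.WX by fun_prop) hs))]
      refine integral_congr_ae (Eventually.of_forall fun q => ?_)
      by_cases hq1 : q.1 ∈ t <;> by_cases hq2 : C.WX q.2 ∈ s <;>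
        simp [k1, k2, Set.indicator, hq1, hq2]
    rw [h6, integral_prod, ← h4]
    · refine integral_congr_ae ?_
      filter_upwards [(hGμ n).prod_right_ae] with p hp
      simp only [integral_const_mul]
      congr 1
      have hGp : Measurable fun v => G n (p, v) := (hG n).comp measurable_prodMk_left
      have hm : Measurable fun y : (𝒰 × 𝒳) × 𝒲 => k1 (y.2, y.1.2) * G n (p, y.1) :=
        (hk1.comp (by fun_prop)).mul (hGp.comp measurable_fst)
      have h7 := ((hκ.W_UX true).integrable_kernel (by fun_prop) (by fun_prop) hm
        (Integrable.bdd_left_mul hp (T := C.WX) (by fun_prop) hk1 hk1b)).2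
      simp only [integral_mul_const] at h7
      exact h7.trans (hUX (fun v => eta0 κW k1 v * G n (p, v)) (hm1.mul hGp)).2
    · have h5 : Measurable fun q : (𝒟 × ℳ) × Ω => k2 q.1 * k1 (C.WX q.2) :=
        (hk2.comp measurable_fst).mul (hk1.comp (by fun_prop))
      refine ((hGμ n).bdd_mul (c := 1) h5.aestronglyMeasurable
        (Eventually.of_forall fun q => ?_)).congr (Eventually.of_forall fun q => ?_)
      · rw [norm_mul]
        exact mul_le_one₀ (hk2b _) (norm_nonneg _) (hk1b _)
      · simp only
        ring
  -- With density $g\le n$ on the truncation set, $g^2r^2\le n\,g r^2$, and the right side has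
  -- integrable sections because $r$ is square-integrable. This is where boundedness in $u$ is used:
  -- completeness concerns square-integrable sections.
  have hsq : ∀ n, ∀ᵐ p ∂ν, MemLp (fun ω => G n (p, C.UX ω)) 2 μ := fun n => by
    have h1 := (hden (fun t => r t ^ 2) (hr.pow_const 2)).1.1 hr2.integrable_sq
    have h2 := h1.prod_right_ae
    have h3 := Measure.ae_ae_of_ae_prod (hae' hKb)
    have h4 := Measure.ae_ae_of_ae_prod (hae' (hpos.pos2 true))
    filter_upwards [h2, h3, h4] with p hp1 hp2 hp3
    have hGp : Measurable fun v => G n (p, v) := (hG n).comp measurable_prodMk_left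
    have hGpm : AEStronglyMeasurable (fun ω => G n (p, C.UX ω)) μ :=
      (hGp.comp (by fun_prop)).aestronglyMeasurable
    rw [memLp_two_iff_integrable_sq hGpm]
    refine (hUX (fun v => G n (p, v) ^ 2) (hGp.pow_const 2)).1.2 ?_
    have h5 : Measurable fun v => f.e true v * G n (p, v) ^ 2 := (f.e_meas true).mul (hGp.pow_const 2)
    refine (hp1.const_mul (n : ℝ)).mono' h5.aestronglyMeasurable ?_
    filter_upwards [hp2, hp3] with v hv1 hv2
    obtain ⟨he, hd, hm⟩ := hv2
    have hA : 0 ≤ f.fD true (J (p, v)).1 * f.fM true (J (p, v)) := (mul_pos hd hm).le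
    have he' : 0 ≤ f.e true v := le_of_lt he
    rw [Real.norm_of_nonneg (mul_nonneg he' (sq_nonneg _))]
    have hden2 : f.den2 true (J (p, v)) =
        f.e true v * (f.fD true (J (p, v)).1 * f.fM true (J (p, v))) := by
      simp only [Densities.den2, Densities.den1, J]
      ring
    rw [hden2]
    by_cases hy : K (p.1, p.2, v.2) ≤ n
    · have : G n (p, v) = f.fD true (J (p, v)).1 * f.fM true (J (p, v)) * r (J (p, v)) := by
        simp [G, I, hy]
      rw [this, mul_pow, sq (f.fD true (J (p, v)).1 * _)]
      have h7 : f.fD true (J (p, v)).1 * f.fM true (J (p, v)) ≤ n := hv1.trans hy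
      have h8 : 0 ≤ f.e true v * (f.fD true (J (p, v)).1 * f.fM true (J (p, v))) * r (J (p, v)) ^ 2 :=
        mul_nonneg (mul_nonneg he' hA) (sq_nonneg _)
      nlinarith [mul_le_mul_of_nonneg_right h7 h8]
    · have : G n (p, v) = 0 := by simp [G, I, hy]
      rw [this]
      simp only [ne_eq, OfNat.ofNat_ne_zero, not_false_eq_true, zero_pow, mul_zero]
      positivity
  have hzero : ∀ n, ∀ᵐ p ∂ν, ∀ᵐ v ∂ρ, G n (p, v) = 0 := fun n => by
    filter_upwards [hsq n, hcm n] with p h1 h2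
    have hGp : Measurable fun v => G n (p, v) := (hG n).comp measurable_prodMk_left
    exact (hpos.ae_UX true (measurableSet_eq_fun hGp measurable_const)).1
      (hc.ae_eq_zero hpos hGp h1 h2)
  have hr' : ∀ᵐ q ∂(ν.prod ρ), r (J q) = 0 := by
    have hms : MeasurableSet {q : (𝒟 × ℳ) × (𝒰 × 𝒳) | r (J q) = 0} :=
      measurableSet_eq_fun (hr.comp hJ) measurable_const
    rw [Measure.ae_prod_iff_ae_ae hms]
    filter_upwards [ae_all_iff.2 hzero, Measure.ae_ae_of_ae_prod (hae' (hpos.pos2 true))] with p h1 h2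
    filter_upwards [ae_all_iff.2 h1, h2] with v h3 h4
    -- At each point some truncation level is inactive; there the section equals $r$ times a
    -- positive density, so $r$ vanishes.
    obtain ⟨n, hn⟩ := exists_nat_ge (K (p.1, p.2, v.2))
    have h5 := h3 n
    have hA : f.fD true (J (p, v)).1 * f.fM true (J (p, v)) ≠ 0 := (mul_pos h4.2.1 h4.2.2).ne'
    simp only [G, I] at h5
    rw [Set.indicator_of_mem (by exact hn)] at h5
    simpa [hA] using h5
  have hr'' : ∀ᵐ t ∂((ρ.prod f.muD).prod f.muM), r t = 0 :=
    hsw.quasiMeasurePreserving.ae hr'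
  exact (hpos.ae_UXDM true (measurableSet_eq_fun hr measurable_const)).2 hr''

end PathSpecific.CausalModel

/-! ### Treatment bridge equations as balance between arms -/

section General

variable {Ω τ β γ α : Type*} [mΩ : MeasurableSpace Ω] [MeasurableSpace τ] [mβ : MeasurableSpace β]
  [MeasurableSpace γ] [MeasurableSpace α] {μ : Measure Ω} [IsFiniteMeasure μ]

/-- `F` on the event `E` and `F'` on the event `E'` have the same integrals over all events
determined by `T`. -/
def CondBalanced (μ : Measure Ω) (E E' : Set Ω) (F F' : Ω → ℝ) (T : Ω → τ) : Prop :=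
  CondMeanZero μ (fun ω => E.indicator F ω - E'.indicator F' ω) T

lemma CondBalanced.symm {E E' : Set Ω} {F F' : Ω → ℝ} {T : Ω → τ} (h : CondBalanced μ E E' F F' T) :
    CondBalanced μ E' E F' F T := CondMeanZero.symm h

lemma CondBalanced.integral_mul {E E' : Set Ω} {F F' : Ω → ℝ} {T : Ω → τ} (h : CondBalanced μ E E' F F' T)
    (hE : MeasurableSet E) (hE' : MeasurableSet E') (hT : Measurable T)
    (hF : IntegrableOn F E μ) (hF' : IntegrableOn F' E' μ) {g : τ → ℝ} (hg : Measurable g)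
    (hgF : IntegrableOn (fun ω => g (T ω) * F ω) E μ)
    (hgF' : IntegrableOn (fun ω => g (T ω) * F' ω) E' μ) :
    ∫ ω in E, g (T ω) * F ω ∂μ = ∫ ω in E', g (T ω) * F' ω ∂μ := by
  have e : ∀ (E : Set Ω) (F : Ω → ℝ), (fun ω => g (T ω) * E.indicator F ω) =
      E.indicator fun ω => g (T ω) * F ω := fun E F => by
    funext ω
    by_cases hω : ω ∈ E <;> simp [hω]
  have h1 := CondMeanZero.integral_mul_congr h hT ((integrable_indicator_iff hE).2 hF)
    ((integrable_indicator_iff hE').2 hF') hg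
    (by rw [e]; exact (integrable_indicator_iff hE).2 hgF)
    (by rw [e]; exact (integrable_indicator_iff hE').2 hgF')
  rwa [e, e, integral_indicator hE, integral_indicator hE'] at h1

/-- A conditional moment equation involving the odds of two events, as a balance equation. -/
lemma balanced_of_odds {E E' : Set Ω} (hE : MeasurableSet E) (hE' : MeasurableSet E')
    {F F' : Ω → ℝ} {T : Ω → τ} (hT : Measurable T)
    (hF : IntegrableOn F E μ) (hF' : IntegrableOn F' E' μ)
    (hac : ∀ s, MeasurableSet s → μ (T ⁻¹' s ∩ E') = 0 → μ (T ⁻¹' s ∩ E) = 0)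
    (h : (fun ω => ((ProbabilityTheory.cond μ E)[F | sigmaOf T]) ω *
        ((μ[E.indicator (fun _ => (1 : ℝ)) | sigmaOf T]) ω /
          (μ[E'.indicator (fun _ => (1 : ℝ)) | sigmaOf T]) ω)) =ᵐ[ProbabilityTheory.cond μ E']
      (ProbabilityTheory.cond μ E')[F' | sigmaOf T]) :
    CondBalanced μ E E' F F' T := by
  set e := (ProbabilityTheory.cond μ E)[F | sigmaOf T] with he
  set e' := (ProbabilityTheory.cond μ E')[F' | sigmaOf T] with he'
  set p := μ[E.indicator (fun _ => (1 : ℝ)) | sigmaOf T] with hp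
  set p' := μ[E'.indicator (fun _ => (1 : ℝ)) | sigmaOf T] with hp'
  -- Conditional expectations under the normalized restriction reproduce set integrals under the
  -- original measure, since the normalizing constant cancels. For a null event both integrals are
  -- zero.
  have hcond : ∀ {G : Set Ω} {R : Ω → ℝ}, MeasurableSet G → IntegrableOn R G μ →
      IntegrableOn ((ProbabilityTheory.cond μ G)[R | sigmaOf T]) G μ ∧
      ∀ s, MeasurableSet s → ∫ ω in T ⁻¹' s ∩ G, R ω ∂μ =
        ∫ ω in T ⁻¹' s ∩ G, ((ProbabilityTheory.cond μ G)[R | sigmaOf T]) ω ∂μ := by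
    intro G R hG hR
    by_cases h0 : μ G = 0
    · have hr : μ.restrict G = 0 := Measure.restrict_eq_zero.2 h0
      refine ⟨by rw [IntegrableOn, hr]; exact integrable_zero_measure, fun s hs => ?_⟩
      have h1 : μ.restrict (T ⁻¹' s ∩ G) = 0 :=
        Measure.restrict_eq_zero.2 (measure_mono_null Set.inter_subset_right h0)
      rw [h1]
      simp
    have hct : (μ G)⁻¹ ≠ ∞ := by simp [h0]
    have hR' : Integrable R (ProbabilityTheory.cond μ G) := hR.smul_measure hct
    have hi : IntegrableOn ((ProbabilityTheory.cond μ G)[R | sigmaOf T]) G μ := by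
      have := (integrable_condExp (μ := ProbabilityTheory.cond μ G) (f := R)
        (m := sigmaOf T)).smul_measure (c := μ G) (measure_ne_top _ _)
      rw [ProbabilityTheory.cond, smul_smul, ENNReal.mul_inv_cancel h0 (measure_ne_top _ _),
        one_smul] at this
      exact this
    refine ⟨hi, fun s hs => ?_⟩
    have : IsProbabilityMeasure (ProbabilityTheory.cond μ G) := cond_isProbabilityMeasure h0
    have h1 := setIntegral_condExp hT.comap_le hR' (s := T ⁻¹' s) ⟨s, hs, rfl⟩
    rw [ProbabilityTheory.cond, Measure.restrict_smul, integral_smul_measure, integral_smul_measure,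
      Measure.restrict_restrict (hT hs)] at h1
    have hc : (μ G)⁻¹.toReal ≠ 0 := (ENNReal.toReal_pos (by simp) hct).ne'
    rw [smul_eq_mul, smul_eq_mul] at h1
    exact (mul_left_cancel₀ hc h1).symm
  obtain ⟨hei, hes⟩ := hcond hE hF
  obtain ⟨hei', hes'⟩ := hcond hE' hF'
  have hae : ∀ᵐ ω ∂(μ.restrict E'), e ω * (p ω / p' ω) = e' ω := ae_cond_iff.1 h
  have hem : StronglyMeasurable[sigmaOf T] e := stronglyMeasurable_condExp
  have hpm : StronglyMeasurable[sigmaOf T] p := stronglyMeasurable_condExp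
  have hpm' : StronglyMeasurable[sigmaOf T] p' := stronglyMeasurable_condExp
  have hind : ∀ {G : Set Ω}, MeasurableSet G → Integrable (G.indicator fun _ => (1 : ℝ)) μ :=
    fun hG => (integrable_const 1).indicator hG
  have hprod : ∀ {G : Set Ω} {R : Ω → ℝ}, MeasurableSet G → StronglyMeasurable[sigmaOf T] R →
      IntegrableOn R G μ → ∀ s, MeasurableSet s →
      ∫ ω in T ⁻¹' s ∩ G, R ω ∂μ =
        ∫ ω in T ⁻¹' s, R ω * (μ[G.indicator (fun _ => (1 : ℝ)) | sigmaOf T]) ω ∂μ := by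
    intro G R hG hRm hR s hs
    have e1 : (R * G.indicator fun _ => (1 : ℝ)) = G.indicator R := by
      funext ω; by_cases hω : ω ∈ G <;> simp [hω]
    have hRi : Integrable (R * G.indicator fun _ => (1 : ℝ)) μ := by
      rw [e1]; exact (integrable_indicator_iff hG).2 hR
    have h1 : μ[R * G.indicator (fun _ => (1 : ℝ)) | sigmaOf T] =ᵐ[μ]
        R * μ[G.indicator (fun _ => (1 : ℝ)) | sigmaOf T] :=
      condExp_mul_of_stronglyMeasurable_left hRm hRi (hind hG)
    have h2 := setIntegral_condExp hT.comap_le hRi (s := T ⁻¹' s) ⟨s, hs, rfl⟩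
    rw [e1, integral_indicator hG, Measure.restrict_restrict hG, Set.inter_comm] at h2
    rw [← h2, ← e1]
    exact integral_congr_ae (ae_restrict_of_ae h1)
  -- Where $p'=0$ the event $E'$ has no mass, so by the absolute continuity assumption neither has
  -- $E$. Thus division by zero in the odds is not seen from $E$.
  have hposE : ∀ᵐ ω ∂(μ.restrict E), p' ω ≠ 0 := by
    obtain ⟨s, hs, hs'⟩ : ∃ s, MeasurableSet s ∧ T ⁻¹' s = {ω | p' ω = 0} :=
      hpm'.measurable (measurableSet_singleton 0)
    have h1 : ∫ ω in T ⁻¹' s ∩ E', (1 : ℝ) ∂μ = 0 := by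
      rw [hprod hE' stronglyMeasurable_const (integrableOn_const (measure_ne_top _ _)) s hs]
      refine (setIntegral_congr_fun (g := fun _ => (0 : ℝ)) (hT hs) fun ω hω => ?_).trans (by simp)
      rw [hs'] at hω
      have : p' ω = 0 := hω
      simp only [one_mul]
      exact this
    rw [setIntegral_const, smul_eq_mul, mul_one, measureReal_eq_zero_iff] at h1
    have h2 := hac s hs h1
    rw [hs'] at h2
    rw [ae_iff, Measure.restrict_apply' hE]
    simpa using h2
  have hei'' : IntegrableOn (fun ω => e ω * (p ω / p' ω)) E' μ := hei'.congr (hae.mono fun _ h => h.symm)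
  intro s hs
  have hi1 := (integrable_indicator_iff hE).2 hF
  have hi2 := (integrable_indicator_iff hE').2 hF'
  rw [integral_sub hi1.integrableOn hi2.integrableOn, sub_eq_zero, integral_indicator hE,
    integral_indicator hE', Measure.restrict_restrict hE, Measure.restrict_restrict hE',
    Set.inter_comm, Set.inter_comm E', hes s hs, hes' s hs]
  have h1 : ∫ ω in T ⁻¹' s ∩ E', e' ω ∂μ = ∫ ω in T ⁻¹' s ∩ E', e ω * (p ω / p' ω) ∂μ := by
    rw [← Measure.restrict_restrict (hT hs)]
    exact integral_congr_ae (ae_restrict_of_ae (hae.mono fun _ h => h.symm))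
  have hrm : StronglyMeasurable[sigmaOf T] fun ω => e ω * (p ω / p' ω) :=
    (hem.measurable.mul (hpm.measurable.div hpm'.measurable)).stronglyMeasurable
  rw [h1, hprod hE' hrm hei'' s hs]
  -- on `E` the odds cancel
  set N : Set Ω := {ω | p' ω ≠ 0} with hN
  have hNm : MeasurableSet[sigmaOf T] N := (hpm'.measurable (measurableSet_singleton 0)).compl
  have hind2 : StronglyMeasurable[sigmaOf T] (N.indicator e) := hem.indicator hNm
  have h2 : ∫ ω in T ⁻¹' s ∩ E, e ω ∂μ = ∫ ω in T ⁻¹' s ∩ E, N.indicator e ω ∂μ := by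
    rw [← Measure.restrict_restrict (hT hs)]
    refine integral_congr_ae (ae_restrict_of_ae (hposE.mono fun ω hω => ?_))
    simp [hN, hω]
  rw [h2, hprod hE hind2 (hei.indicator (hT.comap_le _ hNm)) s hs]
  refine integral_congr_ae (Eventually.of_forall fun ω => ?_)
  by_cases hω : p' ω = 0
  · have h3 : (μ[E'.indicator (fun _ => (1 : ℝ)) | sigmaOf T]) ω = 0 := hω
    simp [hN, hω, h3]
  · simp only [hN, Set.indicator, Set.mem_ofPred_eq, ne_eq, hω, not_false_eq_true, if_true]
    change e ω * p ω = e ω * (p ω / p' ω) * p' ω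
    field_simp

end General

namespace PathSpecific.CausalModel

variable {Ω 𝒰 𝒟 ℳ 𝒲 𝒵 𝒳 : Type*} [mΩ : MeasurableSpace Ω] [MeasurableSpace 𝒰]
  [MeasurableSpace 𝒟] [MeasurableSpace ℳ] [MeasurableSpace 𝒲] [MeasurableSpace 𝒵]
  [MeasurableSpace 𝒳]

variable {C : CausalModel Ω 𝒰 𝒟 ℳ 𝒲 𝒵 𝒳} {P : Measure Ω} [IsProbabilityMeasure P]
  {f : Densities 𝒰 𝒟 ℳ 𝒳} {κW : Kernel (𝒰 × 𝒳) 𝒲} {κZ : Bool → Kernel (𝒰 × 𝒳) 𝒵}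

lemma integrable_mul_of_bdd {μ : Measure Ω} {R k : Ω → ℝ} (hR : Integrable R μ) (hk : Measurable k)
    (hk1 : ∀ ω, |k ω| ≤ 1) : Integrable (fun ω => k ω * R ω) μ :=
  hR.bdd_mul (c := 1) hk.aestronglyMeasurable (Eventually.of_forall hk1)

lemma memLp_of_bdd {μ : Measure Ω} [IsFiniteMeasure μ] {k : Ω → ℝ} (hk : Measurable k)
    (hk1 : ∀ ω, |k ω| ≤ 1) : MemLp k 2 μ :=
  .of_bound hk.aestronglyMeasurable 1 (Eventually.of_forall hk1)

namespace ProxyKernels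

variable {q2 : 𝒵 × ℳ × 𝒟 × 𝒳 → ℝ} {q1 : 𝒵 × 𝒟 × 𝒳 → ℝ} {q0 : 𝒵 × 𝒳 → ℝ}

/-- The averaging operators `eta2`, `eta1`, `eta0` are reused with the law of $Z$ in place of that
of $W$. The residual has mean zero given the whole core, so it can be tested against functions of
$W$ and of $Y$. -/
lemma qbar2_spec (h : C.ProxyKernels P κW κZ) (a : Bool) (hq : Measurable q2)
    (hi : MemLp (fun ω => q2 (C.ZMDX ω)) 2 (C.on P a)) :
    Measurable (eta2 (κZ a) q2) ∧ MemLp (fun ω => eta2 (κZ a) q2 (C.UXDM ω)) 2 (C.on P a) ∧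
      CondMeanZero (C.on P a) (fun ω => q2 (C.ZMDX ω) - eta2 (κZ a) q2 (C.UXDM ω)) C.core := by
  have := h.markovZ
  have hm : Measurable fun p : ((𝒰 × 𝒳) × (𝒲 × 𝒟 × ℳ × ℝ)) × 𝒵 =>
    q2 (p.2, p.1.2.2.2.1, p.1.2.2.1, p.1.1.2) := hq.comp (by fun_prop)
  exact ⟨measurable_eta2 hq, (h.Z a).memLp_two_kernel (by fun_prop) (by fun_prop) hm hi,
    (h.Z a).condMeanZero (by fun_prop) (by fun_prop) hm (hi.integrable one_le_two)⟩

lemma qbar1_spec (h : C.ProxyKernels P κW κZ) (a : Bool) (hq : Measurable q1)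
    (hi : MemLp (fun ω => q1 (C.ZDX ω)) 2 (C.on P a)) :
    Measurable (eta1 (κZ a) q1) ∧ MemLp (fun ω => eta1 (κZ a) q1 (C.UXD ω)) 2 (C.on P a) ∧
      CondMeanZero (C.on P a) (fun ω => q1 (C.ZDX ω) - eta1 (κZ a) q1 (C.UXD ω)) C.core := by
  have := h.markovZ
  have hm : Measurable fun p : ((𝒰 × 𝒳) × (𝒲 × 𝒟 × ℳ × ℝ)) × 𝒵 =>
    q1 (p.2, p.1.2.2.1, p.1.1.2) := hq.comp (by fun_prop)
  exact ⟨measurable_eta1 hq, (h.Z a).memLp_two_kernel (by fun_prop) (by fun_prop) hm hi,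
    (h.Z a).condMeanZero (by fun_prop) (by fun_prop) hm (hi.integrable one_le_two)⟩

lemma qbar0_spec (h : C.ProxyKernels P κW κZ) (a : Bool) (hq : Measurable q0)
    (hi : MemLp (fun ω => q0 (C.ZX ω)) 2 (C.on P a)) :
    Measurable (eta0 (κZ a) q0) ∧ MemLp (fun ω => eta0 (κZ a) q0 (C.UX ω)) 2 (C.on P a) ∧
      CondMeanZero (C.on P a) (fun ω => q0 (C.ZX ω) - eta0 (κZ a) q0 (C.UX ω)) C.core := by
  have := h.markovZ
  have hm : Measurable fun p : ((𝒰 × 𝒳) × (𝒲 × 𝒟 × ℳ × ℝ)) × 𝒵 => q0 (p.2, p.1.1.2) :=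
    hq.comp (by fun_prop)
  exact ⟨measurable_eta0 hq, (h.Z a).memLp_two_kernel (by fun_prop) (by fun_prop) hm hi,
    (h.Z a).condMeanZero (by fun_prop) (by fun_prop) hm (hi.integrable one_le_two)⟩

/-- The conditional mean of `q₀(Z,X)` given the latent variables. -/
lemma qbar0_eq (h : C.ProxyKernels P κW κZ) (hpos : C.Positivity P f) (hc : C.CompleteW1 P)
    (hw : C.Weight0 P f) (hq : Measurable q0) (hi : MemLp (fun ω => q0 (C.ZX ω)) 2 (C.on P true))
    (hb : CondBalanced P {ω | C.A ω = true} Set.univ (fun ω => q0 (C.ZX ω)) (fun _ => 1) C.WX) :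
    (fun ω => eta0 (κZ true) q0 (C.UX ω)) =ᵐ[C.on P true] fun ω => f.w0 (C.UX ω) := by
  have hw' : MemLp (fun ω => f.w0 (C.UX ω)) 2 (C.on P true) :=
    (memLp_cond_iff (hpos.ne_zero true)).1 hw
  have := h.markovW
  obtain ⟨hm, hm2, hr⟩ := h.qbar0_spec true hq hi
  have h0 := hc.ae_eq_zero hpos (g := fun v => eta0 (κZ true) q0 v - f.w0 v)
    (hm.sub f.measurable_w0) (hm2.sub hw') ?_
  · filter_upwards [h0] with ω hω
    exact sub_eq_zero.1 hω
  -- For a bounded $k(W,X)$ with latent mean $\bar k$: $E[A\bar q_0k]=E[Aq_0k]=E[k]=E[\bar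
  -- k]=E[Aw_0\bar k]=E[Aw_0k]$. Hence $\bar q_0-w_0$ has mean zero given $(W,X)$ on arm 1.
  refine condMeanZero_of_integral_mul (by fun_prop) fun k hk hk1 => ?_
  have hkW : Measurable fun ω => k (C.WX ω) := hk.comp (by fun_prop)
  have hq1 := hi.integrable one_le_two
  have hm1 := hm2.integrable one_le_two
  have hw1 := hw'.integrable one_le_two
  have hb1 : ∀ {μ : Measure Ω} {R : Ω → ℝ}, Integrable R μ →
      Integrable (fun ω => k (C.WX ω) * R ω) μ :=
    fun hR => integrable_mul_of_bdd hR hkW fun _ => hk1 _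
  simp only [mul_sub]
  rw [integral_sub (hb1 hm1) (hb1 hw1), sub_eq_zero]
  have e1 := hr.integral_mul_congr (by fun_prop) hq1 hm1 (g := fun t => k (t.2.1, t.1.2))
    (hk.comp (by fun_prop)) (hb1 hq1) (hb1 hm1)
  have e2 := hb.integral_mul (measurableSet_arm true) .univ (by fun_prop) hq1
    (integrable_const 1).integrableOn hk (hb1 hq1) (hb1 (integrable_const 1).integrableOn)
  have hkL : MemLp (fun ω => k (C.WX ω)) 2 (C.on P true) := memLp_of_bdd hkW fun _ => hk1 _
  have e3 := h.eta0_spec true hk hkL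
  have hkm : Measurable (eta0 κW k) := measurable_eta0 hk
  have e4 := e3.2.integral_mul_congr (by fun_prop) (hkL.integrable one_le_two)
    (e3.1.integrable one_le_two) (g := fun t => f.w0 t.1.1) (by fun_prop)
    (hw'.integrable_mul hkL) (hw'.integrable_mul e3.1)
  have e5 := (hpos.integral_w0 hkm).2
  have e6 := h.integral_eta0 hk ((memLp_of_bdd hkW fun _ => hk1 _).integrable one_le_two)
  simp only [mul_one, Measure.restrict_univ] at e2
  rw [← e1, e2, e6, ← e5, ← e4]
  exact integral_congr_ae (Eventually.of_forall fun ω => mul_comm _ _)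

/-- The conditional mean of `q₁(Z,D,X)` given the latent variables. -/
lemma qbar1_eq (h : C.ProxyKernels P κW κZ) (hpos : C.Positivity P f) (hc : C.CompleteW2 P)
    (hw0 : C.Weight0 P f) (hw : C.Weight1 P f) (hq0 : Measurable q0)
    (hi0 : MemLp (fun ω => q0 (C.ZX ω)) 2 (C.on P true))
    (he0 : (fun ω => eta0 (κZ true) q0 (C.UX ω)) =ᵐ[C.on P true] fun ω => f.w0 (C.UX ω))
    (hq : Measurable q1) (hi : MemLp (fun ω => q1 (C.ZDX ω)) 2 (C.on P false))
    (hb : CondBalanced P {ω | C.A ω = false} {ω | C.A ω = true} (fun ω => q1 (C.ZDX ω))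
      (fun ω => q0 (C.ZX ω)) C.WDX) :
    (fun ω => eta1 (κZ false) q1 (C.UXD ω)) =ᵐ[C.on P false] fun ω => f.w1 (C.UXD ω) := by
  have hw0' : MemLp (fun ω => f.w0 (C.UX ω)) 2 (C.on P true) :=
    (memLp_cond_iff (hpos.ne_zero true)).1 hw0
  have hw' : MemLp (fun ω => f.w1 (C.UXD ω)) 2 (C.on P false) :=
    (memLp_cond_iff (hpos.ne_zero false)).1 hw
  have := h.markovW
  obtain ⟨hm, hm2, hr⟩ := h.qbar1_spec false hq hi
  obtain ⟨hm0, hm02, hr0⟩ := h.qbar0_spec true hq0 hi0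
  have h0 := hc.ae_eq_zero hpos (g := fun v => eta1 (κZ false) q1 v - f.w1 v)
    (hm.sub f.measurable_w1) (hm2.sub hw') ?_
  · filter_upwards [h0] with ω hω
    exact sub_eq_zero.1 hω
  -- For a bounded $k(W,D,X)$: $E[(1-A)\bar q_1k]=E[(1-A)q_1k]=E[Aq_0k]=E[A\bar q_0k]=E[Aw_0k]$, and
  -- replacing $k$ by its latent mean allows the change of arm to $E[(1-A)w_1k]$.
  refine condMeanZero_of_integral_mul (by fun_prop) fun k hk hk1 => ?_
  have hkW : Measurable fun ω => k (C.WDX ω) := hk.comp (by fun_prop)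
  have hq1 := hi.integrable one_le_two
  have hm1 := hm2.integrable one_le_two
  have hw1 := hw'.integrable one_le_two
  have hq01 := hi0.integrable one_le_two
  have hm01 := hm02.integrable one_le_two
  have hb1 : ∀ {μ : Measure Ω} {R : Ω → ℝ}, Integrable R μ →
      Integrable (fun ω => k (C.WDX ω) * R ω) μ :=
    fun hR => integrable_mul_of_bdd hR hkW fun _ => hk1 _
  simp only [mul_sub]
  rw [integral_sub (hb1 hm1) (hb1 hw1), sub_eq_zero]
  have e1 := hr.integral_mul_congr (by fun_prop) hq1 hm1 (g := fun t => k (t.2.1, t.2.2.1, t.1.2))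
    (hk.comp (by fun_prop)) (hb1 hq1) (hb1 hm1)
  have e2 := hb.integral_mul (measurableSet_arm false) (measurableSet_arm true) (by fun_prop) hq1
    hq01 hk (hb1 hq1) (hb1 hq01)
  have e1' := hr0.integral_mul_congr (by fun_prop) hq01 hm01
    (g := fun t => k (t.2.1, t.2.2.1, t.1.2)) (hk.comp (by fun_prop)) (hb1 hq01) (hb1 hm01)
  have hkL : ∀ a, MemLp (fun ω => k (C.WDX ω)) 2 (C.on P a) := fun a =>
    memLp_of_bdd hkW fun _ => hk1 _
  have e3 := fun a => h.eta1_spec a hk (hkL a)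
  have hkm : Measurable (eta1 κW k) := measurable_eta1 hk
  have e4 := (e3 true).2.integral_mul_congr (by fun_prop) ((hkL true).integrable one_le_two)
    ((e3 true).1.integrable one_le_two) (g := fun t => f.w0 t.1.1) (by fun_prop)
    (hw0'.integrable_mul (hkL true)) (hw0'.integrable_mul (e3 true).1)
  have e5 := (hpos.integral_w1 hkm).2
  have e6 := (e3 false).2.integral_mul_congr (by fun_prop) ((hkL false).integrable one_le_two)
    ((e3 false).1.integrable one_le_two) (g := fun t => f.w1 t.1) (by fun_prop)
    (hw'.integrable_mul (hkL false)) (hw'.integrable_mul (e3 false).1)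
  have e7 : ∫ ω, k (C.WDX ω) * eta0 (κZ true) q0 (C.UX ω) ∂(C.on P true) =
      ∫ ω, f.w0 (C.UX ω) * k (C.WDX ω) ∂(C.on P true) := integral_congr_ae (by
    filter_upwards [he0] with ω hω
    rw [hω, mul_comm])
  rw [← e1, e2, e1', e7, e4, ← e5, ← e6]
  exact integral_congr_ae (Eventually.of_forall fun ω => mul_comm _ _)

/-- The conditional mean of `q₂(Z,M,D,X)` given the latent variables. -/
lemma qbar2_eq [StandardBorelSpace 𝒲] [StandardBorelSpace 𝒳]
    (h : C.ProxyKernels P κW κZ) (hpos : C.Positivity P f) (hc : C.CompleteW1 P)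
    (hw1 : C.Weight1 P f) (hw : C.Weight2 P f) (hq1 : Measurable q1)
    (hi1 : MemLp (fun ω => q1 (C.ZDX ω)) 2 (C.on P false))
    (he1 : (fun ω => eta1 (κZ false) q1 (C.UXD ω)) =ᵐ[C.on P false] fun ω => f.w1 (C.UXD ω))
    (hq : Measurable q2) (hi : MemLp (fun ω => q2 (C.ZMDX ω)) 2 (C.on P true))
    (hb : CondBalanced P {ω | C.A ω = true} {ω | C.A ω = false} (fun ω => q2 (C.ZMDX ω))
      (fun ω => q1 (C.ZDX ω)) C.WMDX) :
    (fun ω => eta2 (κZ true) q2 (C.UXDM ω)) =ᵐ[C.on P true] fun ω => f.w2 (C.UXDM ω) := by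
  have hw1' : MemLp (fun ω => f.w1 (C.UXD ω)) 2 (C.on P false) :=
    (memLp_cond_iff (hpos.ne_zero false)).1 hw1
  have hw' : MemLp (fun ω => f.w2 (C.UXDM ω)) 2 (C.on P true) :=
    (memLp_cond_iff (hpos.ne_zero true)).1 hw.1
  have := h.markovW
  obtain ⟨K, hK, hKb⟩ := hw.2
  obtain ⟨hm, hm2, hr⟩ := h.qbar2_spec true hq hi
  obtain ⟨hm0, hm02, hr0⟩ := h.qbar1_spec false hq1 hi1
  -- The difference depends on $(U,X,D,M)$, while completeness is given for functions of $(U,X)$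
  -- only; the extension by sections bridges this gap. The remaining identity is the analogue of the
  -- one for $q_1$ with the arms exchanged.
  have h0 := hc.ae_eq_zero_UXDM hpos h hK hKb (r := fun v => eta2 (κZ true) q2 v - f.w2 v)
    (hm.sub f.measurable_w2) (hm2.sub hw') ?_
  · filter_upwards [h0] with ω hω
    exact sub_eq_zero.1 hω
  refine condMeanZero_of_integral_mul (by fun_prop) fun k hk hk1 => ?_
  have hkW : Measurable fun ω => k (C.WMDX ω) := hk.comp (by fun_prop)
  have hq1 := hi.integrable one_le_two
  have hm1 := hm2.integrable one_le_two
  have hw1 := hw'.integrable one_le_two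
  have hq01 := hi1.integrable one_le_two
  have hm01 := hm02.integrable one_le_two
  have hb1 : ∀ {μ : Measure Ω} {R : Ω → ℝ}, Integrable R μ →
      Integrable (fun ω => k (C.WMDX ω) * R ω) μ :=
    fun hR => integrable_mul_of_bdd hR hkW fun _ => hk1 _
  simp only [mul_sub]
  rw [integral_sub (hb1 hm1) (hb1 hw1), sub_eq_zero]
  have e1 := hr.integral_mul_congr (by fun_prop) hq1 hm1
    (g := fun t => k (t.2.1, t.2.2.2.1, t.2.2.1, t.1.2))
    (hk.comp (by fun_prop)) (hb1 hq1) (hb1 hm1)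
  have e2 := hb.integral_mul (measurableSet_arm true) (measurableSet_arm false) (by fun_prop) hq1
    hq01 hk (hb1 hq1) (hb1 hq01)
  have e1' := hr0.integral_mul_congr (by fun_prop) hq01 hm01
    (g := fun t => k (t.2.1, t.2.2.2.1, t.2.2.1, t.1.2)) (hk.comp (by fun_prop)) (hb1 hq01) (hb1 hm01)
  have hkL : ∀ a, MemLp (fun ω => k (C.WMDX ω)) 2 (C.on P a) := fun a =>
    memLp_of_bdd hkW fun _ => hk1 _
  have e3 := fun a => h.eta2_spec a hk (hkL a)
  have hkm : Measurable (eta2 κW k) := measurable_eta2 hk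
  have e4 := (e3 false).2.integral_mul_congr (by fun_prop) ((hkL false).integrable one_le_two)
    ((e3 false).1.integrable one_le_two) (g := fun t => f.w1 t.1) (by fun_prop)
    (hw1'.integrable_mul (hkL false)) (hw1'.integrable_mul (e3 false).1)
  have e5 := (hpos.integral_w2 hkm).2
  have e6 := (e3 true).2.integral_mul_congr (by fun_prop) ((hkL true).integrable one_le_two)
    ((e3 true).1.integrable one_le_two) (g := fun t => f.w2 t) (by fun_prop)
    (hw'.integrable_mul (hkL true)) (hw'.integrable_mul (e3 true).1)
  have e7 : ∫ ω, k (C.WMDX ω) * eta1 (κZ false) q1 (C.UXD ω) ∂(C.on P false) =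
      ∫ ω, f.w1 (C.UXD ω) * k (C.WMDX ω) ∂(C.on P false) := integral_congr_ae (by
    filter_upwards [he1] with ω hω
    rw [hω, mul_comm])
  rw [← e1, e2, e1', e7, e4, ← e5, ← e6]
  exact integral_congr_ae (Eventually.of_forall fun ω => mul_comm _ _)

end ProxyKernels

/-! ### The chain of identification formulas -/

section Chain

variable {h2 : 𝒲 × ℳ × 𝒟 × 𝒳 → ℝ} {h1 : 𝒲 × 𝒟 × 𝒳 → ℝ} {h0 : 𝒲 × 𝒳 → ℝ} {ψ : ℝ}

/-- `E[A w₂ Y] = E[(1-A) w₁ η₂]`. -/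
lemma ProxyKernels.chain_h2 (h : C.ProxyKernels P κW κZ) (hpos : C.Positivity P f)
    (hz1 : C.CompleteZ1 P) (hY : MemLp C.Y 2 P)
    (hψ : Integrable (fun ω => f.w2 (C.UXDM ω) * C.Y ω) (C.on P true) ∧
      ∫ ω, f.w2 (C.UXDM ω) * C.Y ω ∂(C.on P true) = ψ)
    (hh : Measurable h2) (hh2 : MemLp (fun ω => h2 (C.WMDX ω)) 2 P)
    (hb : CondMeanZero (C.on P true) (fun ω => C.Y ω - h2 (C.WMDX ω)) C.ZMDX) :
    Integrable (fun ω => f.w1 (C.UXD ω) * eta2 κW h2 (C.UXDM ω)) (C.on P false) ∧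
      ∫ ω, f.w1 (C.UXD ω) * eta2 κW h2 (C.UXDM ω) ∂(C.on P false) = ψ := by
  have := h.markovW
  have hmη : Measurable (eta2 κW h2) := measurable_eta2 hh
  have hs := h.eta2_spec true hh (hh2.restrict _)
  have hY1 : MemLp C.Y 2 (C.on P true) := hY.restrict _
  have h21 : MemLp (fun ω => h2 (C.WMDX ω)) 2 (C.on P true) := hh2.restrict _
  -- The residual $Y-h_2$ has mean zero given the proxy $Z$; completeness replaces $Z$ by $U$.
  have c1 := h.completeZ1 hpos hz1 (r := fun t => t.2.2.2.2 - h2 (t.2.1, t.2.2.2.1, t.2.2.1, t.1.2))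
    (by fun_prop) (hY1.sub h21) hb
  have hYi := hY1.integrable one_le_two
  have hηi := hs.1.integrable one_le_two
  have c2 := c1.sub_trans hs.2 hYi (h21.integrable one_le_two) hηi
  -- Only integrability of $w_2Y$ is known. That of $w_2\eta_2$ follows because it is a conditional
  -- expectation of $w_2Y$, so the chain needs no square-integrable weights.
  have c3 := c2.integral_mul_eq hmη (by fun_prop) hYi hηi f.measurable_w2 hψ.1
  have c4 := hpos.integral_w2 hmη
  exact ⟨c4.1.1 c3.1, by rw [← c4.2, c3.2, hψ.2]⟩

/-- `E[(1-A) w₁ η₂] = E[A w₀ η₁]`. -/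
lemma ProxyKernels.chain_h1 (h : C.ProxyKernels P κW κZ) (hpos : C.Positivity P f)
    (hz2 : C.CompleteZ2 P)
    (hψ : Integrable (fun ω => f.w1 (C.UXD ω) * eta2 κW h2 (C.UXDM ω)) (C.on P false) ∧
      ∫ ω, f.w1 (C.UXD ω) * eta2 κW h2 (C.UXDM ω) ∂(C.on P false) = ψ)
    (hh : Measurable h2) (hh2 : MemLp (fun ω => h2 (C.WMDX ω)) 2 P)
    (hh' : Measurable h1) (hh1 : MemLp (fun ω => h1 (C.WDX ω)) 2 P)
    (hb : CondMeanZero (C.on P false) (fun ω => h2 (C.WMDX ω) - h1 (C.WDX ω)) C.ZDX) :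
    Integrable (fun ω => f.w0 (C.UX ω) * eta1 κW h1 (C.UXD ω)) (C.on P true) ∧
      ∫ ω, f.w0 (C.UX ω) * eta1 κW h1 (C.UXD ω) ∂(C.on P true) = ψ := by
  have := h.markovW
  have hmη : Measurable (eta1 κW h1) := measurable_eta1 hh'
  have hs2 := h.eta2_spec false hh (hh2.restrict _)
  have hs1 := h.eta1_spec false hh' (hh1.restrict _)
  have h20 : MemLp (fun ω => h2 (C.WMDX ω)) 2 (C.on P false) := hh2.restrict _
  have h10 : MemLp (fun ω => h1 (C.WDX ω)) 2 (C.on P false) := hh1.restrict _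
  have c1 := h.completeZ2 hpos hz2
    (r := fun t => h2 (t.2.1, t.2.2.2.1, t.2.2.1, t.1.2) - h1 (t.2.1, t.2.2.1, t.1.2))
    (by fun_prop) (h20.sub h10) hb
  have hi2 := h20.integrable one_le_two
  have hi1 := h10.integrable one_le_two
  have hη2 := hs2.1.integrable one_le_two
  have hη1 := hs1.1.integrable one_le_two
  -- Here $\eta_2-\eta_1=(\eta_2-h_2)+(h_2-h_1)+(h_1-\eta_1)$, each term having mean zero given
  -- $(U,X,D)$ on arm 0.
  have c2 := (hs2.2.symm.comp (f := Prod.fst) measurable_fst).sub_trans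
    (c1.sub_trans (hs1.2.comp (f := Prod.fst) measurable_fst) hi2 hi1 hη1) hη2 hi2 hη1
  have c3 := c2.integral_mul_eq hmη (by fun_prop) hη2 hη1 f.measurable_w1 hψ.1
  have c4 := hpos.integral_w1 hmη
  exact ⟨c4.1.1 c3.1, by rw [← c4.2, c3.2, hψ.2]⟩

/-- `E[A w₀ η₁] = E[h₀]`. -/
lemma ProxyKernels.chain_h0 (h : C.ProxyKernels P κW κZ) (hpos : C.Positivity P f)
    (hz3 : C.CompleteZ3 P)
    (hψ : Integrable (fun ω => f.w0 (C.UX ω) * eta1 κW h1 (C.UXD ω)) (C.on P true) ∧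
      ∫ ω, f.w0 (C.UX ω) * eta1 κW h1 (C.UXD ω) ∂(C.on P true) = ψ)
    (hh : Measurable h1) (hh1 : MemLp (fun ω => h1 (C.WDX ω)) 2 P)
    (hh' : Measurable h0) (hh0 : MemLp (fun ω => h0 (C.WX ω)) 2 P)
    (hb : CondMeanZero (C.on P true) (fun ω => h1 (C.WDX ω) - h0 (C.WX ω)) C.ZX) :
    ∫ ω, h0 (C.WX ω) ∂P = ψ := by
  have := h.markovW
  have hmη : Measurable (eta0 κW h0) := measurable_eta0 hh'
  have hs1 := h.eta1_spec true hh (hh1.restrict _)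
  have hs0 := h.eta0_spec true hh' (hh0.restrict _)
  have h10 : MemLp (fun ω => h1 (C.WDX ω)) 2 (C.on P true) := hh1.restrict _
  have h00 : MemLp (fun ω => h0 (C.WX ω)) 2 (C.on P true) := hh0.restrict _
  have c1 := h.completeZ3 hpos hz3
    (r := fun t => h1 (t.2.1, t.2.2.1, t.1.2) - h0 (t.2.1, t.1.2))
    (by fun_prop) (h10.sub h00) hb
  have hi1 := h10.integrable one_le_two
  have hi0 := h00.integrable one_le_two
  have hη1 := hs1.1.integrable one_le_two
  have hη0 := hs0.1.integrable one_le_two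
  have c2 := (hs1.2.symm.comp (f := fun t => t.1.1) (by fun_prop)).sub_trans
    (c1.sub_trans (hs0.2.comp (f := fun t => t.1.1) (by fun_prop)) hi1 hi0 hη0) hη1 hi1 hη0
  have c3 := c2.integral_mul_eq hmη (by fun_prop) hη1 hη0 f.measurable_w0 hψ.1
  have c4 := hpos.integral_w0 hmη
  rw [h.integral_eta0 hh' (hh0.integrable one_le_two), ← c4.2, c3.2, hψ.2]

end Chain

end PathSpecific.CausalModel

/-! ### The law of the nested counterfactual -/

section General

variable {Ω τ β γ α : Type*} [mΩ : MeasurableSpace Ω] [MeasurableSpace τ] [mβ : MeasurableSpace β]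
  [MeasurableSpace γ] [MeasurableSpace α]

/-- Conditional independence permits evaluating the second component at an independent $\omega'$
drawn from the conditional law on $\Omega$ given $V$. Drawing whole sample points makes the rule
apply to random functions of an uncountable index. -/
lemma lintegral_of_condIndep [StandardBorelSpace Ω] {P : Measure Ω} [IsProbabilityMeasure P]
    {V : Ω → β} {g : Ω → α} {h : Ω → γ} (hV : Measurable V) (hg : Measurable g) (hh : Measurable h)
    (hci : CondIndep (sigmaOf V) (sigmaOf g) (sigmaOf h) hV.comap_le P)
    {κ : Kernel β Ω} [IsMarkovKernel κ] (hκ : HasCondDistrib (fun ω => ω) V κ P)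
    {F : (β × α) × γ → ℝ≥0∞} (hF : Measurable F) :
    ∫⁻ ω, F ((V ω, g ω), h ω) ∂P = ∫⁻ ω, ∫⁻ ω', F ((V ω, g ω), h ω') ∂(κ (V ω)) ∂P := by
  have : IsMarkovKernel (κ.map h) := Kernel.IsMarkovKernel.map κ hh
  have hκ' : HasCondDistrib h V (κ.map h) P := by
    refine hasCondDistrib_of_lintegral_eq hV hh fun G hG => ?_
    have h1 := hκ.lintegral_eq hV measurable_id (F := fun p => G (p.1, h p.2)) (by fun_prop)
    refine h1.trans (lintegral_congr fun ω => ?_)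
    have hm : Measurable fun c => G (V ω, c) := hG.comp measurable_prodMk_left
    rw [Kernel.map_apply _ hh, lintegral_map hm hh]
  have h2 := (hasCondDistrib_of_condIndep hV hg hh hci hκ').lintegral_eq (by fun_prop) hh hF
  refine h2.trans (lintegral_congr fun ω => ?_)
  have hm : Measurable fun c => F ((V ω, g ω), c) := hF.comp measurable_prodMk_left
  rw [Kernel.prodMkRight_apply, Kernel.map_apply _ hh, lintegral_map hm hh]

/-- Version for sub-σ-algebras. -/
lemma lintegral_of_condIndep_right {Ω : Type*} {𝓗 : MeasurableSpace Ω} [mΩ : MeasurableSpace Ω]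
    [StandardBorelSpace Ω] {P : Measure Ω} [IsProbabilityMeasure P] {V : Ω → β} {g : Ω → α} (hV : Measurable V) (hg : Measurable g)
    (h𝓗 : 𝓗 ≤ mΩ) (hci : CondIndep (sigmaOf V) (sigmaOf g) 𝓗 hV.comap_le P)
    {κ : Kernel β Ω} [IsMarkovKernel κ] (hκ : HasCondDistrib (fun ω => ω) V κ P)
    {F : (β × α) × Ω → ℝ≥0∞}
    (hF : @Measurable _ _ (@Prod.instMeasurableSpace (β × α) Ω inferInstance 𝓗) _ F) :
    ∫⁻ ω, F ((V ω, g ω), ω) ∂P = ∫⁻ ω, ∫⁻ ω', F ((V ω, g ω), ω') ∂(κ (V ω)) ∂P := by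
  -- The sub-σ-algebra is realized as that generated by the identity map into $\Omega$ equipped with
  -- it.
  have hid : @Measurable Ω Ω mΩ 𝓗 id := measurable_id'' h𝓗
  have hc : @sigmaOf Ω Ω 𝓗 id = 𝓗 := MeasurableSpace.comap_id
  refine @lintegral_of_condIndep Ω β Ω α mΩ mβ 𝓗 _ _ P _ V g id hV hg hid ?_ κ _ hκ F hF
  rw [hc]
  exact hci

/-- Version for two sub-σ-algebras. -/
lemma lintegral_of_condIndep_both {Ω : Type*} {𝓖 𝓗 : MeasurableSpace Ω} [mΩ : MeasurableSpace Ω]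
    [StandardBorelSpace Ω] {P : Measure Ω} [IsProbabilityMeasure P] {V : Ω → β} (hV : Measurable V) (h𝓖 : 𝓖 ≤ mΩ)
    (h𝓗 : 𝓗 ≤ mΩ) (hci : CondIndep (sigmaOf V) 𝓖 𝓗 hV.comap_le P)
    {κ : Kernel β Ω} [IsMarkovKernel κ] (hκ : HasCondDistrib (fun ω => ω) V κ P)
    {F : (β × Ω) × Ω → ℝ≥0∞}
    (hF : @Measurable _ _ (@Prod.instMeasurableSpace (β × Ω) Ω
      (@Prod.instMeasurableSpace β Ω mβ 𝓖) 𝓗) _ F) :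
    ∫⁻ ω, F ((V ω, ω), ω) ∂P = ∫⁻ ω, ∫⁻ ω', F ((V ω, ω), ω') ∂(κ (V ω)) ∂P := by
  have hid : @Measurable Ω Ω mΩ 𝓖 id := measurable_id'' h𝓖
  have hc : @sigmaOf Ω Ω 𝓖 id = 𝓖 := MeasurableSpace.comap_id
  refine @lintegral_of_condIndep_right β Ω mβ 𝓖 Ω 𝓗 mΩ _ P _ V id hV hid h𝓗 ?_ κ _ hκ F hF
  rw [hc]
  exact hci

lemma lintegral_comp_of_map_eq_withDensity {μ : Measure Ω} {T : Ω → τ} (hT : Measurable T)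
    {ν : Measure τ} {g : τ → ℝ} (hg : Measurable g)
    (h : μ.map T = ν.withDensity fun t => ENNReal.ofReal (g t)) {F : τ → ℝ≥0∞} (hF : Measurable F) :
    ∫⁻ ω, F (T ω) ∂μ = ∫⁻ t, ENNReal.ofReal (g t) * F t ∂ν := by
  rw [← lintegral_map hF hT, h, lintegral_withDensity_eq_lintegral_mul _ hg.ennreal_ofReal hF]
  rfl

lemma PathSpecific.Carries.mono {ι : Type*} [MeasurableSpace ι] {𝓖 𝓗 : MeasurableSpace Ω}
    {F : ι → Ω → β} (h : Carries 𝓖 F) (hle : 𝓖 ≤ 𝓗) : Carries 𝓗 F := by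
  unfold Carries at *
  refine Measurable.mono h ?_ le_rfl
  exact sup_le_sup_left (MeasurableSpace.comap_mono hle) _

/-- The σ-algebras on the sample spaces are left arbitrary, so that a random function evaluated at a
random index is seen to be measurable with respect to the particular sub-σ-algebra that carries it.
-/
lemma measurable_nested_kernel {𝒟 ℳ : Type*} [MeasurableSpace 𝒟] [MeasurableSpace ℳ]
    {κ : Kernel β γ} [IsMarkovKernel κ] {D : α → 𝒟} (hD : Measurable D) {M : 𝒟 → γ → ℳ}
    (hM : Measurable fun p : 𝒟 × γ => M p.1 p.2) {Y : ℳ → α → ℝ}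
    (hY : Measurable fun p : ℳ × α => Y p.1 p.2) {φ : ℝ → ℝ≥0∞} (hφ : Measurable φ) :
    Measurable fun p : β × α => ∫⁻ c, φ (Y (M (D p.2) c) p.2) ∂(κ p.1) := by
  have h1 : Measurable fun q : (β × α) × γ => M (D q.1.2) q.2 :=
    hM.comp (by fun_prop : Measurable fun q : (β × α) × γ => (D q.1.2, q.2))
  have h2 : Measurable fun q : (β × α) × γ => φ (Y (M (D q.1.2) q.2) q.1.2) :=
    hφ.comp (hY.comp (h1.prodMk (by fun_prop)))
  exact Measurable.lintegral_kernel_prod_right' (κ := κ.comap (fun p : β × α => p.1) measurable_fst) h2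

lemma measurable_nested {𝒟 ℳ : Type*} [MeasurableSpace 𝒟] [MeasurableSpace ℳ]
    {D : α → 𝒟} (hD : Measurable D) {M : 𝒟 → γ → ℳ}
    (hM : Measurable fun p : 𝒟 × γ => M p.1 p.2) {Y : ℳ → α → ℝ}
    (hY : Measurable fun p : ℳ × α => Y p.1 p.2) {φ : ℝ → ℝ≥0∞} (hφ : Measurable φ) :
    Measurable fun q : (β × α) × γ => φ (Y (M (D q.1.2) q.2) q.1.2) := by
  have h1 : Measurable fun q : (β × α) × γ => M (D q.1.2) q.2 :=
    hM.comp (by fun_prop : Measurable fun q : (β × α) × γ => (D q.1.2, q.2))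
  exact hφ.comp (hY.comp (h1.prodMk (by fun_prop)))

lemma measurable_indicator_weight (a : Bool) {w : β → ℝ} (hw : Measurable w) {Γ : β × γ → ℝ≥0∞}
    (hΓ : Measurable Γ) : Measurable fun q : (β × Bool) × γ =>
      ({a} : Set Bool).indicator 1 q.1.2 * (ENNReal.ofReal (w q.1.1) * Γ (q.1.1, q.2)) := by
  have hi : Measurable (({a} : Set Bool).indicator (1 : Bool → ℝ≥0∞)) :=
    measurable_one.indicator (measurableSet_singleton a)
  fun_prop

lemma measurable_indicator_mediator {𝒟 ℳ : Type*} [MeasurableSpace 𝒟] [MeasurableSpace ℳ] (a : Bool)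
    {w : β × 𝒟 → ℝ} (hw : Measurable w) {H : (β × 𝒟) × ℳ → ℝ≥0∞} (hH : Measurable H)
    {M : 𝒟 → γ → ℳ} (hM : Measurable fun p : 𝒟 × γ => M p.1 p.2) :
    Measurable fun q : (β × (𝒟 × Bool)) × γ => ({a} : Set Bool).indicator 1 q.1.2.2 *
      (ENNReal.ofReal (w (q.1.1, q.1.2.1)) * H ((q.1.1, q.1.2.1), M q.1.2.1 q.2)) := by
  have hi : Measurable (({a} : Set Bool).indicator (1 : Bool → ℝ≥0∞)) :=
    measurable_one.indicator (measurableSet_singleton a)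
  have h1 : Measurable fun q : (β × (𝒟 × Bool)) × γ => M q.1.2.1 q.2 :=
    hM.comp (by fun_prop : Measurable fun q : (β × (𝒟 × Bool)) × γ => (q.1.2.1, q.2))
  fun_prop

lemma measurable_indicator_outcome {𝒟 ℳ : Type*} [MeasurableSpace 𝒟] [MeasurableSpace ℳ] (a : Bool)
    {w : (β × 𝒟) × ℳ → ℝ} (hw : Measurable w) {φ : ℝ → ℝ≥0∞} (hφ : Measurable φ)
    {Y : ℳ → γ → ℝ} (hY : Measurable fun p : ℳ × γ => Y p.1 p.2) :
    Measurable fun q : ((𝒟 × Bool × β) × ℳ) × γ => ({a} : Set Bool).indicator 1 q.1.1.2.1 *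
      (ENNReal.ofReal (w ((q.1.1.2.2, q.1.1.1), q.1.2)) * φ (Y q.1.2 q.2)) := by
  have hi : Measurable (({a} : Set Bool).indicator (1 : Bool → ℝ≥0∞)) :=
    measurable_one.indicator (measurableSet_singleton a)
  have h1 : Measurable fun q : ((𝒟 × Bool × β) × ℳ) × γ => Y q.1.2 q.2 :=
    hY.comp (by fun_prop : Measurable fun q : ((𝒟 × Bool × β) × ℳ) × γ => (q.1.2, q.2))
  fun_prop

end General

namespace PathSpecific.CausalModel

variable {Ω 𝒰 𝒟 ℳ 𝒲 𝒵 𝒳 : Type*} [mΩ : MeasurableSpace Ω] [MeasurableSpace 𝒰]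
  [MeasurableSpace 𝒟] [MeasurableSpace ℳ] [MeasurableSpace 𝒲] [MeasurableSpace 𝒵]
  [MeasurableSpace 𝒳]

variable {C : CausalModel Ω 𝒰 𝒟 ℳ 𝒲 𝒵 𝒳} {P : Measure Ω} [IsProbabilityMeasure P]
  {f : Densities 𝒰 𝒟 ℳ 𝒳}

namespace Positivity

lemma lintegral_w0 (h : C.Positivity P f) {F : 𝒰 × 𝒳 → ℝ≥0∞} (hF : Measurable F) :
    ∫⁻ ω, ENNReal.ofReal (f.w0 (C.UX ω)) * F (C.UX ω) ∂(C.on P true) = ∫⁻ ω, F (C.UX ω) ∂P := by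
  have h1 := lintegral_comp_of_map_eq_withDensity (T := C.UX) (by fun_prop) (f.e_meas true)
    (h.dens_A true) (F := fun v => ENNReal.ofReal (f.w0 v) * F v) (by fun_prop)
  rw [h1, ← lintegral_map hF (by fun_prop)]
  refine lintegral_congr_ae ?_
  filter_upwards [h.pos_A true] with v hv
  rw [← mul_assoc, ← ENNReal.ofReal_mul hv.le, Densities.w0, mul_one_div_cancel hv.ne',
    ENNReal.ofReal_one, one_mul]

lemma lintegral_w1 (h : C.Positivity P f) {F : (𝒰 × 𝒳) × 𝒟 → ℝ≥0∞} (hF : Measurable F) :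
    ∫⁻ ω, ENNReal.ofReal (f.w1 (C.UXD ω)) * F (C.UXD ω) ∂(C.on P false) =
      ∫⁻ ω, ENNReal.ofReal (f.w0 (C.UX ω)) * F (C.UXD ω) ∂(C.on P true) := by
  have h1 := lintegral_comp_of_map_eq_withDensity (T := C.UXD) (by fun_prop)
    (f.measurable_den1 false) (h.map_UXD false) (F := fun v => ENNReal.ofReal (f.w1 v) * F v)
    (by fun_prop)
  have h2 := lintegral_comp_of_map_eq_withDensity (T := C.UXD) (by fun_prop)
    (f.measurable_den1 true) (h.map_UXD true) (F := fun v => ENNReal.ofReal (f.w0 v.1) * F v)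
    (by fun_prop)
  rw [h1, h2]
  refine lintegral_congr_ae ?_
  filter_upwards [h.pos1 true, h.pos1 false] with v hv hv'
  obtain ⟨h3, h4⟩ := hv
  obtain ⟨h5, h6⟩ := hv'
  rw [← mul_assoc, ← mul_assoc, ← ENNReal.ofReal_mul (by unfold Densities.den1; positivity),
    ← ENNReal.ofReal_mul (by unfold Densities.den1; positivity)]
  congr 2
  simp only [Densities.w0, Densities.w1, Densities.den1]
  field_simp

lemma lintegral_w2 (h : C.Positivity P f) {F : ((𝒰 × 𝒳) × 𝒟) × ℳ → ℝ≥0∞} (hF : Measurable F) :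
    ∫⁻ ω, ENNReal.ofReal (f.w2 (C.UXDM ω)) * F (C.UXDM ω) ∂(C.on P true) =
      ∫⁻ ω, ENNReal.ofReal (f.w1 (C.UXD ω)) * F (C.UXDM ω) ∂(C.on P false) := by
  have h1 := lintegral_comp_of_map_eq_withDensity (T := C.UXDM) (by fun_prop)
    (f.measurable_den2 true) (h.map_UXDM true) (F := fun v => ENNReal.ofReal (f.w2 v) * F v)
    (by fun_prop)
  have h2 := lintegral_comp_of_map_eq_withDensity (T := C.UXDM) (by fun_prop)
    (f.measurable_den2 false) (h.map_UXDM false) (F := fun v => ENNReal.ofReal (f.w1 v.1) * F v)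
    (by fun_prop)
  rw [h1, h2]
  refine lintegral_congr_ae ?_
  filter_upwards [h.pos2 true, h.pos2 false] with v hv hv'
  obtain ⟨h3, h4, h5⟩ := hv
  obtain ⟨h6, h7, h8⟩ := hv'
  rw [← mul_assoc, ← mul_assoc,
    ← ENNReal.ofReal_mul (by unfold Densities.den2 Densities.den1; positivity),
    ← ENNReal.ofReal_mul (by unfold Densities.den2 Densities.den1; positivity)]
  congr 2
  simp only [Densities.w2, Densities.w1, Densities.den2, Densities.den1]
  field_simp

end Positivity

variable [StandardBorelSpace Ω]

/-- Cross-world independence first replaces $M(0,\cdot)$ by an independent copy given $(U,X)$.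
Exchangeability of the treatment moves the mean to arm 1 with weight $w_0$, where consistency turns
$D(1)$ into $D$ and $Y(1,\cdot)$ into $Y(\cdot)$. After averaging, only a function of $(U,X,D)$ is
left, so it can be moved to arm 0 with weight $w_1$. There $M(0,\cdot)$ is independent of $(D,A)$
and the copy becomes the observed $M$. The weight $w_2$ leads back to arm 1, where $Y(\cdot)\perp M$
restores the observed $Y$. Nonnegative test functions avoid all integrability questions. -/
lemma lintegral_nested_aux {Ω : Type*} {𝓖 𝓗 𝓖₁ 𝓖₂ 𝓗₁ : MeasurableSpace Ω}
    [mΩ : MeasurableSpace Ω] [StandardBorelSpace Ω] {C : CausalModel Ω 𝒰 𝒟 ℳ 𝒲 𝒵 𝒳} {P : Measure Ω}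
    [IsProbabilityMeasure P] {f : Densities 𝒰 𝒟 ℳ 𝒳} (hcons : C.Consistency P)
    (hpos : C.Positivity P f)
    (h𝓖 : 𝓖 ≤ mΩ) (h𝓗 : 𝓗 ≤ mΩ) (hGY : Carries 𝓖 (C.Yam true)) (hGD : Measurable[𝓖] (C.Dpot true))
    (hHM : Carries 𝓗 (C.Mpot false))
    (hGH : CondIndep (sigmaOf C.UX) 𝓖 𝓗 (C.U_meas.prodMk C.X_meas).comap_le P)
    (h𝓖₁ : 𝓖₁ ≤ mΩ) (hG1Y : Carries 𝓖₁ (C.Yam true)) (hG1D : Measurable[𝓖₁] (C.Dpot true))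
    (hG1A : CondIndep (sigmaOf C.UX) 𝓖₁ (sigmaOf C.A) (C.U_meas.prodMk C.X_meas).comap_le P)
    (h𝓖₂ : 𝓖₂ ≤ mΩ) (hG2Y : Carries 𝓖₂ C.Ym)
    (hG2M : CondIndep (sigmaOf fun ω => (C.D ω, C.A ω, C.UX ω)) 𝓖₂ (sigmaOf C.M)
      (C.D_meas.prodMk (C.A_meas.prodMk (C.U_meas.prodMk C.X_meas))).comap_le P)
    (h𝓗₁ : 𝓗₁ ≤ mΩ) (hH1M : Carries 𝓗₁ (C.Mpot false))
    (hH1DA : CondIndep (sigmaOf C.UX) 𝓗₁ (sigmaOf fun ω => (C.D ω, C.A ω))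
      (C.U_meas.prodMk C.X_meas).comap_le P)
    {φ : ℝ → ℝ≥0∞} (hφ : Measurable φ) :
    ∫⁻ ω, φ (C.nested ω) ∂P =
      ∫⁻ ω, ENNReal.ofReal (f.w2 (C.UXDM ω)) * φ (C.Y ω) ∂(C.on P true) := by
  have : Nonempty Ω := nonempty_of_isProbabilityMeasure P
  have hM0 : Measurable fun p : 𝒟 × Ω => C.Mpot false p.1 p.2 := C.Mpot_meas false
  have hYm : Measurable fun p : ℳ × Ω => C.Ym p.1 p.2 := hG2Y.mono h𝓖₂
  have hYam : Measurable fun p : ℳ × Ω => C.Yam true p.1 p.2 := hG1Y.mono h𝓖₁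
  have hUX : Measurable C.UX := by fun_prop
  have hDAUX : Measurable fun ω => (C.D ω, C.A ω, C.UX ω) := by fun_prop
  -- The kernels $\kappa$ and $L$ resample the entire sample point given $(U,X)$ and given
  -- $(D,A,U,X)$.
  let κ : Kernel (𝒰 × 𝒳) Ω := condDistrib (fun ω => ω) C.UX P
  let L : Kernel (𝒟 × Bool × (𝒰 × 𝒳)) Ω :=
    condDistrib (fun ω => ω) (fun ω => (C.D ω, C.A ω, C.UX ω)) P
  have hκ : HasCondDistrib (fun ω => ω) C.UX κ P :=
    ⟨by fun_prop, (compProd_map_condDistrib measurable_id.aemeasurable).symm⟩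
  have hL : HasCondDistrib (fun ω => ω) (fun ω => (C.D ω, C.A ω, C.UX ω)) L P :=
    ⟨by fun_prop, (compProd_map_condDistrib measurable_id.aemeasurable).symm⟩
  let Γ : (𝒰 × 𝒳) × Ω → ℝ≥0∞ := fun p =>
    ∫⁻ ω', φ (C.Yam true (C.Mpot false (C.Dpot true p.2) ω') p.2) ∂(κ p.1)
  -- After the mediator has been averaged out, $\Gamma$ depends on the sample point through $D(1)$
  -- and $Y(1,\cdot)$ only. It is therefore carried by the σ-algebra of the exchangeability
  -- assumption, which may differ from that of the cross-world assumption.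
  have hΓ1 : @Measurable _ _ (@Prod.instMeasurableSpace (𝒰 × 𝒳) Ω _ 𝓖₁) _ Γ :=
    @measurable_nested_kernel (𝒰 × 𝒳) Ω Ω _ mΩ 𝓖₁ 𝒟 ℳ _ _ κ _ _ hG1D _ hM0 _ hG1Y φ hφ
  have hΓ : Measurable Γ := measurable_nested_kernel (C.Dpot_meas true) hM0 hYam hφ
  let Γ₂ : ((𝒰 × 𝒳) × 𝒟) × Ω → ℝ≥0∞ := fun p =>
    ∫⁻ ω', φ (C.Ym (C.Mpot false p.1.2 ω') p.2) ∂(κ p.1.1)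
  have hΓ₂ : Measurable Γ₂ := by
    have h1 : Measurable fun q : (((𝒰 × 𝒳) × 𝒟) × Ω) × Ω => C.Mpot false q.1.1.2 q.2 :=
      hM0.comp (by fun_prop : Measurable fun q : (((𝒰 × 𝒳) × 𝒟) × Ω) × Ω => (q.1.1.2, q.2))
    have h2 : Measurable fun q : (((𝒰 × 𝒳) × 𝒟) × Ω) × Ω =>
        φ (C.Ym (C.Mpot false q.1.1.2 q.2) q.1.2) := hφ.comp (hYm.comp (h1.prodMk (by fun_prop)))
    exact Measurable.lintegral_kernel_prod_right'
      (κ := κ.comap (fun p : ((𝒰 × 𝒳) × 𝒟) × Ω => p.1.1) (by fun_prop)) h2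
  let H : ((𝒰 × 𝒳) × 𝒟) × ℳ → ℝ≥0∞ := fun t => ∫⁻ ω, φ (C.Ym t.2 ω) ∂(L (t.1.2, true, t.1.1))
  have hH : Measurable H := by
    have h2 : Measurable fun q : (((𝒰 × 𝒳) × 𝒟) × ℳ) × Ω => φ (C.Ym q.1.2 q.2) :=
      hφ.comp (hYm.comp (by fun_prop : Measurable fun q : (((𝒰 × 𝒳) × 𝒟) × ℳ) × Ω => (q.1.2, q.2)))
    exact Measurable.lintegral_kernel_prod_right' (κ := L.comap
      (fun t : ((𝒰 × 𝒳) × 𝒟) × ℳ => (t.1.2, true, t.1.1)) (by fun_prop)) h2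
  let N : (𝒰 × 𝒳) × 𝒟 → ℝ≥0∞ := fun t => ∫⁻ ω', H (t, C.Mpot false t.2 ω') ∂(κ t.1)
  have hN : Measurable N := by
    have h1 : Measurable fun q : ((𝒰 × 𝒳) × 𝒟) × Ω => C.Mpot false q.1.2 q.2 :=
      hM0.comp (by fun_prop : Measurable fun q : ((𝒰 × 𝒳) × 𝒟) × Ω => (q.1.2, q.2))
    have h2 : Measurable fun q : ((𝒰 × 𝒳) × 𝒟) × Ω => H (q.1, C.Mpot false q.1.2 q.2) :=
      hH.comp (measurable_fst.prodMk h1)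
    exact Measurable.lintegral_kernel_prod_right'
      (κ := κ.comap (fun p : (𝒰 × 𝒳) × 𝒟 => p.1) (by fun_prop)) h2
  have hind : ∀ (a : Bool) (G : Ω → ℝ≥0∞), ∫⁻ ω, G ω ∂(C.on P a) =
      ∫⁻ ω, ({a} : Set Bool).indicator 1 (C.A ω) * G ω ∂P := fun a G => by
    rw [← lintegral_indicator (measurableSet_arm a)]
    refine lintegral_congr fun ω => ?_
    by_cases hω : C.A ω = a <;> simp [Set.indicator, hω]
  have hindm : ∀ a : Bool, Measurable (({a} : Set Bool).indicator (1 : Bool → ℝ≥0∞)) := fun a =>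
    measurable_one.indicator (measurableSet_singleton a)
  -- cross-world independence
  have s1 : ∫⁻ ω, φ (C.nested ω) ∂P = ∫⁻ ω, Γ (C.UX ω, ω) ∂P :=
    lintegral_of_condIndep_both hUX h𝓖 h𝓗 hGH hκ
      (@measurable_nested (𝒰 × 𝒳) Ω Ω _ 𝓗 𝓖 𝒟 ℳ _ _ _ hGD _ hHM _ hGY φ hφ)
  have s2 : ∫⁻ ω, Γ (C.UX ω, ω) ∂P = ∫⁻ ω, ∫⁻ ω', Γ (C.UX ω, ω') ∂(κ (C.UX ω)) ∂P :=
    hκ.lintegral_eq hUX measurable_id hΓ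
  have hΓκ : Measurable fun v => ∫⁻ ω', Γ (v, ω') ∂(κ v) := hΓ.lintegral_kernel_prod_right'
  have s3 := hpos.lintegral_w0 hΓκ
  -- exchangeability of the treatment
  have s4 : ∫⁻ ω, ENNReal.ofReal (f.w0 (C.UX ω)) * Γ (C.UX ω, ω) ∂(C.on P true) =
      ∫⁻ ω, ENNReal.ofReal (f.w0 (C.UX ω)) * ∫⁻ ω', Γ (C.UX ω, ω') ∂(κ (C.UX ω)) ∂(C.on P true) := by
    rw [hind, hind]
    have hmG : @Measurable _ _ (@Prod.instMeasurableSpace ((𝒰 × 𝒳) × Bool) Ω inferInstance 𝓖₁) _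
        fun q : ((𝒰 × 𝒳) × Bool) × Ω => ({true} : Set Bool).indicator 1 q.1.2 *
          (ENNReal.ofReal (f.w0 q.1.1) * Γ (q.1.1, q.2)) :=
      @measurable_indicator_weight (𝒰 × 𝒳) Ω _ 𝓖₁ true _ f.measurable_w0 _ hΓ1
    refine (lintegral_of_condIndep_right hUX C.A_meas h𝓖₁ hG1A.symm hκ hmG).trans
      (lintegral_congr fun ω => ?_)
    simp only
    have hΓm : Measurable fun ω' => Γ (C.UX ω, ω') := hΓ.comp measurable_prodMk_left
    rw [lintegral_const_mul _ (hΓm.const_mul _), lintegral_const_mul _ hΓm]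
  -- Consistency for $D$ on arm 1; the independent copy of the mediator is now evaluated at the
  -- observed $D$.
  have s5 : ∫⁻ ω, ENNReal.ofReal (f.w0 (C.UX ω)) * Γ (C.UX ω, ω) ∂(C.on P true) =
      ∫⁻ ω, ENNReal.ofReal (f.w0 (C.UX ω)) * Γ₂ (C.UXD ω, ω) ∂(C.on P true) := by
    refine lintegral_congr_ae ?_
    filter_upwards [ae_restrict_of_ae hcons.D, ae_restrict_mem (measurableSet_arm true)] with ω h1 h2
    have h3 : C.A ω = true := h2
    have h4 := h1 true h3
    simp only [Γ, Γ₂, Ym, h3, h4]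
  -- averaging over the potential outcomes
  have hΓ₂L : ∀ t : (𝒰 × 𝒳) × 𝒟, ∫⁻ ω, Γ₂ (t, ω) ∂(L (t.2, true, t.1)) = N t := fun t => by
    have hm : Measurable fun q : Ω × Ω => φ (C.Ym (C.Mpot false t.2 q.2) q.1) := by
      have h1 : Measurable fun q : Ω × Ω => C.Mpot false t.2 q.2 :=
        hM0.comp (by fun_prop : Measurable fun q : Ω × Ω => (t.2, q.2))
      exact hφ.comp (hYm.comp (h1.prodMk measurable_fst))
    exact lintegral_lintegral_swap (μ := L (t.2, true, t.1)) (ν := κ t.1)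
      (f := fun ω ω' => φ (C.Ym (C.Mpot false t.2 ω') ω)) hm.aemeasurable
  have s6 : ∫⁻ ω, ENNReal.ofReal (f.w0 (C.UX ω)) * Γ₂ (C.UXD ω, ω) ∂(C.on P true) =
      ∫⁻ ω, ENNReal.ofReal (f.w0 (C.UX ω)) * N (C.UXD ω) ∂(C.on P true) := by
    rw [hind, hind]
    have hmG : Measurable fun q : (𝒟 × Bool × (𝒰 × 𝒳)) × Ω => ({true} : Set Bool).indicator 1 q.1.2.1 *
        (ENNReal.ofReal (f.w0 q.1.2.2) * Γ₂ ((q.1.2.2, q.1.1), q.2)) :=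
      ((hindm true).comp (by fun_prop)).mul ((f.measurable_w0.comp (by fun_prop)).ennreal_ofReal.mul
        (hΓ₂.comp (by fun_prop)))
    refine (hL.lintegral_eq hDAUX measurable_id hmG).trans (lintegral_congr fun ω => ?_)
    simp only
    have hΓm : Measurable fun ω' => Γ₂ ((C.UX ω, C.D ω), ω') := hΓ₂.comp measurable_prodMk_left
    rw [lintegral_const_mul _ (hΓm.const_mul _), lintegral_const_mul _ hΓm]
    by_cases hω : C.A ω = true
    · rw [hω, hΓ₂L (C.UX ω, C.D ω)]
    · simp [Set.indicator, hω]
  have s8 := hpos.lintegral_w1 hN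
  -- the mediator in arm `0`
  have s9 : ∫⁻ ω, ENNReal.ofReal (f.w1 (C.UXD ω)) * H (C.UXDM ω) ∂(C.on P false) =
      ∫⁻ ω, ENNReal.ofReal (f.w1 (C.UXD ω)) * N (C.UXD ω) ∂(C.on P false) := by
    have e1 : ∫⁻ ω, ENNReal.ofReal (f.w1 (C.UXD ω)) * H (C.UXDM ω) ∂(C.on P false) =
        ∫⁻ ω, ENNReal.ofReal (f.w1 (C.UXD ω)) * H (C.UXD ω, C.Mpot false (C.D ω) ω)
          ∂(C.on P false) := by
      refine lintegral_congr_ae ?_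
      filter_upwards [ae_restrict_of_ae hcons.M, ae_restrict_mem (measurableSet_arm false)]
        with ω h1 h2
      have h3 : C.A ω = false := h2
      rw [h1 false _ h3 rfl]
    rw [e1, hind, hind]
    have hmG : @Measurable _ _ (@Prod.instMeasurableSpace ((𝒰 × 𝒳) × (𝒟 × Bool)) Ω inferInstance 𝓗₁) _
        fun q : ((𝒰 × 𝒳) × (𝒟 × Bool)) × Ω => ({false} : Set Bool).indicator 1 q.1.2.2 *
          (ENNReal.ofReal (f.w1 (q.1.1, q.1.2.1)) *
            H ((q.1.1, q.1.2.1), C.Mpot false q.1.2.1 q.2)) :=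
      @measurable_indicator_mediator (𝒰 × 𝒳) Ω _ 𝓗₁ 𝒟 ℳ _ _ false _ f.measurable_w1 _ hH _ hH1M
    refine (lintegral_of_condIndep_right hUX (C.D_meas.prodMk C.A_meas) h𝓗₁ hH1DA.symm hκ hmG).trans
      (lintegral_congr fun ω => ?_)
    simp only
    have hHm : Measurable fun ω' => H ((C.UX ω, C.D ω), C.Mpot false (C.D ω) ω') :=
      hH.comp (measurable_const.prodMk (hM0.comp measurable_prodMk_left))
    rw [lintegral_const_mul _ (hHm.const_mul _), lintegral_const_mul _ hHm]
  have s10 := hpos.lintegral_w2 hH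
  -- exchangeability of the mediator
  have s11 : ∫⁻ ω, ENNReal.ofReal (f.w2 (C.UXDM ω)) * φ (C.Y ω) ∂(C.on P true) =
      ∫⁻ ω, ENNReal.ofReal (f.w2 (C.UXDM ω)) * H (C.UXDM ω) ∂(C.on P true) := by
    have e1 : ∫⁻ ω, ENNReal.ofReal (f.w2 (C.UXDM ω)) * φ (C.Y ω) ∂(C.on P true) =
        ∫⁻ ω, ENNReal.ofReal (f.w2 (C.UXDM ω)) * φ (C.Ym (C.M ω) ω) ∂(C.on P true) := by
      refine lintegral_congr_ae ?_
      filter_upwards [ae_restrict_of_ae hcons.D, ae_restrict_of_ae hcons.Y,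
        ae_restrict_mem (measurableSet_arm true)] with ω h0 h1 h2
      have h3 : C.A ω = true := h2
      have h4 : C.Ym (C.M ω) ω = C.Y ω := by
        simp only [Ym, Yam, h3]
        rw [h0 true h3]
        exact h1 true _ _ h3 rfl rfl
      rw [h4]
    rw [e1, hind, hind]
    have hmG : @Measurable _ _ (@Prod.instMeasurableSpace ((𝒟 × Bool × (𝒰 × 𝒳)) × ℳ) Ω inferInstance 𝓖₂)
        _ fun q : ((𝒟 × Bool × (𝒰 × 𝒳)) × ℳ) × Ω => ({true} : Set Bool).indicator 1 q.1.1.2.1 *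
          (ENNReal.ofReal (f.w2 ((q.1.1.2.2, q.1.1.1), q.1.2)) * φ (C.Ym q.1.2 q.2)) :=
      @measurable_indicator_outcome (𝒰 × 𝒳) Ω _ 𝓖₂ 𝒟 ℳ _ _ true _ f.measurable_w2 _ hφ _ hG2Y
    refine (lintegral_of_condIndep_right hDAUX C.M_meas h𝓖₂ hG2M.symm hL hmG).trans
      (lintegral_congr fun ω => ?_)
    simp only
    have hYm' : Measurable fun ω' => φ (C.Ym (C.M ω) ω') :=
      hφ.comp (hYm.comp measurable_prodMk_left)
    rw [lintegral_const_mul _ (hYm'.const_mul _), lintegral_const_mul _ hYm']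
    by_cases hω : C.A ω = true
    · simp only [H, hω]
    · simp [Set.indicator, hω]
  rw [s1, s2, ← s3, ← s4, s5, s6, ← s8, ← s9, ← s10, ← s11]

/-- The law of the nested counterfactual is that of `Y` on arm `1`, weighted by `w₂`. -/
lemma lintegral_nested (hcons : C.Consistency P) (hpos : C.Positivity P f)
    (hexch : C.Exchangeability P) (hcross : C.CrossWorld P) {φ : ℝ → ℝ≥0∞} (hφ : Measurable φ) :
    ∫⁻ ω, φ (C.nested ω) ∂P =
      ∫⁻ ω, ENNReal.ofReal (f.w2 (C.UXDM ω)) * φ (C.Y ω) ∂(C.on P true) := by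
  have h1 := hcross true false
  have h2 := hexch.YD true
  have h3 := hexch.Y
  have h4 := hexch.M false
  obtain ⟨_, h𝓖, _, h𝓗, hGY, hGD, hHM, hGH⟩ := h1
  obtain ⟨_, h𝓖₁, hG1Y, hG1D, hG1A⟩ := h2
  obtain ⟨_, h𝓖₂, hG2Y, hG2M⟩ := h3
  obtain ⟨_, h𝓗₁, hH1M, hH1DA⟩ := h4
  exact lintegral_nested_aux (mΩ := mΩ) hcons hpos h𝓖 h𝓗 hGY hGD hHM hGH h𝓖₁ hG1Y hG1D hG1A h𝓖₂
    hG2Y hG2M h𝓗₁ hH1M hH1DA hφ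

/-- Identification of the estimand by weighting with `w₂`. -/
lemma integral_w2_mul_Y (hcons : C.Consistency P) (hpos : C.Positivity P f)
    (hexch : C.Exchangeability P) (hcross : C.CrossWorld P) (hint : Integrable C.nested P) :
    Integrable (fun ω => f.w2 (C.UXDM ω) * C.Y ω) (C.on P true) ∧
      ∫ ω, f.w2 (C.UXDM ω) * C.Y ω ∂(C.on P true) = C.psi P := by
  have hwm : Measurable fun ω => f.w2 (C.UXDM ω) := by fun_prop
  -- Equality of the laws, tested on all nonnegative functions, transfers integrability together
  -- with the mean. Thus existence of the estimand yields integrability of $w_2Y$.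
  have hmap : P.map C.nested =
      ((C.on P true).withDensity fun ω => ENNReal.ofReal (f.w2 (C.UXDM ω))).map C.Y := by
    refine Measure.ext_of_lintegral _ fun φ hφ => ?_
    rw [lintegral_map' hφ.aemeasurable hint.aemeasurable, lintegral_map hφ C.Y_meas,
      lintegral_withDensity_eq_lintegral_mul (g := fun ω => φ (C.Y ω)) _ hwm.ennreal_ofReal
        (hφ.comp C.Y_meas), lintegral_nested hcons hpos hexch hcross hφ]
    rfl
  have hw0 : ∀ᵐ ω ∂(C.on P true), 0 ≤ f.w2 (C.UXDM ω) := by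
    refine (hpos.ae_UXDM true (p := fun t => 0 ≤ f.w2 t)
      (measurableSet_le measurable_const f.measurable_w2)).2 ?_
    filter_upwards [hpos.pos2 true, hpos.pos2 false] with v hv hv'
    obtain ⟨h3, h4, h5⟩ := hv
    obtain ⟨h6, h7, h8⟩ := hv'
    unfold Densities.w2
    positivity
  have hae : (fun ω => (ENNReal.ofReal (f.w2 (C.UXDM ω))).toReal • C.Y ω) =ᵐ[C.on P true]
      fun ω => f.w2 (C.UXDM ω) * C.Y ω := by
    filter_upwards [hw0] with ω hω
    rw [ENNReal.toReal_ofReal hω, smul_eq_mul]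
  have hlt : ∀ᵐ ω ∂(C.on P true), ENNReal.ofReal (f.w2 (C.UXDM ω)) < ∞ :=
    Eventually.of_forall fun _ => ENNReal.ofReal_lt_top
  have hid : Integrable (fun x : ℝ => x) (P.map C.nested) :=
    (integrable_map_measure (by fun_prop) hint.aemeasurable).2 hint
  constructor
  · rw [hmap, integrable_map_measure (by fun_prop) C.Y_meas.aemeasurable,
      integrable_withDensity_iff_integrable_smul' hwm.ennreal_ofReal hlt] at hid
    exact hid.congr hae
  · have h1 : C.psi P = ∫ x, x ∂(P.map C.nested) :=
      (integral_map (f := fun x => x) hint.aemeasurable (by fun_prop)).symm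
    rw [h1, hmap, integral_map C.Y_meas.aemeasurable (by fun_prop),
      integral_withDensity_eq_integral_toReal_smul hwm.ennreal_ofReal hlt]
    exact (integral_congr_ae hae).symm

end PathSpecific.CausalModel

/-! ### Observed-data moment equations -/

section General

variable {Ω τ β : Type*} [mΩ : MeasurableSpace Ω] [MeasurableSpace τ] [MeasurableSpace β]

lemma condMeanZero_map_iff {μ : Measure Ω} {g : Ω → β} (hg : Measurable g) {R : β → ℝ}
    (hR : AEStronglyMeasurable R (μ.map g)) {T : β → τ} (hT : Measurable T) :
    CondMeanZero (μ.map g) R T ↔ CondMeanZero μ (fun ω => R (g ω)) (fun ω => T (g ω)) := by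
  refine forall₂_congr fun s hs => ?_
  rw [setIntegral_map (hT hs) hR hg.aemeasurable]
  rfl

lemma condMeanZero_restrict_iff {μ : Measure Ω} {E : Set Ω} (hE : MeasurableSet E) {R : Ω → ℝ}
    {T : Ω → τ} : CondMeanZero (μ.restrict E) R T ↔ CondMeanZero μ (E.indicator R) T := by
  refine forall₂_congr fun s hs => ?_
  rw [integral_indicator hE, Measure.restrict_restrict hE, Measure.restrict_restrict' hE,
    Set.inter_comm]

lemma CondMeanZero.integral_smul_eq_zero {μ : Measure Ω} [IsFiniteMeasure μ] {R : Ω → ℝ} {T : Ω → τ}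
    (h : CondMeanZero μ R T) (hT : Measurable T) (hR : Integrable R μ) {d : ℕ}
    {c : τ → EuclideanSpace ℝ (Fin d)} (hc : Measurable c)
    (hi : Integrable (fun ω => R ω • c (T ω)) μ) : ∫ ω, R ω • c (T ω) ∂μ = 0 := by
  ext i
  let p : EuclideanSpace ℝ (Fin d) →L[ℝ] ℝ := EuclideanSpace.proj (𝕜 := ℝ) i
  have h1 : ∫ ω, R ω * c (T ω) i ∂μ = (∫ ω, R ω • c (T ω) ∂μ) i := p.integral_comp_comm hi
  have h2 : Integrable (fun ω => R ω * c (T ω) i) μ := p.integrable_comp hi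
  rw [PiLp.zero_apply, ← h1]
  simp only [mul_comm (R _)] at h2 ⊢
  have hci : Measurable fun t => c t i := by fun_prop
  exact h.integral_mul hT hR hci h2

lemma MeasureTheory.MemLp.integrable_mul' {μ : Measure Ω} {f g : Ω → ℝ} (hf : MemLp f 2 μ)
    (hg : MemLp g 2 μ) : Integrable (fun ω => f ω * g ω) μ := hf.integrable_mul hg

lemma integral_mul_sub_of_memLp {μ : Measure Ω} {f g h : Ω → ℝ} (hf : MemLp f 2 μ)
    (hg : MemLp g 2 μ) (hh : MemLp h 2 μ) :
    ∫ ω, f ω * (g ω - h ω) ∂μ = (∫ ω, f ω * g ω ∂μ) - ∫ ω, f ω * h ω ∂μ := by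
  rw [← integral_sub (hf.integrable_mul' hg) (hf.integrable_mul' hh)]
  simp only [mul_sub]

end General

namespace PathSpecific

open Obs

section Observed

variable {𝒟 ℳ 𝒲 𝒵 𝒳 : Type*} [MeasurableSpace 𝒟] [MeasurableSpace ℳ] [MeasurableSpace 𝒲]
  [MeasurableSpace 𝒵] [MeasurableSpace 𝒳] {Q : Measure (Obs 𝒟 ℳ 𝒲 𝒵 𝒳)}

lemma measurableSet_arm (a : Bool) : MeasurableSet (arm a : Set (Obs 𝒟 ℳ 𝒲 𝒵 𝒳)) :=
  measurable_fst (measurableSet_singleton a)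

lemma trt_mul_eq_indicator (R : Obs 𝒟 ℳ 𝒲 𝒵 𝒳 → ℝ) :
    (fun o => trt o * R o) = (arm true).indicator R := by
  funext o
  by_cases h : A o = true <;> simp [trt, arm, Set.indicator, h]

lemma one_sub_trt_mul_eq_indicator (R : Obs 𝒟 ℳ 𝒲 𝒵 𝒳 → ℝ) :
    (fun o => (1 - trt o) * R o) = (arm false).indicator R := by
  funext o
  by_cases h : A o = true <;> simp [trt, arm, Set.indicator, h]

lemma memLp_trt_mul_iff {R : Obs 𝒟 ℳ 𝒲 𝒵 𝒳 → ℝ} {p : ℝ≥0∞} :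
    MemLp (fun o => trt o * R o) p Q ↔ MemLp R p (Q.restrict (arm true)) := by
  rw [trt_mul_eq_indicator, memLp_indicator_iff_restrict (measurableSet_arm true)]

lemma memLp_one_sub_trt_mul_iff {R : Obs 𝒟 ℳ 𝒲 𝒵 𝒳 → ℝ} {p : ℝ≥0∞} :
    MemLp (fun o => (1 - trt o) * R o) p Q ↔ MemLp R p (Q.restrict (arm false)) := by
  rw [one_sub_trt_mul_eq_indicator, memLp_indicator_iff_restrict (measurableSet_arm false)]

lemma integral_trt_mul (R : Obs 𝒟 ℳ 𝒲 𝒵 𝒳 → ℝ) :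
    ∫ o, trt o * R o ∂Q = ∫ o in arm true, R o ∂Q := by
  rw [trt_mul_eq_indicator, integral_indicator (measurableSet_arm true)]

lemma integral_one_sub_trt_mul (R : Obs 𝒟 ℳ 𝒲 𝒵 𝒳 → ℝ) :
    ∫ o, (1 - trt o) * R o ∂Q = ∫ o in arm false, R o ∂Q := by
  rw [one_sub_trt_mul_eq_indicator, integral_indicator (measurableSet_arm false)]

lemma condMeanZero_trt_mul_iff {R : Obs 𝒟 ℳ 𝒲 𝒵 𝒳 → ℝ} {τ : Type*} [MeasurableSpace τ]
    {T : Obs 𝒟 ℳ 𝒲 𝒵 𝒳 → τ} :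
    CondMeanZero Q (fun o => trt o * R o) T ↔ CondMeanZero (Q.restrict (arm true)) R T := by
  rw [trt_mul_eq_indicator, condMeanZero_restrict_iff (measurableSet_arm true)]

lemma condMeanZero_one_sub_trt_mul_iff {R : Obs 𝒟 ℳ 𝒲 𝒵 𝒳 → ℝ} {τ : Type*} [MeasurableSpace τ]
    {T : Obs 𝒟 ℳ 𝒲 𝒵 𝒳 → τ} :
    CondMeanZero Q (fun o => (1 - trt o) * R o) T ↔ CondMeanZero (Q.restrict (arm false)) R T := by
  rw [one_sub_trt_mul_eq_indicator, condMeanZero_restrict_iff (measurableSet_arm false)]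

/-! ### Bridge equations as conditional moment restrictions -/

variable {h2 : 𝒲 × ℳ × 𝒟 × 𝒳 → ℝ} {h1 : 𝒲 × 𝒟 × 𝒳 → ℝ} {h0 : 𝒲 × 𝒳 → ℝ}
  {q0 : 𝒵 × 𝒳 → ℝ} {q1 : 𝒵 × 𝒟 × 𝒳 → ℝ} {q2 : 𝒵 × ℳ × 𝒟 × 𝒳 → ℝ}

variable [IsFiniteMeasure Q]

lemma isH2_iff (hY : MemLp (fun o => Y o) 2 Q) : IsH2 Q h2 ↔
    Measurable h2 ∧ MemLp (fun o => h2 (WMDX o)) 2 Q ∧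
      CondMeanZero Q (fun o => trt o * (Y o - h2 (WMDX o))) ZMDX := by
  have key : ∀ _ : MemLp (fun o => h2 (WMDX o)) 2 Q, _ := fun h =>
    cond_condExp_ae_eq_iff (μ := Q) (E := arm true) (f := fun o => Y o)
      (g := fun o => h2 (WMDX o)) (T := ZMDX) (by fun_prop)
      ((hY.restrict _).integrable one_le_two) ((h.restrict _).integrable one_le_two)
  rw [condMeanZero_trt_mul_iff]
  exact ⟨fun h => ⟨h.meas, h.sq, (key h.sq).1 h.eqn⟩, fun h => ⟨h.1, h.2.1, (key h.2.1).2 h.2.2⟩⟩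

lemma isH1_iff (hh : MemLp (fun o => h2 (WMDX o)) 2 Q) : IsH1 Q h2 h1 ↔
    Measurable h1 ∧ MemLp (fun o => h1 (WDX o)) 2 Q ∧
      CondMeanZero Q (fun o => (1 - trt o) * (h2 (WMDX o) - h1 (WDX o))) ZDX := by
  have key : ∀ _ : MemLp (fun o => h1 (WDX o)) 2 Q, _ := fun h =>
    cond_condExp_ae_eq_iff (μ := Q) (E := arm false) (f := fun o => h2 (WMDX o))
      (g := fun o => h1 (WDX o)) (T := ZDX) (by fun_prop)
      ((hh.restrict _).integrable one_le_two) ((h.restrict _).integrable one_le_two)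
  rw [condMeanZero_one_sub_trt_mul_iff]
  exact ⟨fun h => ⟨h.meas, h.sq, (key h.sq).1 h.eqn⟩, fun h => ⟨h.1, h.2.1, (key h.2.1).2 h.2.2⟩⟩

lemma isH0_iff (hh : MemLp (fun o => h1 (WDX o)) 2 Q) : IsH0 Q h1 h0 ↔
    Measurable h0 ∧ MemLp (fun o => h0 (WX o)) 2 Q ∧
      CondMeanZero Q (fun o => trt o * (h1 (WDX o) - h0 (WX o))) ZX := by
  have key : ∀ _ : MemLp (fun o => h0 (WX o)) 2 Q, _ := fun h =>
    cond_condExp_ae_eq_iff (μ := Q) (E := arm true) (f := fun o => h1 (WDX o))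
      (g := fun o => h0 (WX o)) (T := ZX) (by fun_prop)
      ((hh.restrict _).integrable one_le_two) ((h.restrict _).integrable one_le_two)
  rw [condMeanZero_trt_mul_iff]
  exact ⟨fun h => ⟨h.meas, h.sq, (key h.sq).1 h.eqn⟩, fun h => ⟨h.1, h.2.1, (key h.2.1).2 h.2.2⟩⟩

/-- The arms have equivalent laws of `(W,M,D,X)`. -/
def ArmsEquivalent (Q : Measure (Obs 𝒟 ℳ 𝒲 𝒵 𝒳)) : Prop :=
  ∀ a, Q (arm a) ≠ 0 ∧ ∀ s, MeasurableSet s → Q (WMDX ⁻¹' s ∩ arm a) = 0 → Q (WMDX ⁻¹' s) = 0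

/-- The reciprocal $1/f(A=1\mid W,X)$ is read as the odds of the whole space against arm 1 with
constant numerator 1, so this equation is a special case of the balance lemma. The division is
harmless because the law of $(W,X)$ is carried by arm 1 up to null sets. -/
lemma IsQ0.condMeanZero [IsProbabilityMeasure Q] (hQ : ArmsEquivalent Q) (h : IsQ0 Q q0) :
    MemLp (fun o => trt o * q0 (ZX o)) 2 Q ∧
      CondMeanZero Q (fun o => trt o * q0 (ZX o) - 1) WX := by
  have h2 := (memLp_cond_iff (hQ true).1).1 h.sq
  refine ⟨memLp_trt_mul_iff.2 h2, ?_⟩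
  have h3 := balanced_of_odds (μ := Q) (E := Set.univ) (E' := arm true) .univ (measurableSet_arm true)
    (F := fun _ => 1) (F' := fun o => q0 (ZX o)) (T := WX) (by fun_prop)
    (integrable_const 1).integrableOn (h2.integrable one_le_two) (fun s hs h0 => ?_) ?_
  · have := h3.symm
    unfold CondBalanced at this
    rw [← trt_mul_eq_indicator] at this
    simpa using this
  · have h4 : Measurable fun t : 𝒲 × ℳ × 𝒟 × 𝒳 => (t.1, t.2.2.2) := by fun_prop
    rw [Set.inter_univ]
    exact (hQ true).2 _ (h4 hs) h0
  · have h5 : ProbabilityTheory.cond Q Set.univ = Q := by simp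
    rw [h5]
    have h6 : Measurable (WX : Obs 𝒟 ℳ 𝒲 𝒵 𝒳 → _) := by fun_prop
    simp only [Set.indicator_univ, condExp_const h6.comap_le]
    simpa using h.eqn

lemma IsQ1.condMeanZero (hQ : ArmsEquivalent Q) (h0 : MemLp (fun o => q0 (ZX o)) 2 (given Q true))
    (h : IsQ1 Q q0 q1) :
    MemLp (fun o => (1 - trt o) * q1 (ZDX o)) 2 Q ∧
      CondMeanZero Q (fun o => (1 - trt o) * q1 (ZDX o) - trt o * q0 (ZX o)) WDX := by
  have h2 := (memLp_cond_iff (hQ false).1).1 h.sq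
  have h02 := (memLp_cond_iff (hQ true).1).1 h0
  refine ⟨memLp_one_sub_trt_mul_iff.2 h2, ?_⟩
  have h3 := balanced_of_odds (μ := Q) (measurableSet_arm true) (measurableSet_arm false)
    (F := fun o => q0 (ZX o)) (F' := fun o => q1 (ZDX o)) (T := WDX) (by fun_prop)
    (h02.integrable one_le_two) (h2.integrable one_le_two) (fun s hs h0 => ?_) h.eqn
  · have := h3.symm
    unfold CondBalanced at this
    rwa [← trt_mul_eq_indicator, ← one_sub_trt_mul_eq_indicator] at this
  · have h4 : Measurable fun t : 𝒲 × ℳ × 𝒟 × 𝒳 => (t.1, t.2.2.1, t.2.2.2) := by fun_prop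
    exact measure_mono_null Set.inter_subset_left ((hQ false).2 _ (h4 hs) h0)

lemma IsQ2.condMeanZero (hQ : ArmsEquivalent Q) (h1 : MemLp (fun o => q1 (ZDX o)) 2 (given Q false))
    (h : IsQ2 Q q1 q2) :
    MemLp (fun o => trt o * q2 (ZMDX o)) 2 Q ∧
      CondMeanZero Q (fun o => trt o * q2 (ZMDX o) - (1 - trt o) * q1 (ZDX o)) WMDX := by
  have h2 := (memLp_cond_iff (hQ true).1).1 h.sq
  have h02 := (memLp_cond_iff (hQ false).1).1 h1
  refine ⟨memLp_trt_mul_iff.2 h2, ?_⟩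
  have h3 := balanced_of_odds (μ := Q) (measurableSet_arm false) (measurableSet_arm true)
    (F := fun o => q1 (ZDX o)) (F' := fun o => q2 (ZMDX o)) (T := WMDX) (by fun_prop)
    (h02.integrable one_le_two) (h2.integrable one_le_two) (fun s hs h0 => ?_) h.eqn
  · have := h3.symm
    unfold CondBalanced at this
    rwa [← trt_mul_eq_indicator, ← one_sub_trt_mul_eq_indicator] at this
  · exact measure_mono_null Set.inter_subset_left ((hQ true).2 _ hs h0)

/-! ### The mean of the moment function -/

/-- Square-integrability of the ingredients of the moment function. -/
structure SqBridges (Q : Measure (Obs 𝒟 ℳ 𝒲 𝒵 𝒳)) (h2 : 𝒲 × ℳ × 𝒟 × 𝒳 → ℝ) (h1 : 𝒲 × 𝒟 × 𝒳 → ℝ)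
    (h0 : 𝒲 × 𝒳 → ℝ) (q0 : 𝒵 × 𝒳 → ℝ) (q1 : 𝒵 × 𝒟 × 𝒳 → ℝ) (q2 : 𝒵 × ℳ × 𝒟 × 𝒳 → ℝ) :
    Prop where
  mh2 : Measurable h2
  mh1 : Measurable h1
  mh0 : Measurable h0
  mq0 : Measurable q0
  mq1 : Measurable q1
  mq2 : Measurable q2
  Y : MemLp (fun o => Y o) 2 Q
  h2 : MemLp (fun o => h2 (WMDX o)) 2 Q
  h1 : MemLp (fun o => h1 (WDX o)) 2 Q
  h0 : MemLp (fun o => h0 (WX o)) 2 Q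
  q0 : MemLp (fun o => trt o * q0 (ZX o)) 2 Q
  q1 : MemLp (fun o => (1 - trt o) * q1 (ZDX o)) 2 Q
  q2 : MemLp (fun o => trt o * q2 (ZMDX o)) 2 Q

namespace SqBridges

lemma integral_moment (h : SqBridges Q h2 h1 h0 q0 q1 q2) : ∫ o, moment h2 h1 h0 q0 q1 q2 o ∂Q =
    (∫ o, trt o * q0 (ZX o) * (h1 (WDX o) - h0 (WX o)) ∂Q) +
    (∫ o, (1 - trt o) * q1 (ZDX o) * (h2 (WMDX o) - h1 (WDX o)) ∂Q) +
    (∫ o, trt o * q2 (ZMDX o) * (Obs.Y o - h2 (WMDX o)) ∂Q) + ∫ o, h0 (WX o) ∂Q := by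
  have i1 : Integrable (fun o => trt o * q0 (ZX o) * (h1 (WDX o) - h0 (WX o))) Q :=
    h.q0.integrable_mul (h.h1.sub h.h0)
  have i2 : Integrable (fun o => (1 - trt o) * q1 (ZDX o) * (h2 (WMDX o) - h1 (WDX o))) Q :=
    h.q1.integrable_mul (h.h2.sub h.h1)
  have i3 : Integrable (fun o => trt o * q2 (ZMDX o) * (Obs.Y o - h2 (WMDX o))) Q :=
    h.q2.integrable_mul (h.Y.sub h.h2)
  have i4 := h.h0.integrable one_le_two
  unfold moment
  have i12 : Integrable (fun o => trt o * q0 (ZX o) * (h1 (WDX o) - h0 (WX o)) +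
      (1 - trt o) * q1 (ZDX o) * (h2 (WMDX o) - h1 (WDX o))) Q := i1.add i2
  have i123 : Integrable (fun o => trt o * q0 (ZX o) * (h1 (WDX o) - h0 (WX o)) +
      (1 - trt o) * q1 (ZDX o) * (h2 (WMDX o) - h1 (WDX o)) +
      trt o * q2 (ZMDX o) * (Obs.Y o - h2 (WMDX o))) Q := i12.add i3
  rw [integral_add i123 i4, integral_add i12 i3, integral_add i1 i2]

/-- The factor $q_2$ depends only on the conditioning variables of the $h_2$ equation. Hence a
correct outcome bridge annihilates its increment whatever the treatment function is; the same reason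
serves for $h_1$ and $h_0$. -/
lemma term_h2 (h : SqBridges Q h2 h1 h0 q0 q1 q2)
    (hc : CondMeanZero Q (fun o => trt o * (Obs.Y o - h2 (WMDX o))) ZMDX) :
    ∫ o, trt o * q2 (ZMDX o) * (Obs.Y o - h2 (WMDX o)) ∂Q = 0 := by
  have hi := h.q2.integrable_mul (h.Y.sub h.h2)
  have e : ∀ o : Obs 𝒟 ℳ 𝒲 𝒵 𝒳, trt o * q2 (ZMDX o) * (Obs.Y o - h2 (WMDX o)) =
    q2 (ZMDX o) * (trt o * (Obs.Y o - h2 (WMDX o))) := fun o => by ring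
  rw [integral_congr_ae (Eventually.of_forall e)]
  exact hc.integral_mul (by fun_prop)
    ((memLp_trt_mul_iff.2 ((h.Y.sub h.h2).restrict _)).integrable one_le_two)
    h.mq2 (hi.congr (Eventually.of_forall e))

lemma term_h1 (h : SqBridges Q h2 h1 h0 q0 q1 q2)
    (hc : CondMeanZero Q (fun o => (1 - trt o) * (h2 (WMDX o) - h1 (WDX o))) ZDX) :
    ∫ o, (1 - trt o) * q1 (ZDX o) * (h2 (WMDX o) - h1 (WDX o)) ∂Q = 0 := by
  have hi := h.q1.integrable_mul (h.h2.sub h.h1)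
  have e : ∀ o : Obs 𝒟 ℳ 𝒲 𝒵 𝒳, (1 - trt o) * q1 (ZDX o) * (h2 (WMDX o) - h1 (WDX o)) =
    q1 (ZDX o) * ((1 - trt o) * (h2 (WMDX o) - h1 (WDX o))) := fun o => by ring
  rw [integral_congr_ae (Eventually.of_forall e)]
  exact hc.integral_mul (by fun_prop)
    ((memLp_one_sub_trt_mul_iff.2 ((h.h2.sub h.h1).restrict _)).integrable one_le_two)
    h.mq1 (hi.congr (Eventually.of_forall e))

lemma term_h0 (h : SqBridges Q h2 h1 h0 q0 q1 q2)
    (hc : CondMeanZero Q (fun o => trt o * (h1 (WDX o) - h0 (WX o))) ZX) :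
    ∫ o, trt o * q0 (ZX o) * (h1 (WDX o) - h0 (WX o)) ∂Q = 0 := by
  have hi := h.q0.integrable_mul (h.h1.sub h.h0)
  have e : ∀ o : Obs 𝒟 ℳ 𝒲 𝒵 𝒳, trt o * q0 (ZX o) * (h1 (WDX o) - h0 (WX o)) =
    q0 (ZX o) * (trt o * (h1 (WDX o) - h0 (WX o))) := fun o => by ring
  rw [integral_congr_ae (Eventually.of_forall e)]
  exact hc.integral_mul (by fun_prop)
    ((memLp_trt_mul_iff.2 ((h.h1.sub h.h0).restrict _)).integrable one_le_two)
    h.mq0 (hi.congr (Eventually.of_forall e))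

/-- The dual mechanism: $h_0$ depends only on the conditioning variables of the $q_0$ equation, so a
correct treatment bridge exchanges a weighted mean for the neighbouring one whatever the outcome
function is. -/
lemma term_q0 (h : SqBridges Q h2 h1 h0 q0 q1 q2)
    (hc : CondMeanZero Q (fun o => trt o * q0 (ZX o) - 1) WX) :
    ∫ o, trt o * q0 (ZX o) * h0 (WX o) ∂Q = ∫ o, h0 (WX o) ∂Q := by
  have hi := h.q0.integrable_mul h.h0
  have := hc.integral_mul_congr (R := fun o => trt o * q0 (ZX o)) (R' := fun _ => 1) (by fun_prop)
    (h.q0.integrable one_le_two) (integrable_const 1) h.mh0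
    (hi.congr (Eventually.of_forall fun o => mul_comm _ _)) (by simpa using h.h0.integrable one_le_two)
  simp only [mul_one] at this
  rw [← this]
  exact integral_congr_ae (Eventually.of_forall fun o => mul_comm _ _)

lemma term_q1 (h : SqBridges Q h2 h1 h0 q0 q1 q2)
    (hc : CondMeanZero Q (fun o => (1 - trt o) * q1 (ZDX o) - trt o * q0 (ZX o)) WDX) :
    ∫ o, (1 - trt o) * q1 (ZDX o) * h1 (WDX o) ∂Q = ∫ o, trt o * q0 (ZX o) * h1 (WDX o) ∂Q := by
  have hi := h.q1.integrable_mul h.h1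
  have hi' := h.q0.integrable_mul h.h1
  have := hc.integral_mul_congr (by fun_prop)
    (h.q1.integrable one_le_two) (h.q0.integrable one_le_two) h.mh1
    (hi.congr (Eventually.of_forall fun o => mul_comm _ _))
    (hi'.congr (Eventually.of_forall fun o => mul_comm _ _))
  simpa only [mul_comm (h1 _)] using this

lemma term_q2 (h : SqBridges Q h2 h1 h0 q0 q1 q2)
    (hc : CondMeanZero Q (fun o => trt o * q2 (ZMDX o) - (1 - trt o) * q1 (ZDX o)) WMDX) :
    ∫ o, trt o * q2 (ZMDX o) * h2 (WMDX o) ∂Q = ∫ o, (1 - trt o) * q1 (ZDX o) * h2 (WMDX o) ∂Q := by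
  have hi := h.q2.integrable_mul h.h2
  have hi' := h.q1.integrable_mul h.h2
  have := hc.integral_mul_congr (by fun_prop)
    (h.q2.integrable one_le_two) (h.q1.integrable one_le_two) h.mh2
    (hi.congr (Eventually.of_forall fun o => mul_comm _ _))
    (hi'.congr (Eventually.of_forall fun o => mul_comm _ _))
  simpa only [mul_comm (h2 _)] using this

lemma expand (h : SqBridges Q h2 h1 h0 q0 q1 q2) :
    ((∫ o, trt o * q0 (ZX o) * (h1 (WDX o) - h0 (WX o)) ∂Q) =
      (∫ o, trt o * q0 (ZX o) * h1 (WDX o) ∂Q) - ∫ o, trt o * q0 (ZX o) * h0 (WX o) ∂Q) ∧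
    ((∫ o, (1 - trt o) * q1 (ZDX o) * (h2 (WMDX o) - h1 (WDX o)) ∂Q) =
      (∫ o, (1 - trt o) * q1 (ZDX o) * h2 (WMDX o) ∂Q) -
        ∫ o, (1 - trt o) * q1 (ZDX o) * h1 (WDX o) ∂Q) ∧
    (∫ o, trt o * q2 (ZMDX o) * (Obs.Y o - h2 (WMDX o)) ∂Q) =
      (∫ o, trt o * q2 (ZMDX o) * Obs.Y o ∂Q) - ∫ o, trt o * q2 (ZMDX o) * h2 (WMDX o) ∂Q := by
  exact ⟨integral_mul_sub_of_memLp h.q0 h.h1 h.h0, integral_mul_sub_of_memLp h.q1 h.h2 h.h1,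
    integral_mul_sub_of_memLp h.q2 h.Y h.h2⟩

end SqBridges

end Observed

end PathSpecific

/-! ### Correct specification makes the root a bridge function -/

namespace PathSpecific

open Obs

section Spec

variable {𝒟 ℳ 𝒲 𝒵 𝒳 : Type*} [MeasurableSpace 𝒟] [MeasurableSpace ℳ] [MeasurableSpace 𝒲]
  [MeasurableSpace 𝒵] [MeasurableSpace 𝒳] {Q : Measure (Obs 𝒟 ℳ 𝒲 𝒵 𝒳)} [IsProbabilityMeasure Q]
  {k : Dims} {B : BridgeModels k 𝒟 ℳ 𝒲 𝒵 𝒳} {θs : Param k}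

/-- For a non-integrable product the integral is zero by convention, so no moment condition on the
vector function is needed here. -/
lemma _root_.CondMeanZero.integral_smul_eq_zero' {Ω τ : Type*} [MeasurableSpace Ω] [MeasurableSpace τ]
    {μ : Measure Ω} [IsFiniteMeasure μ] {R : Ω → ℝ} {T : Ω → τ}
    (h : CondMeanZero μ R T) (hT : Measurable T) (hR : Integrable R μ) {d : ℕ}
    {c : τ → EuclideanSpace ℝ (Fin d)} (hc : Measurable c) : ∫ ω, R ω • c (T ω) ∂μ = 0 := by
  by_cases hi : Integrable (fun ω => R ω • c (T ω)) μ
  · exact h.integral_smul_eq_zero hT hR hc hi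
  · exact integral_undef hi

namespace Regularity

/-- A bridge function solves the population estimating equation for any choice of $c_2$, and the
root is unique. The later equations are treated in the same way, each with its predecessor already
fixed at its limit. -/
lemma b2_eq (h : Regularity Q B θs) {β : EuclideanSpace ℝ (Fin k.b2)} (hβ : β ∈ B.B2)
    (hh : IsH2 Q (B.h2 β)) : β = θs.b2 :=
  h.uniq_b2 β hβ (((isH2_iff h.Y_sq).1 hh).2.2.integral_smul_eq_zero' (by fun_prop)
    ((memLp_trt_mul_iff.2 ((h.Y_sq.sub hh.sq).restrict _)).integrable one_le_two) B.c2_meas)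

lemma b1_eq (h : Regularity Q B θs) {β : EuclideanSpace ℝ (Fin k.b1)} (hβ : β ∈ B.B1)
    (hh : IsH1 Q (B.h2 θs.b2) (B.h1 β)) : β = θs.b1 :=
  h.uniq_b1 β hβ (((isH1_iff h.h2_sq).1 hh).2.2.integral_smul_eq_zero' (by fun_prop)
    ((memLp_one_sub_trt_mul_iff.2 ((h.h2_sq.sub hh.sq).restrict _)).integrable one_le_two) B.c1_meas)

lemma b0_eq (h : Regularity Q B θs) {β : EuclideanSpace ℝ (Fin k.b0)} (hβ : β ∈ B.B0)
    (hh : IsH0 Q (B.h1 θs.b1) (B.h0 β)) : β = θs.b0 :=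
  h.uniq_b0 β hβ (((isH0_iff h.h1_sq).1 hh).2.2.integral_smul_eq_zero' (by fun_prop)
    ((memLp_trt_mul_iff.2 ((h.h1_sq.sub hh.sq).restrict _)).integrable one_le_two) B.c0_meas)

lemma g0_eq (h : Regularity Q B θs) (hQ : ArmsEquivalent Q) {γ : EuclideanSpace ℝ (Fin k.g0)}
    (hγ : γ ∈ B.G0) (hh : IsQ0 Q (B.q0 γ)) : γ = θs.g0 :=
  h.uniq_g0 γ hγ ((hh.condMeanZero hQ).2.integral_smul_eq_zero' (by fun_prop)
    (((hh.condMeanZero hQ).1.integrable one_le_two).sub (integrable_const 1)) B.d0_meas)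

lemma memLp_q0 (h : Regularity Q B θs) (hQ : ArmsEquivalent Q) :
    MemLp (fun o => trt o * B.q0 θs.g0 (ZX o)) 2 Q :=
  memLp_trt_mul_iff.2 ((memLp_cond_iff (hQ true).1).1 h.q0_sq)

lemma memLp_q1 (h : Regularity Q B θs) (hQ : ArmsEquivalent Q) :
    MemLp (fun o => (1 - trt o) * B.q1 θs.g1 (ZDX o)) 2 Q :=
  memLp_one_sub_trt_mul_iff.2 ((memLp_cond_iff (hQ false).1).1 h.q1_sq)

lemma memLp_q2 (h : Regularity Q B θs) (hQ : ArmsEquivalent Q) :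
    MemLp (fun o => trt o * B.q2 θs.g2 (ZMDX o)) 2 Q :=
  memLp_trt_mul_iff.2 ((memLp_cond_iff (hQ true).1).1 h.q2_sq)

lemma g1_eq (h : Regularity Q B θs) (hQ : ArmsEquivalent Q) {γ : EuclideanSpace ℝ (Fin k.g1)}
    (hγ : γ ∈ B.G1) (hh : IsQ1 Q (B.q0 θs.g0) (B.q1 γ)) : γ = θs.g1 :=
  h.uniq_g1 γ hγ ((hh.condMeanZero hQ h.q0_sq).2.integral_smul_eq_zero' (by fun_prop)
    (((hh.condMeanZero hQ h.q0_sq).1.integrable one_le_two).sub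
      ((h.memLp_q0 hQ).integrable one_le_two)) B.d1_meas)

lemma g2_eq (h : Regularity Q B θs) (hQ : ArmsEquivalent Q) {γ : EuclideanSpace ℝ (Fin k.g2)}
    (hγ : γ ∈ B.G2) (hh : IsQ2 Q (B.q1 θs.g1) (B.q2 γ)) : γ = θs.g2 :=
  h.uniq_g2 γ hγ ((hh.condMeanZero hQ h.q1_sq).2.integral_smul_eq_zero' (by fun_prop)
    (((hh.condMeanZero hQ h.q1_sq).1.integrable one_le_two).sub
      ((h.memLp_q1 hQ).integrable one_le_two)) B.d2_meas)

lemma of_spec1 (h : Regularity Q B θs) (hs : B.Spec1 Q) : IsH2 Q (B.h2 θs.b2) ∧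
    IsH1 Q (B.h2 θs.b2) (B.h1 θs.b1) ∧ IsH0 Q (B.h1 θs.b1) (B.h0 θs.b0) := by
  obtain ⟨β2, m2, β1, m1, β0, m0, e2, e1, e0⟩ := hs
  obtain rfl := h.b2_eq m2 e2
  obtain rfl := h.b1_eq m1 e1
  obtain rfl := h.b0_eq m0 e0
  exact ⟨e2, e1, e0⟩

lemma of_spec2 (h : Regularity Q B θs) (hQ : ArmsEquivalent Q) (hs : B.Spec2 Q) :
    IsQ0 Q (B.q0 θs.g0) ∧ IsQ1 Q (B.q0 θs.g0) (B.q1 θs.g1) ∧ IsQ2 Q (B.q1 θs.g1) (B.q2 θs.g2) := by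
  obtain ⟨γ0, m0, γ1, m1, γ2, m2, e0, e1, e2⟩ := hs
  obtain rfl := h.g0_eq hQ m0 e0
  obtain rfl := h.g1_eq hQ m1 e1
  obtain rfl := h.g2_eq hQ m2 e2
  exact ⟨e0, e1, e2⟩

lemma of_spec3 (h : Regularity Q B θs) (hQ : ArmsEquivalent Q) (hs : B.Spec3 Q) :
    IsH2 Q (B.h2 θs.b2) ∧ IsH1 Q (B.h2 θs.b2) (B.h1 θs.b1) ∧ IsQ0 Q (B.q0 θs.g0) := by
  obtain ⟨β2, m2, β1, m1, γ0, m0, e2, e1, e0⟩ := hs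
  obtain rfl := h.b2_eq m2 e2
  obtain rfl := h.b1_eq m1 e1
  obtain rfl := h.g0_eq hQ m0 e0
  exact ⟨e2, e1, e0⟩

lemma of_spec4 (h : Regularity Q B θs) (hQ : ArmsEquivalent Q) (hs : B.Spec4 Q) :
    IsH2 Q (B.h2 θs.b2) ∧ IsQ0 Q (B.q0 θs.g0) ∧ IsQ1 Q (B.q0 θs.g0) (B.q1 θs.g1) := by
  obtain ⟨β2, m2, γ0, m0, γ1, m1, e2, e0, e1⟩ := hs
  obtain rfl := h.b2_eq m2 e2
  obtain rfl := h.g0_eq hQ m0 e0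
  obtain rfl := h.g1_eq hQ m1 e1
  exact ⟨e2, e0, e1⟩

lemma sqBridges (h : Regularity Q B θs) (hQ : ArmsEquivalent Q) :
    SqBridges Q (B.h2 θs.b2) (B.h1 θs.b1) (B.h0 θs.b0) (B.q0 θs.g0) (B.q1 θs.g1) (B.q2 θs.g2) where
  mh2 := B.h2_meas.comp measurable_prodMk_left
  mh1 := B.h1_meas.comp measurable_prodMk_left
  mh0 := B.h0_meas.comp measurable_prodMk_left
  mq0 := B.q0_meas.comp measurable_prodMk_left
  mq1 := B.q1_meas.comp measurable_prodMk_left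
  mq2 := B.q2_meas.comp measurable_prodMk_left
  Y := h.Y_sq
  h2 := h.h2_sq
  h1 := h.h1_sq
  h0 := h.h0_sq
  q0 := h.memLp_q0 hQ
  q1 := h.memLp_q1 hQ
  q2 := h.memLp_q2 hQ

end Regularity

end Spec

/-! ### Identification of the estimand under each of the four submodels -/

namespace CausalModel

variable {Ω 𝒰 𝒟 ℳ 𝒲 𝒵 𝒳 : Type*} [mΩ : MeasurableSpace Ω] [MeasurableSpace 𝒰]
  [MeasurableSpace 𝒟] [MeasurableSpace ℳ] [MeasurableSpace 𝒲] [MeasurableSpace 𝒵]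
  [MeasurableSpace 𝒳]

variable {C : CausalModel Ω 𝒰 𝒟 ℳ 𝒲 𝒵 𝒳} {P : Measure Ω} [IsProbabilityMeasure P]
  {f : Densities 𝒰 𝒟 ℳ 𝒳} {κW : Kernel (𝒰 × 𝒳) 𝒲} {κZ : Bool → Kernel (𝒰 × 𝒳) 𝒵}

instance isProbabilityMeasure_map_obs : IsProbabilityMeasure (P.map C.obs) :=
  Measure.isProbabilityMeasure_map measurable_obs.aemeasurable

lemma map_obs_restrict (a : Bool) : (P.map C.obs).restrict (arm a) = (C.on P a).map C.obs :=
  Measure.restrict_map measurable_obs (PathSpecific.measurableSet_arm a)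

/-- Latent positivity makes the laws of $(U,X,D,M)$ on the two arms equivalent, and $W$ has the same
conditional law on both. Hence observed events for $(W,M,D,X)$ have the same null sets on each arm,
which makes the observed odds meaningful. -/
lemma ProxyKernels.armsEquivalent (h : C.ProxyKernels P κW κZ) (hpos : C.Positivity P f) :
    ArmsEquivalent (P.map C.obs) := fun a => by
  refine ⟨?_, fun s hs h0 => ?_⟩
  · rw [Measure.map_apply measurable_obs (PathSpecific.measurableSet_arm a)]
    exact hpos.ne_zero a
  · have hm : Measurable (Obs.WMDX : Obs 𝒟 ℳ 𝒲 𝒵 𝒳 → _) := by fun_prop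
    have h1 := h.ae_of_ae_arm hpos a (p := fun t => t ∉ s) hs.compl ?_
    · rw [Measure.map_apply measurable_obs (hm hs)]
      rw [ae_iff] at h1
      simp only [not_not] at h1
      exact h1
    · rw [Measure.map_apply measurable_obs ((hm hs).inter (PathSpecific.measurableSet_arm a))] at h0
      rw [ae_iff, Measure.restrict_apply' (measurableSet_arm a)]
      simp only [not_not]
      exact h0

lemma integral_obs {F : Obs 𝒟 ℳ 𝒲 𝒵 𝒳 → ℝ} (hF : Measurable F) :
    ∫ o, F o ∂(P.map C.obs) = ∫ ω, F (C.obs ω) ∂P :=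
  integral_map measurable_obs.aemeasurable hF.aestronglyMeasurable

lemma setIntegral_obs (a : Bool) {F : Obs 𝒟 ℳ 𝒲 𝒵 𝒳 → ℝ} (hF : Measurable F) :
    ∫ o in arm a, F o ∂(P.map C.obs) = ∫ ω, F (C.obs ω) ∂(C.on P a) := by
  rw [map_obs_restrict, integral_map measurable_obs.aemeasurable hF.aestronglyMeasurable]

lemma memLp_obs {F : Obs 𝒟 ℳ 𝒲 𝒵 𝒳 → ℝ} (hF : Measurable F) (h : MemLp F 2 (P.map C.obs)) :
    MemLp (fun ω => F (C.obs ω)) 2 P :=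
  (memLp_map_measure_iff hF.aestronglyMeasurable measurable_obs.aemeasurable).1 h

lemma memLp_obs_restrict (a : Bool) {F : Obs 𝒟 ℳ 𝒲 𝒵 𝒳 → ℝ} (hF : Measurable F)
    (h : MemLp F 2 ((P.map C.obs).restrict (arm a))) :
    MemLp (fun ω => F (C.obs ω)) 2 (C.on P a) := by
  rw [map_obs_restrict] at h
  exact (memLp_map_measure_iff hF.aestronglyMeasurable measurable_obs.aemeasurable).1 h

lemma condMeanZero_obs_true {F : Obs 𝒟 ℳ 𝒲 𝒵 𝒳 → ℝ} (hF : Measurable F) {τ : Type*}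
    [MeasurableSpace τ] {T : Obs 𝒟 ℳ 𝒲 𝒵 𝒳 → τ} (hT : Measurable T) :
    CondMeanZero (P.map C.obs) (fun o => trt o * F o) T ↔
    CondMeanZero (C.on P true) (fun ω => F (C.obs ω)) fun ω => T (C.obs ω) := by
  rw [condMeanZero_trt_mul_iff, map_obs_restrict,
    condMeanZero_map_iff measurable_obs hF.aestronglyMeasurable hT]

lemma condMeanZero_obs_false {F : Obs 𝒟 ℳ 𝒲 𝒵 𝒳 → ℝ} (hF : Measurable F) {τ : Type*}
    [MeasurableSpace τ] {T : Obs 𝒟 ℳ 𝒲 𝒵 𝒳 → τ} (hT : Measurable T) :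
    CondMeanZero (P.map C.obs) (fun o => (1 - trt o) * F o) T ↔
    CondMeanZero (C.on P false) (fun ω => F (C.obs ω)) fun ω => T (C.obs ω) := by
  rw [condMeanZero_one_sub_trt_mul_iff, map_obs_restrict,
    condMeanZero_map_iff measurable_obs hF.aestronglyMeasurable hT]

lemma trt_obs (F : Ω → ℝ) : (fun ω => trt (C.obs ω) * F ω) = {ω | C.A ω = true}.indicator F := by
  funext ω
  by_cases h : C.A ω = true <;> simp [trt, obs, Set.indicator, h]

lemma one_sub_trt_obs (F : Ω → ℝ) :
    (fun ω => (1 - trt (C.obs ω)) * F ω) = {ω | C.A ω = false}.indicator F := by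
  funext ω
  by_cases h : C.A ω = true <;> simp [trt, obs, Set.indicator, h]

variable {h2 : 𝒲 × ℳ × 𝒟 × 𝒳 → ℝ} {h1 : 𝒲 × 𝒟 × 𝒳 → ℝ} {h0 : 𝒲 × 𝒳 → ℝ}
  {q0 : 𝒵 × 𝒳 → ℝ} {q1 : 𝒵 × 𝒟 × 𝒳 → ℝ} {q2 : 𝒵 × ℳ × 𝒟 × 𝒳 → ℝ}

lemma balanced_q0 (hq : Measurable q0)
    (h : CondMeanZero (P.map C.obs) (fun o => trt o * q0 (Obs.ZX o) - 1) Obs.WX) :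
    CondBalanced P {ω | C.A ω = true} Set.univ (fun ω => q0 (C.ZX ω)) (fun _ => 1) C.WX := by
  have hm : Measurable fun o : Obs 𝒟 ℳ 𝒲 𝒵 𝒳 => trt o * q0 (Obs.ZX o) - 1 := by fun_prop
  have h' := (condMeanZero_map_iff measurable_obs hm.aestronglyMeasurable (by fun_prop)).1 h
  unfold CondBalanced
  rw [← trt_obs]
  simp only [Set.indicator_univ]
  exact h'

lemma balanced_q1 (hq : Measurable q0) (hq' : Measurable q1)
    (h : CondMeanZero (P.map C.obs)
      (fun o => (1 - trt o) * q1 (Obs.ZDX o) - trt o * q0 (Obs.ZX o)) Obs.WDX) :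
    CondBalanced P {ω | C.A ω = false} {ω | C.A ω = true} (fun ω => q1 (C.ZDX ω))
      (fun ω => q0 (C.ZX ω)) C.WDX := by
  have hm : Measurable fun o : Obs 𝒟 ℳ 𝒲 𝒵 𝒳 =>
    (1 - trt o) * q1 (Obs.ZDX o) - trt o * q0 (Obs.ZX o) := by fun_prop
  have h' := (condMeanZero_map_iff measurable_obs hm.aestronglyMeasurable (by fun_prop)).1 h
  unfold CondBalanced
  rw [← trt_obs, ← one_sub_trt_obs]
  exact h'

lemma balanced_q2 (hq : Measurable q1) (hq' : Measurable q2)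
    (h : CondMeanZero (P.map C.obs)
      (fun o => trt o * q2 (Obs.ZMDX o) - (1 - trt o) * q1 (Obs.ZDX o)) Obs.WMDX) :
    CondBalanced P {ω | C.A ω = true} {ω | C.A ω = false} (fun ω => q2 (C.ZMDX ω))
      (fun ω => q1 (C.ZDX ω)) C.WMDX := by
  have hm : Measurable fun o : Obs 𝒟 ℳ 𝒲 𝒵 𝒳 =>
    trt o * q2 (Obs.ZMDX o) - (1 - trt o) * q1 (Obs.ZDX o) := by fun_prop
  have h' := (condMeanZero_map_iff measurable_obs hm.aestronglyMeasurable (by fun_prop)).1 h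
  unfold CondBalanced
  rw [← trt_obs, ← one_sub_trt_obs]
  exact h'

section Identification

variable (hκ : C.ProxyKernels P κW κZ) (hpos : C.Positivity P f)
  (hψ : Integrable (fun ω => f.w2 (C.UXDM ω) * C.Y ω) (C.on P true) ∧
    ∫ ω, f.w2 (C.UXDM ω) * C.Y ω ∂(C.on P true) = C.psi P)
  (hs : SqBridges (P.map C.obs) h2 h1 h0 q0 q1 q2)
include hκ hpos hψ hs

lemma ident_h2 (hz1 : C.CompleteZ1 P) (e2 : IsH2 (P.map C.obs) h2) :
    Integrable (fun ω => f.w1 (C.UXD ω) * eta2 κW h2 (C.UXDM ω)) (C.on P false) ∧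
      ∫ ω, f.w1 (C.UXD ω) * eta2 κW h2 (C.UXDM ω) ∂(C.on P false) = C.psi P := by
  have hm := hs.mh2
  exact hκ.chain_h2 hpos hz1 (memLp_obs (by fun_prop) hs.Y) hψ hs.mh2
    (memLp_obs (by fun_prop) hs.h2)
    ((condMeanZero_obs_true (by fun_prop) (by fun_prop)).1 ((isH2_iff hs.Y).1 e2).2.2)

lemma ident_h1 (hz1 : C.CompleteZ1 P) (hz2 : C.CompleteZ2 P) (e2 : IsH2 (P.map C.obs) h2)
    (e1 : IsH1 (P.map C.obs) h2 h1) :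
    Integrable (fun ω => f.w0 (C.UX ω) * eta1 κW h1 (C.UXD ω)) (C.on P true) ∧
      ∫ ω, f.w0 (C.UX ω) * eta1 κW h1 (C.UXD ω) ∂(C.on P true) = C.psi P := by
  have hm := hs.mh2
  have hm' := hs.mh1
  exact hκ.chain_h1 hpos hz2 (ident_h2 hκ hpos hψ hs hz1 e2) hs.mh2
    (memLp_obs (by fun_prop) hs.h2) hs.mh1 (memLp_obs (by fun_prop) hs.h1)
    ((condMeanZero_obs_false (by fun_prop) (by fun_prop)).1 ((isH1_iff hs.h2).1 e1).2.2)

/-- Identification by the outcome bridge functions. -/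
lemma integral_moment_of_h (hz1 : C.CompleteZ1 P) (hz2 : C.CompleteZ2 P) (hz3 : C.CompleteZ3 P)
    (e2 : IsH2 (P.map C.obs) h2) (e1 : IsH1 (P.map C.obs) h2 h1) (e0 : IsH0 (P.map C.obs) h1 h0) :
    ∫ o, h0 (Obs.WX o) ∂(P.map C.obs) = C.psi P ∧
      ∫ o, moment h2 h1 h0 q0 q1 q2 o ∂(P.map C.obs) = C.psi P := by
  have hm := hs.mh1
  have hm' := hs.mh0
  have c0 := hκ.chain_h0 hpos hz3 (ident_h1 hκ hpos hψ hs hz1 hz2 e2 e1) hs.mh1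
    (memLp_obs (by fun_prop) hs.h1) hs.mh0 (memLp_obs (by fun_prop) hs.h0)
    ((condMeanZero_obs_true (by fun_prop) (by fun_prop)).1 ((isH0_iff hs.h1).1 e0).2.2)
  have c1 : ∫ o, h0 (Obs.WX o) ∂(P.map C.obs) = C.psi P := by
    rw [integral_obs (by fun_prop)]
    exact c0
  refine ⟨c1, ?_⟩
  rw [hs.integral_moment, hs.term_h0 ((isH0_iff hs.h1).1 e0).2.2,
    hs.term_h1 ((isH1_iff hs.h2).1 e1).2.2, hs.term_h2 ((isH2_iff hs.Y).1 e2).2.2, c1]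
  ring

/-- Identification by the treatment bridge functions. -/
lemma integral_moment_of_q [StandardBorelSpace 𝒲] [StandardBorelSpace 𝒳]
    (hw1 : C.CompleteW1 P) (hw2 : C.CompleteW2 P) (k0 : C.Weight0 P f)
    (k1 : C.Weight1 P f) (k2 : C.Weight2 P f) (e0 : IsQ0 (P.map C.obs) q0)
    (e1 : IsQ1 (P.map C.obs) q0 q1) (e2 : IsQ2 (P.map C.obs) q1 q2) :
    ∫ o, moment h2 h1 h0 q0 q1 q2 o ∂(P.map C.obs) = C.psi P := by
  have hQ := hκ.armsEquivalent hpos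
  have mq0 := hs.mq0
  have mq1 := hs.mq1
  have mq2 := hs.mq2
  obtain ⟨-, r0⟩ := e0.condMeanZero hQ
  obtain ⟨-, r1⟩ := e1.condMeanZero hQ e0.sq
  obtain ⟨-, r2⟩ := e2.condMeanZero hQ e1.sq
  have i0 : MemLp (fun ω => q0 (C.ZX ω)) 2 (C.on P true) :=
    memLp_obs_restrict true (by fun_prop) (memLp_trt_mul_iff.1 hs.q0)
  have i1 : MemLp (fun ω => q1 (C.ZDX ω)) 2 (C.on P false) :=
    memLp_obs_restrict false (by fun_prop) (memLp_one_sub_trt_mul_iff.1 hs.q1)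
  have i2 : MemLp (fun ω => q2 (C.ZMDX ω)) 2 (C.on P true) :=
    memLp_obs_restrict true (by fun_prop) (memLp_trt_mul_iff.1 hs.q2)
  have a0 := hκ.qbar0_eq hpos hw1 k0 hs.mq0 i0 (balanced_q0 hs.mq0 r0)
  have a1 := hκ.qbar1_eq hpos hw2 k0 k1 hs.mq0 i0 a0 hs.mq1 i1 (balanced_q1 hs.mq0 hs.mq1 r1)
  have a2 := hκ.qbar2_eq hpos hw1 k1 k2 hs.mq1 i1 a1 hs.mq2 i2 (balanced_q2 hs.mq1 hs.mq2 r2)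
  have hY : MemLp C.Y 2 (C.on P true) := (memLp_obs (by fun_prop) hs.Y).restrict _
  obtain ⟨-, s2, s2'⟩ := hκ.qbar2_spec true hs.mq2 i2
  -- Conditionally on the core, $q_2$ may be replaced by its latent mean $w_2$ when multiplied by
  -- $Y$; this is the first expression of the identification chain.
  have b1 : ∫ o, trt o * q2 (Obs.ZMDX o) * Obs.Y o ∂(P.map C.obs) = C.psi P := by
    simp only [mul_assoc]
    rw [integral_trt_mul, setIntegral_obs true (by fun_prop), ← hψ.2]
    have b2 := s2'.integral_mul_congr (by fun_prop) (i2.integrable one_le_two)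
      (s2.integrable one_le_two) (g := fun t => t.2.2.2.2) (by fun_prop)
      (hY.integrable_mul i2) (hY.integrable_mul s2)
    refine (integral_congr_ae (Eventually.of_forall fun ω => ?_)).trans
      (b2.trans (integral_congr_ae ?_))
    · exact mul_comm _ _
    · filter_upwards [a2] with ω hω
      rw [hω, mul_comm]
  -- The equations for $q_0,q_1,q_2$ cancel the terms in $h_0,h_1,h_2$ pairwise and leave
  -- $E[Aq_2Y]$.
  obtain ⟨x1, x2, x3⟩ := hs.expand
  rw [hs.integral_moment, x1, x2, x3, hs.term_q0 r0, hs.term_q1 r1, hs.term_q2 r2, b1]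
  ring

/-- Identification by `h₂, h₁, q₀`. -/
lemma integral_moment_of_h2_h1_q0 (hz1 : C.CompleteZ1 P) (hz2 : C.CompleteZ2 P) (hw1 : C.CompleteW1 P)
    (k0 : C.Weight0 P f) (e2 : IsH2 (P.map C.obs) h2) (e1 : IsH1 (P.map C.obs) h2 h1)
    (e0 : IsQ0 (P.map C.obs) q0) : ∫ o, moment h2 h1 h0 q0 q1 q2 o ∂(P.map C.obs) = C.psi P := by
  have hQ := hκ.armsEquivalent hpos
  have mq0 := hs.mq0
  have mh1 := hs.mh1
  obtain ⟨-, r0⟩ := e0.condMeanZero hQ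
  have i0 : MemLp (fun ω => q0 (C.ZX ω)) 2 (C.on P true) :=
    memLp_obs_restrict true (by fun_prop) (memLp_trt_mul_iff.1 hs.q0)
  have a0 := hκ.qbar0_eq hpos hw1 k0 hs.mq0 i0 (balanced_q0 hs.mq0 r0)
  have hh : MemLp (fun ω => h1 (C.WDX ω)) 2 (C.on P true) := (memLp_obs (by fun_prop) hs.h1).restrict _
  have hw : MemLp (fun ω => f.w0 (C.UX ω)) 2 (C.on P true) :=
    (memLp_cond_iff (hpos.ne_zero true)).1 k0
  obtain ⟨-, s0, s0'⟩ := hκ.qbar0_spec true hs.mq0 i0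
  obtain ⟨t1, t1'⟩ := hκ.eta1_spec true hs.mh1 hh
  -- Here $q_0$ is averaged to $w_0$ and then $h_1$ to $\eta_1$, so the integral meets the chain at
  -- $E[Aw_0\eta_1]$.
  have b1 : ∫ o, trt o * q0 (Obs.ZX o) * h1 (Obs.WDX o) ∂(P.map C.obs) = C.psi P := by
    simp only [mul_assoc]
    rw [integral_trt_mul, setIntegral_obs true (by fun_prop), ← (ident_h1 hκ hpos hψ hs hz1 hz2 e2 e1).2]
    have b2 := s0'.integral_mul_congr (by fun_prop) (i0.integrable one_le_two)
      (s0.integrable one_le_two) (g := fun t => h1 (t.2.1, t.2.2.1, t.1.2)) (by fun_prop)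
      (hh.integrable_mul i0) (hh.integrable_mul s0)
    have b3 := t1'.integral_mul_congr (by fun_prop) (hh.integrable one_le_two)
      (t1.integrable one_le_two) (g := fun t => f.w0 t.1.1) (by fun_prop)
      (hw.integrable_mul hh) (hw.integrable_mul t1)
    refine (integral_congr_ae (Eventually.of_forall fun ω => ?_)).trans
      (b2.trans ((integral_congr_ae ?_).trans b3))
    · exact mul_comm _ _
    · filter_upwards [a0] with ω hω
      rw [hω, mul_comm]
  obtain ⟨x1, -, -⟩ := hs.expand
  rw [hs.integral_moment, x1, hs.term_h1 ((isH1_iff hs.h2).1 e1).2.2,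
    hs.term_h2 ((isH2_iff hs.Y).1 e2).2.2, hs.term_q0 r0, b1]
  ring

/-- Identification by `h₂, q₀, q₁`. -/
lemma integral_moment_of_h2_q0_q1 (hz1 : C.CompleteZ1 P) (hw1 : C.CompleteW1 P) (hw2 : C.CompleteW2 P)
    (k0 : C.Weight0 P f) (k1 : C.Weight1 P f) (e2 : IsH2 (P.map C.obs) h2)
    (e0 : IsQ0 (P.map C.obs) q0) (e1 : IsQ1 (P.map C.obs) q0 q1) :
    ∫ o, moment h2 h1 h0 q0 q1 q2 o ∂(P.map C.obs) = C.psi P := by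
  have hQ := hκ.armsEquivalent hpos
  have mq0 := hs.mq0
  have mq1 := hs.mq1
  have mh2 := hs.mh2
  obtain ⟨-, r0⟩ := e0.condMeanZero hQ
  obtain ⟨-, r1⟩ := e1.condMeanZero hQ e0.sq
  have i0 : MemLp (fun ω => q0 (C.ZX ω)) 2 (C.on P true) :=
    memLp_obs_restrict true (by fun_prop) (memLp_trt_mul_iff.1 hs.q0)
  have i1 : MemLp (fun ω => q1 (C.ZDX ω)) 2 (C.on P false) :=
    memLp_obs_restrict false (by fun_prop) (memLp_one_sub_trt_mul_iff.1 hs.q1)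
  have a0 := hκ.qbar0_eq hpos hw1 k0 hs.mq0 i0 (balanced_q0 hs.mq0 r0)
  have a1 := hκ.qbar1_eq hpos hw2 k0 k1 hs.mq0 i0 a0 hs.mq1 i1 (balanced_q1 hs.mq0 hs.mq1 r1)
  have hh : MemLp (fun ω => h2 (C.WMDX ω)) 2 (C.on P false) :=
    (memLp_obs (by fun_prop) hs.h2).restrict _
  have hw : MemLp (fun ω => f.w1 (C.UXD ω)) 2 (C.on P false) :=
    (memLp_cond_iff (hpos.ne_zero false)).1 k1
  obtain ⟨-, s0, s0'⟩ := hκ.qbar1_spec false hs.mq1 i1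
  obtain ⟨t1, t1'⟩ := hκ.eta2_spec false hs.mh2 hh
  -- Here $q_1$ is averaged to $w_1$ and then $h_2$ to $\eta_2$, so the integral meets the chain at
  -- $E[(1-A)w_1\eta_2]$.
  have b1 : ∫ o, (1 - trt o) * q1 (Obs.ZDX o) * h2 (Obs.WMDX o) ∂(P.map C.obs) = C.psi P := by
    simp only [mul_assoc]
    rw [integral_one_sub_trt_mul, setIntegral_obs false (by fun_prop),
      ← (ident_h2 hκ hpos hψ hs hz1 e2).2]
    have b2 := s0'.integral_mul_congr (by fun_prop) (i1.integrable one_le_two)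
      (s0.integrable one_le_two) (g := fun t => h2 (t.2.1, t.2.2.2.1, t.2.2.1, t.1.2)) (by fun_prop)
      (hh.integrable_mul i1) (hh.integrable_mul s0)
    have b3 := t1'.integral_mul_congr (by fun_prop) (hh.integrable one_le_two)
      (t1.integrable one_le_two) (g := fun t => f.w1 t.1) (by fun_prop)
      (hw.integrable_mul hh) (hw.integrable_mul t1)
    refine (integral_congr_ae (Eventually.of_forall fun ω => ?_)).trans
      (b2.trans ((integral_congr_ae ?_).trans b3))
    · exact mul_comm _ _
    · filter_upwards [a1] with ω hω
      rw [hω, mul_comm]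
  obtain ⟨x1, x2, -⟩ := hs.expand
  rw [hs.integral_moment, x1, x2, hs.term_h2 ((isH2_iff hs.Y).1 e2).2.2, hs.term_q0 r0,
    hs.term_q1 r1, b1]
  ring

end Identification

/-- Quadruple robustness: the probability limit is the estimand in each of the four submodels. -/
lemma integral_quad_eq_psi [StandardBorelSpace 𝒲] [StandardBorelSpace 𝒳] {k : Dims}
    {B : BridgeModels k 𝒟 ℳ 𝒲 𝒵 𝒳} {θs : Param k} (hκ : C.ProxyKernels P κW κZ)
    (hpos : C.Positivity P f)
    (hψ : Integrable (fun ω => f.w2 (C.UXDM ω) * C.Y ω) (C.on P true) ∧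
      ∫ ω, f.w2 (C.UXDM ω) * C.Y ω ∂(C.on P true) = C.psi P)
    (hreg : Regularity (P.map C.obs) B θs)
    (h : C.InM1 P B ∨ C.InM2 P f B ∨ C.InM3 P f B ∨ C.InM4 P f B) :
    ∫ o, B.quad o θs ∂(P.map C.obs) = C.psi P := by
  have hQ := hκ.armsEquivalent hpos
  have hs := hreg.sqBridges hQ
  rcases h with h | h | h | h
  · obtain ⟨e2, e1, e0⟩ := hreg.of_spec1 h.spec
    exact (integral_moment_of_h hκ hpos hψ hs h.z1 h.z2 h.z3 e2 e1 e0).2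
  · obtain ⟨e0, e1, e2⟩ := hreg.of_spec2 hQ h.spec
    exact integral_moment_of_q hκ hpos hψ hs h.w1 h.w2 h.weight0 h.weight1 h.weight2 e0 e1 e2
  · obtain ⟨e2, e1, e0⟩ := hreg.of_spec3 hQ h.spec
    exact integral_moment_of_h2_h1_q0 hκ hpos hψ hs h.z1 h.z2 h.w1 h.weight0 e2 e1 e0
  · obtain ⟨e2, e0, e1⟩ := hreg.of_spec4 hQ h.spec
    exact integral_moment_of_h2_q0_q1 hκ hpos hψ hs h.z1 h.w1 h.w2 h.weight0 h.weight1 e2 e0 e1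

end CausalModel

end PathSpecific

/-! ### Orthogonality of the moment function to the nuisance parameters -/

lemma HasFDerivAt.apply_eq_zero_of_eventually_eq {E : Type*} [NormedAddCommGroup E] [NormedSpace ℝ E]
    {F : E → ℝ} {L : E →L[ℝ] ℝ} {x v : E} (h : HasFDerivAt F L x) {N : Set E} (hN : N ∈ 𝓝 x)
    (hv : ∀ t : ℝ, x + t • v ∈ N → F (x + t • v) = F x) : L v = 0 := by
  have hl : HasDerivAt (fun t : ℝ => x + t • v) v 0 := by
    simpa using ((hasDerivAt_id (0 : ℝ)).smul_const v).const_add x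
  have h0 : x + (0 : ℝ) • v = x := by simp
  have h1 : HasDerivAt (fun t : ℝ => F (x + t • v)) (L v) 0 :=
    HasFDerivAt.comp_hasDerivAt (f := fun t : ℝ => x + t • v) 0 (by rwa [h0]) hl
  have h2 : (fun t : ℝ => F (x + t • v)) =ᶠ[𝓝 0] fun _ => F x := by
    filter_upwards [hl.continuousAt.preimage_mem_nhds (t := N) (by rwa [h0])] with t ht
    exact hv t ht
  exact h1.unique ((hasDerivAt_const _ _).congr_of_eventuallyEq h2)

namespace PathSpecific

open Obs

section Orthogonality

variable {𝒟 ℳ 𝒲 𝒵 𝒳 : Type*} [MeasurableSpace 𝒟] [MeasurableSpace ℳ] [MeasurableSpace 𝒲]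
  [MeasurableSpace 𝒵] [MeasurableSpace 𝒳] {Q : Measure (Obs 𝒟 ℳ 𝒲 𝒵 𝒳)} [IsProbabilityMeasure Q]
  {k : Dims} {B : BridgeModels k 𝒟 ℳ 𝒲 𝒵 𝒳} {θs : Param k}

namespace Regularity

lemma hasFDerivAt_integral_quad (h : Regularity Q B θs) :
    HasFDerivAt (fun θ => ∫ o, B.quad o θ ∂Q) (∫ o, fderiv ℝ (B.quad o) θs ∂Q) θs := by
  obtain ⟨N, hN, hθN, hNB, hd, K, hK, hKb⟩ := h.quad_smooth.deriv
  have hm : ∀ θ, AEStronglyMeasurable (fun o => B.quad o θ) Q := fun θ =>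
    (B.measurable_quad.comp measurable_prodMk_right).aestronglyMeasurable
  have hdiff : ∀ᵐ o ∂Q, ∀ θ ∈ N, DifferentiableAt ℝ (B.quad o) θ := by
    filter_upwards [hd] with o ho θ hθ
    exact (ho.differentiableOn one_ne_zero).differentiableAt (hN.mem_nhds hθ)
  refine hasFDerivAt_integral_of_dominated_of_fderiv_le (F := fun θ o => B.quad o θ)
    (F' := fun θ o => fderiv ℝ (B.quad o) θ) (bound := K) (hN.mem_nhds hθN)
    (Eventually.of_forall hm) (h.integrable_quad (hNB hθN)) ?_ hKb hK ?_
  · exact aestronglyMeasurable_fderiv hm (by filter_upwards [hdiff] with o ho using ho θs hθN)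
  · filter_upwards [hdiff] with o ho θ hθ
    exact (ho θ hθ).hasFDerivAt

/-- The mean of the moment function does not change when one bridge function is perturbed within
its model. -/
lemma integral_quad_eq (h : Regularity Q B θs) {θ : Param k} (hθ : θ ∈ B.space)
    (hθs : θs ∈ B.space) {τ : Type*} [MeasurableSpace τ] {T : Obs 𝒟 ℳ 𝒲 𝒵 𝒳 → τ} (hT : Measurable T)
    {R : Obs 𝒟 ℳ 𝒲 𝒵 𝒳 → ℝ} (hR : Integrable R Q) (hRT : CondMeanZero Q R T) {g : τ → ℝ}
    (hg : Measurable g) (hq : ∀ o, B.quad o θ - B.quad o θs = g (T o) * R o) :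
    ∫ o, B.quad o θ ∂Q = ∫ o, B.quad o θs ∂Q := by
  have hi := (h.integrable_quad hθ).sub (h.integrable_quad hθs)
  rw [← sub_eq_zero, ← integral_sub (h.integrable_quad hθ) (h.integrable_quad hθs),
    integral_congr_ae (Eventually.of_forall hq)]
  exact hRT.integral_mul hT hR hg (hi.congr (Eventually.of_forall hq))

lemma fderiv_quad_apply_eq_zero (h : Regularity Q B θs) {v : Param k}
    (hv : ∀ t : ℝ, θs + t • v ∈ B.space →
      ∫ o, B.quad o (θs + t • v) ∂Q = ∫ o, B.quad o θs ∂Q) :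
    (∫ o, fderiv ℝ (B.quad o) θs ∂Q) v = 0 := by
  obtain ⟨N, hN, hθN, hNB, -⟩ := h.quad_smooth.deriv
  exact h.hasFDerivAt_integral_quad.apply_eq_zero_of_eventually_eq
    (mem_of_superset (hN.mem_nhds hθN) hNB) hv

/-- With all bridge functions correct, the expected derivative of the moment function vanishes. -/
lemma integral_fderiv_quad_eq_zero (h : Regularity Q B θs) (hQ : ArmsEquivalent Q)
    (hh : IsH2 Q (B.h2 θs.b2) ∧ IsH1 Q (B.h2 θs.b2) (B.h1 θs.b1) ∧ IsH0 Q (B.h1 θs.b1) (B.h0 θs.b0))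
    (hq : IsQ0 Q (B.q0 θs.g0) ∧ IsQ1 Q (B.q0 θs.g0) (B.q1 θs.g1) ∧
      IsQ2 Q (B.q1 θs.g1) (B.q2 θs.g2)) :
    ∫ o, fderiv ℝ (B.quad o) θs ∂Q = 0 := by
  obtain ⟨e2, e1, e0⟩ := hh
  obtain ⟨k0, k1, k2⟩ := hq
  have hs : θs ∈ B.space := h.quad_smooth.mem
  have S := h.sqBridges hQ
  have c2 := ((isH2_iff h.Y_sq).1 e2).2.2
  have c1 := ((isH1_iff h.h2_sq).1 e1).2.2
  have c0 := ((isH0_iff h.h1_sq).1 e0).2.2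
  obtain ⟨j0, r0⟩ := k0.condMeanZero hQ
  obtain ⟨j1, r1⟩ := k1.condMeanZero hQ k0.sq
  obtain ⟨j2, r2⟩ := k2.condMeanZero hQ k1.sq
  have mh2 : ∀ β, Measurable (B.h2 β) := fun β => B.h2_meas.comp measurable_prodMk_left
  have mh1 : ∀ β, Measurable (B.h1 β) := fun β => B.h1_meas.comp measurable_prodMk_left
  have mh0 : ∀ β, Measurable (B.h0 β) := fun β => B.h0_meas.comp measurable_prodMk_left
  have mq0 : ∀ β, Measurable (B.q0 β) := fun β => B.q0_meas.comp measurable_prodMk_left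
  have mq1 : ∀ β, Measurable (B.q1 β) := fun β => B.q1_meas.comp measurable_prodMk_left
  have mq2 : ∀ β, Measurable (B.q2 β) := fun β => B.q2_meas.comp measurable_prodMk_left
  have i0 := j0.integrable one_le_two
  have i1 := j1.integrable one_le_two
  have i2 := j2.integrable one_le_two
  have l2 := (memLp_trt_mul_iff.2 ((h.Y_sq.sub h.h2_sq).restrict _)).integrable one_le_two
  have l1 := (memLp_one_sub_trt_mul_iff.2 ((h.h2_sq.sub h.h1_sq).restrict _)).integrable one_le_two
  have l0 := (memLp_trt_mul_iff.2 ((h.h1_sq.sub h.h0_sq).restrict _)).integrable one_le_two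
  set L : Param k →L[ℝ] ℝ := ∫ o, fderiv ℝ (B.quad o) θs ∂Q with hL
  -- Changing $\beta_2$ alone changes the moment function by a function of $(W,M,D,X)$ times the
  -- residual of the $q_2$ equation. The other outcome parameters are paired with $q_1$ and $q_0$ in
  -- the same way.
  have b2 : ∀ v, L (v, 0, 0, 0, 0, 0) = 0 := fun v =>
    h.fderiv_quad_apply_eq_zero fun t ht => h.integral_quad_eq ht hs (T := WMDX) (by fun_prop)
      (i2.sub i1) r2 (g := fun w => B.h2 θs.b2 w - B.h2 (θs.b2 + t • v) w)
      ((mh2 _).sub (mh2 _)) fun o => by simp only [BridgeModels.quad, moment, Param.b2, Param.b1, Param.b0, Param.g0,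
        Param.g1, Param.g2, Prod.fst_add, Prod.snd_add, Prod.smul_fst, Prod.smul_snd, smul_zero, add_zero, Pi.sub_apply]; ring
  have b1 : ∀ v, L (0, v, 0, 0, 0, 0) = 0 := fun v =>
    h.fderiv_quad_apply_eq_zero fun t ht => h.integral_quad_eq ht hs (T := WDX) (by fun_prop)
      (i1.sub i0) r1 (g := fun w => B.h1 θs.b1 w - B.h1 (θs.b1 + t • v) w)
      ((mh1 _).sub (mh1 _)) fun o => by simp only [BridgeModels.quad, moment, Param.b2, Param.b1, Param.b0, Param.g0,
        Param.g1, Param.g2, Prod.fst_add, Prod.snd_add, Prod.smul_fst, Prod.smul_snd, smul_zero, add_zero, Pi.sub_apply]; ring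
  have b0 : ∀ v, L (0, 0, v, 0, 0, 0) = 0 := fun v =>
    h.fderiv_quad_apply_eq_zero fun t ht => h.integral_quad_eq ht hs (T := WX) (by fun_prop)
      (i0.sub (integrable_const 1)) r0 (g := fun w => B.h0 θs.b0 w - B.h0 (θs.b0 + t • v) w)
      ((mh0 _).sub (mh0 _)) fun o => by simp only [BridgeModels.quad, moment, Param.b2, Param.b1, Param.b0, Param.g0,
        Param.g1, Param.g2, Prod.fst_add, Prod.snd_add, Prod.smul_fst, Prod.smul_snd, smul_zero, add_zero, Pi.sub_apply]; ring
  -- Conversely, changing $\gamma_j$ multiplies the residual of the $h_j$ equation by a function of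
  -- its conditioning variables.
  have g0 : ∀ v, L (0, 0, 0, v, 0, 0) = 0 := fun v =>
    h.fderiv_quad_apply_eq_zero fun t ht => h.integral_quad_eq ht hs (T := ZX) (by fun_prop)
      l0 c0 (g := fun w => B.q0 (θs.g0 + t • v) w - B.q0 θs.g0 w)
      ((mq0 _).sub (mq0 _)) fun o => by simp only [BridgeModels.quad, moment, Param.b2, Param.b1, Param.b0, Param.g0,
        Param.g1, Param.g2, Prod.fst_add, Prod.snd_add, Prod.smul_fst, Prod.smul_snd, smul_zero, add_zero, Pi.sub_apply]; ring
  have g1 : ∀ v, L (0, 0, 0, 0, v, 0) = 0 := fun v =>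
    h.fderiv_quad_apply_eq_zero fun t ht => h.integral_quad_eq ht hs (T := ZDX) (by fun_prop)
      l1 c1 (g := fun w => B.q1 (θs.g1 + t • v) w - B.q1 θs.g1 w)
      ((mq1 _).sub (mq1 _)) fun o => by simp only [BridgeModels.quad, moment, Param.b2, Param.b1, Param.b0, Param.g0,
        Param.g1, Param.g2, Prod.fst_add, Prod.snd_add, Prod.smul_fst, Prod.smul_snd, smul_zero, add_zero, Pi.sub_apply]; ring
  have g2 : ∀ v, L (0, 0, 0, 0, 0, v) = 0 := fun v =>
    h.fderiv_quad_apply_eq_zero fun t ht => h.integral_quad_eq ht hs (T := ZMDX) (by fun_prop)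
      l2 c2 (g := fun w => B.q2 (θs.g2 + t • v) w - B.q2 θs.g2 w)
      ((mq2 _).sub (mq2 _)) fun o => by simp only [BridgeModels.quad, moment, Param.b2, Param.b1, Param.b0, Param.g0,
        Param.g1, Param.g2, Prod.fst_add, Prod.snd_add, Prod.smul_fst, Prod.smul_snd, smul_zero, add_zero, Pi.sub_apply]; ring
  refine ContinuousLinearMap.ext fun v => ?_
  have : v = (v.1, 0, 0, 0, 0, 0) + (0, v.2.1, 0, 0, 0, 0) + (0, 0, v.2.2.1, 0, 0, 0) +
      (0, 0, 0, v.2.2.2.1, 0, 0) + (0, 0, 0, 0, v.2.2.2.2.1, 0) + (0, 0, 0, 0, 0, v.2.2.2.2.2) := by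
    simp
  rw [this, map_add, map_add, map_add, map_add, map_add, b2, b1, b0, g0, g1, g2]
  simp

end Regularity

end Orthogonality

end PathSpecific

/-! ### Conditional expectation operators on square-integrable functions -/

section CondOperator

open ContinuousLinearMap

variable {Ω α β : Type*} [MeasurableSpace Ω] [MeasurableSpace α] [MeasurableSpace β]

/-- Composition with `w`, as an isometry of `L²` spaces. -/
noncomputable def compLp (ν : Measure Ω) {w : Ω → α} (hw : Measurable w) :
    Lp ℝ 2 (ν.map w) →ₗᵢ[ℝ] Lp ℝ 2 ν :=
  Lp.compMeasurePreservingₗᵢ ℝ w (hw.measurePreserving ν)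

lemma coeFn_compLp (ν : Measure Ω) {w : Ω → α} (hw : Measurable w) (x : Lp ℝ 2 (ν.map w)) :
    compLp ν hw x =ᵐ[ν] fun ω => x (w ω) :=
  Lp.coeFn_compMeasurePreserving x (hw.measurePreserving ν)

/-- The conditional expectation given `z`, as a function of `z`. -/
noncomputable def condLp (ν : Measure Ω) {z : Ω → β} (hz : Measurable z) :
    Lp ℝ 2 ν →L[ℝ] Lp ℝ 2 (ν.map z) :=
  adjoint (compLp ν hz).toContinuousLinearMap

lemma condLp_compLp (ν : Measure Ω) {z : Ω → β} (hz : Measurable z) (k : Lp ℝ 2 (ν.map z)) :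
    condLp ν hz (compLp ν hz k) = k := by
  refine ext_inner_left ℝ fun l => ?_
  rw [condLp, adjoint_inner_right]
  exact (compLp ν hz).inner_map_map l k

lemma norm_condLp_le (ν : Measure Ω) {z : Ω → β} (hz : Measurable z) (F : Lp ℝ 2 ν) :
    ‖condLp ν hz F‖ ≤ ‖F‖ := by
  refine (le_opNorm _ _).trans ?_
  rw [condLp, LinearIsometryEquiv.norm_map]
  exact mul_le_of_le_one_left (norm_nonneg _) (compLp ν hz).norm_toContinuousLinearMap_le

/-- The operator is the adjoint of composition with $z$, so its inner product with $l$ is $\int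
l(z)F$. Its vanishing therefore means orthogonality of $F$ to all functions of $z$. -/
lemma condLp_eq_zero_iff (ν : Measure Ω) [IsFiniteMeasure ν] {z : Ω → β} (hz : Measurable z)
    (F : Lp ℝ 2 ν) : condLp ν hz F = 0 ↔ CondMeanZero ν F z := by
  have hF := (Lp.memLp F).integrable one_le_two
  have key : ∀ l : Lp ℝ 2 (ν.map z), inner ℝ l (condLp ν hz F) = ∫ ω, l (z ω) * F ω ∂ν := fun l => by
    rw [condLp, adjoint_inner_right, L2.inner_def]
    refine integral_congr_ae ?_
    filter_upwards [coeFn_compLp ν hz l] with ω hω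
    change inner ℝ (compLp ν hz l ω) (F ω) = _
    rw [hω, real_inner_eq_re_inner, RCLike.inner_apply]
    simp [mul_comm]
  refine ⟨fun h => condMeanZero_of_integral_mul hz fun g hg hg1 => ?_, fun h => ?_⟩
  · have hg2 : MemLp g 2 (ν.map z) :=
      MemLp.of_bound hg.aestronglyMeasurable 1 (Eventually.of_forall fun t => hg1 t)
    have h1 := key hg2.toLp
    rw [h, inner_zero_right] at h1
    rw [h1]
    refine integral_congr_ae ?_
    filter_upwards [ae_of_ae_map hz.aemeasurable hg2.coeFn_toLp] with ω hω
    rw [hω]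
  · refine ext_inner_left ℝ fun l => ?_
    rw [key, inner_zero_right]
    refine h.integral_mul hz hF (Lp.stronglyMeasurable l).measurable ?_
    have h2 : MemLp (fun ω => l (z ω)) 2 ν :=
      (memLp_map_measure_iff (Lp.aestronglyMeasurable l) hz.aemeasurable).1 (Lp.memLp l)
    exact h2.integrable_mul (Lp.memLp F)

lemma norm_toLp_eq_lpNorm {ν : Measure Ω} {F : Ω → ℝ} (hF : MemLp F 2 ν) :
    ‖hF.toLp‖ = lpNorm F 2 ν := by
  rw [Lp.norm_toLp, toReal_eLpNorm hF.1]

lemma norm_lp_eq_lpNorm {ν : Measure Ω} (F : Lp ℝ 2 ν) : ‖F‖ = lpNorm F 2 ν := by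
  rw [Lp.norm_def, toReal_eLpNorm (Lp.aestronglyMeasurable F)]

variable {μ : Measure Ω} [IsFiniteMeasure μ] {E : Set Ω} {w : Ω → α} {z : Ω → β}

/-- A conditional mean bounds the variable it is the mean of, uniformly over functions of `w`. -/
def Coercive (μ : Measure Ω) (E : Set Ω) (w : Ω → α) (z : Ω → β) : Prop :=
  ∃ c : ℝ, ∀ h : α → ℝ, Measurable h → MemLp (fun ω => h (w ω)) 2 μ → ∀ G : Ω → ℝ,
    MemLp G 2 (μ.restrict E) → CondMeanZero (μ.restrict E) (fun ω => h (w ω) - G ω) z →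
    lpNorm (fun ω => h (w ω)) 2 μ ≤ c * lpNorm G 2 (μ.restrict E)

/-- Solvability of the conditional moment equation `E[p (F - h(w)) | z] = 0` on `E`. -/
def Solvable (μ : Measure Ω) (E : Set Ω) (w : Ω → α) (z : Ω → β) (p : Ω → ℝ) : Prop :=
  ∀ F : Ω → ℝ, MemLp F 2 (μ.restrict E) → ∃ h : α → ℝ, Measurable h ∧
    MemLp (fun ω => h (w ω)) 2 μ ∧ CondMeanZero (μ.restrict E) (fun ω => p ω * (F ω - h (w ω))) z

/-- `h ↦ h(w)`, restricted to `E`. -/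
noncomputable def restrictLp (μ : Measure Ω) (E : Set Ω) (hw : Measurable w) :
    Lp ℝ 2 (μ.map w) →L[ℝ] Lp ℝ 2 (μ.restrict E) :=
  (LpToLpRestrictCLM Ω ℝ ℝ μ 2 E) ∘L (compLp μ hw).toContinuousLinearMap

lemma coeFn_restrictLp (hw : Measurable w) (x : Lp ℝ 2 (μ.map w)) :
    restrictLp μ E hw x =ᵐ[μ.restrict E] fun ω => x (w ω) := by
  refine (LpToLpRestrictCLM_coeFn ℝ E _).trans ?_
  exact ae_restrict_of_ae (coeFn_compLp μ hw x)

/-- Multiplication by a bounded function. -/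
noncomputable def mulLp (ν : Measure Ω) : Lp ℝ ∞ ν →L[ℝ] Lp ℝ 2 ν →L[ℝ] Lp ℝ 2 ν :=
  (ContinuousLinearMap.mul ℝ ℝ).holderL ν ∞ 2 2

lemma coeFn_mulLp {ν : Measure Ω} {p : Ω → ℝ} (hp : MemLp p ∞ ν) (F : Lp ℝ 2 ν) :
    mulLp ν hp.toLp F =ᵐ[ν] fun ω => p ω * F ω := by
  filter_upwards [hp.coeFn_toLp,
    (ContinuousLinearMap.mul ℝ ℝ).coeFn_holder (r := 2) hp.toLp F] with ω h1 h2
  change (holder _ _ _ _ : Lp ℝ 2 _) ω = _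
  rw [h2, h1]
  rfl

/-- The conditional expectation of `p h(w)` on `E` given `z`. -/
noncomputable def bridgeOp (μ : Measure Ω) (E : Set Ω) (hw : Measurable w) (hz : Measurable z)
    (p : Lp ℝ ∞ (μ.restrict E)) : Lp ℝ 2 (μ.map w) →L[ℝ] Lp ℝ 2 ((μ.restrict E).map z) :=
  (condLp (μ.restrict E) hz) ∘L (mulLp (μ.restrict E) p) ∘L restrictLp μ E hw

lemma continuous_bridgeOp (hw : Measurable w) (hz : Measurable z) :
    Continuous (bridgeOp μ E hw hz) :=
  continuous_const.clm_comp ((mulLp _).continuous.clm_comp continuous_const)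

lemma bridgeOp_eq_iff (hw : Measurable w) (hz : Measurable z) {p : Ω → ℝ}
    (hp : MemLp p ∞ (μ.restrict E)) (x : Lp ℝ 2 (μ.map w)) (F : Lp ℝ 2 (μ.restrict E)) :
    bridgeOp μ E hw hz hp.toLp x = condLp (μ.restrict E) hz (mulLp (μ.restrict E) hp.toLp F) ↔
    CondMeanZero (μ.restrict E) (fun ω => p ω * (F ω - x (w ω))) z := by
  have h1 : bridgeOp μ E hw hz hp.toLp x =
    condLp (μ.restrict E) hz (mulLp (μ.restrict E) hp.toLp (restrictLp μ E hw x)) := rfl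
  rw [h1, eq_comm, ← sub_eq_zero, ← map_sub, ← map_sub, condLp_eq_zero_iff]
  have : (mulLp (μ.restrict E) hp.toLp (F - restrictLp μ E hw x)) =ᵐ[μ.restrict E]
      (fun ω => p ω * (F ω - x (w ω))) := by
    filter_upwards [coeFn_restrictLp hw x, coeFn_mulLp hp (F - restrictLp μ E hw x),
      Lp.coeFn_sub F (restrictLp μ E hw x)] with ω h1 h2 h3
    rw [h2, h3, Pi.sub_apply, h1]
  exact ⟨fun h => h.congr this, fun h => h.congr this.symm⟩

lemma mulLp_one {ν : Measure Ω} (h1 : MemLp (fun _ => (1 : ℝ)) ∞ ν) (F : Lp ℝ 2 ν) :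
    mulLp ν h1.toLp F = F := by
  refine Lp.ext ?_
  filter_upwards [coeFn_mulLp h1 F] with ω hω
  rw [hω, one_mul]

lemma memLp_comp_of_lp (hw : Measurable w) (x : Lp ℝ 2 (μ.map w)) : MemLp (fun ω => x (w ω)) 2 μ :=
  (memLp_map_measure_iff (Lp.aestronglyMeasurable x) hw.aemeasurable).1 (Lp.memLp x)

lemma lpNorm_comp_of_lp (hw : Measurable w) (x : Lp ℝ 2 (μ.map w)) :
    lpNorm (fun ω => x (w ω)) 2 μ = ‖x‖ := by
  rw [← (compLp μ hw).norm_map x, norm_lp_eq_lpNorm, ← toReal_eLpNorm (memLp_comp_of_lp hw x).1,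
    ← toReal_eLpNorm (Lp.aestronglyMeasurable _), eLpNorm_congr_ae (coeFn_compLp μ hw x)]

lemma exists_lp (hw : Measurable w) {h : α → ℝ} (hh : Measurable h)
    (h2 : MemLp (fun ω => h (w ω)) 2 μ) : ∃ x : Lp ℝ 2 (μ.map w),
      (fun ω => x (w ω)) =ᵐ[μ] fun ω => h (w ω) := by
  have h3 : MemLp h 2 (μ.map w) :=
    (memLp_map_measure_iff hh.aestronglyMeasurable hw.aemeasurable).2 h2
  exact ⟨h3.toLp, ae_of_ae_map hw.aemeasurable h3.coeFn_toLp⟩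

lemma lpNorm_congr_ae {ν : Measure Ω} {F G : Ω → ℝ} (h : F =ᵐ[ν] G) (hF : MemLp F 2 ν) :
    lpNorm F 2 ν = lpNorm G 2 ν := by
  rw [← toReal_eLpNorm hF.1, ← toReal_eLpNorm (hF.1.congr h), eLpNorm_congr_ae h]

/-- Coercivity and solvability in terms of the operator. -/
lemma coercive_iff (hw : Measurable w) (hz : Measurable z)
    (h1 : MemLp (fun _ => (1 : ℝ)) ∞ (μ.restrict E)) :
    Coercive μ E w z ↔ ∃ c, AntilipschitzWith c (bridgeOp μ E hw hz h1.toLp) := by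
  constructor
  · rintro ⟨c, hc⟩
    refine ⟨c.toNNReal, AddMonoidHomClass.antilipschitz_of_bound _ fun x => ?_⟩
    set y := bridgeOp μ E hw hz h1.toLp x with hy
    have h2 := hc x (Lp.stronglyMeasurable x).measurable (memLp_comp_of_lp hw x)
      (compLp (μ.restrict E) hz y) (Lp.memLp _) ?_
    · rw [lpNorm_comp_of_lp hw, ← norm_lp_eq_lpNorm, (compLp _ hz).norm_map] at h2
      exact h2.trans (mul_le_mul_of_nonneg_right (Real.le_coe_toNNReal c) (norm_nonneg _))
    · have h3 := (bridgeOp_eq_iff hw hz h1 x (compLp (μ.restrict E) hz y)).1 (by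
        rw [mulLp_one, condLp_compLp])
      intro s hs
      have h4 := h3 s hs
      rw [← neg_eq_zero, ← integral_neg]
      simpa using h4
  · rintro ⟨c, hc⟩
    refine ⟨c, fun h hh h2 G hG hz0 => ?_⟩
    obtain ⟨x, hx⟩ := exists_lp hw hh h2
    have h3 := (bridgeOp_eq_iff hw hz h1 x hG.toLp).2 (fun s hs => by
      have h4 := hz0 s hs
      rw [← neg_eq_zero, ← integral_neg, ← h4]
      refine integral_congr_ae (ae_restrict_of_ae ?_)
      filter_upwards [ae_restrict_of_ae hx, hG.coeFn_toLp] with ω h5 h6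
      rw [h5, h6]
      ring)
    rw [mulLp_one] at h3
    rw [← lpNorm_congr_ae hx (memLp_comp_of_lp hw x), lpNorm_comp_of_lp hw, ← norm_toLp_eq_lpNorm hG]
    have h5 := hc.le_mul_norm (map_zero _) x
    rw [h3] at h5
    exact h5.trans (mul_le_mul_of_nonneg_left (norm_condLp_le _ hz _) c.2)

lemma solvable_of_bridgeOp_surjective (hw : Measurable w) (hz : Measurable z) {p : Ω → ℝ}
    (hp : MemLp p ∞ (μ.restrict E)) (h : Function.Surjective (bridgeOp μ E hw hz hp.toLp)) :
    Solvable μ E w z p := fun F hF => by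
  obtain ⟨x, hx⟩ := h (condLp (μ.restrict E) hz (mulLp (μ.restrict E) hp.toLp hF.toLp))
  refine ⟨x, (Lp.stronglyMeasurable x).measurable, memLp_comp_of_lp hw x, ?_⟩
  refine ((bridgeOp_eq_iff hw hz hp x _).1 hx).congr ?_
  filter_upwards [hF.coeFn_toLp] with ω hω
  rw [hω]

lemma bridgeOp_surjective_of_solvable (hw : Measurable w) (hz : Measurable z)
    (h1 : MemLp (fun _ => (1 : ℝ)) ∞ (μ.restrict E)) (h : Solvable μ E w z fun _ => 1) :
    Function.Surjective (bridgeOp μ E hw hz h1.toLp) := fun k => by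
  obtain ⟨g, hg, hg2, hg0⟩ := h (compLp (μ.restrict E) hz k) (Lp.memLp _)
  obtain ⟨x, hx⟩ := exists_lp hw hg hg2
  refine ⟨x, ?_⟩
  rw [(bridgeOp_eq_iff hw hz h1 x (compLp (μ.restrict E) hz k)).2, mulLp_one, condLp_compLp]
  refine hg0.congr ?_
  filter_upwards [ae_restrict_of_ae hx] with ω hω
  rw [hω]

lemma memLp_top_one (ν : Measure Ω) [IsFiniteMeasure ν] : MemLp (fun _ => (1 : ℝ)) ∞ ν :=
  memLp_top_const 1

/-- Solvability is stable under small bounded perturbations of the weight. -/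
lemma Solvable.perturb (hw : Measurable w) (hz : Measurable z) (h : Solvable μ E w z fun _ => 1)
    (hc : Coercive μ E w z) {s : Ω → ℝ} (hs : MemLp s ∞ (μ.restrict E)) :
    ∀ᶠ t : ℝ in 𝓝 0, Solvable μ E w z fun ω => 1 + t * s ω := by
  have h1 := memLp_top_one (μ.restrict E)
  have hb : Function.Bijective (bridgeOp μ E hw hz h1.toLp) := by
    obtain ⟨c, hc'⟩ := (coercive_iff hw hz h1).1 hc
    exact ⟨hc'.injective, bridgeOp_surjective_of_solvable hw hz h1 h⟩
  let e := ContinuousLinearEquiv.ofBijective (bridgeOp μ E hw hz h1.toLp)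
    (LinearMap.ker_eq_bot.2 hb.1) (LinearMap.range_eq_top.2 hb.2)
  have he : (e : Lp ℝ 2 (μ.map w) →L[ℝ] Lp ℝ 2 ((μ.restrict E).map z)) =
    bridgeOp μ E hw hz h1.toLp := ContinuousLinearEquiv.coe_ofBijective _ _ _
  have hcont : Continuous fun t : ℝ => bridgeOp μ E hw hz (h1.toLp + t • hs.toLp) :=
    (continuous_bridgeOp hw hz).comp (by fun_prop)
  -- At $t=0$ the operator is an isomorphism, isomorphisms form an open set, and the operator
  -- depends continuously on $t$ through its bounded weight.
  have hnh := hcont.continuousAt (x := 0).preimage_mem_nhds (t := Set.range _) (by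
    rw [zero_smul, add_zero, ← he]
    exact e.nhds)
  filter_upwards [hnh] with t ht
  obtain ⟨e', he'⟩ := ht
  dsimp only at he'
  have hp : MemLp (fun ω => 1 + t * s ω) ∞ (μ.restrict E) := h1.add (hs.const_mul t)
  have hpe : hp.toLp = h1.toLp + t • hs.toLp := by
    rw [← MemLp.toLp_const_smul, ← MemLp.toLp_add]
    rfl
  refine solvable_of_bridgeOp_surjective hw hz hp ?_
  rw [hpe, ← he']
  exact e'.surjective

/-- The open mapping theorem for conditional moment equations. -/
lemma Solvable.exists_bound (hw : Measurable w) (hz : Measurable z)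
    (h : Solvable μ E w z fun _ => 1) : ∃ c : ℝ, 0 ≤ c ∧ ∀ G : Ω → ℝ, MemLp G 2 (μ.restrict E) →
      ∃ f : α → ℝ, Measurable f ∧ MemLp (fun ω => f (w ω)) 2 μ ∧
        CondMeanZero (μ.restrict E) (fun ω => G ω - f (w ω)) z ∧
        lpNorm (fun ω => f (w ω)) 2 μ ≤ c * lpNorm G 2 (μ.restrict E) := by
  have h1 := memLp_top_one (μ.restrict E)
  obtain ⟨c, hc0, hc⟩ := exists_preimage_norm_le _ (bridgeOp_surjective_of_solvable hw hz h1 h)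
  refine ⟨c, hc0.le, fun G hG => ?_⟩
  obtain ⟨x, hx, hxc⟩ := hc (condLp (μ.restrict E) hz hG.toLp)
  refine ⟨x, (Lp.stronglyMeasurable x).measurable, memLp_comp_of_lp hw x, ?_, ?_⟩
  · refine ((bridgeOp_eq_iff hw hz h1 x hG.toLp).1 (by rw [hx, mulLp_one])).congr ?_
    filter_upwards [hG.coeFn_toLp] with ω hω
    rw [hω, one_mul]
  · rw [lpNorm_comp_of_lp hw, ← norm_toLp_eq_lpNorm hG]
    exact hxc.trans (mul_le_mul_of_nonneg_left (norm_condLp_le _ hz _) hc0.le)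

/-- Solvability and uniqueness give coercivity. -/
lemma Solvable.coercive (hw : Measurable w) (hz : Measurable z) (h : Solvable μ E w z fun _ => 1)
    (hu : ∀ g : α → ℝ, Measurable g → MemLp (fun ω => g (w ω)) 2 μ →
      CondMeanZero (μ.restrict E) (fun ω => g (w ω)) z → (fun ω => g (w ω)) =ᵐ[μ] 0) :
    Coercive μ E w z := by
  have h1 := memLp_top_one (μ.restrict E)
  -- A bounded bijection of Banach spaces is bounded below; uniqueness supplies injectivity.
  refine (coercive_iff hw hz h1).2 ((bijective_iff_dense_range_and_antilipschitz _).1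
    ⟨(injective_iff_map_eq_zero _).2 fun x hx => ?_, bridgeOp_surjective_of_solvable hw hz h1 h⟩).2
  have h2 := (bridgeOp_eq_iff hw hz h1 x 0).1 (by rw [hx, map_zero, map_zero])
  have h3 := hu x (Lp.stronglyMeasurable x).measurable (memLp_comp_of_lp hw x) fun s hs => by
    rw [← neg_eq_zero, ← integral_neg, ← h2 s hs]
    refine integral_congr_ae (ae_restrict_of_ae ?_)
    filter_upwards [Lp.coeFn_zero ℝ 2 (μ.restrict E)] with ω hω
    rw [hω]
    simp
  rw [← norm_eq_zero, ← lpNorm_comp_of_lp hw, lpNorm_eq_zero (memLp_comp_of_lp hw x) (by simp)]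
  exact h3

/-- Coercivity and density of the range give solvability. -/
lemma Coercive.solvable (hw : Measurable w) (hz : Measurable z) (hc : Coercive μ E w z)
    (hd : ∀ k : β → ℝ, Measurable k → MemLp (fun ω => k (z ω)) 2 (μ.restrict E) →
      (∀ g : α → ℝ, Measurable g → MemLp (fun ω => g (w ω)) 2 μ →
        ∫ ω in E, g (w ω) * k (z ω) ∂μ = 0) → (fun ω => k (z ω)) =ᵐ[μ.restrict E] 0) :
    Solvable μ E w z fun _ => 1 := by
  have h1 := memLp_top_one (μ.restrict E)
  refine solvable_of_bridgeOp_surjective hw hz h1 ((bijective_iff_dense_range_and_antilipschitz _).2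
    ⟨?_, (coercive_iff hw hz h1).1 hc⟩).2
  -- A lower bound makes the range closed, so it only remains to see that nothing is orthogonal to
  -- the range.
  rw [Submodule.topologicalClosure_eq_top_iff, Submodule.eq_bot_iff]
  intro k hk
  have hk2 := memLp_comp_of_lp hz k
  have h3 := hd k (Lp.stronglyMeasurable k).measurable hk2 fun g hg hg2 => by
    obtain ⟨x, hx⟩ := exists_lp hw hg hg2
    have h4 := (Submodule.mem_orthogonal _ _).1 hk _ ⟨x, rfl⟩
    have h5 : bridgeOp μ E hw hz h1.toLp x = condLp (μ.restrict E) hz (restrictLp μ E hw x) := by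
      change condLp _ hz (mulLp _ _ _) = _
      rw [mulLp_one]
      rfl
    rw [coe_coe, h5, condLp, adjoint_inner_left, L2.inner_def] at h4
    rw [← h4]
    refine integral_congr_ae ?_
    filter_upwards [ae_restrict_of_ae hx, coeFn_restrictLp hw x, coeFn_compLp (μ.restrict E) hz k]
      with ω h6 h7 h8
    rw [h7, LinearIsometry.coe_toContinuousLinearMap, h8, h6, real_inner_eq_re_inner,
      RCLike.inner_apply]
    simp [mul_comm]
  rw [← norm_eq_zero, ← lpNorm_comp_of_lp hz, lpNorm_eq_zero hk2 (by simp)]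
  exact h3

end CondOperator

/-! ### Quantitative estimates for conditional moment equations -/

section Norms

variable {Ω α β : Type*} [MeasurableSpace Ω] [MeasurableSpace α] [MeasurableSpace β]
  {μ : Measure Ω} {E : Set Ω} {w : Ω → α} {z : Ω → β}

lemma lpNorm_mono_measure {ν : Measure Ω} {F : Ω → ℝ} (hF : MemLp F 2 μ) (h : ν ≤ μ) :
    lpNorm F 2 ν ≤ lpNorm F 2 μ := by
  rw [← toReal_eLpNorm hF.1, ← toReal_eLpNorm (hF.1.mono_measure h)]
  exact ENNReal.toReal_mono hF.2.ne (eLpNorm_mono_measure F h)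

lemma lpNorm_mul_le_of_bdd {p F : Ω → ℝ} {κ : ℝ} (hκ : 0 ≤ κ) (hp : AEStronglyMeasurable p μ)
    (hb : ∀ᵐ ω ∂μ, |p ω| ≤ κ) (hF : MemLp F 2 μ) :
    MemLp (fun ω => p ω * F ω) 2 μ ∧ lpNorm (fun ω => p ω * F ω) 2 μ ≤ κ * lpNorm F 2 μ := by
  have h1 : ∀ᵐ ω ∂μ, ‖p ω * F ω‖ ≤ κ * ‖F ω‖ := by
    filter_upwards [hb] with ω hω
    rw [norm_mul]
    exact mul_le_mul_of_nonneg_right hω (norm_nonneg _)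
  have hm : AEStronglyMeasurable (fun ω => p ω * F ω) μ := hp.mul hF.1
  refine ⟨hF.of_le_mul hm h1, ?_⟩
  rw [← toReal_eLpNorm hm, ← toReal_eLpNorm hF.1]
  have h2 := eLpNorm_le_mul_eLpNorm_of_ae_le_mul h1 2
  refine (ENNReal.toReal_mono (ENNReal.mul_ne_top ENNReal.ofReal_ne_top hF.2.ne) h2).trans ?_
  rw [ENNReal.toReal_mul, ENNReal.toReal_ofReal hκ]

lemma integral_abs_mul_le {F G : Ω → ℝ} (hF : MemLp F 2 μ) (hG : MemLp G 2 μ) :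
    ∫ ω, |F ω * G ω| ∂μ ≤ lpNorm F 2 μ * lpNorm G 2 μ := by
  have h1 := abs_real_inner_le_norm hF.abs.toLp hG.abs.toLp
  rw [norm_toLp_eq_lpNorm hF.abs, norm_toLp_eq_lpNorm hG.abs, L2.inner_def] at h1
  have e : ∀ {F : Ω → ℝ}, MemLp F 2 μ → lpNorm |F| 2 μ = lpNorm F 2 μ := fun h => lpNorm_abs h.1 2
  rw [e hF, e hG] at h1
  refine le_trans (le_of_eq ?_) ((le_abs_self _).trans h1)
  refine integral_congr_ae ?_
  filter_upwards [hF.abs.coeFn_toLp, hG.abs.coeFn_toLp] with ω h2 h3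
  rw [h2, h3, real_inner_eq_re_inner, RCLike.inner_apply]
  simp [abs_mul, mul_comm]

/-- Testing the residual against $g$ itself gives $\|g\|^2=\langle g,F\rangle\le\|g\|\,\|F\|$; the
case $\|g\|=0$ is separate because of the division. -/
lemma lpNorm_le_of_condMeanZero [IsFiniteMeasure μ] {τ : Type*} [MeasurableSpace τ] {F : Ω → ℝ}
    {g : τ → ℝ} {T : Ω → τ} (hF : MemLp F 2 μ) (hg : Measurable g) (hT : Measurable T)
    (hg2 : MemLp (fun ω => g (T ω)) 2 μ) (h : CondMeanZero μ (fun ω => F ω - g (T ω)) T) :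
    lpNorm (fun ω => g (T ω)) 2 μ ≤ lpNorm F 2 μ := by
  have h1 := h.integral_mul hT ((hF.sub hg2).integrable one_le_two) hg
    (hg2.integrable_mul (hF.sub hg2))
  rw [integral_mul_sub_of_memLp hg2 hF hg2, sub_eq_zero] at h1
  have h2 : lpNorm (fun ω => g (T ω)) 2 μ * lpNorm (fun ω => g (T ω)) 2 μ =
      ∫ ω, g (T ω) * g (T ω) ∂μ := by
    rw [← norm_toLp_eq_lpNorm hg2, ← real_inner_self_eq_norm_mul_norm, L2.inner_def]
    refine integral_congr_ae ?_
    filter_upwards [hg2.coeFn_toLp] with ω h3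
    rw [h3, real_inner_eq_re_inner, RCLike.inner_apply]
    simp
  have h3 : ∫ ω, g (T ω) * F ω ∂μ ≤ lpNorm (fun ω => g (T ω)) 2 μ * lpNorm F 2 μ :=
    (integral_mono (hg2.integrable_mul hF) (hg2.integrable_mul hF).abs fun ω => le_abs_self _).trans
      (integral_abs_mul_le hg2 hF)
  rw [h1, ← h2] at h3
  rcases (lpNorm_nonneg (f := fun ω => g (T ω)) (p := 2) (μ := μ)).eq_or_lt with h4 | h4
  · rw [← h4]
    exact lpNorm_nonneg
  · exact le_of_mul_le_mul_left h3 h4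

/-- The solution of a conditional moment equation depends in a Lipschitz way on the weight and the
right-hand side. -/
lemma Coercive.perturb_bound [IsFiniteMeasure μ] (hc : Coercive μ E w z) {F : Ω → ℝ} {h : α → ℝ}
    (hF : MemLp F 2 (μ.restrict E)) (hh : Measurable h) (h2 : MemLp (fun ω => h (w ω)) 2 μ)
    (h0 : CondMeanZero (μ.restrict E) (fun ω => F ω - h (w ω)) z) {a : ℝ} (ha : 0 ≤ a) :
    ∃ b, 0 ≤ b ∧ ∃ κ₀, 0 < κ₀ ∧ κ₀ ≤ 1 ∧ ∀ κ, 0 ≤ κ → κ ≤ κ₀ → ∀ (p F' : Ω → ℝ) (h' : α → ℝ),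
      Measurable p → (∀ᵐ ω ∂μ, |p ω - 1| ≤ κ) → MemLp F' 2 (μ.restrict E) → Measurable h' →
      MemLp (fun ω => h' (w ω)) 2 μ →
      CondMeanZero (μ.restrict E) (fun ω => p ω * (F' ω - h' (w ω))) z →
      lpNorm (fun ω => F' ω - F ω) 2 (μ.restrict E) ≤ κ * a →
      lpNorm (fun ω => h' (w ω) - h (w ω)) 2 μ ≤ κ * b := by
  obtain ⟨c, hc⟩ := hc
  set ν := μ.restrict E with hν
  set r := lpNorm (fun ω => F ω - h (w ω)) 2 ν with hr
  have hr0 : 0 ≤ r := lpNorm_nonneg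
  set c' := max c 0 with hc'
  have hc'0 : 0 ≤ c' := le_max_right _ _
  -- With $\delta$ the distance of the solutions, coercivity yields $\delta\le c'(\kappa
  -- a+\kappa(\kappa a+r+\delta))$. The bounds $\kappa\le1$ and $c'\kappa\le1/2$ absorb half of
  -- $\delta$ and leave $\delta\le\kappa\cdot2c'(2a+r)$.
  refine ⟨2 * c' * (2 * a + r), by positivity, min 1 (2 * (c' + 1))⁻¹, by positivity, min_le_left _ _,
    fun κ hκ0 hκ p F' h' hp hpκ hF' hh' h2' h0' hFF => ?_⟩
  have hκ1 : κ ≤ 1 := hκ.trans (min_le_left _ _)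
  have hcκ : c' * κ ≤ 1 / 2 := by
    have : κ ≤ (2 * (c' + 1))⁻¹ := hκ.trans (min_le_right _ _)
    rw [← one_div, le_div_iff₀ (by positivity)] at this
    nlinarith
  have hres : ν ≤ μ := Measure.restrict_le_self
  have i1 : MemLp (fun ω => F' ω - F ω) 2 ν := hF'.sub hF
  have i2 : MemLp (fun ω => F ω - h (w ω)) 2 ν := hF.sub (h2.mono_measure hres)
  have i3 : MemLp (fun ω => h' (w ω) - h (w ω)) 2 μ := h2'.sub h2
  have i3' := i3.mono_measure hres
  have i4 : MemLp (fun ω => F' ω - h' (w ω)) 2 ν := hF'.sub (h2'.mono_measure hres)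
  have hpm : AEStronglyMeasurable (fun ω => p ω - 1) ν := (hp.sub_const 1).aestronglyMeasurable
  obtain ⟨i5, n5⟩ := lpNorm_mul_le_of_bdd hκ0 hpm (ae_mono hres hpκ) i4
  have n4 : lpNorm (fun ω => F' ω - h' (w ω)) 2 ν ≤ κ * a + r +
      lpNorm (fun ω => h' (w ω) - h (w ω)) 2 μ := by
    have e : (fun ω => F' ω - h' (w ω)) = (fun ω => F' ω - F ω) + (fun ω => F ω - h (w ω)) -
        (fun ω => h' (w ω) - h (w ω)) := by
      funext ω
      simp
    rw [e]
    refine (lpNorm_sub_le (i1.add i2) one_le_two).trans (add_le_add ?_ (lpNorm_mono_measure i3 hres))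
    exact (lpNorm_add_le i1 one_le_two).trans (add_le_add hFF le_rfl)
  have i6 := i1.add i5
  have n6 := lpNorm_add_le (g := fun ω => (p ω - 1) * (F' ω - h' (w ω))) i1 one_le_two
  -- Subtracting the two equations shows that $h'-h$ has the same conditional mean as
  -- $(F'-F)+(p-1)(F'-h')$, which is of order $\kappa$.
  have key := hc (fun t => h' t - h t) (hh'.sub hh) i3 _ i6 (by
    have hi := i4.integrable one_le_two
    have hpi : Integrable (fun ω => p ω * (F' ω - h' (w ω))) ν := by
      refine (hi.add (i5.integrable one_le_two)).congr (Eventually.of_forall fun ω => ?_)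
      simp only [Pi.add_apply]
      ring
    refine (h0.sub h0' (i2.integrable one_le_two) hpi).congr (Eventually.of_forall fun ω => ?_)
    simp only [Pi.add_apply]
    ring)
  set δ := lpNorm (fun ω => h' (w ω) - h (w ω)) 2 μ with hδ
  have hδ0 : 0 ≤ δ := lpNorm_nonneg
  have hG : lpNorm ((fun ω => F' ω - F ω) + fun ω => (p ω - 1) * (F' ω - h' (w ω))) 2 ν ≤
      κ * a + κ * (κ * a + r + δ) :=
    n6.trans (add_le_add hFF (n5.trans (mul_le_mul_of_nonneg_left n4 hκ0)))
  have h3 : δ ≤ c' * (κ * a + κ * (κ * a + r + δ)) :=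
    key.trans ((mul_le_mul_of_nonneg_right (le_max_left c 0) lpNorm_nonneg).trans
      (mul_le_mul_of_nonneg_left hG hc'0))
  have h4 : c' * κ * δ ≤ 1 / 2 * δ := mul_le_mul_of_nonneg_right hcκ hδ0
  have h5 : c' * κ * (κ * a) ≤ c' * κ * a :=
    mul_le_mul_of_nonneg_left (mul_le_of_le_one_left ha hκ1) (mul_nonneg hc'0 hκ0)
  nlinarith

end Norms

/-! ### Bounded changes of density -/

section Density

variable {Ω τ : Type*} [MeasurableSpace Ω] [MeasurableSpace τ] {μ : Measure Ω} {p : Ω → ℝ}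

/-- A likelihood ratio within $1/2$ of one lies between $1/2$ and $2$, so each measure is at most
twice the other. -/
lemma memLp_withDensity_iff (hp : Measurable p) (hb : ∀ᵐ ω ∂μ, |p ω - 1| ≤ 1 / 2) {F : Ω → ℝ}
    {q : ℝ≥0∞} :
    MemLp F q (μ.withDensity fun ω => ENNReal.ofReal (p ω)) ↔ MemLp F q μ := by
  have hm : Measurable fun ω => ENNReal.ofReal (p ω) := hp.ennreal_ofReal
  have h1 : μ.withDensity (fun ω => ENNReal.ofReal (p ω)) ≤ (2 : ℝ≥0∞) • μ := by
    rw [← withDensity_const]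
    refine withDensity_mono ?_
    filter_upwards [hb] with ω hω
    have := (abs_le.1 hω).2
    exact (ENNReal.ofReal_le_ofReal (by linarith : p ω ≤ 2)).trans (by simp)
  have h2 : μ ≤ (2 : ℝ≥0∞) • μ.withDensity (fun ω => ENNReal.ofReal (p ω)) := by
    rw [← withDensity_smul _ hm]
    nth_rewrite 1 [← withDensity_one (μ := μ)]
    refine withDensity_mono ?_
    filter_upwards [hb] with ω hω
    have := (abs_le.1 hω).1
    rw [Pi.smul_apply, smul_eq_mul, Pi.one_apply]
    calc (1 : ℝ≥0∞) = ENNReal.ofReal 1 := by simp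
      _ ≤ ENNReal.ofReal (2 * p ω) := ENNReal.ofReal_le_ofReal (by linarith)
      _ = 2 * ENNReal.ofReal (p ω) := by rw [ENNReal.ofReal_mul zero_le_two]; simp
  exact ⟨fun h => (h.smul_measure (by simp)).mono_measure h2,
    fun h => (h.smul_measure (by simp)).mono_measure h1⟩

lemma integral_withDensity_ofReal (hp : Measurable p) (hb : ∀ᵐ ω ∂μ, |p ω - 1| ≤ 1 / 2)
    (F : Ω → ℝ) : ∫ ω, F ω ∂(μ.withDensity fun ω => ENNReal.ofReal (p ω)) = ∫ ω, p ω * F ω ∂μ := by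
  rw [integral_withDensity_eq_integral_toReal_smul hp.ennreal_ofReal
    (Eventually.of_forall fun _ => ENNReal.ofReal_lt_top)]
  refine integral_congr_ae ?_
  filter_upwards [hb] with ω hω
  have := (abs_le.1 hω).1
  rw [ENNReal.toReal_ofReal (by linarith), smul_eq_mul]

lemma condMeanZero_withDensity_iff (hp : Measurable p) (hb : ∀ᵐ ω ∂μ, |p ω - 1| ≤ 1 / 2)
    (R : Ω → ℝ) {T : Ω → τ} (hT : Measurable T) :
    CondMeanZero (μ.withDensity fun ω => ENNReal.ofReal (p ω)) R T ↔
      CondMeanZero μ (fun ω => p ω * R ω) T := by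
  refine forall₂_congr fun s hs => ?_
  rw [restrict_withDensity (hT hs), integral_withDensity_ofReal hp (ae_restrict_of_ae hb)]

end Density

/-! ### The target at laws near $Q$ -/

namespace PathSpecific

open Obs

section Efficiency

variable {𝒟 ℳ 𝒲 𝒵 𝒳 : Type*} [MeasurableSpace 𝒟] [MeasurableSpace ℳ] [MeasurableSpace 𝒲]
  [MeasurableSpace 𝒵] [MeasurableSpace 𝒳] {Q : Measure (Obs 𝒟 ℳ 𝒲 𝒵 𝒳)} [IsProbabilityMeasure Q]
  {h2 : 𝒲 × ℳ × 𝒟 × 𝒳 → ℝ} {h1 : 𝒲 × 𝒟 × 𝒳 → ℝ} {h0 : 𝒲 × 𝒳 → ℝ}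
  {q0 : 𝒵 × 𝒳 → ℝ} {q1 : 𝒵 × 𝒟 × 𝒳 → ℝ} {q2 : 𝒵 × ℳ × 𝒟 × 𝒳 → ℝ}

/-- `h₂, h₁, h₀` are outcome bridge functions of the law with density `p` with respect to `Q`. -/
structure WeightedBridges (Q : Measure (Obs 𝒟 ℳ 𝒲 𝒵 𝒳)) (p : Obs 𝒟 ℳ 𝒲 𝒵 𝒳 → ℝ)
    (h2 : 𝒲 × ℳ × 𝒟 × 𝒳 → ℝ) (h1 : 𝒲 × 𝒟 × 𝒳 → ℝ) (h0 : 𝒲 × 𝒳 → ℝ) : Prop where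
  mh2 : Measurable h2
  mh1 : Measurable h1
  mh0 : Measurable h0
  sq2 : MemLp (fun o => h2 (WMDX o)) 2 Q
  sq1 : MemLp (fun o => h1 (WDX o)) 2 Q
  sq0 : MemLp (fun o => h0 (WX o)) 2 Q
  eqn2 : CondMeanZero (Q.restrict (arm true)) (fun o => p o * (Obs.Y o - h2 (WMDX o))) ZMDX
  eqn1 : CondMeanZero (Q.restrict (arm false)) (fun o => p o * (h2 (WMDX o) - h1 (WDX o))) ZDX
  eqn0 : CondMeanZero (Q.restrict (arm true)) (fun o => p o * (h1 (WDX o) - h0 (WX o))) ZX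

lemma IsH2.weightedBridges (hY : MemLp (fun o => Obs.Y o) 2 Q) (e2 : IsH2 Q h2) (e1 : IsH1 Q h2 h1)
    (e0 : IsH0 Q h1 h0) : WeightedBridges Q (fun _ => 1) h2 h1 h0 where
  mh2 := e2.meas
  mh1 := e1.meas
  mh0 := e0.meas
  sq2 := e2.sq
  sq1 := e1.sq
  sq0 := e0.sq
  eqn2 := by simpa only [one_mul] using condMeanZero_trt_mul_iff.1 ((isH2_iff hY).1 e2).2.2
  eqn1 := by simpa only [one_mul] using condMeanZero_one_sub_trt_mul_iff.1 ((isH1_iff e2.sq).1 e1).2.2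
  eqn0 := by simpa only [one_mul] using condMeanZero_trt_mul_iff.1 ((isH0_iff e1.sq).1 e0).2.2

/-- The function spaces at nearby laws coincide with those at $Q$, and the likelihood ratio can be
moved into the residuals. All bridge equations thus become weighted equations on the fixed spaces of
$Q$. -/
lemma isTarget_withDensity_iff {p : Obs 𝒟 ℳ 𝒲 𝒵 𝒳 → ℝ} (hp : Measurable p)
    (hb : ∀ᵐ o ∂Q, |p o - 1| ≤ 1 / 2)
    [IsProbabilityMeasure (Q.withDensity fun o => ENNReal.ofReal (p o))] {v : ℝ} :
    IsTarget (Q.withDensity fun o => ENNReal.ofReal (p o)) v ↔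
      MemLp (fun o => Obs.Y o) 2 Q ∧ ∃ h2 h1 h0, WeightedBridges Q p h2 h1 h0 ∧
        v = ∫ o, p o * h0 (WX o) ∂Q := by
  have c2 : ∀ R : Obs 𝒟 ℳ 𝒲 𝒵 𝒳 → ℝ, CondMeanZero (Q.withDensity fun o => ENNReal.ofReal (p o))
      (fun o => trt o * R o) ZMDX ↔ CondMeanZero (Q.restrict (arm true)) (fun o => p o * R o) ZMDX :=
    fun R => by
      rw [condMeanZero_withDensity_iff hp hb _ (by fun_prop), ← condMeanZero_trt_mul_iff]
      simp only [mul_left_comm]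
  have c1 : ∀ R : Obs 𝒟 ℳ 𝒲 𝒵 𝒳 → ℝ, CondMeanZero (Q.withDensity fun o => ENNReal.ofReal (p o))
      (fun o => (1 - trt o) * R o) ZDX ↔
      CondMeanZero (Q.restrict (arm false)) (fun o => p o * R o) ZDX := fun R => by
    rw [condMeanZero_withDensity_iff hp hb _ (by fun_prop), ← condMeanZero_one_sub_trt_mul_iff]
    simp only [mul_left_comm]
  have c0 : ∀ R : Obs 𝒟 ℳ 𝒲 𝒵 𝒳 → ℝ, CondMeanZero (Q.withDensity fun o => ENNReal.ofReal (p o))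
      (fun o => trt o * R o) ZX ↔ CondMeanZero (Q.restrict (arm true)) (fun o => p o * R o) ZX :=
    fun R => by
      rw [condMeanZero_withDensity_iff hp hb _ (by fun_prop), ← condMeanZero_trt_mul_iff]
      simp only [mul_left_comm]
  refine Iff.trans (and_congr_right fun hY => exists₃_congr fun h2 h1 h0 => ?_)
    (and_congr_left' (memLp_withDensity_iff hp hb))
  rw [integral_withDensity_ofReal hp hb, ← and_assoc, ← and_assoc]
  refine and_congr_left' ⟨fun ⟨⟨e2, e1⟩, e0⟩ => ?_, fun h => ?_⟩
  · exact
    { mh2 := e2.meas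
      mh1 := e1.meas
      mh0 := e0.meas
      sq2 := (memLp_withDensity_iff hp hb).1 e2.sq
      sq1 := (memLp_withDensity_iff hp hb).1 e1.sq
      sq0 := (memLp_withDensity_iff hp hb).1 e0.sq
      eqn2 := (c2 _).1 ((isH2_iff hY).1 e2).2.2
      eqn1 := (c1 _).1 ((isH1_iff e2.sq).1 e1).2.2
      eqn0 := (c0 _).1 ((isH0_iff e1.sq).1 e0).2.2 }
  · have s2 := (memLp_withDensity_iff hp hb).2 h.sq2
    have s1 := (memLp_withDensity_iff hp hb).2 h.sq1
    have s0 := (memLp_withDensity_iff hp hb).2 h.sq0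
    exact ⟨⟨(isH2_iff hY).2 ⟨h.mh2, s2, (c2 _).2 h.eqn2⟩,
      (isH1_iff s2).2 ⟨h.mh1, s1, (c1 _).2 h.eqn1⟩⟩, (isH0_iff s1).2 ⟨h.mh0, s0, (c0 _).2 h.eqn0⟩⟩

/-- Square-integrable treatment bridge functions, in weak form. -/
structure WeakTreatmentBridges (Q : Measure (Obs 𝒟 ℳ 𝒲 𝒵 𝒳)) (q0 : 𝒵 × 𝒳 → ℝ)
    (q1 : 𝒵 × 𝒟 × 𝒳 → ℝ) (q2 : 𝒵 × ℳ × 𝒟 × 𝒳 → ℝ) : Prop where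
  mq0 : Measurable q0
  mq1 : Measurable q1
  mq2 : Measurable q2
  sq0 : MemLp (fun o => trt o * q0 (ZX o)) 2 Q
  sq1 : MemLp (fun o => (1 - trt o) * q1 (ZDX o)) 2 Q
  sq2 : MemLp (fun o => trt o * q2 (ZMDX o)) 2 Q
  eqn0 : CondMeanZero Q (fun o => trt o * q0 (ZX o) - 1) WX
  eqn1 : CondMeanZero Q (fun o => (1 - trt o) * q1 (ZDX o) - trt o * q0 (ZX o)) WDX
  eqn2 : CondMeanZero Q (fun o => trt o * q2 (ZMDX o) - (1 - trt o) * q1 (ZDX o)) WMDX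

lemma IsQ0.weakTreatmentBridges (hQ : ArmsEquivalent Q) (e0 : IsQ0 Q q0) (e1 : IsQ1 Q q0 q1)
    (e2 : IsQ2 Q q1 q2) : WeakTreatmentBridges Q q0 q1 q2 where
  mq0 := e0.meas
  mq1 := e1.meas
  mq2 := e2.meas
  sq0 := (e0.condMeanZero hQ).1
  sq1 := (e1.condMeanZero hQ e0.sq).1
  sq2 := (e2.condMeanZero hQ e1.sq).1
  eqn0 := (e0.condMeanZero hQ).2
  eqn1 := (e1.condMeanZero hQ e0.sq).2
  eqn2 := (e2.condMeanZero hQ e1.sq).2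

lemma WeightedBridges.sqBridges {p : Obs 𝒟 ℳ 𝒲 𝒵 𝒳 → ℝ} (hY : MemLp (fun o => Obs.Y o) 2 Q)
    (h : WeightedBridges Q p h2 h1 h0) (k : WeakTreatmentBridges Q q0 q1 q2) :
    SqBridges Q h2 h1 h0 q0 q1 q2 where
  mh2 := h.mh2
  mh1 := h.mh1
  mh0 := h.mh0
  mq0 := k.mq0
  mq1 := k.mq1
  mq2 := k.mq2
  Y := hY
  h2 := h.sq2
  h1 := h.sq1
  h0 := h.sq0
  q0 := k.sq0
  q1 := k.sq1
  q2 := k.sq2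

lemma SqBridges.integrable (h : SqBridges Q h2 h1 h0 q0 q1 q2) :
    Integrable (moment h2 h1 h0 q0 q1 q2) Q :=
  (((h.q0.integrable_mul (h.h1.sub h.h0)).add (h.q1.integrable_mul (h.h2.sub h.h1))).add
    (h.q2.integrable_mul (h.Y.sub h.h2))).add (h.h0.integrable one_le_two)

/-- By the treatment bridge equations, the mean of the moment function does not depend on the outcome
bridge functions. -/
lemma WeakTreatmentBridges.integral_moment (k : WeakTreatmentBridges Q q0 q1 q2)
    (h : SqBridges Q h2 h1 h0 q0 q1 q2) :
    ∫ o, moment h2 h1 h0 q0 q1 q2 o ∂Q = ∫ o, trt o * q2 (ZMDX o) * Obs.Y o ∂Q := by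
  obtain ⟨x1, x2, x3⟩ := h.expand
  rw [h.integral_moment, x1, x2, x3, h.term_q0 k.eqn0, h.term_q1 k.eqn1, h.term_q2 k.eqn2]
  ring

lemma integral_weighted_term {τ : Type*} [MeasurableSpace τ] {a : Bool} {p : Obs 𝒟 ℳ 𝒲 𝒵 𝒳 → ℝ}
    (hp : Measurable p) (hb : ∀ᵐ o ∂Q, |p o - 1| ≤ 1 / 2) {T : Obs 𝒟 ℳ 𝒲 𝒵 𝒳 → τ} (hT : Measurable T)
    {q : τ → ℝ} (hq : Measurable q) (hq2 : MemLp (fun o => q (T o)) 2 (Q.restrict (arm a)))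
    {R : Obs 𝒟 ℳ 𝒲 𝒵 𝒳 → ℝ} (hR : MemLp R 2 (Q.restrict (arm a)))
    (h : CondMeanZero (Q.restrict (arm a)) (fun o => p o * R o) T) :
    ∫ o in arm a, p o * (q (T o) * R o) ∂Q = 0 := by
  have hb' : ∀ᵐ o ∂Q, |p o| ≤ 2 := hb.mono fun o ho => by
    rw [abs_le] at ho ⊢
    constructor <;> linarith [ho.1, ho.2]
  have h1 := (lpNorm_mul_le_of_bdd zero_le_two hp.aestronglyMeasurable (ae_restrict_of_ae hb') hR).1
  simp only [mul_left_comm (p _)]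
  exact h.integral_mul hT (h1.integrable one_le_two) hq (hq2.integrable_mul h1)

/-- The target at a nearby law is the weighted mean of the moment function. -/
lemma WeightedBridges.integral_eq {p : Obs 𝒟 ℳ 𝒲 𝒵 𝒳 → ℝ} (hp : Measurable p)
    (hb : ∀ᵐ o ∂Q, |p o - 1| ≤ 1 / 2) (hY : MemLp (fun o => Obs.Y o) 2 Q)
    (h : WeightedBridges Q p h2 h1 h0) (k : WeakTreatmentBridges Q q0 q1 q2) :
    ∫ o, p o * h0 (WX o) ∂Q = ∫ o, p o * moment h2 h1 h0 q0 q1 q2 o ∂Q := by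
  have hs := h.sqBridges hY k
  have hb' : ∀ᵐ o ∂Q, ‖p o‖ ≤ 2 := hb.mono fun o ho => by
    rw [Real.norm_eq_abs, abs_le]
    rw [abs_le] at ho
    constructor <;> linarith [ho.1, ho.2]
  have bd : ∀ {F : Obs 𝒟 ℳ 𝒲 𝒵 𝒳 → ℝ}, Integrable F Q → Integrable (fun o => p o * F o) Q :=
    fun hF => hF.bdd_mul hp.aestronglyMeasurable hb'
  have t1 : ∫ o, p o * (trt o * q0 (ZX o) * (h1 (WDX o) - h0 (WX o))) ∂Q = 0 := by
    simp only [mul_assoc, mul_left_comm (p _) (trt _)]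
    rw [integral_trt_mul]
    exact integral_weighted_term hp hb (by fun_prop) k.mq0 (memLp_trt_mul_iff.1 k.sq0)
      ((h.sq1.sub h.sq0).restrict _) h.eqn0
  have t2 : ∫ o, p o * ((1 - trt o) * q1 (ZDX o) * (h2 (WMDX o) - h1 (WDX o))) ∂Q = 0 := by
    simp only [mul_assoc, mul_left_comm (p _) (1 - trt _)]
    rw [integral_one_sub_trt_mul]
    exact integral_weighted_term hp hb (by fun_prop) k.mq1 (memLp_one_sub_trt_mul_iff.1 k.sq1)
      ((h.sq2.sub h.sq1).restrict _) h.eqn1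
  have t3 : ∫ o, p o * (trt o * q2 (ZMDX o) * (Obs.Y o - h2 (WMDX o))) ∂Q = 0 := by
    simp only [mul_assoc, mul_left_comm (p _) (trt _)]
    rw [integral_trt_mul]
    exact integral_weighted_term hp hb (by fun_prop) k.mq2 (memLp_trt_mul_iff.1 k.sq2)
      ((hY.sub h.sq2).restrict _) h.eqn2
  have i1 := bd (hs.q0.integrable_mul (hs.h1.sub hs.h0))
  have i2 := bd (hs.q1.integrable_mul (hs.h2.sub hs.h1))
  have i3 := bd (hs.q2.integrable_mul (hs.Y.sub hs.h2))
  have i4 := bd (hs.h0.integrable one_le_two)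
  have e : ∀ o, p o * moment h2 h1 h0 q0 q1 q2 o =
      p o * (trt o * q0 (ZX o) * (h1 (WDX o) - h0 (WX o)))
      + p o * ((1 - trt o) * q1 (ZDX o) * (h2 (WMDX o) - h1 (WDX o)))
      + p o * (trt o * q2 (ZMDX o) * (Obs.Y o - h2 (WMDX o))) + p o * h0 (WX o) := fun o => by
    unfold moment
    ring
  rw [integral_congr_ae (Eventually.of_forall e)]
  have a1 := integral_add (i1.add i2 |>.add i3) i4
  have a2 := integral_add (i1.add i2) i3
  have a3 := integral_add i1 i2
  simp only [Pi.add_apply, Pi.mul_apply, Pi.sub_apply] at a1 a2 a3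
  rw [a1, a2, a3, t1, t2, t3]
  ring

/-- The moment function is Lipschitz in the outcome bridge functions. -/
lemma integral_abs_moment_sub_le {h2' : 𝒲 × ℳ × 𝒟 × 𝒳 → ℝ} {h1' : 𝒲 × 𝒟 × 𝒳 → ℝ} {h0' : 𝒲 × 𝒳 → ℝ}
    (h : SqBridges Q h2 h1 h0 q0 q1 q2) (h' : SqBridges Q h2' h1' h0' q0 q1 q2) :
    ∫ o, |moment h2' h1' h0' q0 q1 q2 o - moment h2 h1 h0 q0 q1 q2 o| ∂Q ≤
      (lpNorm (fun o => trt o * q0 (ZX o)) 2 Q + lpNorm (fun o => (1 - trt o) * q1 (ZDX o)) 2 Q +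
        lpNorm (fun o => trt o * q2 (ZMDX o)) 2 Q + lpNorm (fun _ : Obs 𝒟 ℳ 𝒲 𝒵 𝒳 => (1 : ℝ)) 2 Q) *
      (lpNorm (fun o => h2' (WMDX o) - h2 (WMDX o)) 2 Q +
        lpNorm (fun o => h1' (WDX o) - h1 (WDX o)) 2 Q +
        lpNorm (fun o => h0' (WX o) - h0 (WX o)) 2 Q) := by
  have d2 : MemLp (fun o => h2' (WMDX o) - h2 (WMDX o)) 2 Q := h'.h2.sub h.h2
  have d1 : MemLp (fun o => h1' (WDX o) - h1 (WDX o)) 2 Q := h'.h1.sub h.h1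
  have d0 : MemLp (fun o => h0' (WX o) - h0 (WX o)) 2 Q := h'.h0.sub h.h0
  have one : MemLp (fun _ : Obs 𝒟 ℳ 𝒲 𝒵 𝒳 => (1 : ℝ)) 2 Q := memLp_const 1
  have d10 : MemLp (fun o => h1' (WDX o) - h1 (WDX o) - (h0' (WX o) - h0 (WX o))) 2 Q := d1.sub d0
  have d21 : MemLp (fun o => h2' (WMDX o) - h2 (WMDX o) - (h1' (WDX o) - h1 (WDX o))) 2 Q := d2.sub d1
  have c10 := integral_abs_mul_le h.q0 d10
  have c21 := integral_abs_mul_le h.q1 d21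
  have c2 := integral_abs_mul_le h.q2 d2
  have c0 := integral_abs_mul_le one d0
  have n10 : lpNorm (fun o => h1' (WDX o) - h1 (WDX o) - (h0' (WX o) - h0 (WX o))) 2 Q ≤ _ :=
    lpNorm_sub_le (g := fun o => h0' (WX o) - h0 (WX o)) d1 one_le_two
  have n21 : lpNorm (fun o => h2' (WMDX o) - h2 (WMDX o) - (h1' (WDX o) - h1 (WDX o))) 2 Q ≤ _ :=
    lpNorm_sub_le (g := fun o => h1' (WDX o) - h1 (WDX o)) d2 one_le_two
  have j10 := (h.q0.integrable_mul' d10).abs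
  have j21 := (h.q1.integrable_mul' d21).abs
  have j2 := (h.q2.integrable_mul' d2).abs
  have j0 := (one.integrable_mul' d0).abs
  have tri : ∀ a b c d : ℝ, |a + b - c + d| ≤ |a| + |b| + |c| + |d| := fun a b c d => by
    rw [abs_le]
    constructor <;> linarith [neg_abs_le a, le_abs_self a, neg_abs_le b, le_abs_self b, neg_abs_le c,
      le_abs_self c, neg_abs_le d, le_abs_self d]
  have hle := integral_mono (h'.integrable.sub h.integrable).abs (((j10.add j21).add j2).add j0)
    fun o => by
      refine le_trans (le_of_eq ?_) (tri _ _ _ _)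
      simp only [Pi.sub_apply]
      unfold moment
      congr 1
      ring
  have a1 := integral_add ((j10.add j21).add j2) j0
  have a2 := integral_add (j10.add j21) j2
  have a3 := integral_add j10 j21
  simp only [Pi.add_apply, Pi.sub_apply] at hle a1 a2 a3
  rw [a1, a2, a3] at hle
  set x0 := lpNorm (fun o => trt o * q0 (ZX o)) 2 Q
  set x1 := lpNorm (fun o => (1 - trt o) * q1 (ZDX o)) 2 Q
  set x2 := lpNorm (fun o => trt o * q2 (ZMDX o)) 2 Q
  set x3 := lpNorm (fun _ : Obs 𝒟 ℳ 𝒲 𝒵 𝒳 => (1 : ℝ)) 2 Q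
  set D2 := lpNorm (fun o => h2' (WMDX o) - h2 (WMDX o)) 2 Q
  set D1 := lpNorm (fun o => h1' (WDX o) - h1 (WDX o)) 2 Q
  set D0 := lpNorm (fun o => h0' (WX o) - h0 (WX o)) 2 Q
  have p0 : 0 ≤ x0 := lpNorm_nonneg
  have p1 : 0 ≤ x1 := lpNorm_nonneg
  have p2 : 0 ≤ x2 := lpNorm_nonneg
  have p3 : 0 ≤ x3 := lpNorm_nonneg
  have r2 : 0 ≤ D2 := lpNorm_nonneg
  have r1 : 0 ≤ D1 := lpNorm_nonneg
  have r0 : 0 ≤ D0 := lpNorm_nonneg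
  have s0 := c10.trans (mul_le_mul_of_nonneg_left (n10.trans
    (by linarith : _ ≤ D2 + D1 + D0)) p0)
  have s1 := c21.trans (mul_le_mul_of_nonneg_left (n21.trans
    (by linarith : _ ≤ D2 + D1 + D0)) p1)
  have s2 := c2.trans (mul_le_mul_of_nonneg_left (by linarith : D2 ≤ D2 + D1 + D0) p2)
  have s3 := c0.trans (mul_le_mul_of_nonneg_left (by linarith : D0 ≤ D2 + D1 + D0) p3)
  refine hle.trans ?_
  rw [add_mul, add_mul, add_mul]
  linarith

end Efficiency

end PathSpecific

/-! ### Smooth submodels, differentiability of the target and the tangent space -/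

lemma lpNorm_mul_self {Ω : Type*} [MeasurableSpace Ω] {μ : Measure Ω} {F : Ω → ℝ}
    (hF : MemLp F 2 μ) : lpNorm F 2 μ * lpNorm F 2 μ = ∫ ω, F ω * F ω ∂μ := by
  rw [← norm_toLp_eq_lpNorm hF, ← real_inner_self_eq_norm_mul_norm, L2.inner_def]
  refine integral_congr_ae ?_
  filter_upwards [hF.coeFn_toLp] with ω h3
  rw [h3, real_inner_eq_re_inner, RCLike.inner_apply]
  simp

/-- With $r=\sqrt{1+x}$ one has $x=(r-1)(r+1)$ and $r-1-x/2=-(r-1)^2/2$. -/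
lemma abs_sqrt_one_add_sub_le {x : ℝ} (hx : |x| ≤ 1 / 2) :
    |Real.sqrt (1 + x) - 1| ≤ |x| ∧ |Real.sqrt (1 + x) - 1 - x / 2| ≤ x ^ 2 / 2 := by
  have h1 := (abs_le.1 hx).1
  have hs := Real.sq_sqrt (by linarith : 0 ≤ 1 + x)
  have hs0 := Real.sqrt_nonneg (1 + x)
  set r := Real.sqrt (1 + x)
  have h2 : x = (r - 1) * (r + 1) := by linarith [hs, sq r]
  have h3 : |r - 1| ≤ |x| := by
    rw [h2, abs_mul, abs_of_nonneg (by linarith : 0 ≤ r + 1)]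
    exact le_mul_of_one_le_right (abs_nonneg _) (by linarith)
  refine ⟨h3, ?_⟩
  have h4 : r - 1 - x / 2 = -((r - 1) ^ 2 / 2) := by linarith [hs, sq r, sq (r - 1)]
  rw [h4, abs_neg, abs_of_nonneg (by positivity)]
  have := sq_le_sq.2 h3
  linarith

namespace PathSpecific

open Obs

section Efficiency

variable {𝒟 ℳ 𝒲 𝒵 𝒳 : Type*} [MeasurableSpace 𝒟] [MeasurableSpace ℳ] [MeasurableSpace 𝒲]
  [MeasurableSpace 𝒵] [MeasurableSpace 𝒳] {Q : Measure (Obs 𝒟 ℳ 𝒲 𝒵 𝒳)} [IsProbabilityMeasure Q]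
  {h2 : 𝒲 × ℳ × 𝒟 × 𝒳 → ℝ} {h1 : 𝒲 × 𝒟 × 𝒳 → ℝ} {h0 : 𝒲 × 𝒳 → ℝ}
  {q0 : 𝒵 × 𝒳 → ℝ} {q1 : 𝒵 × 𝒟 × 𝒳 → ℝ} {q2 : 𝒵 × ℳ × 𝒟 × 𝒳 → ℝ}

lemma IsSubmodel.exists_lip {p : ℝ → Obs 𝒟 ℳ 𝒲 𝒵 𝒳 → ℝ} {s : Obs 𝒟 ℳ 𝒲 𝒵 𝒳 → ℝ} {v : ℝ → ℝ}
    (h : IsSubmodel Q p s v) : ∃ C : ℝ, 0 ≤ C ∧ ∀ ε : ℝ, 0 < ε → ∀ᶠ t in 𝓝 (0 : ℝ),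
      C * |t| ≤ ε ∧ ∀ᵐ o ∂Q, |p t o - 1| ≤ C * |t| := by
  obtain ⟨C, hC⟩ := h.lip
  refine ⟨max C 0, le_max_right _ _, fun ε hε => ?_⟩
  have h1 : Tendsto (fun t : ℝ => max C 0 * |t|) (𝓝 0) (𝓝 0) := by
    have : Continuous fun t : ℝ => max C 0 * |t| := by fun_prop
    simpa using this.tendsto 0
  filter_upwards [hC, h1.eventually (ge_mem_nhds hε)] with t ht ht'
  exact ⟨ht', ht.mono fun o ho => ho.trans
    (mul_le_mul_of_nonneg_right (le_max_left _ _) (abs_nonneg _))⟩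

/-- The likelihood ratio is differentiable in the weak sense, with the score as derivative. -/
lemma IsSubmodel.tendsto_integral {p : ℝ → Obs 𝒟 ℳ 𝒲 𝒵 𝒳 → ℝ} {s : Obs 𝒟 ℳ 𝒲 𝒵 𝒳 → ℝ} {v : ℝ → ℝ}
    (h : IsSubmodel Q p s v) {m : Obs 𝒟 ℳ 𝒲 𝒵 𝒳 → ℝ} (hm : MemLp m 2 Q) :
    Tendsto (fun t : ℝ => ∫ o, (p t o - 1) / t * m o ∂Q) (𝓝[≠] 0) (𝓝 (∫ o, m o * s o ∂Q)) := by
  obtain ⟨C, hC0, hC⟩ := h.exists_lip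
  set r : ℝ → Obs 𝒟 ℳ 𝒲 𝒵 𝒳 → ℝ := fun t o => (Real.sqrt (p t o) - 1) / t - s o / 2 with hr
  rw [tendsto_iff_norm_sub_tendsto_zero]
  -- The two terms bound the error from quadratic-mean differentiability, by Cauchy–Schwarz, and the
  -- error from replacing $\sqrt{p_t}$ by 1. The factor 3 is a bound for $\sqrt{p_t}+1$.
  have hb : Tendsto (fun t : ℝ => Real.sqrt (∫ o, r t o ^ 2 ∂Q) * (3 * lpNorm m 2 Q) +
      C * |t| * (1 / 2 * ∫ o, |m o * s o| ∂Q)) (𝓝[≠] 0) (𝓝 0) := by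
    have h1 := ((Real.continuous_sqrt.tendsto 0).comp h.dqm).mul_const (3 * lpNorm m 2 Q)
    have h2 : Tendsto (fun t : ℝ => C * |t| * (1 / 2 * ∫ o, |m o * s o| ∂Q)) (𝓝[≠] 0) (𝓝 0) := by
      have : Continuous fun t : ℝ => C * |t| * (1 / 2 * ∫ o, |m o * s o| ∂Q) := by fun_prop
      simpa using (this.tendsto 0).mono_left nhdsWithin_le_nhds
    simpa using h1.add h2
  refine squeeze_zero' (Eventually.of_forall fun t => norm_nonneg _) ?_ hb
  filter_upwards [self_mem_nhdsWithin, (hC (1 / 2) (by norm_num)).filter_mono nhdsWithin_le_nhds]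
    with t ht0 ht
  have ht0 : t ≠ 0 := ht0
  obtain ⟨htC, htp⟩ := ht
  have hpm := h.meas t
  have hsq : ∀ᵐ o ∂Q, |Real.sqrt (p t o) - 1| ≤ C * |t| := htp.mono fun o ho => by
    have := (abs_sqrt_one_add_sub_le (x := p t o - 1) (ho.trans htC)).1
    rw [add_sub_cancel] at this
    exact this.trans ho
  have hsm : Measurable fun o => Real.sqrt (p t o) := hpm.sqrt
  have one : MemLp (fun _ : Obs 𝒟 ℳ 𝒲 𝒵 𝒳 => (1 : ℝ)) 2 Q := memLp_const 1
  have hrt : MemLp (r t) 2 Q := by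
    have h1 : MemLp (fun o => (Real.sqrt (p t o) - 1) / t) 2 Q := by
      refine MemLp.of_bound (((hsm.sub_const 1).div_const t).aestronglyMeasurable) C ?_
      filter_upwards [hsq] with o ho
      rw [Real.norm_eq_abs, abs_div, div_le_iff₀ (abs_pos.2 ht0)]
      exact ho
    have h2 : MemLp (fun o => s o / 2) 2 Q := by simpa [div_eq_mul_inv] using h.score_sq.mul_const 2⁻¹
    exact h1.sub h2
  have hmm : MemLp (fun o => (Real.sqrt (p t o) + 1) * m o) 2 Q ∧
      lpNorm (fun o => (Real.sqrt (p t o) + 1) * m o) 2 Q ≤ 3 * lpNorm m 2 Q := by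
    refine lpNorm_mul_le_of_bdd (by norm_num) (hsm.add_const 1).aestronglyMeasurable ?_ hm
    filter_upwards [hsq] with o ho
    rw [abs_le] at ho ⊢
    constructor <;> linarith [ho.1, ho.2]
  have i1 := hrt.integrable_mul' hmm.1
  have ims := hm.integrable_mul' h.score_sq
  have i2 : Integrable (fun o => (Real.sqrt (p t o) - 1) * (1 / 2 * (m o * s o))) Q :=
    (ims.const_mul (1 / 2)).bdd_mul (hsm.sub_const 1).aestronglyMeasurable (c := C * |t|) hsq
  -- From $p-1=(\sqrt p-1)(\sqrt p+1)$ and $(\sqrt p-1)/t=r_t+s/2$: the leading part is $ms$, and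
  -- the rest consists of $r_t(\sqrt p+1)m$ and $\tfrac12(\sqrt p-1)ms$.
  have e : (fun o => (p t o - 1) / t * m o) =ᵐ[Q] fun o => m o * s o +
      (r t o * ((Real.sqrt (p t o) + 1) * m o) +
        (Real.sqrt (p t o) - 1) * (1 / 2 * (m o * s o))) := by
    filter_upwards [htp] with o ho
    have hp0 : 0 ≤ p t o := by linarith [(abs_le.1 (ho.trans htC)).1]
    have h3 : p t o - 1 = (Real.sqrt (p t o) - 1) * (Real.sqrt (p t o) + 1) := by
      linarith [Real.mul_self_sqrt hp0]
    rw [h3]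
    simp only [hr]
    field_simp
    ring
  have a1 := integral_add ims (i1.add i2)
  have a2 := integral_add i1 i2
  simp only [Pi.add_apply] at a1 a2
  rw [integral_congr_ae e, a1, a2, add_sub_cancel_left, Real.norm_eq_abs]
  refine (abs_add_le _ _).trans (add_le_add ?_ ?_)
  · refine (abs_integral_le_integral_abs).trans ((integral_abs_mul_le hrt hmm.1).trans ?_)
    refine mul_le_mul (le_of_eq ?_) hmm.2 lpNorm_nonneg (Real.sqrt_nonneg _)
    simp only [sq]
    rw [← lpNorm_mul_self hrt, Real.sqrt_mul_self lpNorm_nonneg]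
  · refine (abs_integral_le_integral_abs).trans ?_
    rw [← integral_const_mul, ← integral_const_mul]
    refine integral_mono_ae i2.abs ((ims.abs.const_mul _).const_mul _) ?_
    filter_upwards [hsq] with o ho
    rw [abs_mul, abs_mul (1 / 2), abs_of_nonneg (by norm_num : (0 : ℝ) ≤ 1 / 2)]
    exact mul_le_mul_of_nonneg_right ho (by positivity)

/-- The constant function 1 has the same mean under all laws of the submodel, so its weak derivative
is zero. -/
lemma IsSubmodel.integral_score {p : ℝ → Obs 𝒟 ℳ 𝒲 𝒵 𝒳 → ℝ} {s : Obs 𝒟 ℳ 𝒲 𝒵 𝒳 → ℝ} {v : ℝ → ℝ}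
    (h : IsSubmodel Q p s v) : ∫ o, s o ∂Q = 0 := by
  have h1 := h.tendsto_integral (memLp_const (1 : ℝ))
  obtain ⟨C, hC0, hC⟩ := h.exists_lip
  have h2 : (fun t : ℝ => ∫ o, (p t o - 1) / t * 1 ∂Q) =ᶠ[𝓝[≠] 0] fun _ => 0 := by
    filter_upwards [(hC (1 / 2) (by norm_num)).filter_mono nhdsWithin_le_nhds,
      h.prob.filter_mono nhdsWithin_le_nhds] with t ⟨htC, htp⟩ hpr
    have hb := htp.mono fun o ho => ho.trans htC
    have h3 := integral_withDensity_ofReal (h.meas t) hb (fun _ => 1)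
    simp only [integral_const, probReal_univ, smul_eq_mul, mul_one] at h3
    have hi : Integrable (p t) Q := by
      refine Integrable.of_bound (h.meas t).aestronglyMeasurable 2 (hb.mono fun o ho => ?_)
      rw [Real.norm_eq_abs, abs_le]
      rw [abs_le] at ho
      constructor <;> linarith [ho.1, ho.2]
    simp only [mul_one]
    rw [integral_div, integral_sub hi (integrable_const 1), ← h3]
    simp
  have h3 := tendsto_nhds_unique (h1.congr' h2) tendsto_const_nhds
  simpa using h3

end Efficiency

end PathSpecific

namespace PathSpecific

open Obs

section Efficiency

variable {𝒟 ℳ 𝒲 𝒵 𝒳 : Type*} [MeasurableSpace 𝒟] [MeasurableSpace ℳ] [MeasurableSpace 𝒲]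
  [MeasurableSpace 𝒵] [MeasurableSpace 𝒳] {Q : Measure (Obs 𝒟 ℳ 𝒲 𝒵 𝒳)} [IsProbabilityMeasure Q]
  {h2 : 𝒲 × ℳ × 𝒟 × 𝒳 → ℝ} {h1 : 𝒲 × 𝒟 × 𝒳 → ℝ} {h0 : 𝒲 × 𝒳 → ℝ}
  {q0 : 𝒵 × 𝒳 → ℝ} {q1 : 𝒵 × 𝒟 × 𝒳 → ℝ} {q2 : 𝒵 × ℳ × 𝒟 × 𝒳 → ℝ}

/-- The three conditional expectation operators, restricted to the arguments of the bridge
functions, are invertible. -/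
structure InvertibleBridges (Q : Measure (Obs 𝒟 ℳ 𝒲 𝒵 𝒳)) : Prop where
  coercive2 : Coercive Q (arm true) WMDX ZMDX
  coercive1 : Coercive Q (arm false) WDX ZDX
  coercive0 : Coercive Q (arm true) WX ZX
  solvable2 : Solvable Q (arm true) WMDX ZMDX fun _ => 1
  solvable1 : Solvable Q (arm false) WDX ZDX fun _ => 1
  solvable0 : Solvable Q (arm true) WX ZX fun _ => 1

/-- The outcome bridge functions are Lipschitz in the law. -/
lemma WeightedBridges.exists_bound (hI : InvertibleBridges Q) (hY : MemLp (fun o => Obs.Y o) 2 Q)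
    (hb : WeightedBridges Q (fun _ => 1) h2 h1 h0) :
    ∃ b, 0 ≤ b ∧ ∃ κ₀, 0 < κ₀ ∧ ∀ κ, 0 ≤ κ → κ ≤ κ₀ → ∀ p h2' h1' h0', Measurable p →
      (∀ᵐ o ∂Q, |p o - 1| ≤ κ) → WeightedBridges Q p h2' h1' h0' →
      lpNorm (fun o => h2' (WMDX o) - h2 (WMDX o)) 2 Q +
        lpNorm (fun o => h1' (WDX o) - h1 (WDX o)) 2 Q +
        lpNorm (fun o => h0' (WX o) - h0 (WX o)) 2 Q ≤ κ * b := by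
  -- The errors propagate through the sequence: the bound $b_2$ for $h_2$ is the right-hand side
  -- error of the $h_1$ equation, and $b_1$ that of the $h_0$ equation. In the first equation the
  -- right-hand side $Y$ is unperturbed, hence the error 0.
  obtain ⟨b2, hb2, k2, hk2, -, H2⟩ := hI.coercive2.perturb_bound (F := fun o => Obs.Y o)
    (hY.restrict _) hb.mh2 hb.sq2 (by simpa only [one_mul] using hb.eqn2) le_rfl
  obtain ⟨b1, hb1, k1, hk1, -, H1⟩ := hI.coercive1.perturb_bound (hb.sq2.restrict _) hb.mh1 hb.sq1
    (by simpa only [one_mul] using hb.eqn1) hb2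
  obtain ⟨b0, hb0, k0, hk0, -, H0⟩ := hI.coercive0.perturb_bound (hb.sq1.restrict _) hb.mh0 hb.sq0
    (by simpa only [one_mul] using hb.eqn0) hb1
  refine ⟨b2 + b1 + b0, by positivity, min k2 (min k1 k0), by positivity,
    fun κ hκ hκ' p h2' h1' h0' hp hpκ h => ?_⟩
  have e2 := H2 κ hκ (hκ'.trans (min_le_left _ _)) p (fun o => Obs.Y o) h2' hp hpκ
    (hY.restrict _) h.mh2 h.sq2 h.eqn2 (by simp)
  have e1 := H1 κ hκ (hκ'.trans ((min_le_right _ _).trans (min_le_left _ _))) p _ h1' hp hpκ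
    (h.sq2.restrict _) h.mh1 h.sq1 h.eqn1
    ((lpNorm_mono_measure (h.sq2.sub hb.sq2) Measure.restrict_le_self).trans e2)
  have e0 := H0 κ hκ (hκ'.trans ((min_le_right _ _).trans (min_le_right _ _))) p _ h0' hp hpκ
    (h.sq1.restrict _) h.mh0 h.sq0 h.eqn0
    ((lpNorm_mono_measure (h.sq1.sub hb.sq1) Measure.restrict_le_self).trans e1)
  linarith

/-- The moment function represents the derivative of the target along smooth submodels. -/
lemma IsSubmodel.hasDerivAt (hI : InvertibleBridges Q) (hY : MemLp (fun o => Obs.Y o) 2 Q)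
    (hb : WeightedBridges Q (fun _ => 1) h2 h1 h0) (k : WeakTreatmentBridges Q q0 q1 q2)
    (hsq : MemLp (moment h2 h1 h0 q0 q1 q2) 2 Q) {p : ℝ → Obs 𝒟 ℳ 𝒲 𝒵 𝒳 → ℝ}
    {s : Obs 𝒟 ℳ 𝒲 𝒵 𝒳 → ℝ} {v : ℝ → ℝ} (h : IsSubmodel Q p s v) :
    HasDerivAt v (∫ o, moment h2 h1 h0 q0 q1 q2 o * s o ∂Q) 0 := by
  obtain ⟨C, hC0, hC⟩ := h.exists_lip
  obtain ⟨b, hb0, κ₀, hκ₀, H⟩ := hb.exists_bound hI hY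
  have hs := hb.sqBridges hY k
  set m := moment h2 h1 h0 q0 q1 q2 with hm
  -- Near zero the target is the weighted mean of a moment function with perturbed outcome bridges
  -- but the treatment bridges of $Q$, so treatment bridges at the perturbed laws need not exist.
  have rep : ∀ᶠ t in 𝓝 (0 : ℝ), C * |t| ≤ κ₀ ∧ C * |t| ≤ 1 / 2 ∧ (∀ᵐ o ∂Q, |p t o - 1| ≤ C * |t|) ∧
      ∃ h2' h1' h0', WeightedBridges Q (p t) h2' h1' h0' ∧
        v t = ∫ o, p t o * moment h2' h1' h0' q0 q1 q2 o ∂Q := by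
    filter_upwards [hC κ₀ hκ₀, hC (1 / 2) (by norm_num), h.prob, h.mem] with t ht1 ht2 ht3 ht4
    have hb' := ht2.2.mono fun o ho => ho.trans ht2.1
    obtain ⟨-, h2', h1', h0', hw, hv⟩ := (isTarget_withDensity_iff (h.meas t) hb').1 ht4
    exact ⟨ht1.1, ht2.1, ht1.2, h2', h1', h0', hw, hv.trans (hw.integral_eq (h.meas t) hb' hY k)⟩
  -- By the treatment equations at $Q$ the unweighted mean is $E[Aq_2Y]$, whatever the outcome
  -- functions are. This removes the first-order effect of the change of bridges.
  have hconst : ∀ {q : Obs 𝒟 ℳ 𝒲 𝒵 𝒳 → ℝ} {h2' h1' h0'}, WeightedBridges Q q h2' h1' h0' →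
      ∫ o, moment h2' h1' h0' q0 q1 q2 o ∂Q = ∫ o, m o ∂Q := fun hw => by
    rw [k.integral_moment (hw.sqBridges hY k), hm, k.integral_moment hs]
  have hv0 : v 0 = ∫ o, m o ∂Q := by
    obtain ⟨-, -, h3, h2', h1', h0', hw, hv⟩ := rep.self_of_nhds
    rw [hv, ← hconst hw]
    refine integral_congr_ae ?_
    filter_upwards [h3] with o ho
    rw [abs_zero, mul_zero] at ho
    rw [sub_eq_zero.1 (abs_nonpos_iff.1 ho), one_mul]
  rw [hasDerivAt_iff_tendsto_slope_zero]
  set K := (lpNorm (fun o => trt o * q0 (ZX o)) 2 Q + lpNorm (fun o => (1 - trt o) * q1 (ZDX o)) 2 Q +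
    lpNorm (fun o => trt o * q2 (ZMDX o)) 2 Q + lpNorm (fun _ : Obs 𝒟 ℳ 𝒲 𝒵 𝒳 => (1 : ℝ)) 2 Q)
    with hK
  have hK0 : 0 ≤ K := add_nonneg (add_nonneg (add_nonneg lpNorm_nonneg lpNorm_nonneg)
    lpNorm_nonneg) lpNorm_nonneg
  have hmain := h.tendsto_integral hsq
  have hrem : Tendsto (fun t : ℝ => t⁻¹ • (v (0 + t) - v 0) -
      ∫ o, (p t o - 1) / t * m o ∂Q) (𝓝[≠] 0) (𝓝 0) := by
    rw [tendsto_zero_iff_norm_tendsto_zero]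
    have hb : Tendsto (fun t : ℝ => C * (K * (C * |t| * b))) (𝓝[≠] 0) (𝓝 0) := by
      have : Continuous fun t : ℝ => C * (K * (C * |t| * b)) := by fun_prop
      simpa using (this.tendsto 0).mono_left nhdsWithin_le_nhds
    refine squeeze_zero' (Eventually.of_forall fun t => norm_nonneg _) ?_ hb
    filter_upwards [self_mem_nhdsWithin, rep.filter_mono nhdsWithin_le_nhds] with t ht0 ht
    have ht0 : t ≠ 0 := ht0
    obtain ⟨e1, e2, e3, h2', h1', h0', hw, hv⟩ := ht
    have hs' := hw.sqBridges hY k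
    set m' := moment h2' h1' h0' q0 q1 q2 with hm'
    have hdiv : ∀ᵐ o ∂Q, ‖(p t o - 1) / t‖ ≤ C := e3.mono fun o ho => by
      rw [Real.norm_eq_abs, abs_div, div_le_iff₀ (abs_pos.2 ht0)]
      exact ho
    have hpm : AEStronglyMeasurable (fun o => (p t o - 1) / t) Q :=
      (((h.meas t).sub_const 1).div_const t).aestronglyMeasurable
    have im : Integrable (fun o => (p t o - 1) / t * m o) Q := hs.integrable.bdd_mul hpm hdiv
    have im' : Integrable (fun o => (p t o - 1) / t * m' o) Q := hs'.integrable.bdd_mul hpm hdiv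
    have hpi : Integrable (fun o => p t o * m' o) Q := by
      refine ((im'.const_mul t).add hs'.integrable).congr (Eventually.of_forall fun o => ?_)
      simp only [Pi.add_apply]
      field_simp
      ring
    have im'' : Integrable m' Q := hs'.integrable
    have hc : ∫ o, m' o ∂Q = ∫ o, m o ∂Q := hconst hw
    -- The remainder is the product of $(p_t-1)/t$, bounded by $C$, and a change of the moment
    -- function of $L^1$-size $O(|t|)$.
    have e : t⁻¹ • (v (0 + t) - v 0) - ∫ o, (p t o - 1) / t * m o ∂Q =
        ∫ o, (p t o - 1) / t * (m' o - m o) ∂Q := by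
      rw [zero_add, hv, hv0, ← hc, ← integral_sub hpi im'', ← integral_smul,
        ← integral_sub _ im]
      · refine integral_congr_ae (Eventually.of_forall fun o => ?_)
        simp only [smul_eq_mul]
        field_simp
      · refine im'.congr (Eventually.of_forall fun o => ?_)
        simp only [smul_eq_mul]
        field_simp
    rw [e]
    refine (norm_integral_le_integral_norm _).trans ?_
    have id : Integrable (fun o => |m' o - m o|) Q := (hs'.integrable.sub hs.integrable).abs
    refine (integral_mono_of_nonneg (Eventually.of_forall fun o => norm_nonneg _)
      (id.const_mul C) ?_).trans ?_
    · filter_upwards [hdiv] with o ho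
      rw [norm_mul]
      exact mul_le_mul_of_nonneg_right ho (norm_nonneg _)
    · rw [integral_const_mul]
      exact mul_le_mul_of_nonneg_left ((integral_abs_moment_sub_le hs hs').trans
        (mul_le_mul_of_nonneg_left (H _ (by positivity) e1 _ _ _ _ (h.meas t) e3 hw) hK0)) hC0
  have := hrem.add hmain
  rw [zero_add] at this
  refine this.congr fun t => ?_
  rw [sub_add_cancel]

open Classical in
/-- Every bounded function with mean zero is a score. -/
lemma mem_scores (hI : InvertibleBridges Q) (hY : MemLp (fun o => Obs.Y o) 2 Q)
    {s : Obs 𝒟 ℳ 𝒲 𝒵 𝒳 → ℝ} (hs : Measurable s) {K : ℝ} (hK : ∀ o, |s o| ≤ K)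
    (h0 : ∫ o, s o ∂Q = 0) : s ∈ scores Q := by
  have hm : ∀ t : ℝ, Measurable fun o => 1 + t * s o := fun t => (hs.const_mul t).const_add 1
  have hs2 : MemLp s 2 Q := MemLp.of_bound hs.aestronglyMeasurable K (Eventually.of_forall hK)
  have hsi := hs2.integrable one_le_two
  have hst : ∀ a, MemLp s ∞ (Q.restrict (arm a)) := fun a =>
    MemLp.of_bound hs.aestronglyMeasurable K (Eventually.of_forall hK)
  have hsm : ∀ᶠ t : ℝ in 𝓝 0, ∀ o, |t * s o| ≤ 1 / 2 := by
    have h1 : Tendsto (fun t : ℝ => |t| * K) (𝓝 0) (𝓝 0) := by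
      have : Continuous fun t : ℝ => |t| * K := by fun_prop
      simpa using this.tendsto 0
    filter_upwards [h1.eventually (ge_mem_nhds (by norm_num : (0 : ℝ) < 1 / 2))] with t ht o
    rw [abs_mul]
    exact (mul_le_mul_of_nonneg_left (hK o) (abs_nonneg t)).trans ht
  have hprob : ∀ᶠ t : ℝ in 𝓝 0,
      IsProbabilityMeasure (Q.withDensity fun o => ENNReal.ofReal (1 + t * s o)) := by
    filter_upwards [hsm] with t ht
    have hi : Integrable (fun o => 1 + t * s o) Q := (integrable_const (1 : ℝ)).add (hsi.const_mul t)
    refine ⟨?_⟩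
    rw [withDensity_apply _ MeasurableSet.univ, Measure.restrict_univ,
      ← ofReal_integral_eq_lintegral_ofReal hi
        (Eventually.of_forall fun o => by
          simp only [Pi.zero_apply]
          linarith [(abs_le.1 (ht o)).1]),
      integral_add (integrable_const 1) (hsi.const_mul t), integral_const_mul, h0]
    simp
  -- The linear path has score $s$. Its target value is chosen where one exists; the value 0
  -- elsewhere does not matter, as only $t$ near 0 counts.
  refine ⟨fun t o => 1 + t * s o, fun t => if h : ∃ x,
    IsTarget (Q.withDensity fun o => ENNReal.ofReal (1 + t * s o)) x then h.choose else 0, hm,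
    ⟨K, Eventually.of_forall fun t => Eventually.of_forall fun o => ?_⟩, hprob, ?_, hs2, ?_⟩
  · rw [add_sub_cancel_left, abs_mul, mul_comm]
    exact mul_le_mul_of_nonneg_right (hK o) (abs_nonneg t)
  -- For small $t$ the three weighted equations are solvable, and solving them in the order
  -- $h_2,h_1,h_0$ shows that the perturbed law belongs to the model.
  · filter_upwards [hsm, hprob,
      hI.solvable2.perturb (by fun_prop) (by fun_prop) hI.coercive2 (hst true),
      hI.solvable1.perturb (by fun_prop) (by fun_prop) hI.coercive1 (hst false),
      hI.solvable0.perturb (by fun_prop) (by fun_prop) hI.coercive0 (hst true)] with t ht hp S2 S1 S0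
    obtain ⟨f2, m2, l2, e2⟩ := S2 (fun o => Obs.Y o) (hY.restrict _)
    obtain ⟨f1, m1, l1, e1⟩ := S1 _ (l2.restrict _)
    obtain ⟨f0, m0, l0, e0⟩ := S0 _ (l1.restrict _)
    have hx : ∃ x, IsTarget (Q.withDensity fun o => ENNReal.ofReal (1 + t * s o)) x :=
      ⟨_, (isTarget_withDensity_iff (hm t) (Eventually.of_forall fun o => by
        rw [add_sub_cancel_left]; exact ht o)).2
        ⟨hY, f2, f1, f0, ⟨m2, m1, m0, l2, l1, l0, e2, e1, e0⟩, rfl⟩⟩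
    rw [dif_pos hx]
    exact hx.choose_spec
  -- The second-order bound for the square root gives a pointwise error at most $|t|K^2/2$, whose
  -- square is the displayed quantity.
  · have hb : Tendsto (fun t : ℝ => t ^ 2 * (K ^ 4 / 4)) (𝓝[≠] 0) (𝓝 0) := by
      have : Continuous fun t : ℝ => t ^ 2 * (K ^ 4 / 4) := by fun_prop
      simpa using (this.tendsto 0).mono_left nhdsWithin_le_nhds
    refine squeeze_zero' (Eventually.of_forall fun t => integral_nonneg fun o => sq_nonneg _) ?_ hb
    filter_upwards [self_mem_nhdsWithin, hsm.filter_mono nhdsWithin_le_nhds] with t ht0 ht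
    have ht0 : t ≠ 0 := ht0
    have hle : ∀ o, ((Real.sqrt (1 + t * s o) - 1) / t - s o / 2) ^ 2 ≤ t ^ 2 * (K ^ 4 / 4) := by
      intro o
      have h1 := (abs_sqrt_one_add_sub_le (ht o)).2
      have h2 : (Real.sqrt (1 + t * s o) - 1) / t - s o / 2 =
          (Real.sqrt (1 + t * s o) - 1 - t * s o / 2) / t := by field_simp
      have h3 : s o ^ 2 ≤ K ^ 2 := sq_le_sq' (abs_le.1 (hK o)).1 (abs_le.1 (hK o)).2
      have h4 : |(Real.sqrt (1 + t * s o) - 1) / t - s o / 2| ≤ |t| * (K ^ 2 / 2) := by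
        rw [h2, abs_div, div_le_iff₀ (abs_pos.2 ht0)]
        refine h1.trans ?_
        have h5 : |t| * (K ^ 2 / 2) * |t| = t ^ 2 * (K ^ 2 / 2) := by rw [← sq_abs t]; ring
        rw [h5, mul_pow]
        nlinarith [sq_nonneg t]
      rw [← sq_abs]
      calc _ ≤ (|t| * (K ^ 2 / 2)) ^ 2 := pow_le_pow_left₀ (abs_nonneg _) h4 2
        _ = t ^ 2 * (K ^ 4 / 4) := by rw [mul_pow, sq_abs]; ring
    refine (integral_mono_of_nonneg (Eventually.of_forall fun o => sq_nonneg _)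
      (integrable_const _) (Eventually.of_forall hle)).trans ?_
    simp

/-- Mean-zero square-integrable functions are in the closure of the scores. -/
lemma exists_mem_scores (hI : InvertibleBridges Q) (hY : MemLp (fun o => Obs.Y o) 2 Q)
    {φ : Obs 𝒟 ℳ 𝒲 𝒵 𝒳 → ℝ} (hφ : MemLp φ 2 Q) (h0 : ∫ o, φ o ∂Q = 0) {ε : ℝ} (hε : 0 < ε) :
    ∃ s ∈ scores Q, eLpNorm (fun o => φ o - s o) 2 Q < ENNReal.ofReal ε := by
  -- Simple functions are bounded and dense, and bounded functions are scores once centred. Half of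
  -- $\varepsilon$ is kept for the centring.
  obtain ⟨g, hg, hg2⟩ := hφ.exists_simpleFunc_eLpNorm_sub_lt (by simp)
    (ε := ENNReal.ofReal (ε / 2)) (ENNReal.ofReal_pos.2 (by positivity)).ne'
  obtain ⟨K, hK⟩ := g.exists_forall_norm_le
  have hgi := hg2.integrable one_le_two
  set c := ∫ o, g o ∂Q with hc
  -- As $\varphi$ has mean zero, the mean of $g$ is minus that of $\varphi-g$ and is bounded by the
  -- norm of the latter.
  have hcm : eLpNorm (fun _ : Obs 𝒟 ℳ 𝒲 𝒵 𝒳 => c) 2 Q ≤ eLpNorm (φ - ⇑g) 2 Q := by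
    rw [eLpNorm_const _ (by simp) (NeZero.ne Q)]
    simp only [measure_univ, ENNReal.one_rpow, mul_one]
    have h1 : -c = ∫ o, (φ o - g o) ∂Q := by
      rw [integral_sub (hφ.integrable one_le_two) hgi, h0, zero_sub]
    rw [← enorm_neg, h1]
    refine (enorm_integral_le_lintegral_enorm _).trans ?_
    have h2 := eLpNorm_le_eLpNorm_of_exponent_le (μ := Q) one_le_two (hφ.sub hg2).1
    rwa [eLpNorm_one_eq_lintegral_enorm] at h2
  refine ⟨fun o => g o - c, mem_scores hI hY (K := |K| + |c|) (g.measurable.sub_const c)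
    (fun o => (abs_sub _ _).trans ?_) ?_, ?_⟩
  · exact add_le_add ((hK o).trans (le_abs_self K)) le_rfl
  · rw [integral_sub hgi (integrable_const c), integral_const, ← hc]
    simp
  · have h3 : (fun o => φ o - (g o - c)) = (φ - ⇑g) + fun _ => c := by
      funext o
      simp only [Pi.add_apply, Pi.sub_apply]
      ring
    rw [h3]
    refine (eLpNorm_add_le (hφ.sub hg2).1 aestronglyMeasurable_const one_le_two).trans_lt ?_
    refine (add_le_add_right hcm _).trans_lt ((ENNReal.add_lt_add hg hg).trans_le ?_)
    rw [← ENNReal.ofReal_add (by positivity) (by positivity), add_halves]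

/-- The centred moment function is the efficient influence function. -/
theorem WeightedBridges.isEIF (hI : InvertibleBridges Q) (hY : MemLp (fun o => Obs.Y o) 2 Q)
    (hb : WeightedBridges Q (fun _ => 1) h2 h1 h0) (k : WeakTreatmentBridges Q q0 q1 q2)
    (hsq : MemLp (moment h2 h1 h0 q0 q1 q2) 2 Q) {ψ : ℝ}
    (hψ : ∫ o, moment h2 h1 h0 q0 q1 q2 o ∂Q = ψ) :
    IsEIF Q fun o => moment h2 h1 h0 q0 q1 q2 o - ψ := by
  have sq : MemLp (fun o => moment h2 h1 h0 q0 q1 q2 o - ψ) 2 Q := hsq.sub (memLp_const ψ)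
  have mean : ∫ o, (moment h2 h1 h0 q0 q1 q2 o - ψ) ∂Q = 0 := by
    rw [integral_sub (hsq.integrable one_le_two) (integrable_const ψ), hψ]
    simp
  refine ⟨sq, mean, fun p s v h => ?_, fun ε hε => ?_⟩
  · have h1 : ∫ o, (moment h2 h1 h0 q0 q1 q2 o - ψ) * s o ∂Q =
        ∫ o, moment h2 h1 h0 q0 q1 q2 o * s o ∂Q := by
      simp only [sub_mul]
      rw [integral_sub (hsq.integrable_mul' h.score_sq)
        ((h.score_sq.integrable one_le_two).const_mul ψ), integral_const_mul, h.integral_score]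
      ring
    rw [h1]
    exact h.hasDerivAt hI hY hb k hsq
  · obtain ⟨s, hs, hs2⟩ := exists_mem_scores hI hY sq mean hε
    exact ⟨s, Submodule.subset_span hs, hs2⟩

end Efficiency

end PathSpecific

/-! ### Invertibility of the bridge operators from surjectivity, uniqueness and completeness -/

section Transfer

variable {Ω Ω' α β γ : Type*} [MeasurableSpace Ω] [MeasurableSpace Ω'] [MeasurableSpace α]
  [MeasurableSpace β] [MeasurableSpace γ] {μ : Measure Ω} [IsFiniteMeasure μ] {E : Set Ω}

/-- An arbitrary right-hand side $F$ enters only through its conditional mean $k(z)$, so it suffices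
to reach functions of $z$. -/
lemma solvable_of_forall {w : Ω → α} {z : Ω → β} (hz : Measurable z)
    (h : ∀ k : β → ℝ, Measurable k → MemLp (fun ω => k (z ω)) 2 (μ.restrict E) →
      ∃ g : α → ℝ, Measurable g ∧ MemLp (fun ω => g (w ω)) 2 μ ∧
        CondMeanZero (μ.restrict E) (fun ω => g (w ω) - k (z ω)) z) :
    Solvable μ E w z fun _ => 1 := fun F hF => by
  set k := condLp (μ.restrict E) hz hF.toLp with hk
  have hk2 := memLp_comp_of_lp hz k
  obtain ⟨g, hg, hg2, hg0⟩ := h k (Lp.stronglyMeasurable k).measurable hk2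
  have h1 : CondMeanZero (μ.restrict E) (hF.toLp - compLp (μ.restrict E) hz k : Lp ℝ 2 _) z := by
    rw [← condLp_eq_zero_iff (μ.restrict E) hz, map_sub, condLp_compLp, hk, sub_self]
  have h2 : CondMeanZero (μ.restrict E) (fun ω => F ω - k (z ω)) z := by
    refine h1.congr ?_
    filter_upwards [Lp.coeFn_sub hF.toLp (compLp (μ.restrict E) hz k), hF.coeFn_toLp,
      coeFn_compLp (μ.restrict E) hz k] with ω e1 e2 e3
    rw [e1, Pi.sub_apply, e2, e3]
  refine ⟨g, hg, hg2, ?_⟩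
  have hg2' := hg2.restrict E
  refine (h2.sub hg0 ((hF.sub hk2).integrable one_le_two)
    ((hg2'.sub hk2).integrable one_le_two)).congr (Eventually.of_forall fun ω => ?_)
  simp only
  ring

variable {g : Ω → Ω'} {E' : Set Ω'} {w : Ω' → α} {z : Ω' → β}

lemma Coercive.map (hg : Measurable g) (hE : MeasurableSet E') (hw : Measurable w) (hz : Measurable z)
    (h : Coercive μ (g ⁻¹' E') (fun ω => w (g ω)) fun ω => z (g ω)) :
    Coercive (μ.map g) E' w z := by
  obtain ⟨c, hc⟩ := h
  refine ⟨c, fun h hh h2 G hG h0 => ?_⟩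
  have hhm : Measurable fun ω => h (w ω) := hh.comp hw
  rw [Measure.restrict_map hg hE] at hG h0 ⊢
  have h2' := (memLp_map_measure_iff hhm.aestronglyMeasurable hg.aemeasurable).1 h2
  have hG' := (memLp_map_measure_iff hG.1 hg.aemeasurable).1 hG
  have key : lpNorm ((fun ω => h (w ω)) ∘ g) 2 μ ≤ _ := hc h hh h2' _ hG'
    ((condMeanZero_map_iff hg (hhm.aestronglyMeasurable.sub hG.1) hz).1 h0)
  rw [← toReal_eLpNorm h2.1, ← toReal_eLpNorm hG.1,
    eLpNorm_map_measure hhm.aestronglyMeasurable hg.aemeasurable,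
    eLpNorm_map_measure hG.1 hg.aemeasurable]
  rwa [← toReal_eLpNorm h2'.1, ← toReal_eLpNorm hG'.1] at key

lemma Solvable.map (hg : Measurable g) (hE : MeasurableSet E') (hw : Measurable w) (hz : Measurable z)
    (h : Solvable μ (g ⁻¹' E') (fun ω => w (g ω)) (fun ω => z (g ω)) fun _ => 1) :
    Solvable (μ.map g) E' w z fun _ => 1 := fun F hF => by
  rw [Measure.restrict_map hg hE] at hF ⊢
  obtain ⟨f, hf, hf2, hf0⟩ := h _ ((memLp_map_measure_iff hF.1 hg.aemeasurable).1 hF)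
  have hfm : Measurable fun ω => f (w ω) := hf.comp hw
  refine ⟨f, hf, (memLp_map_measure_iff hfm.aestronglyMeasurable hg.aemeasurable).2 hf2, ?_⟩
  exact (condMeanZero_map_iff hg ((hF.1.sub hfm.aestronglyMeasurable).const_mul 1) hz).2 hf0

/-- A function of `z` with mean zero given `S` vanishes if it is the conditional mean of a function
of `S`. -/
lemma ae_eq_zero_of_condMeanZero {k : β → ℝ} {z : Ω → β} {f : γ → ℝ} {S : Ω → γ} (hk : Measurable k)
    (hz : Measurable z) (hf : Measurable f) (hS : Measurable S) (hk2 : MemLp (fun ω => k (z ω)) 2 μ)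
    (hf2 : MemLp (fun ω => f (S ω)) 2 μ) (h1 : CondMeanZero μ (fun ω => k (z ω)) S)
    (h2 : CondMeanZero μ (fun ω => k (z ω) - f (S ω)) z) : (fun ω => k (z ω)) =ᵐ[μ] 0 := by
  have i1 := h1.integral_mul hS (hk2.integrable one_le_two) hf (hf2.integrable_mul hk2)
  have i2 := h2.integral_mul hz ((hk2.sub hf2).integrable one_le_two) hk
    (hk2.integrable_mul (hk2.sub hf2))
  simp only [mul_comm (f _)] at i1
  rw [integral_mul_sub_of_memLp hk2 hk2 hf2, i1, sub_zero, ← lpNorm_mul_self hk2] at i2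
  exact (lpNorm_eq_zero hk2 (by simp)).1 (mul_self_eq_zero.1 i2)

end Transfer

namespace PathSpecific.CausalModel

variable {Ω 𝒰 𝒟 ℳ 𝒲 𝒵 𝒳 : Type*} [mΩ : MeasurableSpace Ω] [MeasurableSpace 𝒰]
  [MeasurableSpace 𝒟] [MeasurableSpace ℳ] [MeasurableSpace 𝒲] [MeasurableSpace 𝒵]
  [MeasurableSpace 𝒳]

variable {C : CausalModel Ω 𝒰 𝒟 ℳ 𝒲 𝒵 𝒳} {P : Measure Ω} [IsProbabilityMeasure P]
  {f : Densities 𝒰 𝒟 ℳ 𝒳} {κW : Kernel (𝒰 × 𝒳) 𝒲} {κZ : Bool → Kernel (𝒰 × 𝒳) 𝒵}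

lemma solvable_of_surjective {α β : Type*} [MeasurableSpace α] [MeasurableSpace β]
    (hpos : C.Positivity P f) (a : Bool) {w : Obs 𝒟 ℳ 𝒲 𝒵 𝒳 → α} {z : Obs 𝒟 ℳ 𝒲 𝒵 𝒳 → β}
    (hw : Measurable w) (hz : Measurable z)
    (h : ∀ k : β → ℝ, Measurable k → MemLp (fun o => k (z o)) 2 (PathSpecific.given (P.map C.obs) a) →
      ∃ g : α → ℝ, Measurable g ∧ MemLp (fun o => g (w o)) 2 (P.map C.obs) ∧
      (PathSpecific.given (P.map C.obs) a)[fun o => g (w o) | sigmaOf z]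
        =ᵐ[PathSpecific.given (P.map C.obs) a] fun o => k (z o)) :
    Solvable P {ω | C.A ω = a} (fun ω => w (C.obs ω)) (fun ω => z (C.obs ω)) fun _ => 1 := by
  have hne : (P.map C.obs) (Obs.arm a) ≠ 0 := by
    rw [Measure.map_apply measurable_obs (PathSpecific.measurableSet_arm a)]
    exact hpos.ne_zero a
  have hzo : Measurable fun ω => z (C.obs ω) := hz.comp measurable_obs
  refine solvable_of_forall hzo fun k hk hk2 => ?_
  have hkz : Measurable fun o => k (z o) := hk.comp hz
  have hk3 : MemLp (fun o => k (z o)) 2 ((P.map C.obs).restrict (Obs.arm a)) := by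
    rw [map_obs_restrict]
    exact (memLp_map_measure_iff hkz.aestronglyMeasurable measurable_obs.aemeasurable).2 hk2
  have hk4 := (memLp_cond_iff hne).2 hk3
  obtain ⟨g, hg, hg2, hg0⟩ := h k hk hk4
  have hgw : Measurable fun o => g (w o) := hg.comp hw
  refine ⟨g, hg, memLp_obs hgw hg2, ?_⟩
  have h1 : (PathSpecific.given (P.map C.obs) a)[fun o => k (z o) | sigmaOf z] = fun o => k (z o) :=
    condExp_of_stronglyMeasurable hz.comap_le
      (hk.comp (comap_measurable z)).stronglyMeasurable (hk4.integrable one_le_two)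
  have h2 := (cond_condExp_ae_eq_iff hz ((hg2.restrict _).integrable one_le_two)
    (hk3.integrable one_le_two)).1 (hg0.trans (EventuallyEq.of_eq h1.symm))
  rw [map_obs_restrict] at h2
  exact (condMeanZero_map_iff measurable_obs (hgw.sub hkz).aestronglyMeasurable hz).1 h2

namespace ProxyKernels

/-- Given the latent variables, the proxy `Z` does not affect the mean of a function of
`(W,M,D,X)`. -/
lemma condMeanZero_eta2 (h : C.ProxyKernels P κW κZ) (a : Bool) {h2 : 𝒲 × ℳ × 𝒟 × 𝒳 → ℝ}
    (hh : Measurable h2) (hi : MemLp (fun ω => h2 (C.WMDX ω)) 2 (C.on P a)) :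
    CondMeanZero (C.on P a) (fun ω => h2 (C.WMDX ω) - eta2 κW h2 (C.UXDM ω)) C.ZMDX := by
  have := h.markovW
  have hm : Measurable fun p : ((𝒰 × 𝒳) × (𝒟 × ℳ × 𝒵)) × 𝒲 => h2 (p.2, p.1.2.2.1, p.1.2.1, p.1.1.2) :=
    hh.comp (by fun_prop)
  have h1 := (h.W a).condMeanZero (by fun_prop) (by fun_prop) hm (hi.integrable one_le_two)
  exact h1.comp (f := fun t => (t.2.2.2, t.2.2.1, t.2.1, t.1.2)) (by fun_prop)

end ProxyKernels

/-- Under strict positivity, the arms have comparable laws of `(U,X,D)`. -/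
lemma StrictPositivity.exists_bound (hpos : C.Positivity P f) (hpos' : C.StrictPositivity P f) :
    ∃ b : ℝ, 0 ≤ b ∧ ∀ η : (𝒰 × 𝒳) × 𝒟 → ℝ, Measurable η →
      MemLp (fun ω => η (C.UXD ω)) 2 (C.on P false) → MemLp (fun ω => η (C.UXD ω)) 2 (C.on P true) ∧
      lpNorm (fun ω => η (C.UXD ω)) 2 (C.on P true) ≤
        b * lpNorm (fun ω => η (C.UXD ω)) 2 (C.on P false) := by
  obtain ⟨c, hc, hb⟩ := hpos'
  have : IsProbabilityMeasure (P.map C.UX) := Measure.isProbabilityMeasure_map (by fun_prop)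
  -- The density of a restriction of $P$ relative to $P$ is at most one.
  have he : ∀ᵐ p ∂(P.map C.UX), f.e true p ≤ 1 := by
    have h1 : (fun p => ENNReal.ofReal (f.e true p)) ≤ᵐ[P.map C.UX] fun _ => 1 := by
      refine ae_le_of_forall_setLIntegral_le_of_sigmaFinite (by fun_prop) fun s hs _ => ?_
      rw [← withDensity_apply _ hs, ← hpos.dens_A true, setLIntegral_one]
      exact Measure.map_mono Measure.restrict_le_self (by fun_prop) s
    filter_upwards [h1] with p hp
    exact ENNReal.ofReal_le_one.1 hp
  -- The density on arm 1 is at most $c^{-1}$ and that on arm 0 at least $c^2$, so their ratio is at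
  -- most $c^{-3}$.
  set K : ℝ := c⁻¹ * c⁻¹ * c⁻¹ with hK
  have hle : (C.on P true).map C.UXD ≤ ENNReal.ofReal K • (C.on P false).map C.UXD := by
    rw [hpos.map_UXD, hpos.map_UXD, ← withDensity_smul _ (f.measurable_den1 false).ennreal_ofReal]
    refine withDensity_mono ?_
    filter_upwards [Measure.quasiMeasurePreserving_fst.ae he, (hb true).2.1, (hb false).2.1,
      Measure.quasiMeasurePreserving_fst.ae (hb false).1, hpos.pos1 true] with p h1 h2 h3 h4 h5
    rw [Pi.smul_apply, smul_eq_mul, ← ENNReal.ofReal_mul (by positivity)]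
    refine ENNReal.ofReal_le_ofReal ?_
    have e1 : f.den1 true p ≤ 1 * c⁻¹ := mul_le_mul h1 h2.2 h5.2.le zero_le_one
    have e2 : c * c ≤ f.den1 false p := mul_le_mul h4 h3.1 hc.le (hc.le.trans h4)
    refine e1.trans ((le_of_eq ?_).trans (mul_le_mul_of_nonneg_left e2 (by positivity)))
    rw [hK]
    field_simp
  refine ⟨((ENNReal.ofReal K) ^ (1 / (2 : ℝ≥0∞)).toReal).toReal, ENNReal.toReal_nonneg,
    fun η hη h2 => ?_⟩
  have hm : Measurable C.UXD := by fun_prop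
  have h3 : MemLp η 2 ((C.on P false).map C.UXD) :=
    (memLp_map_measure_iff hη.aestronglyMeasurable hm.aemeasurable).2 h2
  have h4 : MemLp η 2 ((C.on P true).map C.UXD) :=
    (h3.smul_measure ENNReal.ofReal_ne_top).mono_measure hle
  have h5 : MemLp (fun ω => η (C.UXD ω)) 2 (C.on P true) :=
    (memLp_map_measure_iff hη.aestronglyMeasurable hm.aemeasurable).1 h4
  refine ⟨h5, ?_⟩
  rw [← toReal_eLpNorm h5.1, ← toReal_eLpNorm h2.1, ← ENNReal.toReal_mul]
  have e1 := eLpNorm_map_measure (p := 2) (μ := C.on P true) hη.aestronglyMeasurable hm.aemeasurable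
  have e2 := eLpNorm_map_measure (p := 2) (μ := C.on P false) hη.aestronglyMeasurable hm.aemeasurable
  refine ENNReal.toReal_mono (ENNReal.mul_ne_top (by simp) h2.2.ne) ?_
  rw [show (fun ω => η (C.UXD ω)) = η ∘ C.UXD from rfl, ← e1, ← e2, ← smul_eq_mul,
    ← eLpNorm_smul_measure_of_ne_top (by simp)]
  exact eLpNorm_mono_measure η hle

section Invertible

/-- Adding to $h_2$ a function in the kernel of the operator gives another bridge function;
uniqueness makes the operator injective, and with surjectivity it is bounded below. -/
lemma coercive2 (hT : Surjectivity (P.map C.obs)) (hU : UniqueBridges (P.map C.obs))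
    (hpos : C.Positivity P f) (hY : MemLp (fun o => Obs.Y o) 2 (P.map C.obs))
    {h2 : 𝒲 × ℳ × 𝒟 × 𝒳 → ℝ} (e2 : IsH2 (P.map C.obs) h2) :
    Coercive P {ω | C.A ω = true} C.WMDX C.ZMDX := by
  refine (solvable_of_surjective hpos true (w := Obs.WMDX) (z := Obs.ZMDX) (by fun_prop)
    (by fun_prop) hT.T2).coercive (w := C.WMDX) (z := C.ZMDX) (by fun_prop) (by fun_prop)
    fun g hg hg2 hg0 => ?_
  obtain ⟨m2, s2, c2⟩ := (isH2_iff hY).1 e2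
  have c2' := (condMeanZero_obs_true (by fun_prop) (by fun_prop)).1 c2
  have s2' := memLp_obs (F := fun o => h2 (Obs.WMDX o)) (by fun_prop) s2
  have hY' := memLp_obs (F := fun o => Obs.Y o) (by fun_prop) hY
  have hgm : Measurable fun o : Obs 𝒟 ℳ 𝒲 𝒵 𝒳 => g (Obs.WMDX o) := by fun_prop
  have hgQ : MemLp (fun o => g (Obs.WMDX o)) 2 (P.map C.obs) :=
    (memLp_map_measure_iff hgm.aestronglyMeasurable measurable_obs.aemeasurable).2 hg2
  have e2' : IsH2 (P.map C.obs) fun t => h2 t + g t := by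
    refine (isH2_iff hY).2 ⟨m2.add hg, s2.add hgQ, ?_⟩
    refine (condMeanZero_obs_true (by fun_prop) (by fun_prop)).2 ?_
    refine (c2'.sub hg0 (((hY'.sub s2').restrict _).integrable one_le_two)
      ((hg2.restrict _).integrable one_le_two)).congr (Eventually.of_forall fun ω => ?_)
    simp only
    change _ = Obs.Y (C.obs ω) - (h2 (Obs.WMDX (C.obs ω)) + g (C.WMDX ω))
    ring
  filter_upwards [ae_of_ae_map measurable_obs.aemeasurable (hU.h2 _ _ e2' e2)] with ω hω
  exact add_eq_left.1 hω

variable (hκ : C.ProxyKernels P κW κZ) (hpos : C.Positivity P f)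
include hκ hpos

/-- Let $h(W,D,X)$ have the same mean as $G$ given $(A=0,Z,D,X)$. The open mapping theorem for $T_1$
yields $f(W,M,D,X)$ with that mean and $\|f\|\le c\|G\|$. Completeness of $Z$ shows that the latent
mean $\eta$ of $h$ is also that of $f$, so $\|\eta\|\le\|f\|$ on arm 0. Uniform positivity transfers
this bound to arm 1, where $h$ and $\eta$ have the same mean given $(Z,M,D,X)$, and the lower bound
for $T_2$ controls $h$ by $\eta$. -/
lemma ProxyKernels.coercive1 (hpos' : C.StrictPositivity P f) (hz2 : C.CompleteZ2 P)
    (h1 : Solvable P {ω | C.A ω = false} C.WMDX C.ZDX fun _ => 1)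
    (h2 : Coercive P {ω | C.A ω = true} C.WMDX C.ZMDX) :
    Coercive P {ω | C.A ω = false} C.WDX C.ZDX := by
  have := hκ.markovW
  obtain ⟨c, hc0, hc⟩ := h1.exists_bound (by fun_prop) (by fun_prop)
  obtain ⟨c2, H2⟩ := h2
  obtain ⟨b, hb0, hb⟩ := hpos'.exists_bound hpos
  refine ⟨max c2 0 * (b * c), fun h hh hh2 G hG h0 => ?_⟩
  obtain ⟨f, hf, hf2, hf0, hfc⟩ := hc G hG
  have hhF : MemLp (fun ω => h (C.WDX ω)) 2 (C.on P false) := hh2.restrict _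
  have hfF : MemLp (fun ω => f (C.WMDX ω)) 2 (C.on P false) := hf2.restrict _
  have r1 : CondMeanZero (C.on P false) (fun ω => h (C.WDX ω) - f (C.WMDX ω)) C.ZDX := by
    refine (h0.add hf0 ((hhF.sub hG).integrable one_le_two) ((hG.sub hfF).integrable
      one_le_two)).congr (Eventually.of_forall fun ω => ?_)
    simp only
    ring
  have r2 := hκ.completeZ2 hpos hz2
    (r := fun t => h (t.2.1, t.2.2.1, t.1.2) - f (t.2.1, t.2.2.2.1, t.2.2.1, t.1.2))
    (by fun_prop) (hhF.sub hfF) r1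
  obtain ⟨η2, r3⟩ := hκ.eta1_spec false hh hhF
  have r3' := r3.comp (f := fun t => t.1) (by fun_prop)
  have hη : Measurable (eta1 κW h) := measurable_eta1 hh
  have r4 : CondMeanZero (C.on P false) (fun ω => f (C.WMDX ω) - eta1 κW h (C.UXD ω)) C.UXD := by
    refine (r3'.sub r2 ((hhF.sub η2).integrable one_le_two) ((hhF.sub hfF).integrable
      one_le_two)).congr (Eventually.of_forall fun ω => ?_)
    simp only
    ring
  have n1 := (lpNorm_le_of_condMeanZero hfF hη (by fun_prop) η2 r4).trans
    ((lpNorm_mono_measure hf2 Measure.restrict_le_self).trans hfc)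
  obtain ⟨η1, n2⟩ := hb _ hη η2
  have n3 := H2 (fun t => h (t.1, t.2.2)) (by fun_prop) hh2 _ η1
    (hκ.condMeanZero_eta2 true (h2 := fun t => h (t.1, t.2.2)) (by fun_prop) (hh2.restrict _))
  refine n3.trans ((mul_le_mul_of_nonneg_right (le_max_left c2 0) lpNorm_nonneg).trans ?_)
  rw [mul_assoc, mul_assoc]
  exact mul_le_mul_of_nonneg_left (n2.trans (mul_le_mul_of_nonneg_left n1 hb0)) (le_max_right _ _)

/-- The argument for $h_1$ applies with $T_0$ in place of $T_1$. Both equations live on arm 1, so no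
comparison of arms is required. -/
lemma ProxyKernels.coercive0 (hz3 : C.CompleteZ3 P)
    (h0 : Solvable P {ω | C.A ω = true} C.WDX C.ZX fun _ => 1)
    (h2 : Coercive P {ω | C.A ω = true} C.WMDX C.ZMDX) :
    Coercive P {ω | C.A ω = true} C.WX C.ZX := by
  have := hκ.markovW
  obtain ⟨c, hc0, hc⟩ := h0.exists_bound (by fun_prop) (by fun_prop)
  obtain ⟨c2, H2⟩ := h2
  refine ⟨max c2 0 * c, fun h hh hh2 G hG h0 => ?_⟩
  obtain ⟨f, hf, hf2, hf0, hfc⟩ := hc G hG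
  have hhF : MemLp (fun ω => h (C.WX ω)) 2 (C.on P true) := hh2.restrict _
  have hfF : MemLp (fun ω => f (C.WDX ω)) 2 (C.on P true) := hf2.restrict _
  have r1 : CondMeanZero (C.on P true) (fun ω => h (C.WX ω) - f (C.WDX ω)) C.ZX := by
    refine (h0.add hf0 ((hhF.sub hG).integrable one_le_two) ((hG.sub hfF).integrable
      one_le_two)).congr (Eventually.of_forall fun ω => ?_)
    simp only
    ring
  have r2 := hκ.completeZ3 hpos hz3
    (r := fun t => h (t.2.1, t.1.2) - f (t.2.1, t.2.2.1, t.1.2)) (by fun_prop) (hhF.sub hfF) r1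
  obtain ⟨η2, r3⟩ := hκ.eta0_spec true hh hhF
  have r3' := r3.comp (f := fun t => t.1.1) (by fun_prop)
  have hη : Measurable (eta0 κW h) := measurable_eta0 hh
  have r4 : CondMeanZero (C.on P true) (fun ω => f (C.WDX ω) - eta0 κW h (C.UX ω)) C.UX := by
    refine (r3'.sub r2 ((hhF.sub η2).integrable one_le_two) ((hhF.sub hfF).integrable
      one_le_two)).congr (Eventually.of_forall fun ω => ?_)
    simp only
    ring
  have n1 := (lpNorm_le_of_condMeanZero hfF hη (by fun_prop) η2 r4).trans
    ((lpNorm_mono_measure hf2 Measure.restrict_le_self).trans hfc)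
  have n3 := H2 (fun t => h (t.1, t.2.2.2)) (by fun_prop) hh2 _ η2
    (hκ.condMeanZero_eta2 true (h2 := fun t => h (t.1, t.2.2.2)) (by fun_prop) (hh2.restrict _))
  refine n3.trans ((mul_le_mul_of_nonneg_right (le_max_left c2 0) lpNorm_nonneg).trans ?_)
  rw [mul_assoc]
  exact mul_le_mul_of_nonneg_left n1 (le_max_right _ _)

/-- Let $k(Z,D,X)$ be orthogonal to all $g(W,D,X)$ on arm 0. Its latent mean is then orthogonal to
them as well, and vanishes by completeness of $W$. So $k$ has mean zero given the core; but by
surjectivity of $T_1$ it is the conditional mean of a function of $(W,M,D,X)$, and is therefore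
orthogonal to itself. -/
lemma ProxyKernels.solvable1 (hw2 : C.CompleteW2 P)
    (h1 : Solvable P {ω | C.A ω = false} C.WMDX C.ZDX fun _ => 1)
    (hc : Coercive P {ω | C.A ω = false} C.WDX C.ZDX) :
    Solvable P {ω | C.A ω = false} C.WDX C.ZDX fun _ => 1 := by
  refine hc.solvable (by fun_prop) (by fun_prop) fun k hk hk2 hk0 => ?_
  obtain ⟨hm, hm2, hr⟩ := hκ.qbar1_spec false hk hk2
  have hz := hw2.ae_eq_zero hpos hm hm2 <| condMeanZero_of_integral_mul (by fun_prop)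
    fun g hg hg1 => by
      have hgW : Measurable fun ω => g (C.WDX ω) := hg.comp (by fun_prop)
      have g2 : MemLp (fun ω => g (C.WDX ω)) 2 P := memLp_of_bdd hgW fun ω => hg1 _
      have g2' : MemLp (fun ω => g (C.WDX ω)) 2 (C.on P false) := g2.restrict _
      have e1 := hr.integral_mul (by fun_prop) ((hk2.sub hm2).integrable one_le_two)
        (g := fun t => g (t.2.1, t.2.2.1, t.1.2)) (by fun_prop) (g2'.integrable_mul (hk2.sub hm2))
      rwa [integral_mul_sub_of_memLp g2' hk2 hm2, hk0 g hg g2, zero_sub, neg_eq_zero] at e1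
  obtain ⟨F, hF, hF2, hF0⟩ := h1 _ hk2
  refine ae_eq_zero_of_condMeanZero (S := C.core) (f := fun t => F (t.2.1, t.2.2.2.1, t.2.2.1, t.1.2))
    hk (by fun_prop) (by fun_prop) (by fun_prop) hk2 (hF2.restrict _) (hr.congr ?_)
    (by simpa only [one_mul] using hF0)
  filter_upwards [hz] with ω hω
  simp only [Pi.zero_apply] at hω
  rw [hω, sub_zero]

/-- The duality argument for $h_1$, with completeness of $W$ on arm 1 and surjectivity of $T_0$. -/
lemma ProxyKernels.solvable0 (hw1 : C.CompleteW1 P)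
    (h0 : Solvable P {ω | C.A ω = true} C.WDX C.ZX fun _ => 1)
    (hc : Coercive P {ω | C.A ω = true} C.WX C.ZX) :
    Solvable P {ω | C.A ω = true} C.WX C.ZX fun _ => 1 := by
  refine hc.solvable (by fun_prop) (by fun_prop) fun k hk hk2 hk0 => ?_
  obtain ⟨hm, hm2, hr⟩ := hκ.qbar0_spec true hk hk2
  have hz := hw1.ae_eq_zero hpos hm hm2 <| condMeanZero_of_integral_mul (by fun_prop)
    fun g hg hg1 => by
      have hgW : Measurable fun ω => g (C.WX ω) := hg.comp (by fun_prop)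
      have g2 : MemLp (fun ω => g (C.WX ω)) 2 P := memLp_of_bdd hgW fun ω => hg1 _
      have g2' : MemLp (fun ω => g (C.WX ω)) 2 (C.on P true) := g2.restrict _
      have e1 := hr.integral_mul (by fun_prop) ((hk2.sub hm2).integrable one_le_two)
        (g := fun t => g (t.2.1, t.1.2)) (by fun_prop) (g2'.integrable_mul (hk2.sub hm2))
      rwa [integral_mul_sub_of_memLp g2' hk2 hm2, hk0 g hg g2, zero_sub, neg_eq_zero] at e1
  obtain ⟨F, hF, hF2, hF0⟩ := h0 _ hk2
  refine ae_eq_zero_of_condMeanZero (S := C.core) (f := fun t => F (t.2.1, t.2.2.1, t.1.2))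
    hk (by fun_prop) (by fun_prop) (by fun_prop) hk2 (hF2.restrict _) (hr.congr ?_)
    (by simpa only [one_mul] using hF0)
  filter_upwards [hz] with ω hω
  simp only [Pi.zero_apply] at hω
  rw [hω, sub_zero]

/-- The bridge operators of the observed-data law are invertible. -/
theorem ProxyKernels.invertibleBridges (hpos' : C.StrictPositivity P f)
    (hz2 : C.CompleteZ2 P) (hz3 : C.CompleteZ3 P) (hw1 : C.CompleteW1 P) (hw2 : C.CompleteW2 P)
    (hT : Surjectivity (P.map C.obs)) (hU : UniqueBridges (P.map C.obs))
    (hY : MemLp (fun o => Obs.Y o) 2 (P.map C.obs)) {h2 : 𝒲 × ℳ × 𝒟 × 𝒳 → ℝ}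
    (e2 : IsH2 (P.map C.obs) h2) : InvertibleBridges (P.map C.obs) := by
  have t2 : Solvable P {ω | C.A ω = true} C.WMDX C.ZMDX fun _ => 1 :=
    solvable_of_surjective hpos true (w := Obs.WMDX) (z := Obs.ZMDX) (by fun_prop) (by fun_prop) hT.T2
  have t1 : Solvable P {ω | C.A ω = false} C.WMDX C.ZDX fun _ => 1 :=
    solvable_of_surjective hpos false (w := Obs.WMDX) (z := Obs.ZDX) (by fun_prop) (by fun_prop) hT.T1
  have t0 : Solvable P {ω | C.A ω = true} C.WDX C.ZX fun _ => 1 :=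
    solvable_of_surjective hpos true (w := Obs.WDX) (z := Obs.ZX) (by fun_prop) (by fun_prop) hT.T0
  have c2 := coercive2 hT hU hpos hY e2
  have c1 := hκ.coercive1 hpos hpos' hz2 t1 c2
  have c0 := hκ.coercive0 hpos hz3 t0 c2
  have hm := fun a => PathSpecific.measurableSet_arm (𝒟 := 𝒟) (ℳ := ℳ) (𝒲 := 𝒲) (𝒵 := 𝒵) (𝒳 := 𝒳) a
  exact
  { coercive2 := Coercive.map measurable_obs (hm true) (by fun_prop) (by fun_prop) c2
    coercive1 := Coercive.map measurable_obs (hm false) (by fun_prop) (by fun_prop) c1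
    coercive0 := Coercive.map measurable_obs (hm true) (by fun_prop) (by fun_prop) c0
    solvable2 := Solvable.map measurable_obs (hm true) (by fun_prop) (by fun_prop) t2
    solvable1 := Solvable.map measurable_obs (hm false) (by fun_prop) (by fun_prop)
      (hκ.solvable1 hpos hw2 t1 c1)
    solvable0 := Solvable.map measurable_obs (hm true) (by fun_prop) (by fun_prop)
      (hκ.solvable0 hpos hw1 t0 c0) }

end Invertible

end PathSpecific.CausalModel

theorem theorem6
    {Ω 𝒰 𝒟 ℳ 𝒲 𝒵 𝒳 S : Type*}
    [MeasurableSpace Ω] [StandardBorelSpace Ω]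
    [MeasurableSpace 𝒰] [StandardBorelSpace 𝒰] [MeasurableSpace 𝒟] [StandardBorelSpace 𝒟]
    [MeasurableSpace ℳ] [StandardBorelSpace ℳ] [MeasurableSpace 𝒲] [StandardBorelSpace 𝒲]
    [MeasurableSpace 𝒵] [StandardBorelSpace 𝒵] [MeasurableSpace 𝒳] [StandardBorelSpace 𝒳]
    [MeasurableSpace S]
    -- the causal model
    (P : Measure Ω) [IsProbabilityMeasure P]
    (C : CausalModel Ω 𝒰 𝒟 ℳ 𝒲 𝒵 𝒳) (f : Densities 𝒰 𝒟 ℳ 𝒳)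
    (hcons : C.Consistency P) (hpos : C.Positivity P f) (hexch : C.Exchangeability P)
    (hcross : C.CrossWorld P) (hproxy : C.Proxies P) (hint : Integrable C.nested P)
    -- the bridge models and the regularity conditions
    {k : Dims} (B : BridgeModels k 𝒟 ℳ 𝒲 𝒵 𝒳) (θs : Param k)
    (hreg : Regularity (P.map C.obs) B θs)
    -- the i.i.d. sample
    (Pr : Measure S) [IsProbabilityMeasure Pr] (O : ℕ → S → Obs 𝒟 ℳ 𝒲 𝒵 𝒳)
    (hO : ∀ i, Measurable (O i)) (hlaw : ∀ i, Pr.map (O i) = P.map C.obs)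
    (hindep : iIndepFun O Pr)
    -- the solutions of the estimating equations
    (θhat : ℕ → S → Param k) (hθ : ∀ n, Measurable (θhat n))
    (hsol : Tendsto (fun n => Pr {ω | θhat n ω ∈ B.space ∧
      ∑ i ∈ Finset.range n, B.est (O i ω) (θhat n ω) = 0}) atTop (𝓝 1)) :
    -- consistency and asymptotic normality under the union model
    (C.InM1 P B ∨ C.InM2 P f B ∨ C.InM3 P f B ∨ C.InM4 P f B →
      TendstoInMeasure Pr (fun n ω => B.psiHat n (fun i => O i ω) (θhat n ω)) atTop
        (fun _ => C.psi P) ∧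
      ∃ φ : Obs 𝒟 ℳ 𝒲 𝒵 𝒳 → ℝ,
        AsympLinear Pr (P.map C.obs) O
          (fun n ω => B.psiHat n (fun i => O i ω) (θhat n ω)) (C.psi P) φ ∧
        AsympNormal Pr (fun n ω => B.psiHat n (fun i => O i ω) (θhat n ω)) (C.psi P)
          (∫ o, φ o ^ 2 ∂(P.map C.obs))) ∧
    -- local efficiency at the intersection submodel
    (C.InM1 P B ∧ C.InM2 P f B ∧ C.InM3 P f B ∧ C.InM4 P f B →
      Surjectivity (P.map C.obs) → UniqueBridges (P.map C.obs) → C.StrictPositivity P f →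
      ∃ h2 h1 h0 q0 q1 q2,
        IsH2 (P.map C.obs) h2 ∧ IsH1 (P.map C.obs) h2 h1 ∧ IsH0 (P.map C.obs) h1 h0 ∧
        IsQ0 (P.map C.obs) q0 ∧ IsQ1 (P.map C.obs) q0 q1 ∧ IsQ2 (P.map C.obs) q1 q2 ∧
        IsEIF (P.map C.obs) (fun o => moment h2 h1 h0 q0 q1 q2 o - C.psi P) ∧
        AsympLinear Pr (P.map C.obs) O
          (fun n ω => B.psiHat n (fun i => O i ω) (θhat n ω)) (C.psi P)
          (fun o => moment h2 h1 h0 q0 q1 q2 o - C.psi P) ∧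
        AsympNormal Pr (fun n ω => B.psiHat n (fun i => O i ω) (θhat n ω)) (C.psi P)
          (∫ o, (moment h2 h1 h0 q0 q1 q2 o - C.psi P) ^ 2 ∂(P.map C.obs))) := by
  have hS : IsSample Pr (P.map C.obs) O := ⟨hO, hlaw, hindep⟩
  obtain ⟨κW, κZ, hκ⟩ := CausalModel.exists_proxyKernels hproxy
  have hψ := CausalModel.integral_w2_mul_Y hcons hpos hexch hcross hint
  have hm := fun n => B.measurable_psiHat hS hθ n
  refine ⟨fun hM => ?_, fun hM hT hU hpos' => ?_⟩
  · obtain ⟨ℓ, -, hA⟩ := hreg.exists_asympLinear hS hθ hsol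
      (CausalModel.integral_quad_eq_psi hκ hpos hψ hreg hM)
    exact ⟨hS.tendstoInMeasure_of_asympLinear hA, _, hA, hS.asympNormal hm hA⟩
  · obtain ⟨ℓ, hℓ, hA⟩ := hreg.exists_asympLinear hS hθ hsol
      (CausalModel.integral_quad_eq_psi hκ hpos hψ hreg (Or.inl hM.1))
    have hQ := hκ.armsEquivalent hpos
    have hh := hreg.of_spec1 hM.1.spec
    have hq := hreg.of_spec2 hQ hM.2.1.spec
    -- Orthogonality makes the nuisance correction vanish, so the influence function is the centred
    -- moment function itself.
    rw [hℓ (hreg.integral_fderiv_quad_eq_zero hQ hh hq)] at hA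
    simp only [zero_apply, sub_zero] at hA
    refine ⟨_, _, _, _, _, _, hh.1, hh.2.1, hh.2.2, hq.1, hq.2.1, hq.2.2, ?_, hA,
      hS.asympNormal hm hA⟩
    have hs := hreg.sqBridges hQ
    exact (hh.1.weightedBridges hreg.Y_sq hh.2.1 hh.2.2).isEIF
      (hκ.invertibleBridges hpos hpos' hM.1.z2 hM.1.z3 hM.2.1.w1 hM.2.1.w2 hT hU hreg.Y_sq hh.1)
      hreg.Y_sq (hq.1.weakTreatmentBridges hQ hq.2.1 hq.2.2) hreg.quad_smooth.sq
      (CausalModel.integral_moment_of_h hκ hpos hψ hs hM.1.z1 hM.1.z2 hM.1.z3 hh.1 hh.2.1 hh.2.2).2
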